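/- Let $\pi:\mathcal X\to\mathbb D$ be an snc degeneration: a proper surjective holomorphic map from a connected complex manifold of dimension $n+1$ onto the open unit disc, submersive over $\mathbb D^*$, with $\mathcal X_0=\pi^{-1}(0)=\sum_{i\in I}b_iE_i$ a divisor with simple normal crossing support ($I$ finite, $b_i\ge 1$, $E_i$ irreducible). Put $X=\pi^{-1}(\mathbb D^*)$ and $X_t=\pi^{-1}(t)$. Let $\mathcal L$ be a $\mathbb Q$-line bundle on $\mathcal X$ extending the relative canonical bundle $K_{X/\mathbb D^*}$, and let $a_i\in\mathbb Q$ be the coefficients of the decomposition $$K^{\log}_{\mathcal X/\mathbb D}:=K_{\mathcal X/\mathbb D}+\mathcal X_{0,\mathrm{red}}-\mathcal X_0=\mathcal L+\sum_{i\in I}a_iE_i ,$$ which is understood to extend the given identification over $X$. Let $\psi$ be a continuous metric on $\mathcal L$, and for $t\in\mathbb D^*$ let $\nu_t=e^{2\psi_t}$ be the measure on $X_t$ given locally by $|\Omega|^2/|\Omega|^2_{\psi}$ for any local generator $\Omega$ of $K_{X_t}$, where $|dz_1\wedge\dots\wedge dz_n|^2$ is Lebesgue measure in the coordinates $z_1,\dots,z_n$.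 The dual complex $\Delta(\mathcal X)$ has one simplex $\sigma_Y=\{w\in\mathbb R_{\ge0}^J:\sum_{i\in J}b_iw_i=1\}$ for each stratum $Y$, that is, for each connected component $Y$ of a non-empty intersection $E_J=\bigcap_{i\in J}E_i$, $\emptyset\ne J\subset I$; $\sigma_{Y'}$ is a face of $\sigma_Y$ if and only if $Y\subset Y'$. The hybrid space is $\mathcal X^{\mathrm{hyb}}=X\sqcup\Delta(\mathcal X)$ with the coarsest topology such that $X$ is openly embedded, $(\mathcal V\setminus\mathcal X_0)\cup\Delta(\mathcal X)$ is open for each open neighbourhood $\mathcal V$ of $\mathcal X_0$, and the tropicalization maps $\mathrm{Log}_{\mathcal V}:\mathcal V\setminus\mathcal X_0\to\Delta(\mathcal X)$, extended by the identity on $\Delta(\mathcal X)$, are continuous on these sets. Here $\mathrm{Log}_{\mathcal V}$ is continuous and, near each point $\xi\in\mathcal X_0$ and in coordinates centred at $\xi$ in which $z_i$ is an equation of $E_i$ for each $i$ with $\xi\in E_i$, it takes values in simplices having the simplex of the stratum of $\xi$ as a face, and its coordinates equal $\log|z_i|/\log|f|+O(1/\log|f|^{-1})$ with $f=\prod z_i^{b_i}$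 (the coordinates with $\xi\notin E_i$ being $O(1/\log|f|^{-1})$). Set $\kappa_i=a_i/b_i$, $\kappa_{\min}=\min_i\kappa_i$, let $\Delta(\mathcal L)\subset\Delta(\mathcal X)$ be the subcomplex of the faces all of whose vertices satisfy $\kappa_i=\kappa_{\min}$, let $d=\dim\Delta(\mathcal L)$, and $\lambda(t)=(\log|t|^{-1})^{-1}$. For a $d$-dimensional face $\sigma$ of $\Delta(\mathcal L)$ with stratum $Y_\sigma$, a component of $E_J$, let $b_\sigma=\gcd_{i\in J}b_i$, let $\lambda_\sigma$ be Lebesgue measure on $\sigma$ normalized by the lattice $\{w\in\mathbb Z^J:\sum_{i\in J}b_iw_i=0\}$, and let $\mathrm{Res}_{Y_\sigma}(\psi)$ be the residual measure on $Y_\sigma$, given by $$\mathrm{Res}_{Y_\sigma}(\psi)=|\tau|_\psi^{-2}\prod_{i\in J'\setminus J}|z_i|^{2(a_i-\kappa_{\min}b_i-1)}\,\Bigl|\bigwedge_{j\notin J}dz_j\Bigr|^2$$ in local coordinates on $\mathcal X$ in which $z_i$, $i\in J'$, are equations of the components $E_i$ meeting the chart and $t=\prod_{i\in J'}z_i^{b_i}$,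 where $\tau=\prod_{i\in J'}z_i^{a_i}\,\Omega\otimes(dt/t)^{-1}$ and $\Omega=\bigwedge_{i\in J'}\frac{dz_i}{z_i}\wedge\bigwedge_{j\notin J'}dz_j$. Then, as $t\to0$, the finite measures $$\mu_t:=\frac{\lambda(t)^d}{(2\pi)^d|t|^{2\kappa_{\min}}}\,e^{2\psi_t},$$ viewed as measures on $\mathcal X^{\mathrm{hyb}}$, converge weakly to the finite measure $$\mu_0:=\sum_\sigma\Bigl(\int_{Y_\sigma}\mathrm{Res}_{Y_\sigma}(\psi)\Bigr)b_\sigma^{-1}\lambda_\sigma ,$$ where $\sigma$ ranges over the $d$-dimensional faces of $\Delta(\mathcal L)$. Moreover $d\le n$, and there is a constant $c>0$ such that $\nu_t(X_t)\sim c\,|t|^{2\kappa_{\min}}(\log|t|^{-1})^d$ as $t\to0$. -/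

import Mathlib

open Set Filter Topology MeasureTheory Bundle
open scoped Manifold ContDiff ENNReal

noncomputable section

namespace HybridLimit

universe u v

/-- The model space of a complex manifold of dimension `n + 1`. -/
abbrev Model (n : ℕ) : Type := Fin (n + 1) → ℂ

section Degeneration

variable {n : ℕ} {X : Type u} [TopologicalSpace X] [ChartedSpace (Model n) X] {I : Type v}

/-- `z` is a holomorphic chart of `X` in which the components of the divisor `∑ E i` are coordinate
hyperplanes: only the `E i` with `i ∈ J` meet the domain of `z`, and there `E i = {z (k i) = 0}`,
the coordinates `z (k i)`, `i ∈ J`, being distinct. -/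
structure IsSncChart (E : I → Set X) (z : OpenPartialHomeomorph X (Model n)) (J : Finset I)
    (k : I → Fin (n + 1)) : Prop where
  holomorphic : z ∈ IsManifold.maximalAtlas 𝓘(ℂ, Model n) ω X
  injOn : Set.InjOn k (J : Set I)
  mem_iff : ∀ x ∈ z.source, ∀ i, x ∈ E i ↔ i ∈ J ∧ z x (k i) = 0

variable (n X I) in
/-- An snc degeneration over the unit disc: a proper surjective holomorphic map `proj` from the
complex manifold `X` onto the unit disc, which is a submersion outside the zero fibre, and whose
zero fibre is the divisor `∑ b i • E i` with simple normal crossing support. -/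
structure SncDegeneration where
  proj : X → ℂ
  holomorphic : ContMDiff 𝓘(ℂ, Model n) 𝓘(ℂ, ℂ) ω proj
  range_eq : range proj = Metric.ball 0 1
  proper : ∀ K : Set ℂ, K ⊆ Metric.ball 0 1 → IsCompact K → IsCompact (proj ⁻¹' K)
  submersion : ∀ x, proj x ≠ 0 →
    Function.Surjective (mfderiv 𝓘(ℂ, Model n) 𝓘(ℂ, ℂ) proj x)
  /-- the irreducible components of the zero fibre -/
  E : I → Set X
  /-- their multiplicities -/
  b : I → ℕ
  b_pos : ∀ i, 0 < b i
  connected : ∀ i, IsConnected (E i)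
  zero_iff : ∀ x, proj x = 0 ↔ ∃ i, x ∈ E i
  /-- near each point of the zero fibre there is a chart adapted to the `E i` in which
  `proj` equals `∏ z_i ^ b i` up to a nowhere vanishing holomorphic function -/
  snc : ∀ x, proj x = 0 → ∃ (z : OpenPartialHomeomorph X (Model n)) (J : Finset I)
    (k : I → Fin (n + 1)) (f : X → ℂ), IsSncChart E z J k ∧ x ∈ z.source ∧
      ContMDiffOn 𝓘(ℂ, Model n) 𝓘(ℂ, ℂ) ω f z.source ∧
      ∀ y ∈ z.source, f y ≠ 0 ∧ proj y = f y * ∏ i ∈ J, z y (k i) ^ b i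

namespace SncDegeneration

variable (D : SncDegeneration n X I)

/-- The punctured total space, the complement of the zero fibre. -/
def generic : Set X := {x | D.proj x ≠ 0}

/-- A holomorphic chart adapted to the zero fibre, with the labelling of its coordinates. -/
structure Chart where
  z : OpenPartialHomeomorph X (Model n)
  J : Finset I
  k : I → Fin (n + 1)
  isSnc : IsSncChart D.E z J k

/-! ### The dual complex -/

/-- The intersection `E_J` of the components with index in `J`. -/
def inter (J : Finset I) : Set X := {x | ∀ i ∈ J, x ∈ D.E i}

/-- A stratum: a connected component of a non-empty intersection `E_J`, `J` non-empty. -/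
structure Stratum where
  J : Finset I
  carrier : Set X
  nonempty : J.Nonempty
  isComponent : ∃ x ∈ D.inter J, carrier = connectedComponentIn (D.inter J) x

/-- The simplex `{w ∈ ℝ_{≥ 0}^J | ∑ b i * w i = 1}`, inside `ℝ^I`. -/
def simplex (J : Finset I) : Set (I → ℝ) :=
  {w | (∀ i, 0 ≤ w i) ∧ (∀ i, i ∉ J → w i = 0) ∧ ∑ i ∈ J, (D.b i : ℝ) * w i = 1}

/-- The disjoint union over all strata `Y` of the simplices `σ_Y`. -/
abbrev Simplices : Type (max u v) := Σ Y : D.Stratum, D.simplex Y.J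

/-- `σ_Y` is glued to `σ_Y'` as a face if `Y' ⊆ Y`; the inclusion of simplices is extension of the
coordinates by zero. -/
def glue (p q : D.Simplices) : Prop :=
  q.1.carrier ⊆ p.1.carrier ∧ (p.2 : I → ℝ) = q.2

/-- The dual complex, with its topology as a quotient of the disjoint union of the simplices. -/
def DualComplex : Type (max u v) := Quot D.glue

instance : TopologicalSpace D.DualComplex := inferInstanceAs (TopologicalSpace (Quot D.glue))

/-- The canonical map from the simplex of a stratum to the dual complex. -/
def ofSimplex (Y : D.Stratum) (w : D.simplex Y.J) : D.DualComplex := Quot.mk D.glue ⟨Y, w⟩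

/-! ### The hybrid space -/

/-- The local equation `∏ z_i ^ b i` of the zero fibre in an adapted chart. -/
def Chart.eqn {D : SncDegeneration n X I} (c : D.Chart) (x : X) : ℂ :=
  ∏ i ∈ c.J, c.z x (c.k i) ^ D.b i

open scoped Classical in
/-- The map `Log_U = (log |z_i| / log |f_U|)_i` of an adapted chart. -/
def Chart.log {D : SncDegeneration n X I} (c : D.Chart) (x : X) : I → ℝ := fun i =>
  if i ∈ c.J then Real.log ‖c.z x (c.k i)‖ / Real.log ‖c.eqn x‖ else 0

/-- `Log` is a tropicalization map on the open neighbourhood `V` of the zero fibre: it is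
continuous on `V` minus the zero fibre, and near each point `ξ` of the zero fibre, in each adapted
chart `c` centred at `ξ` (all the coordinates `z_i`, `i ∈ c.J`, vanish at `ξ`), it takes its
values in simplices having the simplex of the stratum of `ξ` as a face and differs from
`Log_U` by `O(1 / log |f_U|⁻¹)`. -/
structure IsTropicalization (V : Set X) (Log : X → D.DualComplex) : Prop where
  isOpen : IsOpen V
  subset : ∀ x, D.proj x = 0 → x ∈ V
  continuousOn : ContinuousOn Log (V ∩ D.generic)
  estimate : ∀ ξ, D.proj ξ = 0 → ∀ c : D.Chart, ξ ∈ c.z.source →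
    (∀ i ∈ c.J, c.z ξ (c.k i) = 0) →
    ∃ C : ℝ, ∀ᶠ x in 𝓝[D.generic] ξ, ∃ (Y : D.Stratum) (w : D.simplex Y.J),
      Y.carrier ⊆ connectedComponentIn (D.inter c.J) ξ ∧ Log x = D.ofSimplex Y w ∧
      ∀ i, |(w : I → ℝ) i - c.log x i| ≤ C / Real.log ‖c.eqn x‖⁻¹

/-- The hybrid space: the disjoint union of the punctured total space and the dual complex. -/
def Hybrid : Type (max u v) := D.generic ⊕ D.DualComplex

/-- The inclusion of the punctured total space. -/
def ofGeneric (x : D.generic) : D.Hybrid := Sum.inl x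

/-- The inclusion of the dual complex. -/
def ofDual (p : D.DualComplex) : D.Hybrid := Sum.inr p

/-- The hybrid topology, the coarsest one such that the punctured total space is openly embedded,
`(V \ X₀) ∪ Δ` is open for each open neighbourhood `V` of the zero fibre, and every tropicalization
map, extended by the identity of `Δ`, is continuous on `(V \ X₀) ∪ Δ` (one such map would give the
same topology as all of them). -/
instance : TopologicalSpace D.Hybrid := TopologicalSpace.generateFrom
  ({S | ∃ G : Set D.generic, IsOpen G ∧ S = D.ofGeneric '' G} ∪
   {S | ∃ V : Set X, IsOpen V ∧ (∀ x, D.proj x = 0 → x ∈ V) ∧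
      S = D.ofGeneric '' {x | (x : X) ∈ V} ∪ range D.ofDual} ∪
   {S | ∃ (V : Set X) (Log : X → D.DualComplex) (O : Set D.DualComplex),
      D.IsTropicalization V Log ∧ IsOpen O ∧
      S = D.ofGeneric '' {x | (x : X) ∈ V ∧ Log x ∈ O} ∪ D.ofDual '' O})

instance : MeasurableSpace D.Hybrid := borel _

instance : BorelSpace D.Hybrid := ⟨rfl⟩

/-! ### Normalized Lebesgue measure of a simplex -/

variable [Fintype I]

/-- The tangent space `{v ∈ ℝ^J | ∑ b i * v i = 0}` of a simplex. -/
def tangent (J : Finset I) : Submodule ℝ (I → ℝ) where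
  carrier := {v | (∀ i, i ∉ J → v i = 0) ∧ ∑ i ∈ J, (D.b i : ℝ) * v i = 0}
  add_mem' := by
    rintro v w ⟨hv, hv'⟩ ⟨hw, hw'⟩
    refine ⟨fun i hi => by simp [hv i hi, hw i hi], ?_⟩
    simp [mul_add, Finset.sum_add_distrib, hv', hw']
  zero_mem' := by simp
  smul_mem' := by
    rintro c v ⟨hv, hv'⟩
    refine ⟨fun i hi => by simp [hv i hi], ?_⟩
    have : ∑ i ∈ J, (D.b i : ℝ) * (c • v) i = c * ∑ i ∈ J, (D.b i : ℝ) * v i := by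
      rw [Finset.mul_sum]
      exact Finset.sum_congr rfl fun i _ => by simp; ring
    rw [this, hv', mul_zero]

/-- The lattice of integral vectors of the tangent space. -/
def lattice (J : Finset I) : Submodule ℤ (D.tangent J) where
  carrier := {v | ∀ i, ∃ m : ℤ, (v : I → ℝ) i = m}
  add_mem' := by
    intro v w hv hw i
    obtain ⟨p, hp⟩ := hv i
    obtain ⟨q, hq⟩ := hw i
    exact ⟨p + q, by simp [hp, hq]⟩
  zero_mem' := fun i => ⟨0, by simp⟩
  smul_mem' := by
    intro c v hv i
    obtain ⟨p, hp⟩ := hv i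
    exact ⟨c * p, by simp [hp]⟩

/-- The Haar measure of the tangent space for which the integral lattice has covolume one. -/
def tangentMeasure (J : Finset I) : Measure (D.tangent J) :=
  (ENNReal.ofReal (ZLattice.covolume (D.lattice J) Measure.addHaar))⁻¹ • Measure.addHaar

open scoped Classical in
/-- The barycentre of a simplex. -/
def barycentre (J : Finset I) : I → ℝ := fun i =>
  if i ∈ J then ((J.card : ℝ) * D.b i)⁻¹ else 0

/-- The Lebesgue measure `λ_σ` of a simplex, normalized by its integral affine structure. -/
def simplexMeasure (J : Finset I) : Measure (D.simplex J) :=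
  ((D.tangentMeasure J).map fun v : D.tangent J => D.barycentre J + (v : I → ℝ)).comap Subtype.val

/-- The integer `b_σ = gcd (b i)`, `i ∈ J`. -/
def bGcd (J : Finset I) : ℕ := J.gcd D.b

/-! ### The invariants attached to the coefficients `a i` -/

/-- `κ_i = a_i / b_i`. -/
def kappa (a : I → ℚ) (i : I) : ℝ := ((a i / D.b i : ℚ) : ℝ)

/-- `κ_min`, the minimum of the finitely many numbers `κ_i`. -/
def kappaMin (a : I → ℚ) : ℝ := ⨅ i, D.kappa a i

/-- The face of a stratum belongs to `Δ(ℒ)` if all its vertices achieve the minimum. -/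
def IsMinFace (a : I → ℚ) (Y : D.Stratum) : Prop := ∀ i ∈ Y.J, D.kappa a i = D.kappaMin a

/-- The dimension of `Δ(ℒ)`. -/
def dimMin (a : I → ℚ) : ℕ := sSup {p | ∃ Y : D.Stratum, D.IsMinFace a Y ∧ Y.J.card = p + 1}

end SncDegeneration

end Degeneration

/-! ### Pluricanonical forms, line bundles and metrics -/

section Bundles

variable {n : ℕ} {X : Type u} [TopologicalSpace X] [ChartedSpace (Model n) X] {I : Type v}

/-- The coordinate frame `∂/∂z_0, …, ∂/∂z_n` of a chart at the point `x`. -/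
def coordFrame (z : OpenPartialHomeomorph X (Model n)) (x : X) :
    Fin (n + 1) → TangentSpace 𝓘(ℂ, Model n) x :=
  fun j => mfderiv 𝓘(ℂ, Model n) 𝓘(ℂ, Model n) z.symm (z x) (Pi.single j (1 : ℂ) : Model n)

/-- An element of the fibre at `x` of the `m`-th power of the canonical bundle, as a function of
`n + 1` tangent vectors: since this fibre is a complex line, each element of it is the `m`-th power
of an alternating form. -/
def IsPluricanonical (m : ℕ) (x : X)
    (F : (Fin (n + 1) → TangentSpace 𝓘(ℂ, Model n) x) → ℂ) : Prop :=
  ∃ η : (TangentSpace 𝓘(ℂ, Model n) x) [⋀^Fin (n + 1)]→ₗ[ℂ] ℂ, ∀ v, F v = η v ^ m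

variable (L : X → Type*) [TopologicalSpace (TotalSpace ℂ L)] [∀ x, AddCommGroup (L x)]
  [∀ x, Module ℂ (L x)] [∀ x, TopologicalSpace (L x)] [FiberBundle ℂ L] [VectorBundle ℂ ℂ L]

/-- A `ℚ`-line bundle `ℒ` extending the relative canonical bundle of the degeneration `D` over the
punctured disc, given by a line bundle `L = m ℒ`, `m ≥ 1`, and a holomorphic isomorphism
`L ≃ m K` over the punctured total space, where `K` is the relative canonical bundle
`K_X - proj^* K_disc`. Here `K_disc` is trivialized by `dt`, so the element of `m K` corresponding
to `s : L x` is written `toForm x s ⊗ dt^{-m}` with `toForm x s` in the fibre of `m K_X`. The values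
of `toForm` on the zero fibre are not used. -/
structure CanonicalExtension (D : SncDegeneration n X I) where
  m : ℕ
  m_pos : 0 < m
  toForm : ∀ x, L x →ₗ[ℂ] ((Fin (n + 1) → TangentSpace 𝓘(ℂ, Model n) x) → ℂ)
  injective : ∀ x ∈ D.generic, Function.Injective (toForm x)
  isPluricanonical : ∀ x ∈ D.generic, ∀ s : L x, IsPluricanonical m x (toForm x s)
  holomorphic : ∀ (e : Trivialization ℂ (TotalSpace.proj : TotalSpace ℂ L → X))
    [MemTrivializationAtlas e],
    ∀ z ∈ IsManifold.maximalAtlas 𝓘(ℂ, Model n) ω X,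
      ContMDiffOn 𝓘(ℂ, Model n) 𝓘(ℂ, ℂ) ω
        (fun x => toForm x (e.symm x 1) (coordFrame z x)) (z.source ∩ e.baseSet ∩ D.generic)

/-- A continuous Hermitian metric on the line bundle `L`: the length of the elements of its fibres.
If `L = m ℒ`, this is the metric `m ψ`, where `ψ` is a continuous metric on the `ℚ`-line bundle
`ℒ`. -/
structure ContinuousMetric where
  len : ∀ x, L x → ℝ
  len_smul : ∀ x (c : ℂ) (s : L x), len x (c • s) = ‖c‖ * len x s
  len_pos : ∀ x (s : L x), s ≠ 0 → 0 < len x s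
  continuous : Continuous fun p : TotalSpace ℂ L => len p.proj p.snd

variable {L}

namespace CanonicalExtension

variable {D : SncDegeneration n X I} (ℒ : CanonicalExtension L D)

/-- The coefficient `c` of `s : L x` in a chart `z`, for which
`s = c (dz_0 ∧ … ∧ dz_n ⊗ dt⁻¹)^m`. -/
def coeff (z : OpenPartialHomeomorph X (Model n)) (x : X) (s : L x) : ℂ :=
  ℒ.toForm x s (coordFrame z x)

/-- The identity `K^log = ℒ + ∑ a i E i` of `ℚ`-line bundles on `X`, where `K^log` is the relative
logarithmic canonical bundle. In an adapted chart, `K^log` is generated by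
`Ω ⊗ (dt / t)⁻¹`, with `Ω = dz_0 ∧ … ∧ dz_n / ∏_{i ∈ J} z_i`, hence `m ℒ` is generated by
`∏ z_i ^ (m a i) (Ω ⊗ (dt / t)⁻¹)^m`: each local frame of `m ℒ` is the product of the latter and of
a nowhere vanishing holomorphic function. -/
def IsDecomposition (a : I → ℚ) : Prop :=
  ∃ r : I → ℤ, (∀ i, (r i : ℚ) = ℒ.m * a i) ∧
    ∀ (c : D.Chart) (e : Trivialization ℂ (TotalSpace.proj : TotalSpace ℂ L → X))
      [MemTrivializationAtlas e],
      ∃ f : X → ℂ, ContMDiffOn 𝓘(ℂ, Model n) 𝓘(ℂ, ℂ) ω f (c.z.source ∩ e.baseSet) ∧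
        (∀ x ∈ c.z.source ∩ e.baseSet, f x ≠ 0) ∧
        ∀ x ∈ c.z.source ∩ e.baseSet ∩ D.generic,
          ℒ.coeff c.z x (e.symm x 1) =
            f x * (∏ i ∈ c.J, c.z x (c.k i) ^ r i) *
              (D.proj x / ∏ i ∈ c.J, c.z x (c.k i)) ^ ℒ.m

/-- The function `|dz_0 ∧ … ∧ dz_n ⊗ dt⁻¹|_ψ^{-2}` on the domain of a chart. It is computed from an
arbitrary nonzero vector of `L x`. -/
def density (ψ : ContinuousMetric L) (z : OpenPartialHomeomorph X (Model n)) (x : X) : ℝ :=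
  (‖ℒ.coeff z x ((trivializationAt ℂ L x).symm x 1)‖ /
    ψ.len x ((trivializationAt ℂ L x).symm x 1)) ^ (2 / (ℒ.m : ℝ))

variable [MeasurableSpace X]

/-! ### The measures on the fibres -/

variable (D) in
/-- The holomorphic charts whose coordinate `z_0` is `t`; in these, the fibre over `t` is the slice
`z_0 = t`, with coordinates `z_1, …, z_n`. -/
def FibreChart : Type u :=
  {z : OpenPartialHomeomorph X (Model n) //
    z ∈ IsManifold.maximalAtlas 𝓘(ℂ, Model n) ω X ∧ ∀ x ∈ z.source, z x 0 = D.proj x}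

/-- The measure `e^{2 ψ_t} = |dz_1 ∧ … ∧ dz_n|² / |dz_1 ∧ … ∧ dz_n|_ψ²` on the part of the fibre
over `t` lying in the domain of a chart with `z_0 = t`, as a measure on `X`. -/
def localFibreMeasure (ψ : ContinuousMetric L) (t : ℂ) (z : FibreChart D) : Measure X :=
  (((volume : Measure (Fin n → ℂ)).restrict
      {y | (Fin.cons t y : Model n) ∈ z.1.target}).withDensity
    fun y => ENNReal.ofReal (ℒ.density ψ z.1 (z.1.symm (Fin.cons t y)))).map
      fun y => z.1.symm (Fin.cons t y)

/-- The measure `e^{2 ψ_t}` on the fibre over `t ≠ 0`, as a measure on `X`. The local measures agree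
on overlaps, and their supremum is the measure obtained by glueing them. -/
def fibreMeasure (ψ : ContinuousMetric L) (t : ℂ) : Measure X :=
  ⨆ z : FibreChart D, ℒ.localFibreMeasure ψ t z

/-! ### Residual measures -/

variable (D) in
/-- An adapted chart in which `t = ∏ z_i ^ b i`. -/
def MonomialChart : Type (max u v) :=
  {c : D.Chart // ∀ x ∈ c.z.source, D.proj x = c.eqn x}

/-- The function `|τ|_ψ^{-2}` on the domain of an adapted chart minus the zero fibre, where
`τ = ∏ z_i ^ a i Ω ⊗ (dt / t)⁻¹ = t ∏ z_i ^ (a i - 1) dz_0 ∧ … ∧ dz_n ⊗ dt⁻¹` is the local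
generator of `ℒ`. -/
def genNorm (ψ : ContinuousMetric L) (a : I → ℚ) (c : D.Chart) (x : X) : ℝ :=
  ℒ.density ψ c.z x * (‖D.proj x‖ ^ 2)⁻¹ *
    ∏ i ∈ c.J, ‖c.z x (c.k i)‖ ^ (2 - 2 * (a i : ℝ))

variable [Fintype I]

open scoped Classical in
/-- The coordinates of an adapted chart on the locus `z_i = 0`, `i ∈ J`. -/
abbrev SliceIndex (c : D.Chart) (J : Finset I) : Type :=
  {j : Fin (n + 1) // j ∉ J.image c.k}

open scoped Classical in
/-- The point of the locus `z_i = 0`, `i ∈ J`, with given coordinates. -/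
def slicePoint (c : D.Chart) (J : Finset I) (y : SliceIndex c J → ℂ) : X :=
  c.z.symm fun j => if h : j ∉ J.image c.k then y ⟨j, h⟩ else 0

open scoped Classical in
/-- The domain of the coordinates of the locus `z_i = 0`, `i ∈ J`. -/
def sliceDomain (c : D.Chart) (J : Finset I) : Set (SliceIndex c J → ℂ) :=
  {y | (fun j => if h : j ∉ J.image c.k then y ⟨j, h⟩ else 0 : Model n) ∈ c.z.target}

open scoped Classical in
/-- The residual measure of `ψ` on the part of the stratum `Y` in the domain of a chart with
`t = ∏ z_i ^ b i`, as a measure on `X`: it is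
`|τ|_ψ^{-2} ∏ |z_i| ^ (2 (a i - κ_min b i - 1)) |⋀ dz_j|²`, where the product is over the components
meeting the chart other than those cutting out `Y`, and `⋀ dz_j` is over the coordinates of `Y`.
The function `|τ|_ψ^{-2}` is extended by continuity to the zero fibre. -/
def localResMeasure (ψ : ContinuousMetric L) (a : I → ℚ) (Y : D.Stratum)
    (c : MonomialChart D) : Measure X :=
  (((volume.restrict (sliceDomain c.1 Y.J)).withDensity fun y =>
      ENNReal.ofReal (extendFrom D.generic (ℒ.genNorm ψ a c.1) (slicePoint c.1 Y.J y) *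
        ∏ i ∈ c.1.J \ Y.J, ‖c.1.z (slicePoint c.1 Y.J y) (c.1.k i)‖ ^
          (2 * ((a i : ℝ) - D.kappaMin a * D.b i - 1)))).map
    (slicePoint c.1 Y.J)).restrict Y.carrier

/-- The residual measure of `ψ` on the stratum `Y`, as a measure on `X`, obtained by glueing the
local ones. -/
def resMeasure (ψ : ContinuousMetric L) (a : I → ℚ) (Y : D.Stratum) : Measure X :=
  ⨆ c : {c : MonomialChart D // Y.J ⊆ c.1.J}, ℒ.localResMeasure ψ a Y c.1

/-! ### The measures on the hybrid space -/

/-- The rescaled measure `μ_t = λ(t)^d e^{2 ψ_t} / ((2π)^d |t|^{2 κ_min})`, with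
`λ(t) = (log |t|⁻¹)⁻¹`, viewed on the hybrid space. -/
def rescaledMeasure (ψ : ContinuousMetric L) (a : I → ℚ) (t : ℂ) : Measure D.Hybrid :=
  ENNReal.ofReal ((Real.log ‖t‖⁻¹)⁻¹ ^ D.dimMin a /
      ((2 * Real.pi) ^ D.dimMin a * ‖t‖ ^ (2 * D.kappaMin a))) •
    ((ℒ.fibreMeasure ψ t).comap (Subtype.val : D.generic → X)).map D.ofGeneric

/-- The limit measure `∑_σ (∫_{Y_σ} Res_{Y_σ}(ψ)) b_σ⁻¹ λ_σ`, the sum being over the faces of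
`Δ(ℒ)` of dimension `d = dim Δ(ℒ)`, viewed on the hybrid space. -/
def limitMeasure (ψ : ContinuousMetric L) (a : I → ℚ) : Measure D.Hybrid :=
  Measure.sum fun Y : {Y : D.Stratum // D.IsMinFace a Y ∧ Y.J.card = D.dimMin a + 1} =>
    (ℒ.resMeasure ψ a Y.1 Y.1.carrier * (D.bGcd Y.1.J : ℝ≥0∞)⁻¹) •
      (D.simplexMeasure Y.1.J).map fun w => D.ofDual (D.ofSimplex Y.1 w)

end CanonicalExtension

end Bundles

end HybridLimit

end

/-!
The proof computes the integrals over `X_t` in adapted coordinates. Around a point of the zero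
fibre a root of the invertible factor of the projection can be absorbed into an equation of a
component, so that the projection is a monomial `t = ∏ z_i ^ b_i` (`exists_monomialChart`). Fix a
set `K` of components through the point and `i₀ ∈ K`. The equation of the fibre is solved for
`z_{i₀}` in `b_{i₀}` branches, the parameters being `log z_i` for the other `i ∈ K` and the remaining
coordinates (`fibreMeasure_restrict_chart`, `integral_fibreMeasure_chart`). Put
`γ_i = a_i - κ_min b_i ≥ 0`. The decomposition of the logarithmic canonical bundle says that the
density of `e^{2ψ_t}`, in these parameters, is `b_{i₀}^{-2} |t|^{2 κ_min} |τ|_ψ^{-2}` times the weight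
`∏_{i ∈ K} |z_i|^{2 γ_i} ∏_{i ∉ K} |z_i|^{2 (γ_i - 1)}`, where `|τ|_ψ^{-2}` is continuous and positive
across the zero fibre (`genNormExt_spec`, `density_branch`).

Take for `K` the components through the point with `γ_i = 0`. Rescaling the real parts of the
logarithms by `T = - log |t|` produces the factor `T ^ (|K| - 1)`. In a polydisc the rescaled real
parts stay bounded, the exponents `2 (γ_i - 1)` of the components outside `K` through the point are
greater than `-2`, so the weight has an integrable majorant that is a product of functions of one
parameter (`IsBox.weight_le_majorant`). By dominated convergence (`tendsto_integral_box`) the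
integrals converge; in the limit the real parts range over the open simplex, the imaginary parts
over a cube of volume `(2π) ^ (|K| - 1)`, and the remaining coordinates carry the density of the
residual measure (`integral_limDom`). Lebesgue measure in the coordinates of the simplex different
from `i₀` differs from the normalized one by the covolume `b_{i₀} / gcd b_i` of a lattice
(`covolume_congruenceLattice`, `integral_simplexMeasure`), which turns `b_{i₀}^{-1}` into `b_σ^{-1}`.
If no component through the point has `γ_i = 0`, the same argument with `K` a single component
gives the limit zero, because the weight tends to zero (`sliceIntegral_eq_zero`).

Test functions live on the hybrid space. Its topology is used through two consequences of the
estimate for tropicalization maps: convergence of the logarithmic coordinates implies convergence in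
the hybrid space (`tendsto_ofDual`), and a continuous function on the hybrid space is bounded near
the zero fibre, by a compactness argument with ultrafilters (`exists_bound`).

That the residual measures in different charts agree is not computed by a change of coordinates: for
`F = 1` both are limits of the same integrals over the fibres, and a limit is unique
(`integral_localResMeasure_eq`, `localResMeasure_agree`). The residual measure of a stratum is finite
and not zero. A partition of unity near the zero fibre (`exists_partition`) adds up the local limits;
only the faces of `Δ(ℒ)` of maximal dimension survive the division by `T ^ d`
(`tendsto_integral_adapted`, `tendsto_integral_fibreMeasure`). The function `F = 1` gives the
asymptotics of the total mass (`isEquivalent_fibreMeasure`).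
-/

noncomputable section

namespace HybridLimit

universe u v

set_option linter.unusedSectionVars false

/-! ### Glueing measures -/

/-- Measures carried by the sets `U i` which agree on the overlaps glue, and the supremum of the
family is the glued measure. -/
theorem iSup_restrict_of_agree {X ι : Type*} [MeasurableSpace X] (m : ι → Measure X)
    (U : ι → Set X) (hU : ∀ i, MeasurableSet (U i)) (h0 : ∀ i, m i (U i)ᶜ = 0)
    (hag : ∀ i j, (m i).restrict (U i ∩ U j) = (m j).restrict (U i ∩ U j)) (i : ι) :
    (⨆ i, m i).restrict (U i) = m i := by
  have hi : (m i).restrict (U i) = m i := Measure.restrict_eq_self_of_ae_mem (by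
    rw [ae_iff]; exact h0 i)
  apply le_antisymm
  · -- `m i` on `U i`, plus infinite mass off `U i`, is an upper bound of all the `m j`
    have hle : (⨆ j, m j) ≤ m i + (⊤ : Measure X).restrict (U i)ᶜ := by
      refine iSup_le fun j => ?_
      rw [← Measure.restrict_add_restrict_compl (μ := m j) (hU i)]
      refine add_le_add ?_ (Measure.restrict_mono le_rfl le_top)
      have hj : (m j).restrict (U i) = (m j).restrict (U i ∩ U j) := by
        have : (m j).restrict (U j) = m j := Measure.restrict_eq_self_of_ae_mem (by
          rw [ae_iff]; exact h0 j)
        conv_lhs => rw [← this]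
        rw [Measure.restrict_restrict (hU i)]
      rw [hj, ← hag]
      exact Measure.restrict_le_self
    calc (⨆ j, m j).restrict (U i)
        ≤ (m i + (⊤ : Measure X).restrict (U i)ᶜ).restrict (U i) :=
          Measure.restrict_mono le_rfl hle
      _ = m i := by
        rw [Measure.restrict_add, hi, Measure.restrict_restrict (hU i)]
        simp
  · calc m i = (m i).restrict (U i) := hi.symm
      _ ≤ _ := Measure.restrict_mono le_rfl (le_iSup m i)

theorem iSup_measure_compl_eq_zero {X ι : Type*} [MeasurableSpace X] (m : ι → Measure X)
    (S : Set X) (hS : MeasurableSet S) (h0 : ∀ i, m i Sᶜ = 0) : (⨆ i, m i) Sᶜ = 0 := by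
  have hle : (⨆ j, m j) ≤ (⊤ : Measure X).restrict S := by
    refine iSup_le fun j => ?_
    have : (m j).restrict S = m j := Measure.restrict_eq_self_of_ae_mem (by
          rw [ae_iff]; exact h0 j)
    rw [← this]
    exact Measure.restrict_mono le_rfl le_top
  refine le_antisymm ((hle _).trans ?_) bot_le
  rw [Measure.restrict_apply hS.compl]; simp

/-- Two measures agree on a union of open sets on each of which they agree. -/
theorem restrict_eq_of_forall_exists_open {X : Type*} [TopologicalSpace X]
    [SecondCountableTopology X] [MeasurableSpace X] [OpensMeasurableSpace X]
    (μ ν : Measure X) (S : Set X)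
    (h : ∀ x ∈ S, ∃ N, IsOpen N ∧ x ∈ N ∧ μ.restrict N = ν.restrict N) :
    μ.restrict S = ν.restrict S := by
  choose! N hNo hxN hN using h
  obtain ⟨T, hTc, hT⟩ := TopologicalSpace.isOpen_iUnion_countable
    (fun x : S => N x) (fun x => hNo x x.2)
  have hu : μ.restrict (⋃ x ∈ T, N x) = ν.restrict (⋃ x ∈ T, N x) :=
    (Measure.restrict_biUnion_congr hTc).2 fun x _ => hN x x.2
  refine Measure.restrict_congr_mono ?_ hu
  rw [hT]
  intro x hx
  exact mem_iUnion.2 ⟨⟨x, hx⟩, hxN x hx⟩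

/-! ### Holomorphic coordinate changes -/

/-- The real Jacobian of a complex linear map is the squared norm of its complex determinant. -/
theorem abs_det_restrictScalars {E : Type*} [NormedAddCommGroup E] [NormedSpace ℂ E]
    (A : E →L[ℂ] E) : |(A.restrictScalars ℝ).det| = ‖A.det‖ ^ 2 := by
  have h : (A.restrictScalars ℝ).det = Algebra.norm ℝ A.det := by
    have := LinearMap.det_restrictScalars (R := ℝ) (S := ℂ) (A := E) (f := (A : E →ₗ[ℂ] E))
    exact this
  rw [h, Algebra.norm_complex_apply, Complex.normSq_eq_norm_sq, abs_of_nonneg (by positivity)]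

section CoordinateChange

variable {E : Type*} [NormedAddCommGroup E] [NormedSpace ℂ E] [FiniteDimensional ℂ E]

/-- The inverse of an analytic homeomorphism between open sets is analytic if the Jacobian
determinant does not vanish. -/
theorem contDiffOn_symm_of_det_ne_zero (e : OpenPartialHomeomorph E E)
    (he : ContDiffOn ℂ ω e e.source) (hdet : ∀ x ∈ e.source, (fderiv ℂ e x).det ≠ 0) :
    ContDiffOn ℂ ω e.symm e.target := by
  have : CompleteSpace E := FiniteDimensional.complete ℂ E
  intro y hy
  have hx := e.map_target hy
  have hc : ContDiffAt ℂ ω e (e.symm y) := (he _ hx).contDiffAt (e.open_source.mem_nhds hx)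
  refine (e.contDiffAt_symm (f₀' :=
    (fderiv ℂ e (e.symm y)).toContinuousLinearEquivOfDetNeZero (hdet _ hx)) hy ?_
    hc).contDiffWithinAt
  rw [ContinuousLinearMap.coe_toContinuousLinearEquivOfDetNeZero]
  exact (hc.differentiableAt (by simp)).hasFDerivAt

/-- The inverse function theorem for analytic maps, with the condition on the derivative stated by
its determinant. -/
theorem exists_openPartialHomeomorph_of_det_ne_zero {F : E → E} {Ω : Set E} (hΩ : IsOpen Ω)
    (hF : ContDiffOn ℂ ω F Ω) {x : E} (hx : x ∈ Ω) (hdet : (fderiv ℂ F x).det ≠ 0) :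
    ∃ e : OpenPartialHomeomorph E E, x ∈ e.source ∧ e.source ⊆ Ω ∧ (∀ y, e y = F y) ∧
      ContDiffOn ℂ ω e e.source ∧ ContDiffOn ℂ ω e.symm e.target := by
  have : CompleteSpace E := FiniteDimensional.complete ℂ E
  have hc : ContDiffAt ℂ ω F x := (hF x hx).contDiffAt (hΩ.mem_nhds hx)
  have hd : HasFDerivAt F (((fderiv ℂ F x).toContinuousLinearEquivOfDetNeZero hdet : E ≃L[ℂ] E) :
      E →L[ℂ] E) x := by
    rw [ContinuousLinearMap.coe_toContinuousLinearEquivOfDetNeZero]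
    exact (hc.differentiableAt (by simp)).hasFDerivAt
  let e₀ := hc.toOpenPartialHomeomorph F hd (by simp)
  have he₀ : ∀ y, e₀ y = F y := fun y => rfl
  have hcd : ContinuousOn (fun y => (fderiv ℂ F y).det) Ω := by
    have h1 : ContinuousOn (fun y => fderiv ℂ F y) Ω :=
      hF.continuousOn_fderiv_of_isOpen hΩ (by simp)
    exact ContinuousLinearMap.continuous_det.comp_continuousOn h1
  have hO : IsOpen (Ω ∩ (fun y => (fderiv ℂ F y).det) ⁻¹' {0}ᶜ) :=
    hcd.isOpen_inter_preimage hΩ isOpen_compl_singleton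
  let e := e₀.restrOpen _ hO
  have hs : e.source ⊆ Ω ∩ (fun y => (fderiv ℂ F y).det) ⁻¹' {0}ᶜ := fun y hy => hy.2
  have hee : ∀ y, e y = F y := fun y => rfl
  have hef : (e : E → E) = F := funext hee
  have hce : ContDiffOn ℂ ω e e.source := by
    rw [hef]; exact hF.mono fun y hy => (hs hy).1
  refine ⟨e, ⟨hc.mem_toOpenPartialHomeomorph_source hd (by simp), hx, hdet⟩,
    fun y hy => (hs hy).1, hee, hce, contDiffOn_symm_of_det_ne_zero e hce fun y hy => ?_⟩
  rw [hef]
  exact (hs hy).2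

/-- The global form of the inverse function theorem: an injective analytic map with nonvanishing
Jacobian determinant is an analytic isomorphism onto an open set. -/
theorem exists_openPartialHomeomorph_of_injOn {F : E → E} {Ω : Set E} (hΩ : IsOpen Ω)
    (hF : ContDiffOn ℂ ω F Ω) (hinj : InjOn F Ω) (hdet : ∀ x ∈ Ω, (fderiv ℂ F x).det ≠ 0) :
    ∃ e : OpenPartialHomeomorph E E, e.source = Ω ∧ (∀ y, e y = F y) ∧
      ContDiffOn ℂ ω e e.source ∧ ContDiffOn ℂ ω e.symm e.target := by
  have hopen : IsOpenMap (Ω.domRestrict F) := by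
    intro S hS
    obtain ⟨S', hS', rfl⟩ := isOpen_induced_iff.1 hS
    rw [isOpen_iff_mem_nhds]
    rintro _ ⟨⟨x, hxΩ⟩, hxS, rfl⟩
    obtain ⟨e, hxe, -, hee, -, -⟩ :=
      exists_openPartialHomeomorph_of_det_ne_zero hΩ hF hxΩ (hdet x hxΩ)
    have : F x = e x := (hee x).symm
    rw [show Ω.domRestrict F ⟨x, hxΩ⟩ = e x from this]
    have himg : e '' (e.source ∩ (Ω ∩ S')) ∈ 𝓝 (e x) :=
      (e.isOpen_image_source_inter (hΩ.inter hS')).mem_nhds ⟨x, ⟨hxe, hxΩ, hxS⟩, rfl⟩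
    refine mem_of_superset himg ?_
    rintro _ ⟨y, ⟨-, hy, hyS⟩, rfl⟩
    exact ⟨⟨y, hy⟩, hyS, (hee y).symm⟩
  rcases isEmpty_or_nonempty E with hE | hE
  · exact (hE.false 0).elim
  let e := OpenPartialHomeomorph.ofContinuousOpenRestrict (hinj.toPartialEquiv F Ω)
    hF.continuousOn hopen hΩ
  have hee : ∀ y, e y = F y := fun y => rfl
  have hef : (e : E → E) = F := funext hee
  have hes : e.source = Ω := rfl
  have hce : ContDiffOn ℂ ω e e.source := by rw [hef]; exact hF
  refine ⟨e, rfl, hee, hce, contDiffOn_symm_of_det_ne_zero e hce fun y hy => ?_⟩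
  rw [hef]; exact hdet y hy

end CoordinateChange

section Atlas

variable {n : ℕ} {X : Type u} [TopologicalSpace X] [ChartedSpace (Model n) X]

theorem contDiffOn_transition {z z' : OpenPartialHomeomorph X (Model n)}
    (hz : z ∈ IsManifold.maximalAtlas 𝓘(ℂ, Model n) ω X)
    (hz' : z' ∈ IsManifold.maximalAtlas 𝓘(ℂ, Model n) ω X) :
    ContDiffOn ℂ ω (z' ∘ z.symm) (z.target ∩ z.symm ⁻¹' z'.source) := by
  have h := StructureGroupoid.compatible_of_mem_maximalAtlas hz hz'
  rw [contDiffGroupoid, mem_groupoid_of_pregroupoid] at h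
  simpa [contDiffPregroupoid, ContDiffOn, Function.comp_def] using h.1

theorem trans_mem_maximalAtlas {z : OpenPartialHomeomorph X (Model n)}
    (hz : z ∈ IsManifold.maximalAtlas 𝓘(ℂ, Model n) ω X)
    (e : OpenPartialHomeomorph (Model n) (Model n))
    (he : ContDiffOn ℂ ω e e.source) (he' : ContDiffOn ℂ ω e.symm e.target) :
    z ≫ₕ e ∈ IsManifold.maximalAtlas 𝓘(ℂ, Model n) ω X := by
  have hG : e ∈ contDiffGroupoid ω 𝓘(ℂ, Model n) := by
    rw [contDiffGroupoid, mem_groupoid_of_pregroupoid]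
    simpa [contDiffPregroupoid, Function.comp_def] using ⟨he, he'⟩
  intro c hc
  constructor
  · rw [OpenPartialHomeomorph.trans_symm_eq_symm_trans_symm, OpenPartialHomeomorph.trans_assoc]
    exact (contDiffGroupoid ω 𝓘(ℂ, Model n)).trans
      ((contDiffGroupoid ω 𝓘(ℂ, Model n)).symm hG) (hz c hc).1
  · rw [← OpenPartialHomeomorph.trans_assoc]
    exact (contDiffGroupoid ω 𝓘(ℂ, Model n)).trans (hz c hc).2 hG

theorem restr_mem_maximalAtlas' {z : OpenPartialHomeomorph X (Model n)}
    (hz : z ∈ IsManifold.maximalAtlas 𝓘(ℂ, Model n) ω X) {s : Set X} (hs : IsOpen s) :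
    z.restr s ∈ IsManifold.maximalAtlas 𝓘(ℂ, Model n) ω X :=
  restr_mem_maximalAtlas (contDiffGroupoid ω 𝓘(ℂ, Model n)) hz hs

end Atlas

/-! ### Images of densities under continuous maps -/

theorem measurableSet_inter_preimage {Y X : Type*} [TopologicalSpace Y] [MeasurableSpace Y]
    [OpensMeasurableSpace Y] [TopologicalSpace X] [MeasurableSpace X] [BorelSpace X]
    {S : Set Y} (hS : MeasurableSet S) {g : Y → X} (hg : ContinuousOn g S) {A : Set X}
    (hA : MeasurableSet A) : MeasurableSet (S ∩ g ⁻¹' A) := by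
  have h1 : Measurable (S.domRestrict g) := hg.domRestrict.measurable
  have h2 : S ∩ g ⁻¹' A = Subtype.val '' ((S.domRestrict g) ⁻¹' A) := by
    ext y; simp [Set.domRestrict, and_comm]
  rw [h2]
  exact hS.subtype_image (h1 hA)

theorem aemeasurable_of_continuousOn {Y X : Type*} [TopologicalSpace Y] [MeasurableSpace Y]
    [OpensMeasurableSpace Y] [TopologicalSpace X] [MeasurableSpace X] [BorelSpace X]
    {μ : Measure Y}
    {S : Set Y} (hS : MeasurableSet S) {g : Y → X} (hg : ContinuousOn g S) :
    AEMeasurable g (μ.restrict S) := by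
  classical
  rcases isEmpty_or_nonempty X with hX | ⟨⟨x₀⟩⟩
  · exact (measurable_of_subsingleton_codomain g).aemeasurable
  refine ⟨S.piecewise g fun _ => x₀, ?_, ?_⟩
  · intro A hA
    rw [Set.piecewise_preimage, Set.ite]
    refine (by simpa [inter_comm] using measurableSet_inter_preimage hS hg hA :
      MeasurableSet (g ⁻¹' A ∩ S)).union ?_
    exact (measurable_const hA).diff hS
  · filter_upwards [ae_restrict_mem hS] with y hy
    simp [hy]

theorem map_withDensity_apply {Y X : Type*} [TopologicalSpace Y] [MeasurableSpace Y]
    [OpensMeasurableSpace Y] [TopologicalSpace X] [MeasurableSpace X] [BorelSpace X]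
    (μ : Measure Y) [SFinite μ] {S : Set Y} (hS : MeasurableSet S) {g : Y → X}
    (hg : ContinuousOn g S) (ρ : Y → ℝ≥0∞) {A : Set X} (hA : MeasurableSet A) :
    (((μ.restrict S).withDensity ρ).map g) A = ∫⁻ y in S ∩ g ⁻¹' A, ρ y ∂μ := by
  rw [Measure.map_apply_of_aemeasurable ((aemeasurable_of_continuousOn hS hg).mono_ac
    (withDensity_absolutelyContinuous _ _)) hA, withDensity_apply', Measure.restrict_restrict' hS,
    inter_comm]

/-! ### Transformation of the density -/

section Density

variable {n : ℕ} {X : Type u} [TopologicalSpace X] [ChartedSpace (Model n) X]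
  [IsManifold 𝓘(ℂ, Model n) ω X] {I : Type v}

/-- The change of the coordinate frame of the tangent space under a change of coordinates. The map
`M` is the derivative of the inverse of the chart `z'`. -/
theorem coordFrame_change {z z' : OpenPartialHomeomorph X (Model n)}
    (hz : z ∈ IsManifold.maximalAtlas 𝓘(ℂ, Model n) ω X)
    (hz' : z' ∈ IsManifold.maximalAtlas 𝓘(ℂ, Model n) ω X) {x : X} (hx : x ∈ z.source)
    (hx' : x ∈ z'.source) :
    ∃ M : Model n →ₗ[ℂ] TangentSpace 𝓘(ℂ, Model n) x,
      (∀ j, coordFrame z' x j = M (Pi.single j 1)) ∧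
      ∀ j, coordFrame z x j = M (fderiv ℂ (z' ∘ z.symm) (z x) (Pi.single j 1)) := by
  have hzx : z.symm (z x) = x := z.left_inv hx
  have hmem : z x ∈ z.target ∩ z.symm ⁻¹' z'.source := ⟨z.map_source hx, by
    rw [mem_preimage, hzx]; exact hx'⟩
  have hopen : IsOpen (z.target ∩ z.symm ⁻¹' z'.source) :=
    z.symm.isOpen_inter_preimage z'.open_source
  have h1 : MDifferentiableAt 𝓘(ℂ, Model n) 𝓘(ℂ, Model n) z'.symm (z' x) :=
    ((contMDiffOn_symm_of_mem_maximalAtlas hz' _ (z'.map_source hx')).contMDiffAt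
      (z'.open_target.mem_nhds (z'.map_source hx'))).mdifferentiableAt (by simp)
  have h2 : HasFDerivAt (z' ∘ z.symm) (fderiv ℂ (z' ∘ z.symm) (z x)) (z x) :=
    (((contDiffOn_transition hz hz') _ hmem).contDiffAt (hopen.mem_nhds hmem)).differentiableAt
      (by simp) |>.hasFDerivAt
  have h3 : (z' ∘ z.symm) (z x) = z' x := by simp [hzx]
  have h4 : HasMFDerivAt 𝓘(ℂ, Model n) 𝓘(ℂ, Model n) z.symm (z x)
      ((mfderiv 𝓘(ℂ, Model n) 𝓘(ℂ, Model n) z'.symm (z' x)).comp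
        (fderiv ℂ (z' ∘ z.symm) (z x))) := by
    have h5 : HasMFDerivAt 𝓘(ℂ, Model n) 𝓘(ℂ, Model n) z'.symm ((z' ∘ z.symm) (z x))
      (mfderiv 𝓘(ℂ, Model n) 𝓘(ℂ, Model n) z'.symm (z' x)) := by
      rw [h3]; exact h1.hasMFDerivAt
    have h6 := h5.comp (z x) h2.hasMFDerivAt
    refine h6.congr_of_eventuallyEq ?_
    filter_upwards [hopen.mem_nhds hmem] with w hw
    exact (z'.left_inv hw.2).symm
  let M : Model n →L[ℂ] Model n := mfderiv 𝓘(ℂ, Model n) 𝓘(ℂ, Model n) z'.symm (z' x)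
  refine ⟨(M : Model n →ₗ[ℂ] Model n), fun j => rfl, fun j => ?_⟩
  rw [coordFrame, h4.mfderiv]
  rfl

/-- An alternating form of top degree, pulled back by `M ∘ A`, is its pullback by `M` multiplied by
the determinant of `A`. -/
theorem alternatingMap_comp_det {n : ℕ} {V : Type*} [AddCommGroup V] [Module ℂ V]
    (η : V [⋀^Fin (n + 1)]→ₗ[ℂ] ℂ) (M : Model n →ₗ[ℂ] V) (A : Model n →ₗ[ℂ] Model n) :
    η (fun j => M (A (Pi.single j 1))) = LinearMap.det A * η fun j => M (Pi.single j 1) := by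
  have h := (η.compLinearMap M).eq_smul_basis_det (Pi.basisFun ℂ (Fin (n + 1)))
  have h1 := congrArg (fun f => f fun j => A (Pi.single j 1)) h
  simp only [AlternatingMap.compLinearMap_apply, AlternatingMap.smul_apply, smul_eq_mul] at h1
  have h2 : (Pi.basisFun ℂ (Fin (n + 1))).det (fun j => A (Pi.single j 1)) = LinearMap.det A := by
    have := (Pi.basisFun ℂ (Fin (n + 1))).det_comp A (Pi.basisFun ℂ (Fin (n + 1)))
    rw [Module.Basis.det_self, mul_one] at this
    rw [← this]
    congr 1
    ext j
    simp
  rw [h1, h2]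
  simp [Pi.basisFun_apply, mul_comm]

variable {L : X → Type*} [TopologicalSpace (TotalSpace ℂ L)] [∀ x, AddCommGroup (L x)]
  [∀ x, Module ℂ (L x)] [∀ x, TopologicalSpace (L x)] [FiberBundle ℂ L] [VectorBundle ℂ ℂ L]
  {D : SncDegeneration n X I} (ℒ : CanonicalExtension L D)

namespace CanonicalExtension

theorem coeff_change {z z' : OpenPartialHomeomorph X (Model n)}
    (hz : z ∈ IsManifold.maximalAtlas 𝓘(ℂ, Model n) ω X)
    (hz' : z' ∈ IsManifold.maximalAtlas 𝓘(ℂ, Model n) ω X) {x : X} (hx : x ∈ z.source)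
    (hx' : x ∈ z'.source) (hg : x ∈ D.generic) (s : L x) :
    ℒ.coeff z x s = (fderiv ℂ (z' ∘ z.symm) (z x)).det ^ ℒ.m * ℒ.coeff z' x s := by
  obtain ⟨M, hM, hM'⟩ := coordFrame_change hz hz' hx hx'
  obtain ⟨η, hη⟩ := ℒ.isPluricanonical x hg s
  rw [coeff, coeff, hη, hη, ← mul_pow]
  congr 1
  rw [funext hM, funext hM']
  exact alternatingMap_comp_det η M _

theorem len_nonneg (ψ : ContinuousMetric L) (x : X) (s : L x) : 0 ≤ ψ.len x s := by
  by_cases h : s = 0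
  · have := ψ.len_smul x 0 0
    simp at this
    rw [h, this]
  · exact (ψ.len_pos x _ h).le

/-- The density transforms by the square of the absolute value of the Jacobian. -/
theorem density_change (ψ : ContinuousMetric L) {z z' : OpenPartialHomeomorph X (Model n)}
    (hz : z ∈ IsManifold.maximalAtlas 𝓘(ℂ, Model n) ω X)
    (hz' : z' ∈ IsManifold.maximalAtlas 𝓘(ℂ, Model n) ω X) {x : X} (hx : x ∈ z.source)
    (hx' : x ∈ z'.source) (hg : x ∈ D.generic) :
    ℒ.density ψ z x = ‖(fderiv ℂ (z' ∘ z.symm) (z x)).det‖ ^ 2 * ℒ.density ψ z' x := by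
  have hm : (0 : ℝ) < ℒ.m := by exact_mod_cast ℒ.m_pos
  have hlen := len_nonneg ψ x ((trivializationAt ℂ L x).symm x 1)
  rw [density, density, ℒ.coeff_change hz hz' hx hx' hg, norm_mul, norm_pow, mul_div_assoc,
    Real.mul_rpow (by positivity) (by positivity), ← Real.rpow_natCast,
    ← Real.rpow_mul (by positivity)]
  congr 1
  rw [mul_div_cancel₀ _ hm.ne']
  exact_mod_cast Real.rpow_natCast _ 2

theorem density_nonneg (ψ : ContinuousMetric L) (z : OpenPartialHomeomorph X (Model n)) (x : X) :
    0 ≤ ℒ.density ψ z x := by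
  have hlen := len_nonneg ψ x ((trivializationAt ℂ L x).symm x 1)
  exact Real.rpow_nonneg (by positivity) _

/-- The density can be computed from an arbitrary local frame. -/
theorem density_eq (ψ : ContinuousMetric L) (z : OpenPartialHomeomorph X (Model n)) {x : X}
    (e : Trivialization ℂ (TotalSpace.proj : TotalSpace ℂ L → X)) [MemTrivializationAtlas e]
    (hx : x ∈ e.baseSet) :
    ℒ.density ψ z x =
      (‖ℒ.coeff z x (e.symm x 1)‖ / ψ.len x (e.symm x 1)) ^ (2 / (ℒ.m : ℝ)) := by
  set e' := trivializationAt ℂ L x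
  have hx' : x ∈ e'.baseSet := mem_baseSet_trivializationAt ℂ L x
  obtain ⟨c, hc0, hc⟩ : ∃ c : ℂ, c ≠ 0 ∧ e'.symm x 1 = c • e.symm x 1 := by
    refine ⟨e.continuousLinearEquivAt ℂ x hx (e'.symm x 1), ?_, ?_⟩
    · intro h
      have h1 : e'.symm x (1 : ℂ) = 0 := (map_eq_zero_iff _ (ContinuousLinearEquiv.injective _)).1 h
      have h2 : (e'.continuousLinearEquivAt ℂ x hx').symm 1 = 0 := h1
      exact one_ne_zero ((map_eq_zero_iff _ (ContinuousLinearEquiv.injective _)).1 h2)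
    · have h1 : ∀ w : ℂ, (e.continuousLinearEquivAt ℂ x hx).symm w = e.symm x w := fun w => rfl
      rw [← h1, ← map_smul, smul_eq_mul, mul_one, ContinuousLinearEquiv.symm_apply_apply]
  have hs : ∀ s : L x, ℒ.coeff z x (c • s) = c * ℒ.coeff z x s := fun s => by
    simp [coeff, map_smul]
  rw [density]
  change (‖ℒ.coeff z x (e'.symm x 1)‖ / ψ.len x (e'.symm x 1)) ^ (2 / (ℒ.m : ℝ)) = _
  rw [hc, hs, ψ.len_smul, norm_mul, mul_div_mul_left _ _ (norm_ne_zero_iff.2 hc0)]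


/-! ### The measures on the fibres -/

/-- The inclusion of the hyperplane `z 0 = 0`. -/
def consZero : (Fin n → ℂ) →L[ℂ] Model n :=
  LinearMap.toContinuousLinearMap
    { toFun := fun v => (Fin.cons 0 v : Model n)
      map_add' := fun v w => by ext i; refine Fin.cases ?_ (fun j => ?_) i <;> simp
      map_smul' := fun c v => by ext i; refine Fin.cases ?_ (fun j => ?_) i <;> simp }

theorem consZero_apply (v : Fin n → ℂ) : consZero v = (Fin.cons 0 v : Model n) := rfl

/-- The determinant of an endomorphism that preserves the coordinate zero is the determinant of its
restriction to the kernel of that coordinate. -/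
theorem det_of_apply_zero (A : Model n →ₗ[ℂ] Model n) (hA : ∀ v, A v 0 = v 0)
    (B : (Fin n → ℂ) →ₗ[ℂ] (Fin n → ℂ)) (hB : ∀ v j, B v j = A (consZero v) j.succ) :
    LinearMap.det A = LinearMap.det B := by
  classical
  rw [← LinearMap.det_toMatrix', ← LinearMap.det_toMatrix', Matrix.det_succ_row_zero,
    Finset.sum_eq_single 0]
  · simp only [Fin.val_zero, pow_zero, one_mul, LinearMap.toMatrix'_apply, hA]
    simp only [Pi.single_eq_same, one_mul]
    congr 1
    funext i j
    simp only [Matrix.submatrix_apply, LinearMap.toMatrix'_apply, Fin.succAbove_zero, hB]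
    have h : (Pi.single j.succ (1 : ℂ) : Model n) = consZero (Pi.single j 1) := by
      rw [consZero_apply]
      funext l
      refine Fin.cases ?_ (fun l => ?_) l
      · simp
      · simp [Pi.single_apply]
    rw [h]
  · intro j _ hj
    simp [LinearMap.toMatrix'_apply, hA, hj.symm]
  · simp

/-- The inclusion of the slice `z 0 = t`. -/
def slice (t : ℂ) (y : Fin n → ℂ) : Model n := Fin.cons t y

theorem hasFDerivAt_slice (t : ℂ) (y : Fin n → ℂ) :
    HasFDerivAt (slice t : (Fin n → ℂ) → Model n) consZero y := by
  have h : (slice t : (Fin n → ℂ) → Model n) = fun y => consZero y + slice t 0 := by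
    funext y
    rw [consZero_apply]
    ext i
    refine Fin.cases ?_ (fun j => ?_) i <;> simp [slice]
  rw [h]
  exact consZero.hasFDerivAt.add_const _

theorem continuous_slice (t : ℂ) : Continuous (slice t : (Fin n → ℂ) → Model n) :=
  continuous_iff_continuousAt.2 fun y => (hasFDerivAt_slice t y).continuousAt

variable [MeasurableSpace X] [BorelSpace X]

theorem isOpen_sliceTarget (z : OpenPartialHomeomorph X (Model n)) (t : ℂ) :
    IsOpen {y : Fin n → ℂ | (Fin.cons t y : Model n) ∈ z.target} :=
  z.open_target.preimage (continuous_slice t)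

theorem continuousOn_sliceTarget (z : OpenPartialHomeomorph X (Model n)) (t : ℂ) :
    ContinuousOn (fun y => z.symm (Fin.cons t y))
      {y : Fin n → ℂ | (Fin.cons t y : Model n) ∈ z.target} :=
  z.symm.continuousOn.comp (continuous_slice t).continuousOn fun _ hy => hy

theorem localFibreMeasure_apply (ψ : ContinuousMetric L) (t : ℂ) (z : FibreChart D) {A : Set X}
    (hA : MeasurableSet A) :
    ℒ.localFibreMeasure ψ t z A =
      ∫⁻ y in {y | (Fin.cons t y : Model n) ∈ z.1.target} ∩ (fun y => z.1.symm (Fin.cons t y)) ⁻¹' A,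
        ENNReal.ofReal (ℒ.density ψ z.1 (z.1.symm (Fin.cons t y))) :=
  map_withDensity_apply volume (isOpen_sliceTarget z.1 t).measurableSet
    (continuousOn_sliceTarget z.1 t) _ hA

/-- The measure on the fibre does not depend on the chart: the transition map of two fibre charts
preserves the coordinate zero, so that its Jacobian is that of the induced map of the fibres, and
the density transforms by the squared norm of this Jacobian. -/
theorem localFibreMeasure_agree (ψ : ContinuousMetric L) {t : ℂ} (ht : t ≠ 0)
    (z z' : FibreChart D) {A : Set X} (hA : MeasurableSet A) (hAz : A ⊆ z.1.source)
    (hAz' : A ⊆ z'.1.source) :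
    ℒ.localFibreMeasure ψ t z A = ℒ.localFibreMeasure ψ t z' A := by
  rw [localFibreMeasure_apply ℒ ψ t z hA, localFibreMeasure_apply ℒ ψ t z' hA]
  set g : (Fin n → ℂ) → X := fun y => z.1.symm (Fin.cons t y) with hg
  set g' : (Fin n → ℂ) → X := fun y => z'.1.symm (Fin.cons t y) with hg'
  set S := {y : Fin n → ℂ | (Fin.cons t y : Model n) ∈ z.1.target} with hS
  set S' := {y : Fin n → ℂ | (Fin.cons t y : Model n) ∈ z'.1.target} with hS'
  -- the transition map `Ψ` preserves the coordinate zero, hence maps slices to slices; `φ` is the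
  -- induced map of the slices over `t`
  let Ψ : Model n → Model n := z'.1 ∘ z.1.symm
  let φ : (Fin n → ℂ) → (Fin n → ℂ) := fun y => Fin.tail (Ψ (slice t y))
  have hproj : ∀ y ∈ S, D.proj (g y) = t := fun y hy => by
    rw [← z.2.2 _ (z.1.map_target hy)]
    simp [z.1.right_inv hy]
  have hcons : ∀ y ∈ S ∩ g ⁻¹' A, (Fin.cons t (φ y) : Model n) = z'.1 (g y) := by
    intro y hy
    have h1 : z'.1 (g y) 0 = t := by rw [z'.2.2 _ (hAz' hy.2), hproj y hy.1]
    rw [← h1]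
    exact Fin.cons_self_tail _
  have hg'φ : ∀ y ∈ S ∩ g ⁻¹' A, φ y ∈ S' ∧ g' (φ y) = g y := by
    intro y hy
    constructor
    · change (Fin.cons t (φ y) : Model n) ∈ z'.1.target
      rw [hcons y hy]
      exact z'.1.map_source (hAz' hy.2)
    · change z'.1.symm (Fin.cons t (φ y)) = _
      rw [hcons y hy, z'.1.left_inv (hAz' hy.2)]
  have hinj : InjOn φ (S ∩ g ⁻¹' A) := by
    intro y hy y' hy' h
    have h1 : g y = g y' := by rw [← (hg'φ y hy).2, h, (hg'φ y' hy').2]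
    have h2 : z.1 (g y) = z.1 (g y') := by rw [h1]
    simp only [hg] at h2
    rw [z.1.right_inv hy.1, z.1.right_inv hy'.1] at h2
    exact Fin.cons_right_injective (α := fun _ => ℂ) t h2
  have himg : φ '' (S ∩ g ⁻¹' A) = S' ∩ g' ⁻¹' A := by
    ext y'
    constructor
    · rintro ⟨y, hy, rfl⟩
      exact ⟨(hg'φ y hy).1, by rw [mem_preimage, (hg'φ y hy).2]; exact hy.2⟩
    · rintro ⟨hy', hyA⟩
      have h0 : z.1 (g' y') 0 = t := by
        rw [z.2.2 _ (hAz hyA), ← z'.2.2 _ (hAz' hyA)]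
        simp [hg', z'.1.right_inv hy']
      have h1 : (Fin.cons t (Fin.tail (z.1 (g' y'))) : Model n) = z.1 (g' y') := by
        conv_lhs => rw [← h0]
        exact Fin.cons_self_tail _
      have h2 : g (Fin.tail (z.1 (g' y'))) = g' y' := by
        simp only [hg, h1]
        exact z.1.left_inv (hAz hyA)
      have hm : Fin.tail (z.1 (g' y')) ∈ S ∩ g ⁻¹' A := by
        refine ⟨?_, ?_⟩
        · change (Fin.cons t (Fin.tail (z.1 (g' y'))) : Model n) ∈ z.1.target
          rw [h1]; exact z.1.map_source (hAz hyA)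
        · rw [mem_preimage, h2]; exact hyA
      refine ⟨_, hm, ?_⟩
      have h3 := hcons _ hm
      rw [h2] at h3
      simp only [hg'] at h3
      rw [z'.1.right_inv hy'] at h3
      exact Fin.cons_right_injective (α := fun _ => ℂ) t h3
  have hmeas : MeasurableSet (S ∩ g ⁻¹' A) := measurableSet_inter_preimage
    (isOpen_sliceTarget z.1 t).measurableSet (continuousOn_sliceTarget z.1 t) hA
  let dΨ : (Fin n → ℂ) → (Model n →L[ℂ] Model n) := fun y => fderiv ℂ Ψ (slice t y)
  let dφ : (Fin n → ℂ) → ((Fin n → ℂ) →L[ℂ] (Fin n → ℂ)) := fun y =>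
    (ContinuousLinearMap.pi fun j : Fin n => ContinuousLinearMap.proj (R := ℂ)
      (φ := fun _ : Fin (n + 1) => ℂ) j.succ).comp
    ((dΨ y).comp consZero)
  have hΨ : ∀ y ∈ S ∩ g ⁻¹' A, HasFDerivAt Ψ (dΨ y) (slice t y) ∧ ∀ v, dΨ y v 0 = v 0 := by
    intro y hy
    have hmem : slice t y ∈ z.1.target ∩ z.1.symm ⁻¹' z'.1.source := ⟨hy.1, hAz' hy.2⟩
    have hopen : IsOpen (z.1.target ∩ z.1.symm ⁻¹' z'.1.source) :=
      z.1.symm.isOpen_inter_preimage z'.1.open_source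
    have h2 : HasFDerivAt Ψ (dΨ y) (slice t y) :=
      (((contDiffOn_transition z.2.1 z'.2.1) _ hmem).contDiffAt
        (hopen.mem_nhds hmem)).differentiableAt (by simp) |>.hasFDerivAt
    refine ⟨h2, fun v => ?_⟩
    have h3 := (hasFDerivAt_pi'.1 h2) 0
    have h4 : HasFDerivAt (fun w : Model n => Ψ w 0)
        (ContinuousLinearMap.proj (R := ℂ) (φ := fun _ : Fin (n + 1) => ℂ) 0) (slice t y) := by
      -- both coordinates zero are the projection
      refine (hasFDerivAt_apply (𝕜 := ℂ) (0 : Fin (n + 1)) (slice t y)).congr_of_eventuallyEq ?_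
      filter_upwards [hopen.mem_nhds hmem] with w hw
      change z'.1 (z.1.symm w) 0 = w 0
      rw [z'.2.2 _ hw.2, ← z.2.2 _ (z.1.map_target hw.1), z.1.right_inv hw.1]
    have h5 := congrArg (fun f => f v) (h3.unique h4)
    simpa using h5
  have hφ : ∀ y ∈ S ∩ g ⁻¹' A, HasFDerivWithinAt φ ((dφ y).restrictScalars ℝ) (S ∩ g ⁻¹' A) y := by
    intro y hy
    have h1 := (hΨ y hy).1.comp y (hasFDerivAt_slice t y)
    have h2 : HasFDerivAt φ (dφ y) y := by
      rw [hasFDerivAt_pi']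
      intro j
      exact hasFDerivAt_pi'.1 h1 j.succ
    exact (h2.restrictScalars ℝ).hasFDerivWithinAt
  have hdet : ∀ y ∈ S ∩ g ⁻¹' A, (dΨ y).det = (dφ y).det := by
    intro y hy
    exact det_of_apply_zero _ (hΨ y hy).2 _ fun v j => rfl
  rw [← himg, lintegral_image_eq_lintegral_abs_det_fderiv_mul volume hmeas hφ hinj]
  refine setLIntegral_congr_fun hmeas fun y hy => ?_
  rw [← ENNReal.ofReal_mul (abs_nonneg _), abs_det_restrictScalars, ← hdet y hy]
  congr 1
  change ℒ.density ψ z.1 (g y) = ‖(dΨ y).det‖ ^ 2 * ℒ.density ψ z'.1 (g' (φ y))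
  rw [(hg'φ y hy).2, ℒ.density_change ψ z.2.1 z'.2.1 (hAz hy.2) (hAz' hy.2)
    (by change D.proj (g y) ≠ 0; rw [hproj y hy.1]; exact ht)]
  congr 3
  simp only [hg]
  rw [z.1.right_inv hy.1]
  rfl

theorem localFibreMeasure_compl (ψ : ContinuousMetric L) (t : ℂ) (z : FibreChart D) :
    ℒ.localFibreMeasure ψ t z z.1.sourceᶜ = 0 := by
  rw [localFibreMeasure_apply ℒ ψ t z z.1.open_source.measurableSet.compl]
  convert lintegral_zero_measure _
  rw [Measure.restrict_eq_zero]
  convert measure_empty (μ := volume)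
  ext y
  simp only [mem_inter_iff, mem_ofPred_eq, mem_preimage, mem_compl_iff, mem_empty_iff_false,
    iff_false, not_and, not_not]
  exact fun hy => z.1.map_target hy

/-- In a fibre chart, the measure of the fibre is given by the density in the coordinates. -/
theorem fibreMeasure_restrict (ψ : ContinuousMetric L) {t : ℂ} (ht : t ≠ 0) (z : FibreChart D) :
    (ℒ.fibreMeasure ψ t).restrict z.1.source = ℒ.localFibreMeasure ψ t z := by
  refine iSup_restrict_of_agree (fun z => ℒ.localFibreMeasure ψ t z) (fun z => z.1.source)
    (fun z => z.1.open_source.measurableSet) (fun z => localFibreMeasure_compl ℒ ψ t z) ?_ z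
  intro z z'
  ext A hA
  have hm := z.1.open_source.measurableSet.inter z'.1.open_source.measurableSet
  rw [Measure.restrict_apply hA, Measure.restrict_apply hA]
  exact localFibreMeasure_agree ℒ ψ ht z z' (hA.inter hm) (fun x hx => hx.2.1) fun x hx => hx.2.2

theorem fibreMeasure_compl (ψ : ContinuousMetric L) (t : ℂ) :
    ℒ.fibreMeasure ψ t (D.proj ⁻¹' {t})ᶜ = 0 := by
  have hc : Continuous D.proj := D.holomorphic.continuous
  have hm : MeasurableSet (D.proj ⁻¹' {t}) := (isClosed_singleton.preimage hc).measurableSet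
  refine iSup_measure_compl_eq_zero _ _ hm fun z => ?_
  rw [localFibreMeasure_apply ℒ ψ t z hm.compl]
  convert lintegral_zero_measure _
  rw [Measure.restrict_eq_zero]
  convert measure_empty (μ := volume)
  ext y
  simp only [mem_inter_iff, mem_ofPred_eq, mem_preimage, mem_compl_iff, mem_empty_iff_false,
    iff_false, not_and, not_not, mem_singleton_iff]
  intro hy
  rw [← z.2.2 _ (z.1.map_target hy), z.1.right_inv hy]
  simp

end CanonicalExtension
end Density

/-! ### Fibre charts and monomial charts -/

section Charts

theorem det_ne_zero_of_injective {E : Type*} [NormedAddCommGroup E] [NormedSpace ℂ E]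
    [FiniteDimensional ℂ E] (A : E →L[ℂ] E) (hA : ∀ v, A v = 0 → v = 0) : A.det ≠ 0 := by
  intro h
  have := LinearMap.bot_lt_ker_of_det_eq_zero (f := (A : E →ₗ[ℂ] E)) h
  refine this.ne' ((LinearMap.ker_eq_bot').2 fun v hv => hA v hv)

variable {n : ℕ} {X : Type u} [TopologicalSpace X] [ChartedSpace (Model n) X]
  [IsManifold 𝓘(ℂ, Model n) ω X] {I : Type v} (D : SncDegeneration n X I)

theorem contDiffOn_comp_symm {f : X → ℂ} {z : OpenPartialHomeomorph X (Model n)}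
    (hz : z ∈ IsManifold.maximalAtlas 𝓘(ℂ, Model n) ω X)
    (hf : ContMDiffOn 𝓘(ℂ, Model n) 𝓘(ℂ, ℂ) ω f z.source) :
    ContDiffOn ℂ ω (f ∘ z.symm) z.target := by
  rw [← contMDiffOn_iff_contDiffOn]
  exact hf.comp (contMDiffOn_symm_of_mem_maximalAtlas hz) fun w hw => z.map_target hw

namespace SncDegeneration

theorem isOpen_generic : IsOpen D.generic :=
  isOpen_compl_singleton.preimage D.holomorphic.continuous

/-- The submersion `D.proj` can be completed to a system of coordinates around each generic point.
-/
theorem exists_fibreChart {x : X} (hx : x ∈ D.generic) :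
    ∃ z : CanonicalExtension.FibreChart D, x ∈ z.1.source := by
  let z := chartAt (Model n) x
  have hz : z ∈ IsManifold.maximalAtlas 𝓘(ℂ, Model n) ω X := IsManifold.chart_mem_maximalAtlas x
  have hxz : x ∈ z.source := mem_chart_source _ x
  let p : Model n → ℂ := D.proj ∘ z.symm
  have hp : ContDiffOn ℂ ω p z.target := contDiffOn_comp_symm hz D.holomorphic.contMDiffOn
  have hzx : z x ∈ z.target := z.map_source hxz
  have hpd : DifferentiableAt ℂ p (z x) :=
    ((hp _ hzx).contDiffAt (z.open_target.mem_nhds hzx)).differentiableAt (by simp)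
  have hsurj : Function.Surjective (fderiv ℂ p (z x)) := by
    have h1 : HasMFDerivAt 𝓘(ℂ, Model n) 𝓘(ℂ, Model n) z x
        (mfderiv 𝓘(ℂ, Model n) 𝓘(ℂ, Model n) z x) :=
      (((contMDiffOn_of_mem_maximalAtlas hz) _ hxz).contMDiffAt
        (z.open_source.mem_nhds hxz)).mdifferentiableAt (by simp) |>.hasMFDerivAt
    have h2 := hpd.hasFDerivAt.hasMFDerivAt.comp x h1
    have h3 : HasMFDerivAt 𝓘(ℂ, Model n) 𝓘(ℂ, ℂ) D.proj x
        ((fderiv ℂ p (z x)).comp (mfderiv 𝓘(ℂ, Model n) 𝓘(ℂ, Model n) z x)) := by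
      refine h2.congr_of_eventuallyEq ?_
      filter_upwards [z.open_source.mem_nhds hxz] with y hy
      simp [p, z.left_inv hy]
    have h4 := D.submersion x hx
    rw [h3.mfderiv] at h4
    intro c
    obtain ⟨v, hv⟩ := h4 c
    exact ⟨_, hv⟩
  obtain ⟨j, hj⟩ : ∃ j, fderiv ℂ p (z x) (Pi.single j 1) ≠ 0 := by
    by_contra! h
    obtain ⟨v, hv⟩ := hsurj 1
    have h0 : (fderiv ℂ p (z x) : Model n →ₗ[ℂ] ℂ) = 0 :=
      (Pi.basisFun ℂ (Fin (n + 1))).ext fun j => by simpa using h j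
    have h1 : fderiv ℂ p (z x) v = (0 : Model n →ₗ[ℂ] ℂ) v := by rw [← h0]; rfl
    rw [hv] at h1
    simp at h1
  -- the projection replaces a coordinate `j` along which its derivative does not vanish
  let F : Model n → Model n := fun w => Fin.cons (p w) fun i => w (j.succAbove i)
  have hF : ContDiffOn ℂ ω F z.target := by
    rw [contDiffOn_pi]
    intro i
    refine Fin.cases ?_ (fun i => ?_) i
    · simpa [F] using hp
    · simpa [F] using (contDiff_apply ℂ ℂ (j.succAbove i)).contDiffOn
  have hFd : HasFDerivAt F (fderiv ℂ F (z x)) (z x) :=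
    (((hF _ hzx).contDiffAt (z.open_target.mem_nhds hzx)).differentiableAt (by simp)).hasFDerivAt
  have hdet : (fderiv ℂ F (z x)).det ≠ 0 := by
    refine det_ne_zero_of_injective _ fun v hv => ?_
    have h0 : fderiv ℂ p (z x) v = 0 := by
      have h1 := hasFDerivAt_pi'.1 hFd 0
      have h2 : HasFDerivAt (fun w => F w 0) (fderiv ℂ p (z x)) (z x) := by
        simpa [F] using hpd.hasFDerivAt
      rw [h2.unique h1]
      simp [hv]
    have h1 : ∀ i, v (j.succAbove i) = 0 := fun i => by
      have h1 := hasFDerivAt_pi'.1 hFd i.succ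
      have h2 : HasFDerivAt (fun w => F w i.succ) (ContinuousLinearMap.proj (R := ℂ)
          (φ := fun _ : Fin (n + 1) => ℂ) (j.succAbove i)) (z x) := by
        simpa [F] using hasFDerivAt_apply (𝕜 := ℂ) (j.succAbove i) (z x)
      have h3 := congrArg (fun f => f v) (h2.unique h1)
      simpa [hv] using h3
    have h2 : v = v j • Pi.single j (1 : ℂ) := by
      funext l
      rcases Fin.eq_self_or_eq_succAbove j l with rfl | ⟨i, rfl⟩
      · simp
      · simp [h1]
    rw [h2, map_smul, smul_eq_mul, mul_eq_zero] at h0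
    rw [h2, h0.resolve_right hj, zero_smul]
  obtain ⟨e, hxe, hes, heF, he, he'⟩ :=
    exists_openPartialHomeomorph_of_det_ne_zero z.open_target hF hzx hdet
  refine ⟨⟨z ≫ₕ e, trans_mem_maximalAtlas hz e he he', fun y hy => ?_⟩, ⟨hxz, hxe⟩⟩
  change e (z y) 0 = _
  rw [heF]
  simp [F, p, z.left_inv hy.1]

/-- Around each point of the zero fibre there is an adapted chart in which the projection is a
monomial: a root of the invertible factor is absorbed into one of the coordinates. -/
theorem exists_monomialChart {x : X} (hx : D.proj x = 0) :
    ∃ c : CanonicalExtension.MonomialChart D, x ∈ c.1.z.source := by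
  classical
  obtain ⟨z, J, k, f, hs, hxz, hf, hfp⟩ := D.snc x hx
  obtain ⟨i₀, hi₀⟩ := (D.zero_iff x).1 hx
  obtain ⟨hi₀J, hz0⟩ := (hs.mem_iff x hxz i₀).1 hi₀
  have hb : (D.b i₀ : ℂ) ≠ 0 := by exact_mod_cast (D.b_pos i₀).ne'
  have hzx : z x ∈ z.target := z.map_source hxz
  let φ : Model n → ℂ := f ∘ z.symm
  have hφ : ContDiffOn ℂ ω φ z.target := contDiffOn_comp_symm hs.holomorphic hf
  have hφx : φ (z x) = f x := by simp [φ, z.left_inv hxz]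
  have hfx : f x ≠ 0 := (hfp x hxz).1
  -- where `φ / f x` avoids the negative half axis, the invertible factor `φ` has a logarithm, and
  -- hence a root `h` of order `b i₀`
  let Ω : Set (Model n) := z.target ∩ (fun w => φ w / f x) ⁻¹' Complex.slitPlane
  have hΩ : IsOpen Ω := (hφ.continuousOn.div_const _).isOpen_inter_preimage z.open_target
    Complex.isOpen_slitPlane
  have hxΩ : z x ∈ Ω := ⟨hzx, by simp [hφx, div_self hfx]⟩
  let h : Model n → ℂ := fun w =>
    Complex.exp ((Complex.log (φ w / f x) + Complex.log (f x)) / D.b i₀)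
  have hh : ContDiffOn ℂ ω h Ω := by
    refine ContDiffOn.cexp (ContDiffOn.div_const (ContDiffOn.add (fun w hw => ?_)
      contDiffOn_const) _)
    exact (Complex.contDiffAt_log hw.2).comp_contDiffWithinAt w
      (((hφ.mono inter_subset_left).div_const _) w hw)
  have hhpow : ∀ w ∈ Ω, h w ^ D.b i₀ = φ w := by
    intro w hw
    rw [← Complex.exp_nat_mul, mul_div_cancel₀ _ hb, Complex.exp_add, Complex.exp_log hfx,
      Complex.exp_log (Complex.slitPlane_ne_zero hw.2), div_mul_cancel₀ _ hfx]
  have hh0 : ∀ w, h w ≠ 0 := fun w => Complex.exp_ne_zero _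
  -- the root is absorbed into the equation of the component `i₀`
  let F : Model n → Model n := fun w => Function.update w (k i₀) (w (k i₀) * h w)
  have hFk : ∀ w, F w (k i₀) = w (k i₀) * h w := fun w => by simp [F]
  have hFl : ∀ w l, l ≠ k i₀ → F w l = w l := fun w l hl => by simp [F, hl]
  have hF : ContDiffOn ℂ ω F Ω := by
    rw [contDiffOn_pi]
    intro l
    by_cases hl : l = k i₀
    · subst hl
      simp only [hFk]
      exact (contDiff_apply ℂ ℂ (k i₀)).contDiffOn.mul hh
    · simp only [hFl _ l hl]
      exact (contDiff_apply ℂ ℂ l).contDiffOn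
  have hFd : HasFDerivAt F (fderiv ℂ F (z x)) (z x) :=
    (((hF _ hxΩ).contDiffAt (hΩ.mem_nhds hxΩ)).differentiableAt (by simp)).hasFDerivAt
  have hhd : HasFDerivAt h (fderiv ℂ h (z x)) (z x) :=
    (((hh _ hxΩ).contDiffAt (hΩ.mem_nhds hxΩ)).differentiableAt (by simp)).hasFDerivAt
  -- the coordinate `k i₀` vanishes at `x`, so that the derivative of `h` does not contribute
  have hdet : (fderiv ℂ F (z x)).det ≠ 0 := by
    refine det_ne_zero_of_injective _ fun v hv => ?_
    funext l
    have h1 := hasFDerivAt_pi'.1 hFd l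
    by_cases hl : l = k i₀
    · subst hl
      simp only [hFk] at h1
      have h2 := (hasFDerivAt_apply (𝕜 := ℂ) (k i₀) (z x)).mul hhd
      have h3 := congrArg (fun f => f v) (h2.unique h1)
      have h4 : h (z x) * v (k i₀) = 0 := by simpa [hz0, hv] using h3
      exact (mul_eq_zero.1 h4).resolve_left (hh0 _)
    · simp only [hFl _ l hl] at h1
      have h3 := congrArg (fun f => f v) ((hasFDerivAt_apply (𝕜 := ℂ) l (z x)).unique h1)
      simpa [hv] using h3
  obtain ⟨e, hxe, hes, heF, he, he'⟩ :=
    exists_openPartialHomeomorph_of_det_ne_zero hΩ hF hxΩ hdet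
  have hkk : ∀ i ∈ J, i ≠ i₀ → k i ≠ k i₀ := fun i hi hne hk =>
    hne (hs.injOn (by exact_mod_cast hi) (by exact_mod_cast hi₀J) hk)
  refine ⟨⟨⟨z ≫ₕ e, J, k, ?_, hs.injOn, ?_⟩, ?_⟩, ⟨hxz, hxe⟩⟩
  · exact trans_mem_maximalAtlas hs.holomorphic e he he'
  · intro y hy i
    rw [hs.mem_iff y hy.1]
    refine and_congr_right fun hi => ?_
    change _ ↔ e (z y) (k i) = 0
    rw [heF]
    by_cases hii : i = i₀
    · subst hii; simp [hFk, hh0]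
    · rw [hFl _ _ (hkk i hi hii)]
  · intro y hy
    rw [(hfp y hy.1).2]
    change _ = ∏ i ∈ J, e (z y) (k i) ^ D.b i
    simp only [heF]
    rw [← Finset.mul_prod_erase _ _ hi₀J, ← Finset.mul_prod_erase J (fun i => F (z y) (k i) ^ D.b i)
      hi₀J, hFk, mul_pow, hhpow (z y) (hes hy.2)]
    have : ∏ i ∈ J.erase i₀, F (z y) (k i) ^ D.b i = ∏ i ∈ J.erase i₀, z y (k i) ^ D.b i :=
      Finset.prod_congr rfl fun i hi => by
        rw [hFl _ _ (hkk i (Finset.mem_of_mem_erase hi) (Finset.ne_of_mem_erase hi))]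
    rw [this]
    simp only [φ, Function.comp_apply, z.left_inv hy.1]
    ring

end SncDegeneration

section Line

variable {D}
variable {L : X → Type*} [TopologicalSpace (TotalSpace ℂ L)] [∀ x, AddCommGroup (L x)]
  [∀ x, Module ℂ (L x)] [∀ x, TopologicalSpace (L x)] [FiberBundle ℂ L] [VectorBundle ℂ ℂ L]
  (ℒ : CanonicalExtension L D)

theorem continuousOn_len_symm (ψ : ContinuousMetric L)
    (e : Trivialization ℂ (TotalSpace.proj : TotalSpace ℂ L → X)) [MemTrivializationAtlas e] :
    ContinuousOn (fun x => ψ.len x (e.symm x 1)) e.baseSet := by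
  have h1 : ContinuousOn (fun x => (⟨x, e.symm x 1⟩ : TotalSpace ℂ L)) e.baseSet := by
    have h2 : ContinuousOn (fun x : X => e.toOpenPartialHomeomorph.symm (x, (1 : ℂ))) e.baseSet :=
      e.toOpenPartialHomeomorph.symm.continuousOn.comp (by fun_prop) fun x hx => by
        change (x, (1 : ℂ)) ∈ e.target
        rw [e.target_eq]
        exact ⟨hx, trivial⟩
    refine h2.congr fun x hx => ?_
    exact e.mk_symm hx 1
  exact ψ.continuous.comp_continuousOn h1

theorem symm_one_ne_zero (e : Trivialization ℂ (TotalSpace.proj : TotalSpace ℂ L → X))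
    [MemTrivializationAtlas e] {x : X} (hx : x ∈ e.baseSet) : e.symm x (1 : ℂ) ≠ 0 := by
  intro h
  have h2 : (e.continuousLinearEquivAt ℂ x hx).symm 1 = 0 := h
  exact one_ne_zero ((map_eq_zero_iff _ (ContinuousLinearEquiv.injective _)).1 h2)

theorem len_symm_pos (ψ : ContinuousMetric L)
    (e : Trivialization ℂ (TotalSpace.proj : TotalSpace ℂ L → X))
    [MemTrivializationAtlas e] {x : X} (hx : x ∈ e.baseSet) : 0 < ψ.len x (e.symm x 1) :=
  ψ.len_pos x _ (symm_one_ne_zero e hx)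

namespace CanonicalExtension

theorem continuousOn_density (ψ : ContinuousMetric L) {z : OpenPartialHomeomorph X (Model n)}
    (hz : z ∈ IsManifold.maximalAtlas 𝓘(ℂ, Model n) ω X) :
    ContinuousOn (ℒ.density ψ z) (z.source ∩ D.generic) := by
  intro x hx
  let e := trivializationAt ℂ L x
  have hxe : x ∈ e.baseSet := mem_baseSet_trivializationAt ℂ L x
  have hc : ContinuousOn (fun y => (‖ℒ.coeff z y (e.symm y 1)‖ / ψ.len y (e.symm y 1)) ^
      (2 / (ℒ.m : ℝ))) (z.source ∩ e.baseSet ∩ D.generic) := by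
    refine ContinuousOn.rpow_const (ContinuousOn.div (ℒ.holomorphic e z hz).continuousOn.norm
      ((continuousOn_len_symm ψ e).mono fun y hy => hy.1.2)
      fun y hy => (len_symm_pos ψ e hy.1.2).ne') fun y hy => Or.inr (by positivity)
  have hopen : IsOpen (z.source ∩ e.baseSet ∩ D.generic) :=
    (z.open_source.inter e.open_baseSet).inter D.isOpen_generic
  have hmem : x ∈ z.source ∩ e.baseSet ∩ D.generic := ⟨⟨hx.1, hxe⟩, hx.2⟩
  refine ((hc x hmem).continuousAt (hopen.mem_nhds hmem)).congr_of_eventuallyEq ?_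
    |>.continuousWithinAt
  filter_upwards [hopen.mem_nhds hmem] with y hy
  exact ℒ.density_eq ψ z e hy.1.2

variable [MeasurableSpace X] [BorelSpace X]

/-- The measures on the fibres are locally finite, since the density is continuous in a fibre chart.
-/
theorem fibreMeasure_finiteAt (ψ : ContinuousMetric L) {t : ℂ} (ht : t ≠ 0) {x : X}
    (hx : D.proj x = t) : ∃ N ∈ 𝓝 x, ℒ.fibreMeasure ψ t N < ⊤ := by
  obtain ⟨z, hxz⟩ := D.exists_fibreChart (x := x) (by change D.proj x ≠ 0; rwa [hx])
  have hg : x ∈ D.generic := by change D.proj x ≠ 0; rwa [hx]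
  -- a neighbourhood on which the density is bounded, with relatively compact image in the chart
  have hW : z.1.source ∩ D.generic ∩ {y | ℒ.density ψ z.1 y < ℒ.density ψ z.1 x + 1} ∩
      z.1 ⁻¹' (Metric.closedBall (z.1 x) 1) ∈ 𝓝 x := by
    have hop := (z.1.open_source.inter D.isOpen_generic).mem_nhds ⟨hxz, hg⟩
    refine inter_mem (inter_mem hop ?_) ?_
    · exact ((ℒ.continuousOn_density ψ z.2.1 x ⟨hxz, hg⟩).continuousAt hop).eventually_lt
        continuousAt_const (by linarith)
    · exact (z.1.continuousAt hxz).preimage_mem_nhds (Metric.closedBall_mem_nhds _ one_pos)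
  obtain ⟨N, hNW, hNo, hxN⟩ := mem_nhds_iff.1 hW
  refine ⟨N, hNo.mem_nhds hxN, ?_⟩
  have h1 : ℒ.fibreMeasure ψ t N = ℒ.localFibreMeasure ψ t z N := by
    rw [← ℒ.fibreMeasure_restrict ψ ht z, Measure.restrict_apply hNo.measurableSet,
      inter_eq_left.2 fun y hy => (hNW hy).1.1.1]
  rw [h1, localFibreMeasure_apply ℒ ψ t z hNo.measurableSet]
  set S := {y : Fin n → ℂ | (Fin.cons t y : Model n) ∈ z.1.target} ∩
    (fun y => z.1.symm (Fin.cons t y)) ⁻¹' N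
  have hS : MeasurableSet S := measurableSet_inter_preimage
    (isOpen_sliceTarget z.1 t).measurableSet (continuousOn_sliceTarget z.1 t) hNo.measurableSet
  have hSb : S ⊆ Metric.closedBall (Fin.tail (z.1 x)) 1 := by
    rintro y ⟨hy, hyN⟩
    have h2 : (Fin.cons t y : Model n) ∈ Metric.closedBall (z.1 x) 1 := by
      have := (hNW hyN).2
      rwa [mem_preimage, z.1.right_inv hy] at this
    rw [Metric.mem_closedBall, dist_pi_le_iff (by norm_num)] at h2 ⊢
    intro i
    simpa [Fin.tail] using h2 i.succ
  calc ∫⁻ y in S, ENNReal.ofReal (ℒ.density ψ z.1 (z.1.symm (Fin.cons t y)))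
      ≤ ∫⁻ y in S, ENNReal.ofReal (ℒ.density ψ z.1 x + 1) :=
        setLIntegral_mono' hS fun y hy => ENNReal.ofReal_le_ofReal (hNW hy.2).1.2.le
    _ = ENNReal.ofReal (ℒ.density ψ z.1 x + 1) * volume S := by simp
    _ < ⊤ := ENNReal.mul_lt_top (by simp)
        ((measure_mono hSb).trans_lt (isCompact_closedBall _ _).measure_lt_top)

/-- The fibres are compact, so that local finiteness implies finiteness. -/
theorem isFiniteMeasure_fibreMeasure (ψ : ContinuousMetric L) {t : ℂ} (ht : t ≠ 0)
    (ht1 : ‖t‖ < 1) : IsFiniteMeasure (ℒ.fibreMeasure ψ t) := by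
  have hK : IsCompact (D.proj ⁻¹' {t}) := D.proper _ (by simpa using ht1) isCompact_singleton
  have h1 : ℒ.fibreMeasure ψ t (D.proj ⁻¹' {t}) < ⊤ :=
    hK.measure_lt_top_of_nhdsWithin fun x hx => by
      obtain ⟨N, hN, hN'⟩ := ℒ.fibreMeasure_finiteAt ψ ht hx
      exact ⟨N, mem_nhdsWithin_of_mem_nhds hN, hN'⟩
  refine ⟨?_⟩
  rw [← union_compl_self (D.proj ⁻¹' {t})]
  refine (measure_union_le _ _).trans_lt ?_
  rw [ℒ.fibreMeasure_compl, add_zero]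
  exact h1

end CanonicalExtension
end Line
end Charts

/-! ### Strata of the zero fibre -/

section Strata

variable {n : ℕ} {X : Type u} [TopologicalSpace X] [ChartedSpace (Model n) X]
  [IsManifold 𝓘(ℂ, Model n) ω X] {I : Type v}

namespace SncDegeneration

section Chart
variable {D : SncDegeneration n X I}

theorem Chart.coord_ne_zero (c : D.Chart) {x : X} (hx : x ∈ c.z.source) (hg : x ∈ D.generic) {i : I}
    (hi : i ∈ c.J) : c.z x (c.k i) ≠ 0 := fun h =>
  hg ((D.zero_iff x).2 ⟨i, (c.isSnc.mem_iff x hx i).2 ⟨hi, h⟩⟩)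

theorem Chart.mem_generic (c : D.Chart) {x : X} (hx : x ∈ c.z.source)
    (h : ∀ i ∈ c.J, c.z x (c.k i) ≠ 0) : x ∈ D.generic := by
  intro h0
  obtain ⟨i, hi⟩ := (D.zero_iff x).1 h0
  have := (c.isSnc.mem_iff x hx i).1 hi
  exact h i this.1 this.2

/-- The complement of the zero fibre is dense in an adapted chart. -/
theorem Chart.mem_closure_generic (c : D.Chart) {x : X} (hx : x ∈ c.z.source) :
    x ∈ closure D.generic := by
  -- all coordinates are translated by `s`; for small `s ≠ 0` none of them vanishes
  let γ : ℂ → Model n := fun s l => c.z x l + s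
  have hγ : Continuous γ := by fun_prop
  have hγ0 : γ 0 = c.z x := by ext; simp [γ]
  have h1 : Tendsto γ (𝓝[≠] 0) (𝓝 (c.z x)) := by
    rw [← hγ0]; exact (hγ.tendsto 0).mono_left nhdsWithin_le_nhds
  have h2 : Tendsto (fun s => c.z.symm (γ s)) (𝓝[≠] 0) (𝓝 x) := by
    have := (c.z.continuousAt_symm (c.z.map_source hx)).tendsto.comp h1
    rwa [c.z.left_inv hx] at this
  refine mem_closure_of_tendsto h2 ?_
  have h3 : ∀ᶠ s in 𝓝[≠] (0 : ℂ), ∀ l, γ s l ≠ 0 := by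
    rw [eventually_all]
    intro l
    by_cases hl : c.z x l = 0
    · filter_upwards [self_mem_nhdsWithin] with s hs
      simpa [γ, hl] using hs
    · have h4 : Tendsto (fun s => γ s l) (𝓝[≠] 0) (𝓝 (c.z x l)) := tendsto_pi_nhds.1 h1 l
      exact h4.eventually_ne hl
  filter_upwards [h3, h1.eventually (c.z.open_target.mem_nhds (c.z.map_source hx))] with s hs hs'
  refine c.mem_generic (c.z.map_target hs') fun i _ => ?_
  rw [c.z.right_inv hs']
  exact hs _

end Chart

variable (D : SncDegeneration n X I)

theorem exists_chart {x : X} (hx : D.proj x = 0) : ∃ c : D.Chart, x ∈ c.z.source := by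
  obtain ⟨z, J, k, f, hs, hxz, -, -⟩ := D.snc x hx
  exact ⟨⟨z, J, k, hs⟩, hxz⟩

/-- Components are closed: off the zero fibre by continuity of the projection, and near the zero
fibre because a component is cut out by a coordinate of an adapted chart. -/
theorem isClosed_E (i : I) : IsClosed (D.E i) := by
  rw [← isOpen_compl_iff, isOpen_iff_mem_nhds]
  intro x hx
  by_cases h0 : D.proj x = 0
  · obtain ⟨c, hc⟩ := D.exists_chart h0
    by_cases hi : i ∈ c.J
    · have hne : c.z x (c.k i) ≠ 0 := fun h => hx ((c.isSnc.mem_iff x hc i).2 ⟨hi, h⟩)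
      have h1 : Tendsto (fun y => c.z y (c.k i)) (𝓝 x) (𝓝 (c.z x (c.k i))) :=
        tendsto_pi_nhds.1 (c.z.continuousAt hc).tendsto _
      filter_upwards [h1.eventually_ne hne, c.z.open_source.mem_nhds hc] with y hy hyc hyE
      exact hy ((c.isSnc.mem_iff y hyc i).1 hyE).2
    · filter_upwards [c.z.open_source.mem_nhds hc] with y hyc hyE
      exact hi ((c.isSnc.mem_iff y hyc i).1 hyE).1
  · filter_upwards [D.isOpen_generic.mem_nhds h0] with y hy hyE
    exact hy ((D.zero_iff y).2 ⟨i, hyE⟩)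

theorem isClosed_inter (J : Finset I) : IsClosed (D.inter J) := by
  have : D.inter J = ⋂ i ∈ J, D.E i := by ext; simp [inter]
  rw [this]
  exact isClosed_biInter fun i _ => D.isClosed_E i

theorem isCompact_zeroFibre : IsCompact (D.proj ⁻¹' {0}) :=
  D.proper _ (by simp) isCompact_singleton

theorem inter_subset_zeroFibre {J : Finset I} (hJ : J.Nonempty) :
    D.inter J ⊆ D.proj ⁻¹' {0} := by
  obtain ⟨i, hi⟩ := hJ
  exact fun x hx => (D.zero_iff x).2 ⟨i, hx i hi⟩

theorem isCompact_inter {J : Finset I} (hJ : J.Nonempty) : IsCompact (D.inter J) :=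
  D.isCompact_zeroFibre.of_isClosed_subset (D.isClosed_inter J) (D.inter_subset_zeroFibre hJ)

variable {D} in
theorem Chart.inter_subset (c : D.Chart) {x : X} (hx : x ∈ c.z.source) {J : Finset I}
    (hJ : x ∈ D.inter J) : J ⊆ c.J := fun i hi => ((c.isSnc.mem_iff x hx i).1 (hJ i hi)).1

variable {D} in
/-- In a polydisc around a point of `E_J`, the set `E_J` is connected. -/
theorem Chart.mem_component (c : D.Chart) {p : X} (hp : p ∈ c.z.source) {r : ℝ}
    (hr : Metric.closedBall (c.z p) r ⊆ c.z.target) {J : Finset I} (hJ : p ∈ D.inter J) {q : X}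
    (hq : q ∈ c.z.source) (hqr : c.z q ∈ Metric.closedBall (c.z p) r) (hqJ : q ∈ D.inter J) :
    q ∈ connectedComponentIn (D.inter J) p := by
  let S : Set (Model n) := Metric.closedBall (c.z p) r ∩ {w | ∀ i ∈ J, w (c.k i) = 0}
  have hSc : Convex ℝ S := by
    refine (convex_closedBall _ _).inter ?_
    intro v hv w hw a b _ _ _ i hi
    simp [hv i hi, hw i hi]
  have hpS : c.z p ∈ S := ⟨Metric.mem_closedBall_self
    (Metric.nonempty_closedBall.1 ⟨_, hqr⟩), fun i hi => ((c.isSnc.mem_iff p hp i).1 (hJ i hi)).2⟩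
  have hqS : c.z q ∈ S := ⟨hqr, fun i hi => ((c.isSnc.mem_iff q hq i).1 (hqJ i hi)).2⟩
  have hcon : IsPreconnected (c.z.symm '' S) :=
    hSc.isPreconnected.image _ (c.z.symm.continuousOn.mono fun w hw => hr hw.1)
  have hsub : c.z.symm '' S ⊆ D.inter J := by
    rintro _ ⟨w, hw, rfl⟩ i hi
    refine (c.isSnc.mem_iff _ (c.z.map_target (hr hw.1)) i).2 ⟨c.inter_subset hp hJ hi, ?_⟩
    rw [c.z.right_inv (hr hw.1)]
    exact hw.2 i hi
  exact hcon.subset_connectedComponentIn ⟨_, hpS, c.z.left_inv hp⟩ hsub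
    ⟨_, hqS, c.z.left_inv hq⟩

variable {D} in
theorem Chart.exists_closedBall (c : D.Chart) {p : X} (hp : p ∈ c.z.source) :
    ∃ r > 0, Metric.closedBall (c.z p) r ⊆ c.z.target :=
  Metric.nhds_basis_closedBall.mem_iff.1 (c.z.open_target.mem_nhds (c.z.map_source hp))

/-- The intersections of components are locally connected: near a point, they coincide with the
connected component of that point. -/
theorem exists_nhds_component {J : Finset I} (hJ : J.Nonempty) {p : X} (hp : p ∈ D.inter J) :
    ∃ N ∈ 𝓝 p, ∀ q ∈ N, q ∈ D.inter J → q ∈ connectedComponentIn (D.inter J) p := by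
  obtain ⟨c, hc⟩ := D.exists_chart (D.inter_subset_zeroFibre hJ hp)
  obtain ⟨r, hr0, hr⟩ := c.exists_closedBall hc
  refine ⟨_, inter_mem (c.z.open_source.mem_nhds hc)
    ((c.z.continuousAt hc).preimage_mem_nhds (Metric.closedBall_mem_nhds _ hr0)), ?_⟩
  exact fun q hq hqJ => c.mem_component hc hr hp hq.1 hq.2 hqJ

namespace Stratum

variable {D} (Y : D.Stratum)

theorem carrier_subset : Y.carrier ⊆ D.inter Y.J := by
  obtain ⟨x, hx, h⟩ := Y.isComponent
  rw [h]; exact connectedComponentIn_subset _ _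

theorem carrier_nonempty : Y.carrier.Nonempty := by
  obtain ⟨x, hx, h⟩ := Y.isComponent
  rw [h]; exact ⟨x, mem_connectedComponentIn hx⟩

theorem carrier_eq {x : X} (hx : x ∈ Y.carrier) :
    Y.carrier = connectedComponentIn (D.inter Y.J) x := by
  obtain ⟨y, hy, h⟩ := Y.isComponent
  rw [h] at hx ⊢
  exact connectedComponentIn_eq hx

theorem isClosed_carrier : IsClosed Y.carrier := by
  obtain ⟨y, hy, h⟩ := Y.isComponent
  rw [h, connectedComponentIn_eq_image hy]
  exact (D.isClosed_inter _).isClosedEmbedding_subtypeVal.isClosedMap _ isClosed_connectedComponent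

theorem isCompact_carrier : IsCompact Y.carrier :=
  (D.isCompact_inter Y.nonempty).of_isClosed_subset Y.isClosed_carrier Y.carrier_subset

theorem proj_eq_zero {x : X} (hx : x ∈ Y.carrier) : D.proj x = 0 :=
  D.inter_subset_zeroFibre Y.nonempty (Y.carrier_subset hx)

theorem ext' {Y Y' : D.Stratum} (hJ : Y.J = Y'.J) (hc : Y.carrier = Y'.carrier) : Y = Y' := by
  cases Y; cases Y'; cases hJ; cases hc; rfl

theorem card_le : Y.J.card ≤ n + 1 := by
  obtain ⟨x, hx⟩ := Y.carrier_nonempty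
  obtain ⟨c, hc⟩ := D.exists_chart (Y.proj_eq_zero hx)
  have h1 := c.inter_subset hc (Y.carrier_subset hx)
  have h2 := Finset.card_le_card_of_injOn (s := Y.J) (t := Finset.univ) c.k (by simp)
    (c.isSnc.injOn.mono (by exact_mod_cast h1))
  simpa using h2

end Stratum

/-- The stratum of a point of `E_J`. -/
def stratumAt {J : Finset I} (hJ : J.Nonempty) {p : X} (hp : p ∈ D.inter J) : D.Stratum :=
  ⟨J, connectedComponentIn (D.inter J) p, hJ, p, hp, rfl⟩

/-- There are finitely many strata: the connected components of an intersection of components are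
relatively open in a compact set. -/
instance [Finite I] : Finite D.Stratum := by
  have hfin : ∀ J : Finset I, J.Nonempty →
      {C : Set X | ∃ x ∈ D.inter J, C = connectedComponentIn (D.inter J) x}.Finite := by
    intro J hJ
    choose! N hN hNc using fun p hp => D.exists_nhds_component hJ (p := p) hp
    obtain ⟨t, ht, hcov⟩ := (D.isCompact_inter hJ).elim_nhds_subcover N hN
    refine (t.finite_toSet.image fun x => connectedComponentIn (D.inter J) x).subset ?_
    rintro _ ⟨x, hx, rfl⟩
    obtain ⟨y, hy, hxy⟩ := mem_iUnion₂.1 (hcov hx)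
    exact ⟨y, hy, connectedComponentIn_eq (hNc y (ht y hy) x hxy hx)⟩
  have hfin' : (⋃ J : {J : Finset I // J.Nonempty}, (fun C => (J.1, C)) ''
      {C : Set X | ∃ x ∈ D.inter J.1, C = connectedComponentIn (D.inter J.1) x}).Finite :=
    Set.finite_iUnion fun J => (hfin J.1 J.2).image _
  have := hfin'.to_subtype
  refine Finite.of_injective (fun Y : D.Stratum => (⟨(Y.J, Y.carrier), mem_iUnion.2
    ⟨⟨Y.J, Y.nonempty⟩, Y.carrier, Y.isComponent, rfl⟩⟩ : ↥(⋃ J : {J : Finset I // J.Nonempty},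
      (fun C => (J.1, C)) ''
      {C : Set X | ∃ x ∈ D.inter J.1, C = connectedComponentIn (D.inter J.1) x}))) ?_
  intro Y Y' h
  have h' := Prod.mk.inj (Subtype.mk.inj h)
  exact Stratum.ext' h'.1 h'.2

section Min

variable [Fintype I] (a : I → ℚ)

theorem kappaMin_le (i : I) : D.kappaMin a ≤ D.kappa a i :=
  ciInf_le (Finite.bddBelow_range _) i

theorem bddAbove_dims : BddAbove {p | ∃ Y : D.Stratum, D.IsMinFace a Y ∧ Y.J.card = p + 1} :=
  ⟨n, by rintro p ⟨Y, -, hY⟩; have := Y.card_le; omega⟩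

theorem card_le_of_isMinFace {Y : D.Stratum} (hY : D.IsMinFace a Y) :
    Y.J.card ≤ D.dimMin a + 1 := by
  have h1 : 1 ≤ Y.J.card := Y.nonempty.card_pos
  have h2 : Y.J.card - 1 ≤ D.dimMin a := le_csSup (D.bddAbove_dims a) ⟨Y, hY, by omega⟩
  omega

theorem exists_minFace : ∃ Y : D.Stratum, D.IsMinFace a Y ∧ Y.J.card = D.dimMin a + 1 := by
  have hne : {p | ∃ Y : D.Stratum, D.IsMinFace a Y ∧ Y.J.card = p + 1}.Nonempty := by
    obtain ⟨x, hx⟩ : ∃ x, D.proj x = 0 := by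
      have : (0 : ℂ) ∈ range D.proj := by rw [D.range_eq]; simp
      exact this
    obtain ⟨i₀, -⟩ := (D.zero_iff x).1 hx
    have : Nonempty I := ⟨i₀⟩
    obtain ⟨i, hi⟩ := exists_eq_ciInf_of_finite (f := D.kappa a)
    obtain ⟨p, hp⟩ := (D.connected i).nonempty
    refine ⟨0, D.stratumAt (J := {i}) (by simp) (p := p) (by simpa [inter] using hp), ?_, ?_⟩
    · intro j hj
      have : j = i := by simpa [stratumAt] using hj
      rw [this]; exact hi
    · simp [stratumAt]
  exact Nat.sSup_mem hne (D.bddAbove_dims a)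

theorem dimMin_le : D.dimMin a ≤ n := by
  obtain ⟨Y, -, hY⟩ := D.exists_minFace a
  have := Y.card_le
  omega

end Min

end SncDegeneration

/-! ### The norm of the local generator -/

section GenNorm

variable {D : SncDegeneration n X I}
variable {L : X → Type*} [TopologicalSpace (TotalSpace ℂ L)] [∀ x, AddCommGroup (L x)]
  [∀ x, Module ℂ (L x)] [∀ x, TopologicalSpace (L x)] [FiberBundle ℂ L] [VectorBundle ℂ ℂ L]
  (ℒ : CanonicalExtension L D)

namespace CanonicalExtension

/-- The function `|τ|_ψ^{-2}` of an adapted chart, extended by continuity to the zero fibre. -/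
def genNormExt (ψ : ContinuousMetric L) (a : I → ℚ) (c : D.Chart) : X → ℝ :=
  extendFrom D.generic (ℒ.genNorm ψ a c)

/-- Local form of the statement that `genNorm`, the inverse squared norm of the local generator,
extends continuously and without zeros across the zero fibre. In a local frame of the line bundle
the identification with the pluricanonical forms is given by the monomial of the decomposition and
an invertible function `f`, and the monomial cancels against the powers of the coordinates in the
definition of `genNorm`. -/
theorem exists_genNorm_eq (ψ : ContinuousMetric L) {a : I → ℚ} (ha : ℒ.IsDecomposition a)
    (c : D.Chart) {x : X} (hx : x ∈ c.z.source) :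
    ∃ (U : Set X) (G : X → ℝ), IsOpen U ∧ x ∈ U ∧ U ⊆ c.z.source ∧ ContinuousOn G U ∧
      (∀ y ∈ U, 0 < G y) ∧ ∀ y ∈ U ∩ D.generic, ℒ.genNorm ψ a c y = G y := by
  obtain ⟨r, hr, hdec⟩ := ha
  let e := trivializationAt ℂ L x
  have hxe : x ∈ e.baseSet := mem_baseSet_trivializationAt ℂ L x
  -- `f` is the invertible factor of the coefficient in the frame `e`
  obtain ⟨f, hf, hf0, hfe⟩ := hdec c e
  have hm : (0 : ℝ) < ℒ.m := by exact_mod_cast ℒ.m_pos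
  refine ⟨c.z.source ∩ e.baseSet, fun y => (‖f y‖ / ψ.len y (e.symm y 1)) ^ (2 / (ℒ.m : ℝ)),
    c.z.open_source.inter e.open_baseSet, ⟨hx, hxe⟩, inter_subset_left, ?_, ?_, ?_⟩
  · exact ContinuousOn.rpow_const (hf.continuousOn.norm.div
      ((continuousOn_len_symm ψ e).mono inter_subset_right)
      fun y hy => (len_symm_pos ψ e hy.2).ne') fun y hy => Or.inr (by positivity)
  · intro y hy
    exact Real.rpow_pos_of_pos (div_pos (norm_pos_iff.2 (hf0 y hy)) (len_symm_pos ψ e hy.2)) _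
  · intro y hy
    have hpos : ∀ i ∈ c.J, 0 < ‖c.z y (c.k i)‖ := fun i hi =>
      norm_pos_iff.2 (c.coord_ne_zero hy.1.1 hy.2 hi)
    have hp : 0 < ‖D.proj y‖ := norm_pos_iff.2 hy.2
    have hl := len_symm_pos ψ e hy.1.2
    have hP : 0 < ∏ i ∈ c.J, ‖c.z y (c.k i)‖ := Finset.prod_pos hpos
    rw [genNorm, ℒ.density_eq ψ c.z e hy.1.2, hfe y hy]
    rw [norm_mul, norm_mul, norm_pow, norm_div, norm_prod, norm_prod]
    have h1 : ‖f y‖ * (∏ i ∈ c.J, ‖c.z y (c.k i) ^ r i‖) *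
        (‖D.proj y‖ / ∏ i ∈ c.J, ‖c.z y (c.k i)‖) ^ ℒ.m / ψ.len y (e.symm y 1) =
        (‖f y‖ / ψ.len y (e.symm y 1)) * (∏ i ∈ c.J, ‖c.z y (c.k i)‖ ^ (r i : ℝ)) *
        (‖D.proj y‖ / ∏ i ∈ c.J, ‖c.z y (c.k i)‖) ^ (ℒ.m : ℝ) := by
      simp only [norm_zpow, Real.rpow_intCast, Real.rpow_natCast]
      ring
    have hq : 0 ≤ ∏ i ∈ c.J, ‖c.z y (c.k i)‖ ^ (r i : ℝ) :=
      Finset.prod_nonneg fun i _ => Real.rpow_nonneg (norm_nonneg _) _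
    rw [h1, Real.mul_rpow (by positivity) (by positivity), Real.mul_rpow (by positivity) hq,
      ← Real.rpow_mul (by positivity), mul_div_cancel₀ _ hm.ne',
      ← Real.finsetProd_rpow _ _ fun i _ => Real.rpow_nonneg (norm_nonneg _) _]
    -- the integral exponents `r i` are `m a i`, so that the root of order `m` produces `a i`
    have h2 : ∀ i ∈ c.J, (‖c.z y (c.k i)‖ ^ (r i : ℝ)) ^ (2 / (ℒ.m : ℝ)) =
        ‖c.z y (c.k i)‖ ^ (2 * (a i : ℝ)) := fun i hi => by
      rw [← Real.rpow_mul (norm_nonneg _)]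
      congr 1
      have : (r i : ℝ) = ℒ.m * (a i : ℝ) := by exact_mod_cast congrArg (fun q : ℚ => (q : ℝ)) (hr i)
      rw [this]; field_simp
    rw [Finset.prod_congr rfl h2, Real.rpow_two, div_pow]
    have h3 : (∏ i ∈ c.J, ‖c.z y (c.k i)‖ ^ (2 * (a i : ℝ))) *
        ∏ i ∈ c.J, ‖c.z y (c.k i)‖ ^ (2 - 2 * (a i : ℝ)) = (∏ i ∈ c.J, ‖c.z y (c.k i)‖) ^ 2 := by
      rw [← Finset.prod_mul_distrib, ← Finset.prod_pow]
      refine Finset.prod_congr rfl fun i hi => ?_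
      rw [← Real.rpow_add (hpos i hi)]
      norm_num
    calc _ = (‖f y‖ / ψ.len y (e.symm y 1)) ^ (2 / (ℒ.m : ℝ)) *
          ((∏ i ∈ c.J, ‖c.z y (c.k i)‖ ^ (2 * (a i : ℝ))) *
          ∏ i ∈ c.J, ‖c.z y (c.k i)‖ ^ (2 - 2 * (a i : ℝ))) *
          (‖D.proj y‖ ^ 2 / (∏ i ∈ c.J, ‖c.z y (c.k i)‖) ^ 2 * (‖D.proj y‖ ^ 2)⁻¹) := by ring
      _ = _ := by rw [h3]; field_simp

/-- The limit from the generic fibres is a continuous positive extension of `genNorm` to the whole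
chart. -/
theorem genNormExt_spec (ψ : ContinuousMetric L) {a : I → ℚ} (ha : ℒ.IsDecomposition a)
    (c : D.Chart) : ContinuousOn (ℒ.genNormExt ψ a c) c.z.source ∧
      (∀ x ∈ c.z.source, 0 < ℒ.genNormExt ψ a c x) ∧
      ∀ x ∈ c.z.source ∩ D.generic, ℒ.genNormExt ψ a c x = ℒ.genNorm ψ a c x := by
  have key : ∀ x ∈ c.z.source, ∃ (U : Set X) (G : X → ℝ), IsOpen U ∧ x ∈ U ∧ U ⊆ c.z.source ∧
      ContinuousOn G U ∧ (∀ y ∈ U, 0 < G y) ∧ (∀ y ∈ U ∩ D.generic, ℒ.genNorm ψ a c y = G y) ∧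
      ∀ y ∈ U, ℒ.genNormExt ψ a c y = G y := by
    intro x hx
    obtain ⟨U, G, hU, hxU, hUs, hG, hpos, heq⟩ := ℒ.exists_genNorm_eq ψ ha c hx
    refine ⟨U, G, hU, hxU, hUs, hG, hpos, heq, fun y hy => ?_⟩
    refine extendFrom_eq (c.mem_closure_generic (hUs hy)) ?_
    refine (((hG y hy).continuousAt (hU.mem_nhds hy)).tendsto.mono_left nhdsWithin_le_nhds).congr' ?_
    filter_upwards [mem_nhdsWithin_of_mem_nhds (hU.mem_nhds hy), self_mem_nhdsWithin] with w hw hw'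
    exact (heq w ⟨hw, hw'⟩).symm
  refine ⟨fun x hx => ?_, fun x hx => ?_, fun x hx => ?_⟩
  · obtain ⟨U, G, hU, hxU, hUs, hG, hpos, heq, hext⟩ := key x hx
    refine (((hG x hxU).continuousAt (hU.mem_nhds hxU)).congr ?_).continuousWithinAt
    filter_upwards [hU.mem_nhds hxU] with y hy
    exact (hext y hy).symm
  · obtain ⟨U, G, hU, hxU, hUs, hG, hpos, heq, hext⟩ := key x hx
    rw [hext x hxU]; exact hpos x hxU
  · obtain ⟨U, G, hU, hxU, hUs, hG, hpos, heq, hext⟩ := key x hx.1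
    rw [hext x hxU, heq x ⟨hxU, hx.2⟩]

end CanonicalExtension
end GenNorm
end Strata

/-! ### Convergence in the hybrid space -/

section HybridSpace

variable {n : ℕ} {X : Type u} [TopologicalSpace X] [ChartedSpace (Model n) X]
  [IsManifold 𝓘(ℂ, Model n) ω X] {I : Type v}

namespace SncDegeneration

open CanonicalExtension (MonomialChart)

variable {D : SncDegeneration n X I}

theorem continuous_proj : Continuous D.proj := D.holomorphic.continuous

/-- A neighbourhood of the zero fibre contains the fibres over a small disc. -/
theorem exists_tube {V : Set X} (hV : IsOpen V) (h0 : ∀ x, D.proj x = 0 → x ∈ V) :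
    ∃ δ > 0, δ < 1 ∧ ∀ x, ‖D.proj x‖ ≤ δ → x ∈ V := by
  have hK : IsCompact (D.proj ⁻¹' Metric.closedBall 0 (1 / 2) \ V) :=
    (D.proper _ (Metric.closedBall_subset_ball (by norm_num)) (isCompact_closedBall _ _)).diff hV
  have hc : ContinuousOn (fun x => ‖D.proj x‖) (D.proj ⁻¹' Metric.closedBall 0 (1 / 2) \ V) :=
    D.continuous_proj.norm.continuousOn
  rcases (D.proj ⁻¹' Metric.closedBall 0 (1 / 2) \ V).eq_empty_or_nonempty with he | hne
  · refine ⟨1 / 2, by norm_num, by norm_num, fun x hx => ?_⟩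
    by_contra hxV
    have : x ∈ D.proj ⁻¹' Metric.closedBall 0 (1 / 2) \ V := ⟨by simpa using hx, hxV⟩
    rw [he] at this
    exact this
  · obtain ⟨y, hy, hmin⟩ := hK.exists_isMinOn hne hc
    have hy0 : 0 < ‖D.proj y‖ := norm_pos_iff.2 fun h => hy.2 (h0 y h)
    have hy1 : ‖D.proj y‖ ≤ 1 / 2 := by simpa using hy.1
    refine ⟨‖D.proj y‖ / 2, by positivity, by linarith, fun x hx => ?_⟩
    by_contra hxV
    have : ‖D.proj y‖ ≤ ‖D.proj x‖ := hmin (a := x)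
      ⟨by simp only [mem_preimage, mem_closedBall_zero_iff]; linarith, hxV⟩
    linarith

theorem continuous_ofGeneric : Continuous D.ofGeneric := by
  have hinj : Function.Injective D.ofGeneric := Sum.inl_injective
  refine continuous_generateFrom_iff.2 ?_
  rintro S ((⟨G, hG, rfl⟩ | ⟨V, hV, -, rfl⟩) | ⟨V, Log, O, hT, hO, rfl⟩)
  · rwa [hinj.preimage_image]
  · rw [preimage_union, hinj.preimage_image]
    have : D.ofGeneric ⁻¹' range D.ofDual = ∅ :=
      eq_empty_of_forall_notMem fun _ ⟨_, hp⟩ => Sum.inr_ne_inl hp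
    rw [this, union_empty]
    exact hV.preimage continuous_subtype_val
  · rw [preimage_union, hinj.preimage_image]
    have : D.ofGeneric ⁻¹' (D.ofDual '' O) = ∅ :=
      eq_empty_of_forall_notMem fun _ ⟨_, _, hp⟩ => Sum.inr_ne_inl hp
    rw [this, union_empty]
    have h1 := hT.continuousOn.isOpen_inter_preimage (hT.isOpen.inter D.isOpen_generic) hO
    have h2 : {x : D.generic | (x : X) ∈ V ∧ Log x ∈ O} =
        Subtype.val ⁻¹' (V ∩ D.generic ∩ Log ⁻¹' O) := by
      ext x; simp
    rw [h2]
    exact h1.preimage continuous_subtype_val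

theorem continuous_ofDual : Continuous D.ofDual := by
  have hinj : Function.Injective D.ofDual := Sum.inr_injective
  refine continuous_generateFrom_iff.2 ?_
  rintro S ((⟨G, hG, rfl⟩ | ⟨V, hV, -, rfl⟩) | ⟨V, Log, O, hT, hO, rfl⟩)
  · have : D.ofDual ⁻¹' (D.ofGeneric '' G) = ∅ :=
      eq_empty_of_forall_notMem fun _ ⟨_, _, hp⟩ => Sum.inl_ne_inr hp
    rw [this]; exact isOpen_empty
  · rw [preimage_union, preimage_range, union_univ]; exact isOpen_univ
  · have : D.ofDual ⁻¹' (D.ofGeneric '' {x | (x : X) ∈ V ∧ Log x ∈ O}) = ∅ :=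
      eq_empty_of_forall_notMem fun _ ⟨_, _, hp⟩ => Sum.inl_ne_inr hp
    rw [preimage_union, this, hinj.preimage_image, empty_union]
    exact hO

theorem continuous_ofSimplex (Y : D.Stratum) : Continuous (D.ofSimplex Y) :=
  continuous_quot_mk.comp continuous_sigmaMk

theorem isClosed_simplex (J : Finset I) : IsClosed (D.simplex J) := by
  have : D.simplex J = (⋂ i, {w | 0 ≤ w i}) ∩ ((⋂ i, ⋂ (_ : i ∉ J), {w | w i = 0}) ∩
      {w | ∑ i ∈ J, (D.b i : ℝ) * w i = 1}) := by
    ext w; simp [simplex]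
  rw [this]
  refine (isClosed_iInter fun i => isClosed_le continuous_const (continuous_apply i)).inter
    ((isClosed_iInter fun i => isClosed_iInter fun _ =>
      isClosed_eq (continuous_apply i) continuous_const).inter (isClosed_eq ?_ continuous_const))
  fun_prop

theorem Chart.isOpen_setOf_coord_ne_zero (c : D.Chart) (J : Finset I) :
    IsOpen {w : Model n | ∀ i ∈ c.J, i ∉ J → w (c.k i) ≠ 0} := by
  have : {w : Model n | ∀ i ∈ c.J, i ∉ J → w (c.k i) ≠ 0} =
      ⋂ i ∈ c.J, ⋂ (_ : i ∉ J), {w : Model n | w (c.k i) ≠ 0} := by ext w; simp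
  rw [this]
  refine isOpen_biInter_finset fun i _ => ?_
  by_cases hi : i ∈ J
  · simp [hi]
  · simp only [hi, not_false_eq_true, iInter_true]
    exact isOpen_ne_fun (continuous_apply _) continuous_const

/-- The restriction of an adapted chart to the locus where the coordinates `z_i`, `i ∉ J`, do not
vanish. -/
def Chart.shrink (c : D.Chart) (J : Finset I) (hJ : J ⊆ c.J) : D.Chart where
  z := c.z.restr ((c.z.source ∩ c.z ⁻¹' {w | ∀ i ∈ c.J, i ∉ J → w (c.k i) ≠ 0}))
  J := J
  k := c.k
  isSnc := by
    have hop := c.isOpen_setOf_coord_ne_zero J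
    have hO := c.z.isOpen_inter_preimage hop
    refine ⟨restr_mem_maximalAtlas' c.isSnc.holomorphic hO,
      c.isSnc.injOn.mono (by exact_mod_cast hJ), fun x hx i => ?_⟩
    rw [c.z.restr_source' _ hO] at hx
    rw [c.isSnc.mem_iff x hx.1]
    constructor
    · rintro ⟨hi, h0⟩
      refine ⟨?_, h0⟩
      by_contra hiJ
      exact hx.2.2 i hi hiJ h0
    · rintro ⟨hi, h0⟩
      exact ⟨hJ hi, h0⟩

theorem Chart.mem_shrink_source (c : D.Chart) (J : Finset I) (hJ : J ⊆ c.J) {x : X}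
    (hx : x ∈ c.z.source) (h : ∀ i ∈ c.J, i ∉ J → c.z x (c.k i) ≠ 0) :
    x ∈ (c.shrink J hJ).z.source := by
  refine ⟨hx, ?_⟩
  have hop := c.isOpen_setOf_coord_ne_zero J
  rw [(c.z.isOpen_inter_preimage hop).interior_eq]
  exact ⟨hx, h⟩

/-- The stratum `Y` is the one containing `ξ` in its relative interior. -/
structure IsInterior (Y : D.Stratum) (ξ : X) : Prop where
  mem : ξ ∈ Y.carrier
  mem_iff : ∀ i, ξ ∈ D.E i ↔ i ∈ Y.J

section Asymptotics

variable {c : MonomialChart D} {ξ : X} {Y : D.Stratum} {ι : Type*} {l : Filter ι} {x : ι → X}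

theorem tendsto_log_proj (h0 : D.proj ξ = 0) (hx : Tendsto x l (𝓝 ξ))
    (hg : ∀ᶠ s in l, x s ∈ D.generic) :
    Tendsto (fun s => Real.log ‖D.proj (x s)‖) l atBot := by
  have h1 : Tendsto (fun s => ‖D.proj (x s)‖) l (𝓝[≠] 0) := by
    refine tendsto_nhdsWithin_iff.2 ⟨?_, hg.mono fun s hs => norm_ne_zero_iff.2 hs⟩
    have := ((D.continuous_proj.norm.tendsto ξ).comp hx)
    simpa [h0, Function.comp_def] using this
  exact Real.tendsto_log_nhdsNE_zero.comp h1

/-- Near a point in the interior of the stratum `Y`, the logarithm of the local equation of the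
components through `Y` is asymptotic to `log |t|`. -/
theorem tendsto_log_eqn_div (hξ : ξ ∈ c.1.z.source) (hY : IsInterior Y ξ)
    (hx : Tendsto x l (𝓝 ξ)) (hg : ∀ᶠ s in l, x s ∈ D.generic) :
    Tendsto (fun s => Real.log ‖∏ i ∈ Y.J, c.1.z (x s) (c.1.k i) ^ D.b i‖ /
      Real.log ‖D.proj (x s)‖) l (𝓝 1) := by
  classical
  have hJ : Y.J ⊆ c.1.J := c.1.inter_subset hξ (Y.carrier_subset hY.mem)
  have h0 := Y.proj_eq_zero hY.mem
  have hlog := tendsto_log_proj h0 hx hg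
  have hz : ∀ i ∈ c.1.J \ Y.J, c.1.z ξ (c.1.k i) ≠ 0 := fun i hi h =>
    (Finset.mem_sdiff.1 hi).2 ((hY.mem_iff i).1 ((c.1.isSnc.mem_iff ξ hξ i).2
      ⟨(Finset.mem_sdiff.1 hi).1, h⟩))
  have hzt : ∀ j, Tendsto (fun s => c.1.z (x s) j) l (𝓝 (c.1.z ξ j)) := fun j =>
    tendsto_pi_nhds.1 ((c.1.z.continuousAt hξ).tendsto.comp hx) j
  have h1 : Tendsto (fun s => ∑ i ∈ c.1.J \ Y.J, (D.b i : ℝ) * Real.log ‖c.1.z (x s) (c.1.k i)‖) l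
      (𝓝 (∑ i ∈ c.1.J \ Y.J, (D.b i : ℝ) * Real.log ‖c.1.z ξ (c.1.k i)‖)) :=
    tendsto_finsetSum _ fun i hi => ((hzt _).norm.log
      (norm_ne_zero_iff.2 (hz i hi))).const_mul _
  have h2 := (h1.div_atBot hlog).const_sub 1
  rw [sub_zero] at h2
  refine h2.congr' ?_
  filter_upwards [hg, hx.eventually (c.1.z.open_source.mem_nhds hξ),
    hlog.eventually (eventually_lt_atBot 0)] with s hs hsc hs0
  have hne : ∀ i ∈ c.1.J, c.1.z (x s) (c.1.k i) ≠ 0 := fun i hi => c.1.coord_ne_zero hsc hs hi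
  rw [eq_div_iff hs0.ne, sub_mul, div_mul_cancel₀ _ hs0.ne, one_mul, c.2 _ hsc, Chart.eqn,
    ← Finset.prod_sdiff hJ, norm_mul, Real.log_mul, sub_eq_iff_eq_add, add_comm]
  · congr 1
    rw [norm_prod, Real.log_prod]
    · exact Finset.sum_congr rfl fun i hi => by rw [norm_pow, Real.log_pow]
    · exact fun i hi => norm_ne_zero_iff.2 (pow_ne_zero _ (hne i (Finset.mem_sdiff.1 hi).1))
  · exact norm_ne_zero_iff.2 (Finset.prod_ne_zero_iff.2 fun i hi =>
      pow_ne_zero _ (hne i (Finset.mem_sdiff.1 hi).1))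
  · exact norm_ne_zero_iff.2 (Finset.prod_ne_zero_iff.2 fun i hi => pow_ne_zero _ (hne i (hJ hi)))

end Asymptotics

variable [Fintype I]

/-- Convergence in the hybrid space is implied by convergence of the logarithmic coordinates:
only the estimate satisfied by tropicalization maps is used. -/
theorem tendsto_ofDual {c : MonomialChart D} {ξ : X} {Y : D.Stratum} {ι : Type*} {l : Filter ι}
    (hξ : ξ ∈ c.1.z.source) (hY : IsInterior Y ξ) (w : D.simplex Y.J) (x : ι → D.generic)
    (hx : Tendsto (fun s => (x s : X)) l (𝓝 ξ))
    (hw : ∀ i ∈ Y.J, Tendsto (fun s => Real.log ‖c.1.z (x s) (c.1.k i)‖ /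
      Real.log ‖D.proj (x s)‖) l (𝓝 ((w : I → ℝ) i))) :
    Tendsto (fun s => D.ofGeneric (x s)) l (𝓝 (D.ofDual (D.ofSimplex Y w))) := by
  have hJ : Y.J ⊆ c.1.J := c.1.inter_subset hξ (Y.carrier_subset hY.mem)
  have h0 := Y.proj_eq_zero hY.mem
  refine TopologicalSpace.tendsto_nhds_generateFrom_iff.2 ?_
  rintro S ((⟨G, hG, rfl⟩ | ⟨V, hV, hV0, rfl⟩) | ⟨V, Log, O, hT, hO, rfl⟩) hS
  · obtain ⟨y, -, hy⟩ := hS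
    exact absurd hy Sum.inl_ne_inr
  · filter_upwards [hx.eventually (hV.mem_nhds (hV0 ξ h0))] with s hs
    exact Or.inl ⟨x s, hs, rfl⟩
  · have hpO : D.ofSimplex Y w ∈ O := by
      rcases hS with ⟨y, -, hy⟩ | ⟨y, hy, hyp⟩
      · exact absurd hy Sum.inl_ne_inr
      · rwa [← Sum.inr_injective hyp]
    -- the estimate requires a chart in which all equations vanish at `ξ`
    let c' := c.1.shrink Y.J hJ
    have hξ' : ξ ∈ c'.z.source := c.1.mem_shrink_source _ hJ hξ fun i hi hiY h =>
      hiY ((hY.mem_iff i).1 ((c.1.isSnc.mem_iff ξ hξ i).2 ⟨hi, h⟩))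
    obtain ⟨C, hC⟩ := hT.estimate ξ h0 c' hξ' fun i hi =>
      ((c.1.isSnc.mem_iff ξ hξ i).1 ((hY.mem_iff i).2 hi)).2
    have hg : ∀ᶠ s in l, (x s : X) ∈ D.generic := Eventually.of_forall fun s => (x s).2
    have hx' : Tendsto (fun s => (x s : X)) l (𝓝[D.generic] ξ) :=
      tendsto_nhdsWithin_iff.2 ⟨hx, hg⟩
    have hratio := tendsto_log_eqn_div (c := c) hξ hY hx hg
    have hlog := tendsto_log_proj h0 hx hg
    have heqn : ∀ y, c'.eqn y = ∏ i ∈ Y.J, c.1.z y (c.1.k i) ^ D.b i := fun y => rfl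
    have hlogeqn : Tendsto (fun s => Real.log ‖c'.eqn (x s)‖) l atBot := by
      have h1 := hratio.pos_mul_atBot one_pos hlog
      refine h1.congr' ?_
      filter_upwards [hlog.eventually (eventually_lt_atBot 0)] with s hs
      rw [heqn, div_mul_cancel₀ _ hs.ne]
    have herr : Tendsto (fun s => C / Real.log ‖c'.eqn (x s)‖⁻¹) l (𝓝 0) := by
      simp only [Real.log_inv]
      exact (tendsto_neg_atBot_atTop.comp hlogeqn).const_div_atTop C
    have hlogw : Tendsto (fun s => c'.log (x s)) l (𝓝 (w : I → ℝ)) := by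
      rw [tendsto_pi_nhds]
      intro i
      by_cases hi : i ∈ Y.J
      · have h1 := (hw i hi).div hratio one_ne_zero
        rw [div_one] at h1
        refine h1.congr' ?_
        filter_upwards [hlog.eventually (eventually_lt_atBot 0)] with s hs
        have : c'.log (x s) i = Real.log ‖c.1.z (x s) (c.1.k i)‖ / Real.log ‖c'.eqn (x s)‖ := by
          have : i ∈ c'.J := hi
          simp only [Chart.log, this, if_true]; rfl
        simp only [Pi.div_apply]
        rw [this, heqn, div_div_div_cancel_right₀ hs.ne]
      · have h1 : ∀ s, c'.log (x s) i = 0 := fun s => by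
          have : i ∉ c'.J := hi
          simp [Chart.log, this]
        simp only [h1]
        rw [w.2.2.1 i hi]
        exact tendsto_const_nhds
    have hYc := Y.carrier_eq hY.mem
    -- the points of the simplex of a fixed stratum `Y'` outside `O` stay away from `w`
    have key : ∀ Y' : D.Stratum, Y'.carrier ⊆ Y.carrier → ∀ᶠ s in l, ∀ w' : D.simplex Y'.J,
        (∀ i, |(w' : I → ℝ) i - c'.log (x s) i| ≤ C / Real.log ‖c'.eqn (x s)‖⁻¹) →
        D.ofSimplex Y' w' ∈ O := by
      intro Y' hY'
      let B : Set (I → ℝ) := Subtype.val '' ((D.ofSimplex Y') ⁻¹' Oᶜ)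
      have hB : IsClosed B := (isClosed_simplex Y'.J).isClosedEmbedding_subtypeVal.isClosedMap _
        (hO.isClosed_compl.preimage (continuous_ofSimplex Y'))
      have hwB : (w : I → ℝ) ∈ Bᶜ := by
        rintro ⟨w', hw', hww'⟩
        refine hw' ?_
        have : D.ofSimplex Y w = D.ofSimplex Y' w' := Quot.sound ⟨hY', hww'.symm⟩
        rw [← this]; exact hpO
      obtain ⟨δ, hδ, hball⟩ := Metric.isOpen_iff.1 hB.isOpen_compl _ hwB
      filter_upwards [herr.eventually (gt_mem_nhds (half_pos hδ)),
        hlogw.eventually (Metric.ball_mem_nhds _ (half_pos hδ))] with s hs1 hs2 w' hw'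
      by_contra hcon
      have hd : dist (w' : I → ℝ) (w : I → ℝ) < δ := by
        have h1 : dist (w' : I → ℝ) (c'.log (x s)) < δ / 2 :=
          (dist_pi_lt_iff (half_pos hδ)).2 fun i => (hw' i).trans_lt hs1
        linarith [dist_triangle (w' : I → ℝ) (c'.log (x s)) w, Metric.mem_ball.1 hs2]
      exact hball (Metric.mem_ball.2 hd) ⟨w', hcon, rfl⟩
    have key' : ∀ᶠ s in l, ∀ Y' : D.Stratum, Y'.carrier ⊆ Y.carrier → ∀ w' : D.simplex Y'.J,
        (∀ i, |(w' : I → ℝ) i - c'.log (x s) i| ≤ C / Real.log ‖c'.eqn (x s)‖⁻¹) →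
        D.ofSimplex Y' w' ∈ O := by
      rw [eventually_all]
      intro Y'
      by_cases h : Y'.carrier ⊆ Y.carrier
      · filter_upwards [key Y' h] with s hs _ using hs
      · exact Eventually.of_forall fun s h' => absurd h' h
    filter_upwards [key', hx'.eventually hC, hx.eventually (hT.isOpen.mem_nhds (hT.subset ξ h0))]
      with s hs1 hs2 hs3
    obtain ⟨Y', w', hY', hLog, hest⟩ := hs2
    refine Or.inl ⟨x s, ⟨hs3, ?_⟩, rfl⟩
    rw [hLog]
    exact hs1 Y' (by rw [hYc]; exact hY') w' hest

/-- A continuous function on the hybrid space is bounded near the zero fibre. -/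
theorem exists_bound (F : D.Hybrid → ℝ) (hF : Continuous F) :
    ∃ M : ℝ, ∃ δ > 0, δ < 1 ∧ ∀ x : D.generic, ‖D.proj x‖ ≤ δ → |F (D.ofGeneric x)| ≤ M := by
  classical
  have hloc : ∀ ξ : X, D.proj ξ = 0 → ∃ N : Set X, IsOpen N ∧ ξ ∈ N ∧ ∃ M : ℝ,
      ∀ x : D.generic, (x : X) ∈ N → |F (D.ofGeneric x)| ≤ M := by
    intro ξ h0
    by_contra! hcon
    -- if `F` were unbounded near `ξ`, there would be an ultrafilter converging to `ξ` along which
    -- `|F|` tends to infinity; by compactness the logarithmic coordinates converge along it, hence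
    -- the points converge in the hybrid space, and `F` has a finite limit
    let l : Filter D.generic := comap Subtype.val (𝓝 ξ) ⊓ comap (fun x => |F (D.ofGeneric x)|) atTop
    have hl : NeBot l := by
      refine (((nhds_basis_opens ξ).comap _).inf (atTop_basis.comap _)).neBot_iff.2 ?_
      rintro ⟨N, M⟩ ⟨⟨hξN, hN⟩, -⟩
      obtain ⟨x, hx, hxM⟩ := hcon N hN hξN M
      exact ⟨x, hx, hxM.le⟩
    obtain ⟨c, hc⟩ := D.exists_monomialChart h0
    let J : Finset I := Finset.univ.filter fun i => ξ ∈ D.E i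
    have hJne : J.Nonempty := by
      obtain ⟨i, hi⟩ := (D.zero_iff ξ).1 h0
      exact ⟨i, by simp [J, hi]⟩
    have hξJ : ξ ∈ D.inter J := fun i hi => by simpa [J] using hi
    let Y : D.Stratum := D.stratumAt hJne hξJ
    have hY : IsInterior Y ξ := ⟨mem_connectedComponentIn hξJ, fun i => by simp [Y, stratumAt, J]⟩
    have hJ : Y.J ⊆ c.1.J := c.1.inter_subset hc (Y.carrier_subset hY.mem)
    let U := Ultrafilter.of l
    have hUl : (U : Filter D.generic) ≤ l := Ultrafilter.of_le l
    have hx : Tendsto (fun x : D.generic => (x : X)) U (𝓝 ξ) :=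
      tendsto_comap.mono_left (hUl.trans inf_le_left)
    have hFU : Tendsto (fun x : D.generic => |F (D.ofGeneric x)|) U atTop :=
      tendsto_comap.mono_left (hUl.trans inf_le_right)
    have hg : ∀ᶠ x : D.generic in U, (x : X) ∈ D.generic := Eventually.of_forall fun x => x.2
    have hratio := tendsto_log_eqn_div (c := c) hc hY hx hg
    have hlog := tendsto_log_proj h0 hx hg
    let v : D.generic → I → ℝ := fun x i => if i ∈ Y.J then
      Real.log ‖c.1.z x (c.1.k i)‖ / Real.log ‖D.proj x‖ else 0
    have hzt : ∀ i ∈ Y.J, Tendsto (fun x : D.generic => c.1.z x (c.1.k i)) U (𝓝 0) := by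
      intro i hi
      have := tendsto_pi_nhds.1 ((c.1.z.continuousAt hc).tendsto.comp hx) (c.1.k i)
      rwa [((c.1.isSnc.mem_iff ξ hc i).1 ((hY.mem_iff i).2 hi)).2] at this
    have hv0 : ∀ᶠ x in (U : Filter D.generic), ∀ i, 0 ≤ v x i := by
      rw [eventually_all]
      intro i
      by_cases hi : i ∈ Y.J
      · have h1 := (hzt i hi).norm
        rw [norm_zero] at h1
        filter_upwards [h1.eventually (gt_mem_nhds one_pos),
          hlog.eventually (eventually_lt_atBot 0)] with x hx1 hx2
        simp only [v, hi, if_true]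
        exact div_nonneg_of_nonpos (Real.log_nonpos (norm_nonneg _) hx1.le) hx2.le
      · exact Eventually.of_forall fun x => by simp [v, hi]
    have hvsum : Tendsto (fun x => ∑ i ∈ Y.J, (D.b i : ℝ) * v x i) U (𝓝 1) := by
      refine hratio.congr' ?_
      filter_upwards [hx.eventually (c.1.z.open_source.mem_nhds hc)] with x hxc
      rw [norm_prod, Real.log_prod, Finset.sum_div]
      · refine Finset.sum_congr rfl fun i hi => ?_
        rw [norm_pow, Real.log_pow]
        simp only [v, hi, if_true]
        ring
      · exact fun i hi => norm_ne_zero_iff.2 (pow_ne_zero _ (c.1.coord_ne_zero hxc x.2 (hJ hi)))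
    have hv2 : ∀ᶠ x in (U : Filter D.generic), v x ∈ Set.Icc (0 : I → ℝ) 2 := by
      filter_upwards [hv0, hvsum.eventually (gt_mem_nhds (by norm_num : (1 : ℝ) < 2))] with x h1 h2
      refine ⟨fun i => h1 i, fun i => ?_⟩
      by_cases hi : i ∈ Y.J
      · have hb : (1 : ℝ) ≤ D.b i := by exact_mod_cast D.b_pos i
        have h3 := Finset.single_le_sum (f := fun i => (D.b i : ℝ) * v x i)
          (fun j _ => mul_nonneg (Nat.cast_nonneg _) (h1 j)) hi
        have h4 : v x i ≤ (D.b i : ℝ) * v x i := le_mul_of_one_le_left (h1 i) hb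
        change v x i ≤ 2
        linarith
      · simp [v, hi]
    obtain ⟨w, hw, hvw⟩ : ∃ w ∈ Set.Icc (0 : I → ℝ) 2, Tendsto v U (𝓝 w) := by
      have := isCompact_Icc.ultrafilter_le_nhds (U.map v) (le_principal_iff.2 hv2)
      exact this
    have hwi := tendsto_pi_nhds.1 hvw
    have hwS : w ∈ D.simplex Y.J := by
      refine ⟨fun i => hw.1 i, fun i hi => ?_, ?_⟩
      · refine tendsto_nhds_unique (hwi i) ?_
        simp only [v, hi, if_false]
        exact tendsto_const_nhds
      · refine tendsto_nhds_unique (tendsto_finsetSum _ fun i _ => (hwi i).const_mul _) hvsum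
    have hlim := tendsto_ofDual hc hY ⟨w, hwS⟩ (fun x => x) hx fun i hi => by
      have := hwi i
      simpa only [v, hi, if_true] using this
    have h1 := ((hF.tendsto _).comp hlim).abs
    exact not_tendsto_atTop_of_tendsto_nhds h1 hFU
  choose! N hN hξN M hM using hloc
  obtain ⟨t, ht, hcov⟩ := D.isCompact_zeroFibre.elim_nhds_subcover N
    fun ξ hξ => (hN ξ hξ).mem_nhds (hξN ξ hξ)
  have hVo : IsOpen (⋃ ξ ∈ t, N ξ) := isOpen_biUnion fun ξ hξ => hN ξ (ht ξ hξ)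
  obtain ⟨δ, hδ, hδ1, hδV⟩ := exists_tube hVo fun x hx => hcov hx
  refine ⟨∑ ξ ∈ t, |M ξ|, δ, hδ, hδ1, fun x hx => ?_⟩
  obtain ⟨ξ, hξ, hxN⟩ := mem_iUnion₂.1 (hδV x hx)
  exact (hM ξ (ht ξ hξ) x hxN).trans ((le_abs_self _).trans
    (Finset.single_le_sum (f := fun ξ => |M ξ|) (fun _ _ => abs_nonneg _) hξ))

end SncDegeneration
end HybridSpace

/-! ### Parametrization of the fibres of a monomial -/

section MonomialParam

open Complex (slitPlane)

variable {n : ℕ}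

/-- The determinant of a map which, up to a permutation of the rows, is block triangular with the
diagonal entries `α` and `d j`. -/
theorem norm_det_of_insertNth (l₀ : Fin (n + 1)) (A : Model n →ₗ[ℂ] Model n) (α : ℂ)
    (d : Fin n → ℂ) (h0 : A (Pi.single 0 1) l₀ = α)
    (h1 : ∀ i, A (Pi.single 0 1) (l₀.succAbove i) = 0)
    (h2 : ∀ i j, A (Pi.single (Fin.succ j) 1) (l₀.succAbove i) = if i = j then d i else 0) :
    ‖LinearMap.det A‖ = ‖α‖ * ∏ j, ‖d j‖ := by
  rw [← LinearMap.det_toMatrix', Matrix.det_succ_column_zero, Finset.sum_eq_single l₀]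
  · have : (LinearMap.toMatrix' A).submatrix l₀.succAbove Fin.succ = Matrix.diagonal d := by
      ext i j
      simp [Matrix.submatrix_apply, LinearMap.toMatrix'_apply, h2, Matrix.diagonal_apply]
    rw [this, Matrix.det_diagonal]
    simp [LinearMap.toMatrix'_apply, h0]
  · intro l _ hl
    obtain ⟨i, rfl⟩ := Fin.exists_succAbove_eq hl
    simp [LinearMap.toMatrix'_apply, h1]
  · simp

variable (l₀ : Fin (n + 1)) (b₀ : ℕ) (β : Fin n → ℕ) (S : Finset (Fin n)) (φ : Fin n → ℝ)

/-- The domain of the `j`-th parameter: a strip around the line of imaginary part `φ j` for the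
logarithmic parameters, the plane cut along a ray for the other ones which occur in the
monomial. -/
def paramDom (j : Fin n) : Set ℂ :=
  if j ∈ S then {u | |u.im - φ j| < Real.pi} else
    if β j = 0 then univ else {y | y * Complex.exp (-(φ j * Complex.I)) ∈ slitPlane}

/-- The `j`-th coordinate as a function of the parameter. -/
def paramMap (j : Fin n) : ℂ → ℂ := if j ∈ S then Complex.exp else id

/-- The derivative of the `j`-th coordinate with respect to the parameter. -/
def paramDeriv (j : Fin n) : ℂ → ℂ := if j ∈ S then Complex.exp else 1

/-- The logarithm of the `j`-th coordinate as a function of the parameter. -/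
def paramLog (j : Fin n) : ℂ → ℂ :=
  if j ∈ S then id else
    if β j = 0 then 0 else
      fun y => Complex.log (y * Complex.exp (-(φ j * Complex.I))) + φ j * Complex.I

theorem isOpen_paramDom (j : Fin n) : IsOpen (paramDom β S φ j) := by
  unfold paramDom
  split_ifs
  · exact isOpen_lt (by fun_prop) continuous_const
  · exact isOpen_univ
  · exact Complex.isOpen_slitPlane.preimage (by fun_prop)

theorem hasDerivAt_paramMap (j : Fin n) (u : ℂ) :
    HasDerivAt (paramMap S j) (paramDeriv S j u) u := by
  unfold paramMap paramDeriv
  split_ifs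
  · exact Complex.hasDerivAt_exp u
  · exact hasDerivAt_id u

theorem paramDeriv_ne_zero (j : Fin n) (u : ℂ) : paramDeriv S j u ≠ 0 := by
  unfold paramDeriv
  split_ifs <;> simp

theorem contDiff_paramMap (j : Fin n) : ContDiff ℂ ω (paramMap S j) := by
  unfold paramMap
  split_ifs
  · exact Complex.contDiff_exp
  · exact contDiff_id

theorem contDiffOn_paramLog (j : Fin n) : ContDiffOn ℂ ω (paramLog β S φ j) (paramDom β S φ j) := by
  unfold paramLog paramDom
  split_ifs
  · exact contDiffOn_id
  · exact contDiffOn_const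
  · intro y hy
    have h : ContDiffAt ℂ ω (fun y : ℂ => y * Complex.exp (-(φ j * Complex.I))) y := by fun_prop
    exact (((Complex.contDiffAt_log hy).comp y h).add contDiffAt_const).contDiffWithinAt

theorem injOn_paramMap (j : Fin n) : InjOn (paramMap S j) (paramDom β S φ j) := by
  unfold paramMap paramDom
  split_ifs
  · intro u hu v hv h
    simp only [mem_ofPred_eq, abs_lt] at hu hv
    obtain ⟨m, hm⟩ := Complex.exp_eq_exp_iff_exists_int.1 h
    have him := congrArg Complex.im hm
    simp only [Complex.add_im, Complex.mul_im, Complex.intCast_re, Complex.intCast_im,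
      Complex.ofReal_re, Complex.ofReal_im, Complex.I_re, Complex.I_im, Complex.mul_re] at him
    norm_num at him
    have hpi := Real.pi_pos
    have h1 : (m : ℝ) < 1 := by nlinarith
    have h2 : (-1 : ℝ) < m := by nlinarith
    have h3 : m = 0 := by
      have h1' : m < 1 := by exact_mod_cast h1
      have h2' : -1 < m := by exact_mod_cast h2
      omega
    simpa [h3] using hm
  · exact injOn_id _
  · exact injOn_id _

theorem exp_paramLog {j : Fin n} (hj : β j ≠ 0) {u : ℂ} (hu : u ∈ paramDom β S φ j) :
    Complex.exp (paramLog β S φ j u) = paramMap S j u := by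
  unfold paramLog paramMap
  unfold paramDom at hu
  split_ifs at hu ⊢
  · rfl
  · rw [Complex.exp_add, Complex.exp_log (Complex.slitPlane_ne_zero hu), mul_assoc,
      ← Complex.exp_add]
    simp

theorem exists_paramMap_eq (hS : ∀ j ∈ S, β j ≠ 0) {j : Fin n} {w : ℂ}
    (hw : β j ≠ 0 → w * Complex.exp (-(φ j * Complex.I)) ∈ slitPlane) :
    ∃ u ∈ paramDom β S φ j, paramMap S j u = w := by
  by_cases hj : j ∈ S
  · have h := hw (hS j hj)
    refine ⟨Complex.log (w * Complex.exp (-(φ j * Complex.I))) + φ j * Complex.I, ?_, ?_⟩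
    · simp only [paramDom, hj, if_true, mem_ofPred_eq, Complex.add_im, Complex.log_im,
        Complex.mul_im, Complex.ofReal_re, Complex.I_im, Complex.ofReal_im, Complex.I_re]
      have h' := Complex.mem_slitPlane_iff_arg.1 h
      simpa using abs_lt.2 ⟨Complex.neg_pi_lt_arg _, (Complex.arg_le_pi _).lt_of_ne h'.1⟩
    · simp only [paramMap, hj, if_true]
      rw [Complex.exp_add, Complex.exp_log (Complex.slitPlane_ne_zero h), mul_assoc,
        ← Complex.exp_add]
      simp
  · refine ⟨w, ?_, by simp [paramMap, hj]⟩
    unfold paramDom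
    split_ifs with h
    · trivial
    · exact hw h

/-- The point with the given values of the parameters, its coordinate with index `l₀` being the
exponential of `(q - ∑ β j * log z_j) / b₀`. -/
def monoParam (q : ℂ) (u : Fin n → ℂ) : Model n :=
  l₀.insertNth (α := fun _ => ℂ)
    (Complex.exp ((q - ∑ j, (β j : ℂ) * paramLog β S φ j (u j)) / b₀))
    fun j => paramMap S j (u j)

@[simp] theorem monoParam_same (q : ℂ) (u : Fin n → ℂ) : monoParam l₀ b₀ β S φ q u l₀ =
    Complex.exp ((q - ∑ j, (β j : ℂ) * paramLog β S φ j (u j)) / b₀) := by simp [monoParam]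

@[simp] theorem monoParam_succAbove (q : ℂ) (u : Fin n → ℂ) (j : Fin n) :
    monoParam l₀ b₀ β S φ q u (l₀.succAbove j) = paramMap S j (u j) := by simp [monoParam]

/-- The monomial `z_{l₀} ^ b₀ * ∏ z_j ^ β j`. -/
def monomial (w : Model n) : ℂ := w l₀ ^ b₀ * ∏ j, w (l₀.succAbove j) ^ β j

variable {b₀}

/-- The parametrization takes its values in the fibre of the monomial over `exp q`. -/
theorem monomial_monoParam (hb : b₀ ≠ 0) (q : ℂ) {u : Fin n → ℂ}
    (hu : ∀ j, u j ∈ paramDom β S φ j) :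
    monomial l₀ b₀ β (monoParam l₀ b₀ β S φ q u) = Complex.exp q := by
  have hb' : (b₀ : ℂ) ≠ 0 := by exact_mod_cast hb
  have h1 : ∀ j, paramMap S j (u j) ^ β j =
      Complex.exp ((β j : ℂ) * paramLog β S φ j (u j)) := by
    intro j
    by_cases hj : β j = 0
    · simp [hj]
    · rw [Complex.exp_nat_mul, exp_paramLog β S φ hj (hu j)]
  simp only [monomial, monoParam_same, monoParam_succAbove, h1]
  rw [← Complex.exp_sum, ← Complex.exp_nat_mul, mul_div_cancel₀ _ hb', ← Complex.exp_add,
    sub_add_cancel]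

/-- Every point of the fibre of the monomial whose coordinates do not lie on the cuts is
parametrized by one of `b₀` branches. -/
theorem exists_monoParam_eq (hb : b₀ ≠ 0) (hS : ∀ j ∈ S, β j ≠ 0) (q : ℂ) {w : Model n}
    (hw : monomial l₀ b₀ β w = Complex.exp q)
    (hcut : ∀ j, β j ≠ 0 → w (l₀.succAbove j) * Complex.exp (-(φ j * Complex.I)) ∈ slitPlane) :
    ∃ k ∈ Finset.range b₀, ∃ u : Fin n → ℂ, (∀ j, u j ∈ paramDom β S φ j) ∧
      monoParam l₀ b₀ β S φ (q + 2 * Real.pi * Complex.I * k) u = w := by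
  have hb' : (b₀ : ℂ) ≠ 0 := by exact_mod_cast hb
  choose u hu huw using fun j => exists_paramMap_eq β S φ hS (hcut j)
  let σ := ∑ j, (β j : ℂ) * paramLog β S φ j (u j)
  -- the quotient by the principal branch is a root of unity, which selects the branch
  let ζ := w l₀ / Complex.exp ((q - σ) / b₀)
  have hζ : ζ ^ b₀ = 1 := by
    have h1 := monomial_monoParam l₀ β S φ hb q hu
    rw [← hw] at h1
    simp only [monomial, monoParam_same, monoParam_succAbove, huw] at h1
    have hne : ∏ j, w (l₀.succAbove j) ^ β j ≠ 0 := by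
      intro h0
      rw [monomial, h0, mul_zero] at hw
      exact Complex.exp_ne_zero _ hw.symm
    rw [div_pow, ← mul_right_cancel₀ hne h1, div_self]
    exact pow_ne_zero _ (Complex.exp_ne_zero _)
  have : NeZero b₀ := ⟨hb⟩
  obtain ⟨k, hk, hkζ⟩ := (Complex.mem_rootsOfUnity b₀
    (Units.mk0 ζ (fun h => by rw [h, zero_pow hb] at hζ; exact zero_ne_one hζ))).1 (by
      rw [mem_rootsOfUnity]
      ext
      simpa using hζ)
  refine ⟨k, Finset.mem_range.2 hk, u, hu, ?_⟩
  funext l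
  rcases Fin.eq_self_or_eq_succAbove l₀ l with rfl | ⟨j, rfl⟩
  · rw [monoParam_same]
    simp only [Units.val_mk0] at hkζ
    have h2 : w l = ζ * Complex.exp ((q - σ) / b₀) := by
      rw [div_mul_cancel₀ _ (Complex.exp_ne_zero _)]
    rw [h2, ← hkζ, ← Complex.exp_add]
    congr 1
    change (q + 2 * Real.pi * Complex.I * k - σ) / b₀ = _
    field_simp
    ring
  · rw [monoParam_succAbove, huw]

/-- The branches of the fibre which correspond to the different roots are disjoint. -/
theorem monoParam_branch_inj (hb : b₀ ≠ 0) (q : ℂ) {u v : Fin n → ℂ}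
    (hu : ∀ j, u j ∈ paramDom β S φ j) (hv : ∀ j, v j ∈ paramDom β S φ j) {k k' : ℕ}
    (hk : k < b₀) (hk' : k' < b₀)
    (h : monoParam l₀ b₀ β S φ (q + 2 * Real.pi * Complex.I * k) u =
      monoParam l₀ b₀ β S φ (q + 2 * Real.pi * Complex.I * k') v) : k = k' := by
  have hb' : (b₀ : ℂ) ≠ 0 := by exact_mod_cast hb
  have huv : u = v := by
    funext j
    refine injOn_paramMap β S φ j (hu j) (hv j) ?_
    have := congrFun h (l₀.succAbove j)
    simpa using this
  subst huv
  have h1 := congrFun h l₀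
  rw [monoParam_same, monoParam_same, Complex.exp_eq_exp_iff_exists_int] at h1
  obtain ⟨m, hm⟩ := h1
  have h2 : (k : ℂ) = k' + m * b₀ := by
    have hpi : (Real.pi : ℂ) ≠ 0 := by exact_mod_cast Real.pi_ne_zero
    field_simp at hm
    have h3 : (2 * Real.pi * Complex.I) * (k : ℂ) = (2 * Real.pi * Complex.I) * (k' + m * b₀) := by
      linear_combination hm
    exact mul_left_cancel₀ Complex.two_pi_I_ne_zero h3
  have h3 : (k : ℤ) = k' + m * b₀ := by exact_mod_cast h2
  have h4 : m = 0 := by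
    by_contra hm0
    rcases lt_or_gt_of_ne hm0 with hlt | hgt
    · have : m * (b₀ : ℤ) ≤ -1 * b₀ := mul_le_mul_of_nonneg_right (by omega) (by positivity)
      omega
    · have : 1 * (b₀ : ℤ) ≤ m * b₀ := mul_le_mul_of_nonneg_right (by omega) (by positivity)
      omega
  rw [h4] at h3
  omega

/-- The parametrization depending holomorphically on the value of the monomial as well, which is
the coordinate with index zero. -/
def monoParamFull (t q : ℂ) (v : Model n) : Model n :=
  monoParam l₀ b₀ β S φ (Complex.log (v 0 / t) + q) (Fin.tail v)

/-- The domain of `monoParamFull`. -/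
def monoParamDom (t : ℂ) : Set (Model n) :=
  {v | v 0 / t ∈ slitPlane ∧ ∀ j : Fin n, v j.succ ∈ paramDom β S φ j}

theorem isOpen_monoParamDom (t : ℂ) : IsOpen (monoParamDom β S φ t) := by
  have : monoParamDom β S φ t = {v | v 0 / t ∈ slitPlane} ∩
      ⋂ j : Fin n, {v : Model n | v j.succ ∈ paramDom β S φ j} := by
    ext v; simp [monoParamDom]
  rw [this]
  exact (Complex.isOpen_slitPlane.preimage (by fun_prop)).inter (isOpen_iInter_of_finite fun j =>
    (isOpen_paramDom β S φ j).preimage (continuous_apply _))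

variable {t q : ℂ}

theorem monomial_monoParamFull (hb : b₀ ≠ 0) (ht : t ≠ 0) (hq : Complex.exp q = t) {v : Model n}
    (hv : v ∈ monoParamDom β S φ t) :
    monomial l₀ b₀ β (monoParamFull l₀ (b₀ := b₀) β S φ t q v) = v 0 := by
  rw [monoParamFull, monomial_monoParam l₀ β S φ hb _ (u := Fin.tail v) hv.2, Complex.exp_add, hq,
    Complex.exp_log (Complex.slitPlane_ne_zero hv.1), div_mul_cancel₀ _ ht]

theorem injOn_monoParamFull (hb : b₀ ≠ 0) (ht : t ≠ 0) (hq : Complex.exp q = t) :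
    InjOn (monoParamFull l₀ (b₀ := b₀) β S φ t q) (monoParamDom β S φ t) := by
  intro v hv w hw h
  funext l
  refine Fin.cases ?_ (fun j => ?_) l
  · rw [← monomial_monoParamFull l₀ β S φ hb ht hq hv, h,
      monomial_monoParamFull l₀ β S φ hb ht hq hw]
  · refine injOn_paramMap β S φ j (hv.2 j) (hw.2 j) ?_
    have := congrFun h (l₀.succAbove j)
    simpa [monoParamFull, Fin.tail] using this

theorem contDiffOn_monoParamFull :
    ContDiffOn ℂ ω (monoParamFull l₀ (b₀ := b₀) β S φ t q) (monoParamDom β S φ t) := by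
  rw [contDiffOn_pi]
  intro l
  rcases Fin.eq_self_or_eq_succAbove l₀ l with rfl | ⟨j, rfl⟩
  · simp only [monoParamFull, monoParam_same]
    refine (ContDiffOn.div_const (ContDiffOn.sub (ContDiffOn.add ?_ contDiffOn_const)
      (ContDiffOn.sum fun j _ => contDiffOn_const.mul ?_)) _).cexp
    · intro v hv
      have h : ContDiffAt ℂ ω (fun v : Model n => v 0 / t) v :=
        (contDiff_apply ℂ ℂ (0 : Fin (n + 1))).contDiffAt.div_const t
      exact ((Complex.contDiffAt_log hv.1).comp v h).contDiffWithinAt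
    · exact (contDiffOn_paramLog β S φ j).comp (contDiff_apply ℂ ℂ j.succ).contDiffOn
        fun v hv => hv.2 j
  · simp only [monoParamFull, monoParam_succAbove]
    exact ((contDiff_paramMap S j).comp (contDiff_apply ℂ ℂ j.succ)).contDiffOn

/-- The Jacobian of the parametrization with the value of the monomial as a coordinate. The
derivative of the coordinate `l₀` by that value is the coordinate divided by `b₀` times the value,
and the other coordinates depend each on a single parameter. -/
theorem norm_det_monoParamFull (hb : b₀ ≠ 0) (ht : t ≠ 0) {v : Model n}
    (hv : v ∈ monoParamDom β S φ t) :
    ‖(fderiv ℂ (monoParamFull l₀ (b₀ := b₀) β S φ t q) v).det‖ =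
      ‖monoParamFull l₀ (b₀ := b₀) β S φ t q v l₀‖ / (b₀ * ‖v 0‖) *
        ∏ j, ‖paramDeriv S j (v j.succ)‖ := by
  have hb' : (b₀ : ℂ) ≠ 0 := by exact_mod_cast hb
  have hd : HasFDerivAt (monoParamFull l₀ (b₀ := b₀) β S φ t q)
      (fderiv ℂ (monoParamFull l₀ (b₀ := b₀) β S φ t q) v) v :=
    (((contDiffOn_monoParamFull l₀ β S φ v hv).contDiffAt
      ((isOpen_monoParamDom β S φ t).mem_nhds hv)).differentiableAt (by simp)).hasFDerivAt
  set A := fderiv ℂ (monoParamFull l₀ (b₀ := b₀) β S φ t q) v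
  -- the coordinates different from `l₀` depend each on one parameter, so that only the derivative
  -- by the value of the monomial is needed of the coordinate `l₀`
  have hsucc : ∀ j h, A h (l₀.succAbove j) = h j.succ * paramDeriv S j (v j.succ) := by
    intro j h
    have h1 := hasFDerivAt_pi'.1 hd (l₀.succAbove j)
    have h2 : HasFDerivAt (fun w : Model n => paramMap S j (w j.succ)) _ v :=
      (hasDerivAt_paramMap S j (v j.succ)).hasFDerivAt.comp v
        (hasFDerivAt_apply (𝕜 := ℂ) j.succ v)
    have h3 : (fun w => monoParamFull l₀ (b₀ := b₀) β S φ t q w (l₀.succAbove j)) =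
        fun w : Model n => paramMap S j (w j.succ) := by
      funext w; simp [monoParamFull, Fin.tail]
    rw [h3] at h1
    have h4 := congrArg (fun f => f h) (h1.unique h2)
    simpa using h4
  have h0 : A (Pi.single 0 1) l₀ =
      monoParamFull l₀ (b₀ := b₀) β S φ t q v l₀ / (b₀ * v 0) := by
    -- restrict to the line through `v` in the direction of the coordinate zero
    have h1 := hasFDerivAt_pi'.1 hd l₀
    have hv0 : v 0 ≠ 0 := fun h => by
      have := Complex.slitPlane_ne_zero hv.1
      simp [h] at this
    let γ : ℂ → Model n := fun s => v + s • Pi.single 0 1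
    have hγ : HasDerivAt γ (Pi.single 0 1) 0 := by
      have := ((hasDerivAt_id (0 : ℂ)).smul_const (Pi.single 0 1 : Model n)).const_add v
      rwa [one_smul] at this
    have h2 := (h1.congr_of_eventuallyEq (Eventually.of_forall fun _ => rfl) :
      HasFDerivAt (fun x => monoParamFull l₀ (b₀ := b₀) β S φ t q x l₀) _ (v))
    have h3 : HasDerivAt (fun s => monoParamFull l₀ (b₀ := b₀) β S φ t q (γ s) l₀)
        (A (Pi.single 0 1) l₀) 0 := by
      have hγ0 : γ 0 = v := by simp [γ]
      rw [← hγ0] at h2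
      exact h2.comp_hasDerivAt (0 : ℂ) hγ
    have h4 : HasDerivAt (fun s => monoParamFull l₀ (b₀ := b₀) β S φ t q (γ s) l₀)
        (monoParamFull l₀ (b₀ := b₀) β S φ t q v l₀ / (b₀ * v 0)) 0 := by
      have htail : ∀ s, Fin.tail (γ s) = Fin.tail v := fun s => by
        funext j; simp [γ, Fin.tail]
      have hz : ∀ s, γ s 0 = v 0 + s := fun s => by simp [γ]
      simp only [monoParamFull, monoParam_same, htail, hz]
      have h5 : HasDerivAt (fun s : ℂ => (v 0 + s) / t) (1 / t) 0 :=
        ((hasDerivAt_id (0 : ℂ)).const_add (v 0)).div_const t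
      have h6 : HasDerivAt (fun s : ℂ => Complex.log ((v 0 + s) / t)) (1 / v 0) 0 := by
        have h := (Complex.hasDerivAt_log (z := (v 0 + 0) / t) (by simpa using hv.1)).comp 0 h5
        have h' : ((v 0 + 0) / t)⁻¹ * (1 / t) = 1 / v 0 := by rw [add_zero]; field_simp
        rwa [h'] at h
      refine ((((h6.add_const q).sub_const (∑ j, (β j : ℂ) * paramLog β S φ j
        (Fin.tail v j))).div_const (b₀ : ℂ)).cexp).congr_deriv ?_
      rw [add_zero, div_div, mul_one_div, mul_comm (v 0)]
    exact h3.unique h4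
  rw [ContinuousLinearMap.det, norm_det_of_insertNth l₀ (A : Model n →ₗ[ℂ] Model n) _
    (fun j => paramDeriv S j (v j.succ)) h0]
  · simp
  · intro j
    change A _ _ = 0
    rw [hsucc]; simp
  · intro i j
    change A _ _ = _
    rw [hsucc]
    by_cases hij : i = j
    · subst hij; simp
    · simp [hij]

end MonomialParam

/-! ### Branches of the fibres in an adapted chart -/

section BranchCharts

open Complex (slitPlane)

variable {n : ℕ} {X : Type u} [TopologicalSpace X] [ChartedSpace (Model n) X]
  [IsManifold 𝓘(ℂ, Model n) ω X] {I : Type v} {D : SncDegeneration n X I}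

open CanonicalExtension (MonomialChart FibreChart)

namespace SncDegeneration

/-- The multiplicity of the coordinate with index `l` in the local equation of the zero fibre. -/
def Chart.mult (c : D.Chart) (l : Fin (n + 1)) : ℕ :=
  ∑ i ∈ c.J, if c.k i = l then D.b i else 0

theorem Chart.mult_k (c : D.Chart) {i : I} (hi : i ∈ c.J) : c.mult (c.k i) = D.b i := by
  rw [mult, Finset.sum_eq_single i]
  · simp
  · intro j hj hji
    rw [if_neg fun h => hji (c.isSnc.injOn (by exact_mod_cast hj) (by exact_mod_cast hi) h)]
  · exact fun h => absurd hi h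

theorem Chart.exists_of_mult_ne_zero (c : D.Chart) {l : Fin (n + 1)} (h : c.mult l ≠ 0) :
    ∃ i ∈ c.J, c.k i = l := by
  by_contra! hcon
  exact h (Finset.sum_eq_zero fun i hi => if_neg (hcon i hi))

/-- The multiplicities of the coordinates other than that of `i₀`. -/
def Chart.multRest (c : D.Chart) (i₀ : I) (j : Fin n) : ℕ := c.mult ((c.k i₀).succAbove j)

theorem Chart.prod_pow_eq (c : D.Chart) (w : Model n) :
    ∏ i ∈ c.J, w (c.k i) ^ D.b i = ∏ l, w l ^ c.mult l := by
  classical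
  have h : ∀ l, w l ^ c.mult l = ∏ i ∈ c.J with c.k i = l, w (c.k i) ^ D.b i := by
    intro l
    rw [mult, ← Finset.sum_filter, ← Finset.prod_pow_eq_pow_sum]
    exact Finset.prod_congr rfl fun i hi => by rw [(Finset.mem_filter.1 hi).2]
  simp only [h]
  rw [Finset.prod_fiberwise_of_maps_to (g := c.k) fun _ _ => Finset.mem_univ _]

theorem Chart.eqn_eq_monomial (c : D.Chart) {i₀ : I} (hi₀ : i₀ ∈ c.J) (x : X) :
    c.eqn x = monomial (c.k i₀) (D.b i₀) (c.multRest i₀) (c.z x) := by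
  rw [Chart.eqn, c.prod_pow_eq, Fin.prod_univ_succAbove _ (c.k i₀), c.mult_k hi₀]
  rfl

variable (D) in
theorem b_ne_zero (i : I) : D.b i ≠ 0 := (D.b_pos i).ne'

/-- The parametrization `monoParamFull` attached to an adapted chart. -/
abbrev Chart.param (c : D.Chart) (i₀ : I) (S : Finset (Fin n)) (φ : Fin n → ℝ) (t q : ℂ) :
    Model n → Model n :=
  monoParamFull (c.k i₀) (b₀ := D.b i₀) (c.multRest i₀) S φ t q

/-- A branch of the fibres of the monomial in an adapted chart provides a fibre chart: its
coordinate zero is the projection, and its other coordinates are the parameters. -/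
theorem exists_branchChart (c : MonomialChart D) {i₀ : I} (hi₀ : i₀ ∈ c.1.J) (S : Finset (Fin n))
    (φ : Fin n → ℝ) {t q : ℂ} (hq : Complex.exp q = t) :
    ∃ z : FibreChart D,
      z.1.target = {v | v ∈ monoParamDom (c.1.multRest i₀) S φ t ∧
        c.1.param i₀ S φ t q v ∈ c.1.z.target} ∧
      (∀ v, z.1.symm v = c.1.z.symm (c.1.param i₀ S φ t q v)) ∧
      z.1.source = {x ∈ c.1.z.source | c.1.z x ∈ c.1.param i₀ S φ t q ''
        monoParamDom (c.1.multRest i₀) S φ t} := by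
  have ht : t ≠ 0 := by rw [← hq]; exact Complex.exp_ne_zero _
  have hdet : ∀ v ∈ monoParamDom (c.1.multRest i₀) S φ t,
      (fderiv ℂ (c.1.param i₀ S φ t q) v).det ≠ 0 := by
    intro v hv
    rw [← norm_ne_zero_iff, norm_det_monoParamFull _ _ S φ (D.b_ne_zero i₀) ht hv]
    refine mul_ne_zero (div_ne_zero ?_ (mul_ne_zero (by exact_mod_cast D.b_ne_zero i₀) ?_)) ?_
    · rw [norm_ne_zero_iff, monoParamFull, monoParam_same]
      exact Complex.exp_ne_zero _
    · rw [norm_ne_zero_iff]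
      intro h
      have := Complex.slitPlane_ne_zero hv.1
      simp [h] at this
    · exact Finset.prod_ne_zero_iff.2 fun j _ => norm_ne_zero_iff.2 (paramDeriv_ne_zero S j _)
  obtain ⟨e, hes, heF, he, he'⟩ := exists_openPartialHomeomorph_of_injOn
    (isOpen_monoParamDom (c.1.multRest i₀) S φ t)
    (contDiffOn_monoParamFull (c.1.k i₀) (b₀ := D.b i₀) (c.1.multRest i₀) S φ (q := q))
    (injOn_monoParamFull _ _ S φ (D.b_ne_zero i₀) ht hq) hdet
  have het : e.target = c.1.param i₀ S φ t q '' monoParamDom (c.1.multRest i₀) S φ t := by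
    rw [← e.image_source_eq_target, hes]
    exact image_congr fun v _ => heF v
  refine ⟨⟨c.1.z ≫ₕ e.symm, trans_mem_maximalAtlas c.1.isSnc.holomorphic e.symm he'
    (by simpa using he), ?_⟩, ?_, ?_, ?_⟩
  · rintro x ⟨hx, hxe⟩
    have hxe' : c.1.z x ∈ e.target := hxe
    rw [c.2 x hx, c.1.eqn_eq_monomial hi₀]
    change e.symm (c.1.z x) 0 = _
    have h1 := monomial_monoParamFull (c.1.k i₀) (c.1.multRest i₀) S φ (D.b_ne_zero i₀) ht hq
      (v := e.symm (c.1.z x)) (by rw [← hes]; exact e.map_target hxe')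
    rw [← heF, e.right_inv hxe'] at h1
    exact h1.symm
  · ext v
    simp only [OpenPartialHomeomorph.trans_target, OpenPartialHomeomorph.symm_target, mem_inter_iff,
      OpenPartialHomeomorph.symm_symm, mem_preimage, mem_ofPred_eq, hes, heF]
  · intro v
    change c.1.z.symm (e v) = _
    rw [heF]
  · ext x
    simp only [OpenPartialHomeomorph.trans_source, OpenPartialHomeomorph.symm_source, mem_inter_iff,
      mem_preimage, het, mem_ofPred_eq]

/-- The chart of the total space, with the projection as coordinate of index zero, whose inverse is
the given branch of the parametrization of an adapted chart. -/
def branchChart (c : MonomialChart D) {i₀ : I} (hi₀ : i₀ ∈ c.1.J) (S : Finset (Fin n))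
    (φ : Fin n → ℝ) {t q : ℂ} (hq : Complex.exp q = t) : FibreChart D :=
  (exists_branchChart c hi₀ S φ hq).choose

section
variable (c : MonomialChart D) {i₀ : I} (hi₀ : i₀ ∈ c.1.J) (S : Finset (Fin n)) (φ : Fin n → ℝ)
  {t q : ℂ} (hq : Complex.exp q = t)

theorem branchChart_target : (branchChart c hi₀ S φ hq).1.target =
    {v | v ∈ monoParamDom (c.1.multRest i₀) S φ t ∧ c.1.param i₀ S φ t q v ∈ c.1.z.target} :=
  (exists_branchChart c hi₀ S φ hq).choose_spec.1

theorem branchChart_symm (v : Model n) : (branchChart c hi₀ S φ hq).1.symm v =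
    c.1.z.symm (c.1.param i₀ S φ t q v) :=
  (exists_branchChart c hi₀ S φ hq).choose_spec.2.1 v

theorem branchChart_source : (branchChart c hi₀ S φ hq).1.source =
    {x ∈ c.1.z.source | c.1.z x ∈ c.1.param i₀ S φ t q ''
        monoParamDom (c.1.multRest i₀) S φ t} :=
  (exists_branchChart c hi₀ S φ hq).choose_spec.2.2

end

variable {L : X → Type*} [TopologicalSpace (TotalSpace ℂ L)] [∀ x, AddCommGroup (L x)]
  [∀ x, Module ℂ (L x)] [∀ x, TopologicalSpace (L x)] [FiberBundle ℂ L] [VectorBundle ℂ ℂ L]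
  (ℒ : CanonicalExtension L D) (ψ : ContinuousMetric L)

/-- The density in the chart of a branch, in terms of the density in the adapted chart. -/
theorem density_branchChart (c : MonomialChart D) {i₀ : I} (hi₀ : i₀ ∈ c.1.J) (S : Finset (Fin n))
    (φ : Fin n → ℝ) {t q : ℂ} (hq : Complex.exp q = t) {v : Model n}
    (hv : v ∈ (branchChart c hi₀ S φ hq).1.target) :
    ℒ.density ψ (branchChart c hi₀ S φ hq).1 (c.1.z.symm (c.1.param i₀ S φ t q v)) =
      (‖c.1.param i₀ S φ t q v (c.1.k i₀)‖ / (D.b i₀ * ‖v 0‖) *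
        ∏ j, ‖paramDeriv S j (v j.succ)‖) ^ 2 *
      ℒ.density ψ c.1.z (c.1.z.symm (c.1.param i₀ S φ t q v)) := by
  have ht : t ≠ 0 := by rw [← hq]; exact Complex.exp_ne_zero _
  set z := branchChart c hi₀ S φ hq
  have hv' := hv
  rw [branchChart_target] at hv'
  have hx := z.1.map_target hv
  have hsymm : z.1.symm v = c.1.z.symm (c.1.param i₀ S φ t q v) := branchChart_symm c hi₀ S φ hq v
  rw [← hsymm]
  have hx' : z.1.symm v ∈ c.1.z.source := by
    rw [hsymm]; exact c.1.z.map_target hv'.2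
  have hg : z.1.symm v ∈ D.generic := by
    change D.proj _ ≠ 0
    rw [← z.2.2 _ hx, z.1.right_inv hv]
    intro h
    have := Complex.slitPlane_ne_zero hv'.1.1
    simp [h] at this
  rw [ℒ.density_change ψ z.2.1 c.1.isSnc.holomorphic hx hx' hg, z.1.right_inv hv,
    ← norm_det_monoParamFull (c.1.k i₀) (c.1.multRest i₀) S φ (q := q) (D.b_ne_zero i₀) ht hv'.1]
  congr 4
  refine Filter.EventuallyEq.fderiv_eq ?_
  filter_upwards [z.1.open_target.mem_nhds hv] with w hw
  rw [branchChart_target] at hw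
  change c.1.z (z.1.symm w) = _
  rw [branchChart_symm, c.1.z.right_inv hw.2]

variable [MeasurableSpace X] [BorelSpace X]

theorem volume_setOf_im_eq_zero (j : Fin n) : volume {u : Fin n → ℂ | (u j).im = 0} = 0 := by
  let P : Submodule ℝ (Fin n → ℂ) :=
    LinearMap.ker (Complex.imLm ∘ₗ LinearMap.proj (R := ℝ) (φ := fun _ : Fin n => ℂ) j)
  have h : {u : Fin n → ℂ | (u j).im = 0} = (P : Set (Fin n → ℂ)) := by
    ext u; simp [P]
  rw [h]
  refine Measure.addHaar_submodule _ _ fun htop => ?_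
  have : (fun _ => Complex.I : Fin n → ℂ) ∈ P := by rw [htop]; trivial
  simp [P] at this

theorem exp_branch {t q : ℂ} (hq : Complex.exp q = t) (k : ℕ) :
    Complex.exp (q + 2 * Real.pi * Complex.I * k) = t := by
  rw [Complex.exp_add, hq]
  have : (2 * Real.pi * Complex.I * k : ℂ) = k * (2 * Real.pi * Complex.I) := by ring
  rw [this, Complex.exp_nat_mul_two_pi_mul_I, mul_one]

theorem cons_mem_monoParamDom {β : Fin n → ℕ} {S : Finset (Fin n)} {φ : Fin n → ℝ} {t : ℂ}
    (ht : t ≠ 0) (u : Fin n → ℂ) :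
    (Fin.cons t u : Model n) ∈ monoParamDom β S φ t ↔ ∀ j, u j ∈ paramDom β S φ j := by
  simp [monoParamDom, div_self ht]

theorem param_cons (c : D.Chart) (i₀ : I) (S : Finset (Fin n))
    (φ : Fin n → ℝ) {t q : ℂ} (ht : t ≠ 0) (u : Fin n → ℂ) :
    c.param i₀ S φ t q (Fin.cons t u) =
      monoParam (c.k i₀) (D.b i₀) (c.multRest i₀) S φ q u := by
  simp [Chart.param, monoParamFull, div_self ht, Fin.tail_cons]

/-- A point of the fibre over `t` off the cuts lies in one of the branches. -/
theorem exists_mem_branchChart (c : MonomialChart D) {i₀ : I} (hi₀ : i₀ ∈ c.1.J)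
    (S : Finset (Fin n)) (hS : ∀ j ∈ S, c.1.multRest i₀ j ≠ 0) (φ : Fin n → ℝ) {t q : ℂ}
    (hq : Complex.exp q = t) {x : X} (hx : x ∈ c.1.z.source) (hxt : D.proj x = t)
    (hcut : ∀ j, c.1.multRest i₀ j ≠ 0 →
      c.1.z x ((c.1.k i₀).succAbove j) * Complex.exp (-(φ j * Complex.I)) ∈ slitPlane) :
    ∃ k ∈ Finset.range (D.b i₀), x ∈ (branchChart c hi₀ S φ (exp_branch hq k)).1.source := by
  have ht : t ≠ 0 := by rw [← hq]; exact Complex.exp_ne_zero _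
  obtain ⟨k, hk, u, hu, huw⟩ := exists_monoParam_eq (c.1.k i₀) (c.1.multRest i₀) S φ (D.b_ne_zero i₀)
    hS q (w := c.1.z x) (by rw [← c.1.eqn_eq_monomial hi₀, ← c.2 x hx, hxt, hq]) hcut
  refine ⟨k, hk, ?_⟩
  rw [branchChart_source]
  exact ⟨hx, Fin.cons t u, (cons_mem_monoParamDom ht u).2 hu, by rw [param_cons _ _ _ _ ht, huw]⟩

/-- The charts of the different branches are disjoint. -/
theorem disjoint_branchChart (c : MonomialChart D) {i₀ : I} (hi₀ : i₀ ∈ c.1.J)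
    (S : Finset (Fin n)) (φ : Fin n → ℝ) {t q : ℂ} (hq : Complex.exp q = t) {k k' : ℕ}
    (hk : k < D.b i₀) (hk' : k' < D.b i₀) (hne : k ≠ k') :
    Disjoint (branchChart c hi₀ S φ (exp_branch hq k)).1.source
      (branchChart c hi₀ S φ (exp_branch hq k')).1.source := by
  have ht : t ≠ 0 := by rw [← hq]; exact Complex.exp_ne_zero _
  rw [Set.disjoint_left]
  intro x hx hx'
  rw [branchChart_source] at hx hx'
  obtain ⟨hxc, v, hv, hvx⟩ := hx
  obtain ⟨-, v', hv', hvx'⟩ := hx'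
  have h0 : v 0 = v' 0 := by
    rw [← monomial_monoParamFull (c.1.k i₀) (c.1.multRest i₀) S φ (D.b_ne_zero i₀) ht
      (exp_branch hq k) hv, ← monomial_monoParamFull (c.1.k i₀) (c.1.multRest i₀) S φ
      (D.b_ne_zero i₀) ht (exp_branch hq k') hv']
    exact congrArg _ (hvx.trans hvx'.symm)
  have h1 := hvx.trans hvx'.symm
  simp only [Chart.param, monoParamFull, h0, ← add_assoc] at h1
  exact hne (monoParam_branch_inj (c.1.k i₀) (c.1.multRest i₀) S φ (D.b_ne_zero i₀) _
    (u := Fin.tail v) (v := Fin.tail v') hv.2 hv'.2 hk hk' h1)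

/-- The cuts have measure zero. -/
theorem fibreMeasure_im_eq_zero (c : MonomialChart D) {i₀ : I} (hi₀ : i₀ ∈ c.1.J) {t q : ℂ}
    (hq : Complex.exp q = t) :
    ℒ.fibreMeasure ψ t {x | x ∈ c.1.z.source ∧ D.proj x = t ∧
      ∃ j, c.1.multRest i₀ j ≠ 0 ∧ (c.1.z x ((c.1.k i₀).succAbove j)).im = 0} = 0 := by
  classical
  have ht : t ≠ 0 := by rw [← hq]; exact Complex.exp_ne_zero _
  -- the cuts are moved: for each coordinate the cut is along the negative or along the positive
  -- half axis, so that each point lies off the cuts for a suitable choice `A`; in these charts the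
  -- set is a finite union of real hyperplanes
  let φ : Finset (Fin n) → Fin n → ℝ := fun A j => if j ∈ A then Real.pi else 0
  let z : Finset (Fin n) → ℕ → FibreChart D := fun A k =>
    branchChart c hi₀ ∅ (φ A) (exp_branch hq k)
  let N : Set X := c.1.z.source ∩ c.1.z ⁻¹' {w | ∃ j, (w ((c.1.k i₀).succAbove j)).im = 0}
  have hN : MeasurableSet N := by
    refine measurableSet_inter_preimage c.1.z.open_source.measurableSet c.1.z.continuousOn ?_
    have : {w : Model n | ∃ j, (w ((c.1.k i₀).succAbove j)).im = 0} =
        ⋃ j, {w : Model n | (w ((c.1.k i₀).succAbove j)).im = 0} := by ext; simp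
    rw [this]
    exact MeasurableSet.iUnion fun j => measurableSet_eq_fun (by fun_prop) measurable_const
  have hzero : ∀ A k, ℒ.fibreMeasure ψ t (N ∩ (z A k).1.source) = 0 := by
    intro A k
    rw [← Measure.restrict_apply hN, ℒ.fibreMeasure_restrict ψ ht,
      ℒ.localFibreMeasure_apply ψ t _ hN]
    refine setLIntegral_measure_zero _ _ ?_
    refine measure_mono_null (t := ⋃ j, {u : Fin n → ℂ | (u j).im = 0}) ?_
      (measure_iUnion_null volume_setOf_im_eq_zero)
    rintro u ⟨hu, -, j, hj⟩
    refine mem_iUnion.2 ⟨j, ?_⟩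
    rw [mem_ofPred_eq, branchChart_target] at hu
    change (c.1.z ((branchChart c hi₀ ∅ (φ A) (exp_branch hq k)).1.symm
      (Fin.cons t u)) _).im = 0 at hj
    rw [branchChart_symm, c.1.z.right_inv hu.2, param_cons _ _ _ _ ht, monoParam_succAbove] at hj
    simpa [paramMap] using hj
  refine measure_mono_null (t := ⋃ A : Finset (Fin n), ⋃ k : ℕ, N ∩ (z A k).1.source) ?_
    (measure_iUnion_null fun A => measure_iUnion_null fun k => hzero A k)
  rintro x ⟨hx, hxt, j₀, -, hj₀⟩
  have hg : x ∈ D.generic := by change D.proj x ≠ 0; rwa [hxt]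
  let A : Finset (Fin n) := Finset.univ.filter fun j =>
    c.1.z x ((c.1.k i₀).succAbove j) ∉ slitPlane
  obtain ⟨k, -, hk⟩ := exists_mem_branchChart c hi₀ ∅ (by simp) (φ A) hq hx hxt fun j hj => by
    obtain ⟨i, hi, hik⟩ := c.1.exists_of_mult_ne_zero hj
    have hne : c.1.z x ((c.1.k i₀).succAbove j) ≠ 0 := by
      rw [← hik]; exact c.1.coord_ne_zero hx hg hi
    by_cases hjA : c.1.z x ((c.1.k i₀).succAbove j) ∈ slitPlane
    · simp [φ, A, hjA]
    · have : Complex.exp (-((φ A j : ℝ) * Complex.I)) = -1 := by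
        simp [φ, A, hjA, Complex.exp_neg, Complex.exp_pi_mul_I]
      rw [this, mul_neg_one]
      exact (Complex.mem_slitPlane_or_neg_mem_slitPlane hne).resolve_left hjA
  exact mem_iUnion₂.2 ⟨A, k, ⟨hx, j₀, hj₀⟩, hk⟩

/-- In an adapted chart, the measure on the fibre is the sum of the measures of the branches. -/
theorem fibreMeasure_restrict_chart (c : MonomialChart D) {i₀ : I} (hi₀ : i₀ ∈ c.1.J)
    (S : Finset (Fin n)) (hS : ∀ j ∈ S, c.1.multRest i₀ j ≠ 0) {t q : ℂ}
    (hq : Complex.exp q = t) :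
    (ℒ.fibreMeasure ψ t).restrict c.1.z.source = Measure.sum fun k : Finset.range (D.b i₀) =>
      ℒ.localFibreMeasure ψ t (branchChart c hi₀ S 0 (exp_branch hq k)) := by
  have ht : t ≠ 0 := by rw [← hq]; exact Complex.exp_ne_zero _
  have h1 : (ℒ.fibreMeasure ψ t).restrict c.1.z.source = (ℒ.fibreMeasure ψ t).restrict
      (⋃ k : Finset.range (D.b i₀), (branchChart c hi₀ S 0 (exp_branch hq k)).1.source) := by
    refine Measure.restrict_congr_set ?_
    have hc := ℒ.fibreMeasure_compl ψ t
    have hN := fibreMeasure_im_eq_zero ℒ ψ c hi₀ hq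
    have hc' : ∀ᵐ x ∂(ℒ.fibreMeasure ψ t), D.proj x = t := by
      rw [ae_iff]; exact hc
    filter_upwards [hc', compl_mem_ae_iff.2 hN] with x hxt hxN
    refine propext ⟨fun hx => ?_, fun hx => ?_⟩
    · obtain ⟨k, hk, hxk⟩ := exists_mem_branchChart c hi₀ S hS 0 hq hx hxt fun j hj => by
        by_contra hcon
        refine hxN ⟨hx, hxt, j, hj, ?_⟩
        by_contra him
        exact hcon (by simpa [Complex.mem_slitPlane_iff] using Or.inr him)
      exact mem_iUnion.2 ⟨⟨k, hk⟩, hxk⟩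
    · obtain ⟨k, hk⟩ := mem_iUnion.1 hx
      rw [branchChart_source] at hk
      exact hk.1
  rw [h1, Measure.restrict_iUnion]
  · congr 1
    funext k
    exact ℒ.fibreMeasure_restrict ψ ht _
  · intro k k' hkk
    exact disjoint_branchChart c hi₀ S 0 hq (Finset.mem_range.1 k.2) (Finset.mem_range.1 k'.2)
      fun h => hkk (Subtype.ext h)
  · exact fun k => (OpenPartialHomeomorph.open_source _).measurableSet

end SncDegeneration
end BranchCharts

/-! ### The density in logarithmic coordinates -/

section Weights

open Complex (slitPlane)

theorem integral_map_withDensity {Y X : Type*} [TopologicalSpace Y] [MeasurableSpace Y]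
    [OpensMeasurableSpace Y] [TopologicalSpace X] [MeasurableSpace X] [BorelSpace X]
    {μ : Measure Y} {S : Set Y} (hS : MeasurableSet S) {φ : Y → X} (hφ : ContinuousOn φ S)
    {ρ : Y → ℝ} (hρ : AEMeasurable ρ (μ.restrict S)) (h0 : ∀ y ∈ S, 0 ≤ ρ y) {g : X → ℝ}
    (hg : Measurable g) :
    ∫ x, g x ∂(((μ.restrict S).withDensity fun y => ENNReal.ofReal (ρ y)).map φ) =
      ∫ y in S, ρ y * g (φ y) ∂μ := by
  rw [integral_map ((aemeasurable_of_continuousOn hS hφ).mono_ac (withDensity_absolutelyContinuous _ _))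
    hg.aestronglyMeasurable]
  rw [integral_withDensity_eq_integral_toReal_smul₀ hρ.ennreal_ofReal (by simp)]
  refine setIntegral_congr_fun hS fun y hy => ?_
  simp [ENNReal.toReal_ofReal (h0 y hy)]

variable {n : ℕ} {X : Type u} [TopologicalSpace X] [ChartedSpace (Model n) X]
  [IsManifold 𝓘(ℂ, Model n) ω X] {I : Type v} {D : SncDegeneration n X I}

open CanonicalExtension (MonomialChart FibreChart)

theorem CanonicalExtension.integral_localFibreMeasure {L : X → Type*}
    [TopologicalSpace (TotalSpace ℂ L)] [∀ x, AddCommGroup (L x)]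
    [∀ x, Module ℂ (L x)] [∀ x, TopologicalSpace (L x)] [FiberBundle ℂ L] [VectorBundle ℂ ℂ L]
    [MeasurableSpace X] [BorelSpace X] (ℒ : CanonicalExtension L D) (ψ : ContinuousMetric L)
    {t : ℂ} (ht : t ≠ 0) (z : FibreChart D) {g : X → ℝ} (hg : Measurable g) :
    ∫ x, g x ∂(ℒ.localFibreMeasure ψ t z) =
      ∫ y in {y : Fin n → ℂ | (Fin.cons t y : Model n) ∈ z.1.target},
        ℒ.density ψ z.1 (z.1.symm (Fin.cons t y)) * g (z.1.symm (Fin.cons t y)) := by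
  refine integral_map_withDensity (isOpen_sliceTarget z.1 t).measurableSet
    (continuousOn_sliceTarget z.1 t) ?_ (fun y _ => ℒ.density_nonneg ψ z.1 _) hg
  refine aemeasurable_of_continuousOn (isOpen_sliceTarget z.1 t).measurableSet ?_
  refine (ℒ.continuousOn_density ψ z.2.1).comp (continuousOn_sliceTarget z.1 t) fun y hy => ?_
  refine ⟨z.1.map_target hy, ?_⟩
  change D.proj _ ≠ 0
  rw [← z.2.2 _ (z.1.map_target hy), z.1.right_inv hy]
  simpa using ht

namespace SncDegeneration

open scoped Classical in
/-- The coordinates with index in `K`, other than that of `i₀`, in the labelling of the coordinates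
other than that of `i₀`. -/
def Chart.logSet (c : D.Chart) (K : Finset I) (i₀ : I) : Finset (Fin n) :=
  Finset.univ.filter fun j => ∃ i ∈ K, c.k i = (c.k i₀).succAbove j

theorem Chart.mem_logSet {c : D.Chart} {K : Finset I} {i₀ : I} {j : Fin n} :
    j ∈ c.logSet K i₀ ↔ ∃ i ∈ K, c.k i = (c.k i₀).succAbove j := by simp [logSet]

theorem Chart.prod_logSet (c : D.Chart) {K : Finset I} (hK : K ⊆ c.J) {i₀ : I} (hi₀ : i₀ ∈ K)
    {M : Type*} [CommMonoid M] (h : Fin (n + 1) → M) :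
    ∏ i ∈ K, h (c.k i) = h (c.k i₀) * ∏ j ∈ c.logSet K i₀, h ((c.k i₀).succAbove j) := by
  classical
  have hinj : Set.InjOn c.k (K : Set I) := c.isSnc.injOn.mono (by exact_mod_cast hK)
  rw [← Finset.prod_image (g := c.k) hinj (f := h)]
  have : K.image c.k = insert (c.k i₀) ((c.logSet K i₀).image (c.k i₀).succAbove) := by
    ext l
    simp only [Finset.mem_image, Finset.mem_insert, Chart.mem_logSet]
    constructor
    · rintro ⟨i, hi, rfl⟩
      rcases Fin.eq_self_or_eq_succAbove (c.k i₀) (c.k i) with h | ⟨j, hj⟩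
      · exact Or.inl h
      · exact Or.inr ⟨j, ⟨i, hi, hj⟩, hj.symm⟩
    · rintro (rfl | ⟨j, ⟨i, hi, hij⟩, rfl⟩)
      · exact ⟨i₀, hi₀, rfl⟩
      · exact ⟨i, hi, hij⟩
  rw [this, Finset.prod_insert, Finset.prod_image (Fin.succAbove_right_injective.injOn)]
  simp [Fin.succAbove_ne]

theorem Chart.multRest_ne_zero (c : D.Chart) {K : Finset I} (hK : K ⊆ c.J) {i₀ : I} {j : Fin n}
    (hj : j ∈ c.logSet K i₀) : c.multRest i₀ j ≠ 0 := by
  obtain ⟨i, hi, hij⟩ := Chart.mem_logSet.1 hj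
  rw [multRest, ← hij, c.mult_k (hK hi)]
  exact D.b_ne_zero i

variable [Fintype I]

variable (D) in
/-- The number `a_i - κ_min b_i`. -/
def gam (a : I → ℚ) (i : I) : ℝ := (a i : ℝ) - D.kappaMin a * D.b i

variable (D) in
theorem gam_eq (a : I → ℚ) (i : I) : D.gam a i = (D.kappa a i - D.kappaMin a) * D.b i := by
  have : (D.b i : ℝ) ≠ 0 := by exact_mod_cast D.b_ne_zero i
  simp only [gam, kappa]
  push_cast
  field_simp

variable (D) in
theorem gam_nonneg (a : I → ℚ) (i : I) : 0 ≤ D.gam a i := by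
  rw [gam_eq]
  exact mul_nonneg (sub_nonneg.2 (D.kappaMin_le a i)) (Nat.cast_nonneg _)

variable (D) in
theorem gam_eq_zero_iff (a : I → ℚ) (i : I) : D.gam a i = 0 ↔ D.kappa a i = D.kappaMin a := by
  have : (D.b i : ℝ) ≠ 0 := by exact_mod_cast D.b_ne_zero i
  simp [gam_eq, this, sub_eq_zero]

open scoped Classical in
/-- The density, relative to `|τ|_ψ^{-2}`, of the rescaled measures in the coordinates of an adapted
chart which are logarithmic for the components with index in `K`. -/
def Chart.weight (c : D.Chart) (a : I → ℚ) (K : Finset I) (w : Model n) : ℝ :=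
  (∏ i ∈ K, ‖w (c.k i)‖ ^ (2 * D.gam a i)) *
    ∏ i ∈ c.J \ K, ‖w (c.k i)‖ ^ (2 * (D.gam a i - 1))

theorem Chart.weight_nonneg (c : D.Chart) (a : I → ℚ) (K : Finset I) (w : Model n) :
    0 ≤ c.weight a K w := by
  unfold weight; positivity

/-- The point of the chart with given parameters. -/
def Chart.branch (c : D.Chart) (i₀ : I) (S : Finset (Fin n)) (q : ℂ) (u : Fin n → ℂ) : Model n :=
  monoParam (c.k i₀) (D.b i₀) (c.multRest i₀) S 0 q u

/-- The domain of the parameters of a branch of a fibre in a chart. -/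
def Chart.branchDom (c : D.Chart) (i₀ : I) (S : Finset (Fin n)) (q : ℂ) : Set (Fin n → ℂ) :=
  {u | (∀ j, u j ∈ paramDom (c.multRest i₀) S 0 j) ∧ c.branch i₀ S q u ∈ c.z.target}

theorem Chart.eqn_branch (c : D.Chart) {i₀ : I} (hi₀ : i₀ ∈ c.J) {S : Finset (Fin n)}
    {q : ℂ} {u : Fin n → ℂ} (hu : ∀ j, u j ∈ paramDom (c.multRest i₀) S 0 j) :
    ∏ i ∈ c.J, c.branch i₀ S q u (c.k i) ^ D.b i = Complex.exp q := by
  rw [c.prod_pow_eq, Fin.prod_univ_succAbove _ (c.k i₀), c.mult_k hi₀,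
    ← monomial_monoParam (c.k i₀) (c.multRest i₀) S 0 (D.b_ne_zero i₀) q hu]
  rfl

theorem Chart.proj_branch (c : MonomialChart D) {i₀ : I} (hi₀ : i₀ ∈ c.1.J) {S : Finset (Fin n)}
    {q : ℂ} {u : Fin n → ℂ} (hu : u ∈ c.1.branchDom i₀ S q) :
    D.proj (c.1.z.symm (c.1.branch i₀ S q u)) = Complex.exp q := by
  rw [c.2 _ (c.1.z.map_target hu.2), Chart.eqn, c.1.z.right_inv hu.2, c.1.eqn_branch hi₀ hu.1]

variable {L : X → Type*} [TopologicalSpace (TotalSpace ℂ L)] [∀ x, AddCommGroup (L x)]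
  [∀ x, Module ℂ (L x)] [∀ x, TopologicalSpace (L x)] [FiberBundle ℂ L] [VectorBundle ℂ ℂ L]
  (ℒ : CanonicalExtension L D) (ψ : ContinuousMetric L)

variable [MeasurableSpace X] [BorelSpace X]

/-- On a branch, the density is `|t|^(2 κ_min)` times the weight times the function `genNormExt`,
which is continuous across the zero fibre. The Jacobian of the branch supplies the factor `|z_i|`
for each `i ∈ K`, and the power of `t` is distributed over the coordinates by means of `t = ∏ z_i ^
b_i`. -/
theorem density_branch {a : I → ℚ} (ha : ℒ.IsDecomposition a) (c : MonomialChart D)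
    {K : Finset I} (hK : K ⊆ c.1.J) {i₀ : I} (hi₀ : i₀ ∈ K)
    {t q : ℂ} (hq : Complex.exp q = t) {u : Fin n → ℂ}
    (hu : u ∈ c.1.branchDom i₀ (c.1.logSet K i₀) q) :
    ℒ.density ψ (branchChart c (hK hi₀) (c.1.logSet K i₀) 0 hq).1
        (c.1.z.symm (c.1.branch i₀ (c.1.logSet K i₀) q u)) =
      ‖t‖ ^ (2 * D.kappaMin a) * ((D.b i₀ : ℝ) ^ 2)⁻¹ *
        (ℒ.genNormExt ψ a c.1 (c.1.z.symm (c.1.branch i₀ (c.1.logSet K i₀) q u)) *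
        c.1.weight a K (c.1.branch i₀ (c.1.logSet K i₀) q u)) := by
  classical
  have ht : t ≠ 0 := by rw [← hq]; exact Complex.exp_ne_zero _
  have htn : ‖t‖ ≠ 0 := norm_ne_zero_iff.2 ht
  set S := c.1.logSet K i₀ with hS
  have hP : c.1.branch i₀ S q u = c.1.param i₀ S 0 t q (Fin.cons t u) :=
    (param_cons _ _ _ _ ht u).symm
  have hv : (Fin.cons t u : Model n) ∈ (branchChart c (hK hi₀) S 0 hq).1.target := by
    rw [branchChart_target]
    exact ⟨(cons_mem_monoParamDom ht u).2 hu.1, by rw [← hP]; exact hu.2⟩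
  have h1 := density_branchChart ℒ ψ c (hK hi₀) S 0 hq hv
  rw [← hP] at h1
  rw [h1]
  set P := c.1.branch i₀ S q u
  have hx : c.1.z.symm P ∈ c.1.z.source := c.1.z.map_target hu.2
  have hproj : D.proj (c.1.z.symm P) = t := by rw [Chart.proj_branch c (hK hi₀) hu, hq]
  have hg : c.1.z.symm P ∈ D.generic := by change D.proj _ ≠ 0; rwa [hproj]
  have hne : ∀ i ∈ c.1.J, 0 < ‖P (c.1.k i)‖ := fun i hi => by
    have := c.1.coord_ne_zero hx hg hi
    rw [c.1.z.right_inv hu.2] at this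
    exact norm_pos_iff.2 this
  rw [(ℒ.genNormExt_spec ψ ha c.1).2.2 _ ⟨hx, hg⟩, CanonicalExtension.genNorm, hproj,
    show c.1.z (c.1.z.symm P) = P from c.1.z.right_inv hu.2]
  -- the derivatives of the exponentials are the coordinates themselves
  have hder : ‖P (c.1.k i₀)‖ * ∏ j, ‖paramDeriv S j (u j)‖ = ∏ i ∈ K, ‖P (c.1.k i)‖ := by
    rw [c.1.prod_logSet hK hi₀ fun l => ‖P l‖, ← hS]
    congr 1
    rw [← Finset.prod_subset (Finset.subset_univ S)]
    · refine Finset.prod_congr rfl fun j hj => ?_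
      simp [P, Chart.branch, paramDeriv, paramMap, hj]
    · intro j _ hj
      simp [paramDeriv, hj]
  -- `t` is the monomial in the coordinates
  have ht2 : ‖t‖ ^ (2 * D.kappaMin a) =
      ∏ i ∈ c.1.J, ‖P (c.1.k i)‖ ^ (2 * D.kappaMin a * D.b i) := by
    rw [← hq, ← c.1.eqn_branch (hK hi₀) hu.1, norm_prod,
      ← Real.finsetProd_rpow _ _ fun i _ => norm_nonneg _]
    refine Finset.prod_congr rfl fun i hi => ?_
    rw [norm_pow, ← Real.rpow_natCast, ← Real.rpow_mul (norm_nonneg _), mul_comm]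
  -- comparison of the exponents of the coordinates, separately in `K` and in its complement
  have hprod : (∏ i ∈ K, ‖P (c.1.k i)‖) ^ 2 = ‖t‖ ^ (2 * D.kappaMin a) *
      (∏ i ∈ c.1.J, ‖P (c.1.k i)‖ ^ (2 - 2 * (a i : ℝ))) * c.1.weight a K P := by
    have hJ : ∀ h : I → ℝ, ∏ i ∈ c.1.J, h i = (∏ i ∈ K, h i) * ∏ i ∈ c.1.J \ K, h i := fun h => by
      rw [mul_comm, Finset.prod_sdiff hK]
    rw [ht2, ← Finset.prod_mul_distrib, hJ, Chart.weight]
    rw [mul_mul_mul_comm, ← Finset.prod_mul_distrib, ← Finset.prod_mul_distrib, ← Finset.prod_pow]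
    rw [Finset.prod_eq_one (s := c.1.J \ K), mul_one]
    · refine Finset.prod_congr rfl fun i hi => ?_
      rw [← Real.rpow_add (hne i (hK hi)), ← Real.rpow_add (hne i (hK hi)), ← Real.rpow_natCast]
      congr 1
      simp only [gam]; push_cast; ring
    · intro i hi
      have hi' := (Finset.mem_sdiff.1 hi).1
      rw [← Real.rpow_add (hne i hi'), ← Real.rpow_add (hne i hi')]
      convert Real.rpow_zero _ using 2
      simp only [gam]; ring
  have hcons : ‖(Fin.cons t u : Model n) 0‖ = ‖t‖ := by simp
  have hder' : ‖P (c.1.k i₀)‖ / (D.b i₀ * ‖(Fin.cons t u : Model n) 0‖) *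
      ∏ j, ‖paramDeriv S j ((Fin.cons t u : Model n) j.succ)‖ =
      (∏ i ∈ K, ‖P (c.1.k i)‖) / (D.b i₀ * ‖t‖) := by
    rw [← hder, hcons]
    simp only [Fin.cons_succ]
    ring
  rw [hder', div_pow, hprod, mul_pow]
  have hb : (D.b i₀ : ℝ) ≠ 0 := by exact_mod_cast D.b_ne_zero i₀
  clear_value P
  field_simp

/-- The integral over a fibre of a function supported in an adapted chart, in logarithmic
coordinates. -/
theorem integral_fibreMeasure_chart {a : I → ℚ} (ha : ℒ.IsDecomposition a) (c : MonomialChart D)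
    {K : Finset I} (hK : K ⊆ c.1.J) {i₀ : I} (hi₀ : i₀ ∈ K)
    {t q : ℂ} (hq : Complex.exp q = t) {g : X → ℝ} (hg : Measurable g)
    (hgi : Integrable g (ℒ.fibreMeasure ψ t)) (hg0 : ∀ x ∉ c.1.z.source, g x = 0) :
    (‖t‖ ^ (2 * D.kappaMin a))⁻¹ * ∫ x, g x ∂(ℒ.fibreMeasure ψ t) =
      ((D.b i₀ : ℝ) ^ 2)⁻¹ * ∑ k ∈ Finset.range (D.b i₀),
        ∫ u, (c.1.branchDom i₀ (c.1.logSet K i₀) (q + 2 * Real.pi * Complex.I * k)).indicator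
          (fun u => g (c.1.z.symm (c.1.branch i₀ (c.1.logSet K i₀)
              (q + 2 * Real.pi * Complex.I * k) u)) *
            (ℒ.genNormExt ψ a c.1 (c.1.z.symm (c.1.branch i₀ (c.1.logSet K i₀)
              (q + 2 * Real.pi * Complex.I * k) u)) *
            c.1.weight a K (c.1.branch i₀ (c.1.logSet K i₀)
              (q + 2 * Real.pi * Complex.I * k) u))) u := by
  have ht : t ≠ 0 := by rw [← hq]; exact Complex.exp_ne_zero _
  have htn : ‖t‖ ^ (2 * D.kappaMin a) ≠ 0 := (Real.rpow_pos_of_pos (norm_pos_iff.2 ht) _).ne'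
  set S := c.1.logSet K i₀ with hS
  have h1 : ∫ x, g x ∂(ℒ.fibreMeasure ψ t) = ∑ k : Finset.range (D.b i₀),
      ∫ x, g x ∂(ℒ.localFibreMeasure ψ t (branchChart c (hK hi₀) S 0 (exp_branch hq k))) := by
    rw [← setIntegral_eq_integral_of_forall_compl_eq_zero hg0]
    have hr := fibreMeasure_restrict_chart ℒ ψ c (hK hi₀) S
      (fun j hj => c.1.multRest_ne_zero hK hj) hq
    have hint : Integrable g ((ℒ.fibreMeasure ψ t).restrict c.1.z.source) := hgi.restrict
    rw [hr] at hint ⊢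
    rw [integral_sum_measure hint, tsum_fintype]
  rw [h1, Finset.sum_coe_sort (Finset.range (D.b i₀)) fun k =>
    ∫ x, g x ∂(ℒ.localFibreMeasure ψ t (branchChart c (hK hi₀) S 0 (exp_branch hq k))),
    Finset.mul_sum, Finset.mul_sum]
  refine Finset.sum_congr rfl fun k _ => ?_
  set q' := q + 2 * Real.pi * Complex.I * k with hq'
  have hq'' : Complex.exp q' = t := exp_branch hq k
  have hset : {y : Fin n → ℂ | (Fin.cons t y : Model n) ∈
      (branchChart c (hK hi₀) S 0 hq'').1.target} = c.1.branchDom i₀ S q' := by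
    ext u
    rw [branchChart_target]
    change (_ ∧ _) ↔ (_ ∧ _)
    rw [cons_mem_monoParamDom ht, param_cons _ _ _ _ ht]
    rfl
  have hmeas : MeasurableSet (c.1.branchDom i₀ S q') := by
    rw [← hset]; exact (CanonicalExtension.isOpen_sliceTarget _ t).measurableSet
  rw [ℒ.integral_localFibreMeasure ψ ht _ hg, hset, integral_indicator hmeas,
    ← integral_const_mul, ← integral_const_mul]
  refine setIntegral_congr_fun hmeas fun u hu => ?_
  change _ * (_ * g _) = _
  have hsymm : (branchChart c (hK hi₀) S 0 hq'').1.symm (Fin.cons t u) =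
      c.1.z.symm (c.1.branch i₀ S q' u) := by
    rw [branchChart_symm, param_cons _ _ _ _ ht]
    rfl
  rw [hsymm, density_branch ℒ ψ ha c hK hi₀ hq'' hu]
  change _ = _ * (g (c.1.z.symm (c.1.branch i₀ S q' u)) *
    (ℒ.genNormExt ψ a c.1 (c.1.z.symm (c.1.branch i₀ S q' u)) *
      c.1.weight a K (c.1.branch i₀ S q' u)))
  rw [← hS]
  field_simp

end SncDegeneration
end Weights

/-! ### Rescaling of the logarithms -/

section LogScale

variable {n : ℕ}

/-- The change of the logarithmic parameters, with index in `S`: their real parts are multiplied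
by `-T`. -/
def logScale (S : Finset (Fin n)) (T : ℝ) (v : Fin n → ℂ) : Fin n → ℂ := fun j =>
  if j ∈ S then ⟨-T * (v j).re, (v j).im⟩ else v j

theorem continuous_logScale (S : Finset (Fin n)) (T : ℝ) : Continuous (logScale S T) := by
  refine continuous_pi fun j => ?_
  by_cases hj : j ∈ S
  · simp only [logScale, hj, if_true]
    have : ∀ v : Fin n → ℂ, (⟨-T * (v j).re, (v j).im⟩ : ℂ) =
        ((-T * (v j).re : ℝ) : ℂ) + ((v j).im : ℝ) * Complex.I := fun v => by
      apply Complex.ext <;> simp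
    simp only [this]
    fun_prop
  · simp only [logScale, hj, if_false]
    fun_prop

theorem logScale_logScale_inv (S : Finset (Fin n)) {T : ℝ} (hT : T ≠ 0) (v : Fin n → ℂ) :
    logScale S T (logScale S T⁻¹ v) = v := by
  funext j
  by_cases hj : j ∈ S
  · apply Complex.ext <;> simp [logScale, hj, hT]
  · simp [logScale, hj]

/-- `logScale` as a homeomorphism. -/
def logScaleHomeomorph (S : Finset (Fin n)) {T : ℝ} (hT : T ≠ 0) : (Fin n → ℂ) ≃ₜ (Fin n → ℂ) where
  toFun := logScale S T
  invFun := logScale S T⁻¹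
  left_inv v := by
    have := logScale_logScale_inv S (inv_ne_zero hT) v
    rwa [inv_inv] at this
  right_inv := logScale_logScale_inv S hT
  continuous_toFun := continuous_logScale S T
  continuous_invFun := continuous_logScale S T⁻¹

/-- The rescaling of the real parts of the coordinates in `S` by `-T` multiplies Lebesgue measure by
`T ^ (-|S|)`. -/
theorem map_logScale (S : Finset (Fin n)) {T : ℝ} (hT : 0 < T) :
    (volume : Measure (Fin n → ℂ)).map (logScale S T) =
      ENNReal.ofReal ((T ^ S.card)⁻¹) • volume := by
  -- the rescaling acts on the factors in `S` by a real diagonal matrix of determinant `-T`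
  let ℓ : Fin n → ℂ →ₗ[ℝ] ℂ := fun j =>
    if j ∈ S then Matrix.toLin Complex.basisOneI Complex.basisOneI !![-T, 0; 0, 1] else LinearMap.id
  have hℓ : ∀ j, |LinearMap.det (ℓ j)| = if j ∈ S then T else 1 := by
    intro j
    by_cases hj : j ∈ S
    · simp [ℓ, hj, LinearMap.det_toLin, Matrix.det_fin_two, abs_of_pos hT]
    · simp [ℓ, hj]
  let F : (Fin n → ℂ) →ₗ[ℝ] (Fin n → ℂ) := LinearMap.pi fun j => (ℓ j).comp (LinearMap.proj j)
  have hF : (F : (Fin n → ℂ) → (Fin n → ℂ)) = logScale S T := by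
    funext v j
    by_cases hj : j ∈ S
    · simp only [F, LinearMap.pi_apply, LinearMap.comp_apply, LinearMap.proj_apply, ℓ, hj, if_true,
        logScale]
      have hv : Matrix.toLin Complex.basisOneI Complex.basisOneI !![-T, 0; 0, 1] (v j) =
          (-T * (v j).re : ℝ) • (1 : ℂ) + ((v j).im : ℝ) • Complex.I := by
        rw [Matrix.toLin_apply]
        simp [Matrix.mulVec, dotProduct]
      rw [hv]
      apply Complex.ext <;> simp
    · simp [F, ℓ, hj, logScale]
  have hdet : |LinearMap.det F| = T ^ S.card := by
    rw [LinearMap.det_pi, Finset.abs_prod]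
    simp [hℓ, Finset.prod_ite_mem]
  have hne : LinearMap.det F ≠ 0 := by
    rw [← abs_pos, hdet]; positivity
  rw [← hF, Measure.map_linearMap_addHaar_eq_smul_addHaar volume hne, abs_inv, hdet]

theorem integral_comp_logScale (S : Finset (Fin n)) {T : ℝ} (hT : 0 < T) (H : (Fin n → ℂ) → ℝ) :
    ∫ v, H (logScale S T v) = (T ^ S.card)⁻¹ * ∫ u, H u := by
  have h := (logScaleHomeomorph S hT.ne').measurableEmbedding.integral_map (μ := volume) H
  change ∫ y, H y ∂(Measure.map (logScale S T) volume) = ∫ v, H (logScale S T v) at h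
  rw [← h, map_logScale S hT, integral_smul_measure,
    ENNReal.toReal_ofReal (by positivity), smul_eq_mul]

theorem aestronglyMeasurable_comp_logScale (S : Finset (Fin n)) {T : ℝ} (hT : 0 < T)
    {H : (Fin n → ℂ) → ℝ} (hH : AEStronglyMeasurable H volume) :
    AEStronglyMeasurable (fun v => H (logScale S T v)) volume := by
  refine AEStronglyMeasurable.comp_measurable ?_ (continuous_logScale S T).measurable
  rw [map_logScale S hT]
  exact hH.mono_ac Measure.smul_absolutelyContinuous

end LogScale

section Branch

open Complex (slitPlane)

variable {n : ℕ} {X : Type u} [TopologicalSpace X] [ChartedSpace (Model n) X]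
  [IsManifold 𝓘(ℂ, Model n) ω X] {I : Type v} {D : SncDegeneration n X I}
  [MeasurableSpace X] [BorelSpace X]

namespace SncDegeneration

variable (c : D.Chart) {i₀ : I} {S : Finset (Fin n)} {q : ℂ} {T : ℝ}

theorem logScale_mem_paramDom {β : Fin n → ℕ} {v : Fin n → ℂ} (j : Fin n) :
    logScale S T v j ∈ paramDom β S 0 j ↔ v j ∈ paramDom β S 0 j := by
  unfold paramDom
  by_cases hj : j ∈ S
  · simp [hj, logScale]
  · simp [hj, logScale]

theorem norm_branch_of_mem (v : Fin n → ℂ) {j : Fin n} (hj : j ∈ S) :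
    ‖c.branch i₀ S q (logScale S T v) ((c.k i₀).succAbove j)‖ = Real.exp (-T * (v j).re) := by
  simp [Chart.branch, paramMap, hj, logScale, Complex.norm_exp]

theorem branch_of_notMem (v : Fin n → ℂ) {j : Fin n} (hj : j ∉ S) :
    c.branch i₀ S q (logScale S T v) ((c.k i₀).succAbove j) = v j := by
  simp [Chart.branch, paramMap, hj, logScale]

/-- The logarithm of the dependent coordinate `k i₀` on a branch, in rescaled coordinates. The
scaled part is `-T` times the remaining barycentric weight. -/
theorem log_norm_branch_same (hq : q.re = -T) {v : Fin n → ℂ} :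
    Real.log ‖c.branch i₀ S q (logScale S T v) (c.k i₀)‖ =
      (-T * (1 - ∑ j ∈ S, (c.multRest i₀ j : ℝ) * (v j).re) -
        ∑ j ∈ Sᶜ, (c.multRest i₀ j : ℝ) * Real.log ‖v j‖) / D.b i₀ := by
  have hb : (D.b i₀ : ℝ) ≠ 0 := by exact_mod_cast D.b_ne_zero i₀
  rw [Chart.branch, monoParam_same, Complex.norm_exp, Real.log_exp]
  have h1 : ∀ w : ℂ, (w / (D.b i₀ : ℂ)).re = w.re / D.b i₀ := fun w => by
    rw [← Complex.ofReal_natCast, Complex.div_ofReal_re]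
  rw [h1, Complex.sub_re, Complex.re_sum, hq, ← Finset.sum_add_sum_compl S]
  have hS : ∑ j ∈ S, ((c.multRest i₀ j : ℂ) * paramLog (c.multRest i₀) S 0 j (logScale S T v j)).re =
      -T * ∑ j ∈ S, (c.multRest i₀ j : ℝ) * (v j).re := by
    rw [Finset.mul_sum]
    refine Finset.sum_congr rfl fun j hj => ?_
    simp [paramLog, hj, logScale]
    ring
  have hSc : ∑ j ∈ Sᶜ, ((c.multRest i₀ j : ℂ) * paramLog (c.multRest i₀) S 0 j
      (logScale S T v j)).re = ∑ j ∈ Sᶜ, (c.multRest i₀ j : ℝ) * Real.log ‖v j‖ := by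
    refine Finset.sum_congr rfl fun j hj => ?_
    have hj' : j ∉ S := by simpa using hj
    by_cases h0 : c.multRest i₀ j = 0
    · simp [h0]
    · simp [paramLog, hj', logScale, h0, Complex.log_re]
  rw [hS, hSc]
  congr 1
  ring

theorem branch_same_ne_zero (u : Fin n → ℂ) : c.branch i₀ S q u (c.k i₀) ≠ 0 := by
  rw [Chart.branch, monoParam_same]
  exact Complex.exp_ne_zero _

theorem isOpen_setOf_mem_paramDom (β : Fin n → ℕ) (S : Finset (Fin n)) (φ : Fin n → ℝ) :
    IsOpen {u : Fin n → ℂ | ∀ j, u j ∈ paramDom β S φ j} := by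
  have : {u : Fin n → ℂ | ∀ j, u j ∈ paramDom β S φ j} =
      ⋂ j : Fin n, {u : Fin n → ℂ | u j ∈ paramDom β S φ j} := by ext u; simp
  rw [this]
  exact isOpen_iInter_of_finite fun j =>
    (isOpen_paramDom β S φ j).preimage (continuous_apply _)

theorem continuousOn_branch (i₀ : I) (S : Finset (Fin n)) (q : ℂ) :
    ContinuousOn (c.branch i₀ S q) {u | ∀ j, u j ∈ paramDom (c.multRest i₀) S 0 j} := by
  have ht : Complex.exp q ≠ 0 := Complex.exp_ne_zero _
  have h : c.branch i₀ S q = fun u => monoParamFull (c.k i₀) (b₀ := D.b i₀) (c.multRest i₀) S 0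
      (Complex.exp q) q (CanonicalExtension.slice (Complex.exp q) u) := by
    funext u
    exact (param_cons c i₀ S 0 ht u).symm
  rw [h]
  exact (contDiffOn_monoParamFull (c.k i₀) (b₀ := D.b i₀) (c.multRest i₀) S 0
    (t := Complex.exp q) (q := q)).continuousOn.comp
    (CanonicalExtension.continuous_slice _).continuousOn
    fun u hu => (cons_mem_monoParamDom ht u).2 hu

theorem isOpen_branchDom (i₀ : I) (S : Finset (Fin n)) (q : ℂ) : IsOpen (c.branchDom i₀ S q) :=
  (continuousOn_branch c i₀ S q).isOpen_inter_preimage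
    (isOpen_setOf_mem_paramDom _ S 0) c.z.open_target

/-- The limit of the branches of the fibres with given rescaled parameters. -/
def Chart.limPoint (i₀ : I) (S : Finset (Fin n)) (v : Fin n → ℂ) : Model n :=
  (c.k i₀).insertNth (α := fun _ => ℂ) 0 fun j => if j ∈ S then 0 else v j

open scoped Classical in
/-- The limit in `ℝ^I` of the logarithms of the coordinates of the branches of the fibres with given
rescaled parameters. -/
def Chart.limLog (K : Finset I) (i₀ : I) (S : Finset (Fin n)) (v : Fin n → ℂ) : I → ℝ := fun i =>
  if i ∈ K then (c.k i₀).insertNth (α := fun _ => ℝ)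
    ((1 - ∑ j ∈ S, (c.multRest i₀ j : ℝ) * (v j).re) / D.b i₀) (fun j => (v j).re) (c.k i) else 0

theorem limPoint_k {K : Finset I} (i₀ : I) {i : I} (hi : i ∈ K) (v : Fin n → ℂ) :
    c.limPoint i₀ (c.logSet K i₀) v (c.k i) = 0 := by
  rcases Fin.eq_self_or_eq_succAbove (c.k i₀) (c.k i) with h | ⟨j, hj⟩
  · rw [h]; simp [Chart.limPoint]
  · rw [hj]
    have : j ∈ c.logSet K i₀ := Chart.mem_logSet.2 ⟨i, hi, hj⟩
    simp [Chart.limPoint, this]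

/-- In the limit, the logarithmic coordinates with nonnegative real parts of total weight at most
one are the coordinates of a point of the simplex. -/
theorem limLog_mem_simplex {K : Finset I} (hK : K ⊆ c.J) {i₀ : I} (hi₀ : i₀ ∈ K) {v : Fin n → ℂ}
    (h0 : ∀ j ∈ c.logSet K i₀, 0 ≤ (v j).re)
    (h1 : ∑ j ∈ c.logSet K i₀, (c.multRest i₀ j : ℝ) * (v j).re ≤ 1) :
    c.limLog K i₀ (c.logSet K i₀) v ∈ D.simplex K := by
  classical
  have hb : (0 : ℝ) < D.b i₀ := by exact_mod_cast D.b_pos i₀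
  refine ⟨fun i => ?_, fun i hi => by simp [Chart.limLog, hi], ?_⟩
  · by_cases hi : i ∈ K
    · simp only [Chart.limLog, hi, if_true]
      rcases Fin.eq_self_or_eq_succAbove (c.k i₀) (c.k i) with h | ⟨j, hj⟩
      · rw [h, Fin.insertNth_apply_same]
        exact div_nonneg (sub_nonneg.2 h1) hb.le
      · rw [hj, Fin.insertNth_apply_succAbove]
        exact h0 j (Chart.mem_logSet.2 ⟨i, hi, hj⟩)
    · simp [Chart.limLog, hi]
  · let W : Fin (n + 1) → ℝ := (c.k i₀).insertNth (α := fun _ => ℝ)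
      ((1 - ∑ j ∈ c.logSet K i₀, (c.multRest i₀ j : ℝ) * (v j).re) / D.b i₀) (fun j => (v j).re)
    have h2 : ∀ i ∈ K, (D.b i : ℝ) * c.limLog K i₀ (c.logSet K i₀) v i =
        (fun l => (c.mult l : ℝ) * W l) (c.k i) := by
      intro i hi
      simp only [Chart.limLog, hi, if_true, c.mult_k (hK hi), W]
    rw [Finset.sum_congr rfl h2]
    have h3 := c.prod_logSet hK hi₀ (M := Multiplicative ℝ)
      fun l => Multiplicative.ofAdd ((c.mult l : ℝ) * W l)
    have h4 : ∑ i ∈ K, (fun l => (c.mult l : ℝ) * W l) (c.k i) = (c.mult (c.k i₀) : ℝ) * W (c.k i₀) +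
        ∑ j ∈ c.logSet K i₀, (c.mult ((c.k i₀).succAbove j) : ℝ) * W ((c.k i₀).succAbove j) := by
      have := congrArg Multiplicative.toAdd h3
      simpa [toAdd_prod] using this
    rw [h4, c.mult_k (hK hi₀)]
    simp only [W, Fin.insertNth_apply_same, Fin.insertNth_apply_succAbove]
    rw [mul_div_cancel₀ _ hb.ne']
    simp only [Chart.multRest]
    ring

end SncDegeneration
end Branch

/-! ### Adapted polydiscs and majorants -/

section LocalLimit

open Complex (slitPlane)

variable {n : ℕ} {X : Type u} [TopologicalSpace X] [ChartedSpace (Model n) X]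
  [IsManifold 𝓘(ℂ, Model n) ω X] {I : Type v} {D : SncDegeneration n X I} [Fintype I]
  [MeasurableSpace X] [BorelSpace X]

/-- The power `|y| ^ α` is integrable on bounded subsets of the plane if `α > -2`. -/
theorem integrableOn_norm_rpow {α : ℝ} (hα : -2 < α) (p : ℂ) (r : ℝ) :
    IntegrableOn (fun y : ℂ => ‖y‖ ^ α) (Metric.closedBall p r) := by
  rcases lt_or_ge r 0 with hr | hr
  · simp [Metric.closedBall_eq_empty.2 hr]
  have hsub : Metric.closedBall p r ⊆ Metric.ball 0 (‖p‖ + r + 1) := by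
    intro y hy
    rw [mem_ball_zero_iff]
    have h1 : ‖y - p‖ ≤ r := by rwa [← dist_eq_norm]
    have h2 := norm_le_norm_add_norm_sub p y
    rw [norm_sub_rev] at h2
    linarith
  refine IntegrableOn.mono_set ?_ hsub
  have hpos : 0 < ‖p‖ + r + 1 := by positivity
  rw [integrableOn_fun_norm_addHaar volume (f := fun x => x ^ α), Complex.finrank_real_complex]
  refine ((intervalIntegral.integrableOn_Ioo_rpow_iff (s := α + 1) hpos).2 (by linarith)).congr_fun
    (fun x hx => ?_) measurableSet_Ioo
  change x ^ (α + 1) = x ^ (2 - 1) * x ^ α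
  rw [Real.rpow_add hx.1]
  simp [mul_comm]

namespace SncDegeneration

/-- The polydisc of radius `r` about `p`, inside the domain of an adapted chart, is adapted to the
set `K` of components: these contain the centre, and the other components of the chart which meet
the polydisc do not achieve the minimum `κ_min`. -/
structure IsBox (c : D.Chart) (a : I → ℚ) (K : Finset I) (i₀ : I) (p : Model n) (r : ℝ) : Prop where
  subset : K ⊆ c.J
  mem : i₀ ∈ K
  pos : 0 < r
  le_one : r ≤ 1
  closedBall_subset : Metric.closedBall p r ⊆ c.z.target
  zero : ∀ i ∈ K, p (c.k i) = 0
  rest : ∀ i ∈ c.J, i ∉ K → 0 < D.gam a i ∨ r < ‖p (c.k i)‖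

variable {c : D.Chart} {a : I → ℚ} {K : Finset I} {i₀ : I} {p : Model n} {r : ℝ}

theorem norm_apply_le {w p : Model n} {r : ℝ} (hw : w ∈ Metric.closedBall p r)
    (l : Fin (n + 1)) : ‖w l‖ ≤ ‖p l‖ + r := by
  have h1 : ‖w l - p l‖ ≤ r := by
    rw [← dist_eq_norm]
    exact (dist_le_pi_dist w p l).trans hw
  have h2 := norm_le_norm_add_norm_sub (p l) (w l)
  rw [norm_sub_rev] at h2
  linarith

theorem IsBox.norm_le_one (hB : IsBox c a K i₀ p r) {w : Model n}
    (hw : w ∈ Metric.closedBall p r) {i : I} (hi : i ∈ K) : ‖w (c.k i)‖ ≤ 1 := by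
  have := norm_apply_le hw (c.k i)
  rw [hB.zero i hi, norm_zero, zero_add] at this
  exact this.trans hB.le_one

open scoped Classical in
/-- A product over the components of the chart outside `K`, grouped by the parameter which is the
equation of the component; each group has at most one element. -/
theorem Chart.prod_sdiff_eq (c : D.Chart) {K : Finset I} (hK : K ⊆ c.J) {i₀ : I} (hi₀ : i₀ ∈ K)
    (h : I → ℝ) : ∏ i ∈ c.J \ K, h i =
      ∏ j : Fin n, ∏ i ∈ (c.J \ K).filter fun i => c.k i = (c.k i₀).succAbove j, h i := by
  rw [← Finset.prod_fiberwise_of_maps_to (g := c.k) (t := Finset.univ) fun _ _ => Finset.mem_univ _,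
    Fin.prod_univ_succAbove _ (c.k i₀), Finset.filter_eq_empty_iff.2, Finset.prod_empty, one_mul]
  intro i hi hik
  obtain ⟨hiJ, hiK⟩ := Finset.mem_sdiff.1 hi
  have := c.isSnc.injOn (by exact_mod_cast hiJ) (by exact_mod_cast hK hi₀) hik
  exact hiK (this ▸ hi₀)

open scoped Classical in
/-- An integrable function of one parameter, the product of which over the parameters dominates the
rescaled densities. -/
def majorant (c : D.Chart) (a : I → ℚ) (K : Finset I) (i₀ : I) (p : Model n) (r C : ℝ) (j : Fin n)
    (y : ℂ) : ℝ :=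
  (if j ∈ c.logSet K i₀ then Icc 0 C ×ℂ Icc (-Real.pi) Real.pi
    else Metric.closedBall (p ((c.k i₀).succAbove j)) r).indicator
    (fun y => ∏ i ∈ (c.J \ K).filter fun i => c.k i = (c.k i₀).succAbove j,
      ‖y‖ ^ (2 * (D.gam a i - 1))) y

open scoped Classical in
theorem IsBox.filter_eq_empty (hB : IsBox c a K i₀ p r) {j : Fin n} (hj : j ∈ c.logSet K i₀) :
    (c.J \ K).filter (fun i => c.k i = (c.k i₀).succAbove j) = ∅ := by
  refine Finset.filter_eq_empty_iff.2 fun i hi hik => ?_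
  obtain ⟨i', hi', hij⟩ := Chart.mem_logSet.1 hj
  obtain ⟨hiJ, hiK⟩ := Finset.mem_sdiff.1 hi
  have := c.isSnc.injOn (by exact_mod_cast hiJ) (by exact_mod_cast hB.subset hi')
    (hik.trans hij.symm)
  exact hiK (this ▸ hi')

/-- The factors of the majorant are integrable: a logarithmic parameter is bounded, and for another
parameter the exponent is greater than `-2` or the polydisc avoids zero. -/
theorem IsBox.integrable_majorant (hB : IsBox c a K i₀ p r) (C : ℝ) (j : Fin n) :
    Integrable (majorant c a K i₀ p r C j) := by
  classical
  unfold majorant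
  by_cases hj : j ∈ c.logSet K i₀
  · simp only [hj, if_true]
    rw [hB.filter_eq_empty hj]
    have hc : IsCompact (Icc 0 C ×ℂ Icc (-Real.pi) Real.pi) := isCompact_Icc.reProdIm isCompact_Icc
    rw [integrable_indicator_iff hc.measurableSet]
    exact (continuousOn_const (c := (1 : ℝ))).integrableOn_compact hc |>.congr_fun (by intro; simp)
      hc.measurableSet
  · simp only [hj, if_false]
    rw [integrable_indicator_iff measurableSet_closedBall]
    rcases Finset.eq_empty_or_nonempty
      ((c.J \ K).filter fun i => c.k i = (c.k i₀).succAbove j) with he | ⟨i, hi⟩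
    · rw [he]
      exact (continuousOn_const (c := (1 : ℝ))).integrableOn_compact (isCompact_closedBall _ _)
        |>.congr_fun (by intro; simp) measurableSet_closedBall
    · obtain ⟨hi', hik⟩ := Finset.mem_filter.1 hi
      obtain ⟨hiJ, hiK⟩ := Finset.mem_sdiff.1 hi'
      have hs : (c.J \ K).filter (fun i => c.k i = (c.k i₀).succAbove j) = {i} := by
        refine Finset.eq_singleton_iff_unique_mem.2 ⟨hi, fun i' hi' => ?_⟩
        obtain ⟨h1, h2⟩ := Finset.mem_filter.1 hi'
        exact c.isSnc.injOn (by exact_mod_cast (Finset.mem_sdiff.1 h1).1) (by exact_mod_cast hiJ)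
          (h2.trans hik.symm)
      simp only [hs, Finset.prod_singleton]
      rcases hB.rest i hiJ hiK with hg | hr
      · exact integrableOn_norm_rpow (by linarith) _ _
      · refine ContinuousOn.integrableOn_compact (isCompact_closedBall _ _) fun y hy => ?_
        refine (ContinuousAt.rpow_const continuous_norm.continuousAt (Or.inl ?_)).continuousWithinAt
        rw [hik] at hr
        rw [norm_ne_zero_iff]
        rintro rfl
        have : ‖p ((c.k i₀).succAbove j)‖ ≤ r := by simpa [dist_eq_norm] using hy
        linarith

theorem majorant_nonneg (C : ℝ) (j : Fin n) (y : ℂ) : 0 ≤ majorant c a K i₀ p r C j y :=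
  indicator_nonneg (fun _ _ => Finset.prod_nonneg fun _ _ => by positivity) y

/-- In the polydisc, the rescaled logarithms of the coordinates are bounded. -/
theorem IsBox.re_mem_Icc (hB : IsBox c a K i₀ p r) {q : ℂ} {T : ℝ} (hT : 1 ≤ T) (hq : q.re = -T)
    {v : Fin n → ℂ} (hv : c.branch i₀ (c.logSet K i₀) q (logScale (c.logSet K i₀) T v) ∈
      Metric.closedBall p r) {j : Fin n} (hj : j ∈ c.logSet K i₀) :
    (v j).re ∈ Icc 0 (1 + ∑ l ∈ (c.logSet K i₀)ᶜ,
      (c.multRest i₀ l : ℝ) * (‖p ((c.k i₀).succAbove l)‖ + 1)) := by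
  set S := c.logSet K i₀
  have hT0 : 0 < T := by linarith
  have h0 : ∀ j ∈ S, 0 ≤ (v j).re := by
    intro j hj
    obtain ⟨i, hi, hij⟩ := Chart.mem_logSet.1 hj
    have h := hB.norm_le_one hv hi
    rw [hij, norm_branch_of_mem c v hj, Real.exp_le_one_iff] at h
    by_contra hneg
    push Not at hneg
    have := mul_pos_of_neg_of_neg (neg_neg_of_pos hT0) hneg
    linarith
  refine ⟨h0 j hj, ?_⟩
  have hβ : (1 : ℝ) ≤ c.multRest i₀ j := by
    exact_mod_cast Nat.one_le_iff_ne_zero.2 (c.multRest_ne_zero hB.subset hj)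
  have hle : (v j).re ≤ ∑ j ∈ S, (c.multRest i₀ j : ℝ) * (v j).re := by
    refine le_trans ?_ (Finset.single_le_sum (f := fun j => (c.multRest i₀ j : ℝ) * (v j).re)
      (fun l hl => mul_nonneg (Nat.cast_nonneg _) (h0 l hl)) hj)
    exact le_mul_of_one_le_left (h0 j hj) hβ
  refine hle.trans ?_
  -- the upper bound comes from the inequality `|z_{i₀}| ≤ 1` for the dependent coordinate
  have hl := Real.log_nonpos (norm_nonneg _) (hB.norm_le_one hv hB.mem)
  rw [log_norm_branch_same c hq] at hl
  have hb : (0 : ℝ) < D.b i₀ := by exact_mod_cast D.b_pos i₀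
  rw [div_le_iff₀ hb, zero_mul] at hl
  have hlog : ∑ l ∈ Sᶜ, (c.multRest i₀ l : ℝ) * Real.log ‖v l‖ ≤
      ∑ l ∈ Sᶜ, (c.multRest i₀ l : ℝ) * (‖p ((c.k i₀).succAbove l)‖ + 1) := by
    refine Finset.sum_le_sum fun l hl => mul_le_mul_of_nonneg_left ?_ (Nat.cast_nonneg _)
    have h1 := norm_apply_le hv ((c.k i₀).succAbove l)
    rw [branch_of_notMem c v (by simpa using hl)] at h1
    refine (Real.log_le_self (norm_nonneg _)).trans (h1.trans ?_)
    linarith [hB.le_one]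
  set σ := ∑ j ∈ S, (c.multRest i₀ j : ℝ) * (v j).re
  have hC0 : 0 ≤ ∑ l ∈ Sᶜ, (c.multRest i₀ l : ℝ) * (‖p ((c.k i₀).succAbove l)‖ + 1) :=
    Finset.sum_nonneg fun l _ => by positivity
  set C := ∑ l ∈ Sᶜ, (c.multRest i₀ l : ℝ) * (‖p ((c.k i₀).succAbove l)‖ + 1)
  by_contra hcon
  push Not at hcon
  nlinarith

/-- In an adapted polydisc, the weight is bounded by the product of the majorants, uniformly in the
fibre: the factors of index in `K` are at most one, and the other factors depend each on one
parameter which is not rescaled. -/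
theorem IsBox.weight_le_majorant (hB : IsBox c a K i₀ p r) {q : ℂ} {T : ℝ} (hT : 1 ≤ T)
    (hq : q.re = -T) {v : Fin n → ℂ} (hvd : ∀ j, v j ∈ paramDom (c.multRest i₀) (c.logSet K i₀) 0 j)
    (hv : c.branch i₀ (c.logSet K i₀) q (logScale (c.logSet K i₀) T v) ∈
      Metric.closedBall p r) :
    c.weight a K (c.branch i₀ (c.logSet K i₀) q (logScale (c.logSet K i₀) T v)) ≤
      ∏ j, majorant c a K i₀ p r (1 + ∑ l ∈ (c.logSet K i₀)ᶜ,
        (c.multRest i₀ l : ℝ) * (‖p ((c.k i₀).succAbove l)‖ + 1)) j (v j) := by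
  classical
  rw [Chart.weight, c.prod_sdiff_eq hB.subset hB.mem]
  have h1 : ∏ i ∈ K, ‖c.branch i₀ (c.logSet K i₀) q (logScale (c.logSet K i₀) T v) (c.k i)‖ ^
      (2 * D.gam a i) ≤ 1 :=
    Finset.prod_le_one (fun i _ => by positivity) fun i hi =>
      Real.rpow_le_one (norm_nonneg _) (hB.norm_le_one hv hi)
        (mul_nonneg zero_le_two (D.gam_nonneg a i))
  refine (mul_le_of_le_one_left (Finset.prod_nonneg fun _ _ => Finset.prod_nonneg fun _ _ => by
    positivity) h1).trans (le_of_eq ?_)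
  refine Finset.prod_congr rfl fun j _ => ?_
  unfold majorant
  by_cases hj : j ∈ c.logSet K i₀
  · rw [hB.filter_eq_empty hj, if_pos hj, indicator_of_mem]
    · simp
    · refine ⟨hB.re_mem_Icc hT hq hv hj, ?_⟩
      have := hvd j
      simp only [paramDom, hj, if_true, mem_ofPred_eq, Pi.zero_apply, sub_zero, abs_lt] at this
      exact ⟨this.1.le, this.2.le⟩
  · rw [if_neg hj, indicator_of_mem]
    · refine Finset.prod_congr rfl fun i hi => ?_
      rw [(Finset.mem_filter.1 hi).2, branch_of_notMem c v hj]
    · have h2 := (dist_le_pi_dist _ _ ((c.k i₀).succAbove j)).trans hv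
      rwa [branch_of_notMem c v hj] at h2

end SncDegeneration
end LocalLimit

/-! ### The local limit -/

section LocalLimit

open Complex (slitPlane)

variable {n : ℕ} {X : Type u} [TopologicalSpace X] [ChartedSpace (Model n) X]
  [IsManifold 𝓘(ℂ, Model n) ω X] {I : Type v} {D : SncDegeneration n X I} [Fintype I]
  [MeasurableSpace X] [BorelSpace X]

open CanonicalExtension (MonomialChart FibreChart)

theorem tendsto_neg_log_norm :
    Tendsto (fun t : ℂ => -Real.log ‖t‖) (𝓝[≠] 0) atTop :=
  tendsto_neg_atBot_atTop.comp (Real.tendsto_log_nhdsGT_zero.comp tendsto_norm_nhdsNE_zero)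

theorem tendsto_log_norm_mul_of_pos {s : ℝ} (hs : 0 < s) :
    Tendsto (fun t : ℂ => -(-Real.log ‖t‖) * s) (𝓝[≠] 0) atBot := by
  simp only [neg_mul (-Real.log _)]
  exact tendsto_neg_atTop_atBot.comp (tendsto_neg_log_norm.atTop_mul_const hs)

theorem tendsto_log_norm_mul_of_neg {s : ℝ} (hs : s < 0) :
    Tendsto (fun t : ℂ => -(-Real.log ‖t‖) * s) (𝓝[≠] 0) atTop := by
  refine (tendsto_neg_log_norm.atTop_mul_const (neg_pos.2 hs)).congr fun t => ?_
  ring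

theorem re_branch (t : ℂ) (k : ℕ) :
    (Complex.log t + 2 * Real.pi * Complex.I * k).re = -(-Real.log ‖t‖) := by
  simp [Complex.log_re]

namespace SncDegeneration

section
variable (c : D.Chart) (K : Finset I) (i₀ : I)

/-- The point with rescaled parameters `v` on the `k`-th branch of the fibre over `t`. -/
def Chart.branchAt (k : ℕ) (t : ℂ) (v : Fin n → ℂ) : Model n :=
  c.branch i₀ (c.logSet K i₀) (Complex.log t + 2 * Real.pi * Complex.I * k)
    (logScale (c.logSet K i₀) (-Real.log ‖t‖) v)

variable {c K i₀}

theorem log_branchAt_same (k : ℕ) (t : ℂ) (v : Fin n → ℂ) :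
    Real.log ‖c.branchAt K i₀ k t v (c.k i₀)‖ =
      (-(-Real.log ‖t‖) * (1 - ∑ j ∈ c.logSet K i₀, (c.multRest i₀ j : ℝ) * (v j).re) -
        ∑ j ∈ (c.logSet K i₀)ᶜ, (c.multRest i₀ j : ℝ) * Real.log ‖v j‖) / D.b i₀ :=
  log_norm_branch_same c (re_branch t k)

theorem tendsto_log_branchAt {v : Fin n → ℂ}
    (h1 : ∑ j ∈ c.logSet K i₀, (c.multRest i₀ j : ℝ) * (v j).re < 1) (k : ℕ) :
    Tendsto (fun t => Real.log ‖c.branchAt K i₀ k t v (c.k i₀)‖) (𝓝[≠] 0) atBot := by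
  have hb : (0 : ℝ) < D.b i₀ := by exact_mod_cast D.b_pos i₀
  simp only [log_branchAt_same]
  refine Tendsto.atBot_div_const hb (tendsto_atBot_add_const_right _ _ ?_)
  exact tendsto_log_norm_mul_of_pos (sub_pos.2 h1)

theorem branchAt_ne_zero (k : ℕ) (t : ℂ) (v : Fin n → ℂ) :
    c.branchAt K i₀ k t v (c.k i₀) ≠ 0 := branch_same_ne_zero c _

/-- As `t → 0`, the rescaled coordinates being fixed in the interior of the simplex, the coordinates
of index in `K` tend to zero. -/
theorem tendsto_branchAt {v : Fin n → ℂ} (h0 : ∀ j ∈ c.logSet K i₀, 0 < (v j).re)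
    (h1 : ∑ j ∈ c.logSet K i₀, (c.multRest i₀ j : ℝ) * (v j).re < 1) (k : ℕ) :
    Tendsto (fun t => c.branchAt K i₀ k t v) (𝓝[≠] 0)
      (𝓝 (c.limPoint i₀ (c.logSet K i₀) v)) := by
  refine tendsto_pi_nhds.2 fun l => ?_
  rcases Fin.eq_self_or_eq_succAbove (c.k i₀) l with rfl | ⟨j, rfl⟩
  · have : c.limPoint i₀ (c.logSet K i₀) v (c.k i₀) = 0 := by simp [Chart.limPoint]
    rw [this, tendsto_zero_iff_norm_tendsto_zero]
    refine (Real.tendsto_exp_atBot.comp (tendsto_log_branchAt h1 k)).congr fun t => ?_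
    exact Real.exp_log (norm_pos_iff.2 (branchAt_ne_zero k t v))
  · by_cases hj : j ∈ c.logSet K i₀
    · have : c.limPoint i₀ (c.logSet K i₀) v ((c.k i₀).succAbove j) = 0 := by
        simp [Chart.limPoint, hj]
      rw [this, tendsto_zero_iff_norm_tendsto_zero]
      simp only [Chart.branchAt, norm_branch_of_mem c v hj]
      exact Real.tendsto_exp_atBot.comp (tendsto_log_norm_mul_of_pos (h0 j hj))
    · have : c.limPoint i₀ (c.logSet K i₀) v ((c.k i₀).succAbove j) = v j := by
        simp [Chart.limPoint, hj]
      simp only [this, Chart.branchAt, branch_of_notMem c v hj]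
      exact tendsto_const_nhds

/-- The logarithms of the coordinates of index in `K`, divided by `log |t|`, tend to the limit
logarithmic coordinates. -/
theorem tendsto_log_branchAt_div (v : Fin n → ℂ) (k : ℕ) {i : I} (hi : i ∈ K) :
    Tendsto (fun t => Real.log ‖c.branchAt K i₀ k t v (c.k i)‖ / Real.log ‖t‖) (𝓝[≠] 0)
      (𝓝 (c.limLog K i₀ (c.logSet K i₀) v i)) := by
  have hT : ∀ᶠ t : ℂ in 𝓝[≠] 0, Real.log ‖t‖ ≠ 0 := by
    filter_upwards [tendsto_neg_log_norm.eventually_gt_atTop 0] with t ht h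
    simp [h] at ht
  rcases Fin.eq_self_or_eq_succAbove (c.k i₀) (c.k i) with h | ⟨j, hj⟩
  · simp only [h, Chart.limLog, hi, if_true, Fin.insertNth_apply_same, log_branchAt_same]
    set s := 1 - ∑ j ∈ c.logSet K i₀, (c.multRest i₀ j : ℝ) * (v j).re
    set C := ∑ j ∈ (c.logSet K i₀)ᶜ, (c.multRest i₀ j : ℝ) * Real.log ‖v j‖
    have h2 : Tendsto (fun t : ℂ => (s + C / (-Real.log ‖t‖)) / D.b i₀) (𝓝[≠] 0)
        (𝓝 (s / D.b i₀)) := by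
      have := (tendsto_neg_log_norm.const_div_atTop C).const_add s
      rw [add_zero] at this
      exact this.div_const _
    refine h2.congr' ?_
    filter_upwards [hT] with t ht
    have hb : (D.b i₀ : ℝ) ≠ 0 := by exact_mod_cast D.b_ne_zero i₀
    field_simp
    ring
  · have hjS : j ∈ c.logSet K i₀ := Chart.mem_logSet.2 ⟨i, hi, hj⟩
    simp only [hj, Chart.limLog, hi, if_true, Fin.insertNth_apply_succAbove, Chart.branchAt,
      norm_branch_of_mem c v hjS, Real.log_exp, neg_neg]
    refine tendsto_const_nhds.congr' ?_
    filter_upwards [hT] with t ht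
    field_simp

/-- Off the simplex, the rescaled parameters leave every bounded set. -/
theorem eventually_notMem_closedBall {v : Fin n → ℂ} (p : Model n) (r : ℝ)
    (h : (∃ j ∈ c.logSet K i₀, (v j).re < 0) ∨
      1 < ∑ j ∈ c.logSet K i₀, (c.multRest i₀ j : ℝ) * (v j).re) (k : ℕ) :
    ∀ᶠ t in 𝓝[≠] (0 : ℂ), c.branchAt K i₀ k t v ∉ Metric.closedBall p r := by
  obtain ⟨l, hl⟩ : ∃ l, Tendsto (fun t => ‖c.branchAt K i₀ k t v l‖) (𝓝[≠] 0) atTop := by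
    rcases h with ⟨j, hj, hneg⟩ | h
    · refine ⟨(c.k i₀).succAbove j, ?_⟩
      simp only [Chart.branchAt, norm_branch_of_mem c v hj]
      exact Real.tendsto_exp_atTop.comp (tendsto_log_norm_mul_of_neg hneg)
    · refine ⟨c.k i₀, ?_⟩
      have hb : (0 : ℝ) < D.b i₀ := by exact_mod_cast D.b_pos i₀
      have h2 : Tendsto (fun t => Real.log ‖c.branchAt K i₀ k t v (c.k i₀)‖) (𝓝[≠] 0) atTop := by
        simp only [log_branchAt_same]
        refine Tendsto.atTop_div_const hb (tendsto_atTop_add_const_right _ _ ?_)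
        exact tendsto_log_norm_mul_of_neg (by linarith)
      refine (Real.tendsto_exp_atTop.comp h2).congr fun t => ?_
      exact Real.exp_log (norm_pos_iff.2 (branchAt_ne_zero k t v))
  filter_upwards [hl.eventually_gt_atTop (‖p l‖ + r)] with t ht hmem
  exact absurd (norm_apply_le hmem l) (not_le.2 ht)

theorem weight_continuousAt (a : I → ℚ) {w : Model n} (hw : ∀ i ∈ c.J, i ∉ K → w (c.k i) ≠ 0) :
    ContinuousAt (c.weight a K) w := by
  classical
  unfold Chart.weight
  refine ContinuousAt.mul ?_ ?_
  · refine tendsto_finsetProd _ fun i _ => ?_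
    exact ContinuousAt.rpow_const (continuous_apply (c.k i)).norm.continuousAt
      (Or.inr (mul_nonneg zero_le_two (D.gam_nonneg a i)))
  · refine tendsto_finsetProd _ fun i hi => ?_
    obtain ⟨h1, h2⟩ := Finset.mem_sdiff.1 hi
    exact ContinuousAt.rpow_const (continuous_apply (c.k i)).norm.continuousAt
      (Or.inl (norm_ne_zero_iff.2 (hw i h1 h2)))

theorem measurable_weight (a : I → ℚ) : Measurable (c.weight a K) := by
  classical
  unfold Chart.weight
  refine Measurable.mul ?_ ?_
  · exact Finset.measurable_prod _ fun i _ => (measurable_pi_apply _).norm.pow_const _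
  · exact Finset.measurable_prod _ fun i _ => (measurable_pi_apply _).norm.pow_const _

end

open scoped Classical in
/-- The rescaled parameters whose limit lies in the interior of the simplex and in the chart. -/
def Chart.limDom (c : D.Chart) (K : Finset I) (i₀ : I) : Set (Fin n → ℂ) :=
  {v | (∀ j, v j ∈ paramDom (c.multRest i₀) (c.logSet K i₀) 0 j) ∧
    (∀ j ∈ c.logSet K i₀, 0 < (v j).re) ∧
    ∑ j ∈ c.logSet K i₀, (c.multRest i₀ j : ℝ) * (v j).re < 1 ∧
    c.limPoint i₀ (c.logSet K i₀) v ∈ c.z.target}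

/-- The limit points lie on no component outside `K`: the parameters which are equations of such
components avoid the cuts, which pass through zero. -/
theorem limPoint_ne_zero {c : D.Chart} {K : Finset I} (hK : K ⊆ c.J) {i₀ : I} (hi₀ : i₀ ∈ K)
    {v : Fin n → ℂ}
    (hv : ∀ j, v j ∈ paramDom (c.multRest i₀) (c.logSet K i₀) 0 j) {i : I} (hi : i ∈ c.J)
    (hiK : i ∉ K) : c.limPoint i₀ (c.logSet K i₀) v (c.k i) ≠ 0 := by
  rcases Fin.eq_self_or_eq_succAbove (c.k i₀) (c.k i) with h | ⟨j, hj⟩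
  · have := c.isSnc.injOn (by exact_mod_cast hi) (by exact_mod_cast hK hi₀) h
    exact absurd (this ▸ hi₀) hiK
  · have hjS : j ∉ c.logSet K i₀ := by
      intro hmem
      obtain ⟨i', hi', hij⟩ := Chart.mem_logSet.1 hmem
      have := c.isSnc.injOn (by exact_mod_cast hi) (by exact_mod_cast hK hi') (hj.trans hij.symm)
      exact hiK (this ▸ hi')
    have h2 := hv j
    have h3 : c.multRest i₀ j ≠ 0 := by
      rw [Chart.multRest, ← hj, c.mult_k hi]
      exact D.b_ne_zero i
    simp only [paramDom, hjS, if_false, h3, mem_ofPred_eq] at h2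
    rw [hj]
    simp only [Chart.limPoint, Fin.insertNth_apply_succAbove, hjS, if_false]
    rintro h4
    rw [h4] at h2
    exact Complex.slitPlane_ne_zero h2 (by simp)

theorem volume_setOf_re_eq (j : Fin n) (α : ℝ) : volume {u : Fin n → ℂ | (u j).re = α} = 0 := by
  have h : {u : Fin n → ℂ | (u j).re = α} = (fun u : Fin n → ℂ => (fun _ => ((-α : ℝ) : ℂ)) + u) ⁻¹'
      {u : Fin n → ℂ | (u j).re = 0} := by
    ext u
    simp only [mem_ofPred_eq, mem_preimage, Pi.add_apply, Complex.add_re, Complex.ofReal_re]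
    constructor <;> intro h <;> linarith
  rw [h, measure_preimage_add]
  let P : Submodule ℝ (Fin n → ℂ) :=
    LinearMap.ker (Complex.reLm ∘ₗ LinearMap.proj (R := ℝ) (φ := fun _ : Fin n => ℂ) j)
  have h : {u : Fin n → ℂ | (u j).re = 0} = (P : Set (Fin n → ℂ)) := by
    ext u; simp [P]
  rw [h]
  refine Measure.addHaar_submodule _ _ fun htop => ?_
  have : (fun _ => 1 : Fin n → ℂ) ∈ P := by rw [htop]; trivial
  simp [P] at this

theorem volume_setOf_sum_re_eq (S : Finset (Fin n)) (β : Fin n → ℝ) :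
    volume {u : Fin n → ℂ | ∑ j ∈ S, β j * (u j).re = 1} = 0 := by
  let ℓ : (Fin n → ℂ) →ₗ[ℝ] ℝ := ∑ j ∈ S, β j •
    (Complex.reLm ∘ₗ LinearMap.proj (R := ℝ) (φ := fun _ : Fin n => ℂ) j)
  have hℓ : ∀ u, ℓ u = ∑ j ∈ S, β j * (u j).re := fun u => by simp [ℓ]
  by_cases h0 : ∃ u₀, ℓ u₀ = 1
  · obtain ⟨u₀, hu₀⟩ := h0
    have h : {u : Fin n → ℂ | ∑ j ∈ S, β j * (u j).re = 1} =
        (fun u : Fin n → ℂ => -u₀ + u) ⁻¹' (LinearMap.ker ℓ : Set (Fin n → ℂ)) := by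
      ext u
      simp only [mem_ofPred_eq, ← hℓ, mem_preimage, SetLike.mem_coe, LinearMap.mem_ker, map_add,
        map_neg, hu₀]
      constructor <;> intro h <;> linarith
    rw [h, measure_preimage_add]
    refine Measure.addHaar_submodule _ _ fun htop => ?_
    have : u₀ ∈ LinearMap.ker ℓ := by rw [htop]; trivial
    rw [LinearMap.mem_ker, hu₀] at this
    exact one_ne_zero this
  · have h : {u : Fin n → ℂ | ∑ j ∈ S, β j * (u j).re = 1} = ∅ := by
      ext u
      simp only [mem_ofPred_eq, mem_empty_iff_false, iff_false]
      exact fun h => h0 ⟨u, (hℓ u).trans h⟩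
    rw [h, measure_empty]

variable {L : X → Type*} [TopologicalSpace (TotalSpace ℂ L)] [∀ x, AddCommGroup (L x)]
  [∀ x, Module ℂ (L x)] [∀ x, TopologicalSpace (L x)] [FiberBundle ℂ L] [VectorBundle ℂ ℂ L]
  (ℒ : CanonicalExtension L D) (ψ : ContinuousMetric L)

/-- The limit of the measures of the fibres near a point of the zero fibre, tested against functions
`g` having a limit `g₀` along the branches of the fibres in an adapted polydisc. -/
theorem tendsto_integral_box {a : I → ℚ} (ha : ℒ.IsDecomposition a) (c : MonomialChart D)
    {K : Finset I} {i₀ : I} {p : Model n} {r : ℝ} (hB : IsBox c.1 a K i₀ p r)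
    {g : X → ℝ} (hg : Measurable g) {M δ : ℝ} (hδ : 0 < δ)
    (hgM : ∀ x, ‖D.proj x‖ < δ → |g x| ≤ M)
    (hgi : ∀ᶠ t in 𝓝[≠] (0 : ℂ), Integrable g (ℒ.fibreMeasure ψ t))
    (hg0 : ∀ x, ¬(x ∈ c.1.z.source ∧ c.1.z x ∈ Metric.closedBall p r) → g x = 0)
    (g₀ : Model n → (I → ℝ) → ℝ)
    (hlim : ∀ y ∈ c.1.z.target, (∀ i ∈ K, y (c.1.k i) = 0) →
      (∀ i ∈ c.1.J, i ∉ K → y (c.1.k i) ≠ 0) → ∀ w ∈ D.simplex K, ∀ x : ℂ → X,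
      (∀ᶠ t in 𝓝[≠] 0, D.proj (x t) = t) → Tendsto x (𝓝[≠] 0) (𝓝 (c.1.z.symm y)) →
      (∀ i ∈ K, Tendsto (fun t => Real.log ‖c.1.z (x t) (c.1.k i)‖ / Real.log ‖t‖) (𝓝[≠] 0)
        (𝓝 (w i))) →
      Tendsto (fun t => g (x t)) (𝓝[≠] 0) (𝓝 (g₀ y w))) :
    Tendsto (fun t : ℂ => ((-Real.log ‖t‖) ^ (c.1.logSet K i₀).card)⁻¹ *
      ((‖t‖ ^ (2 * D.kappaMin a))⁻¹ * ∫ x, g x ∂(ℒ.fibreMeasure ψ t))) (𝓝[≠] 0)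
      (𝓝 ((D.b i₀ : ℝ)⁻¹ * ∫ v, (c.1.limDom K i₀).indicator (fun v =>
        g₀ (c.1.limPoint i₀ (c.1.logSet K i₀) v) (c.1.limLog K i₀ (c.1.logSet K i₀) v) *
        (ℒ.genNormExt ψ a c.1 (c.1.z.symm (c.1.limPoint i₀ (c.1.logSet K i₀) v)) *
          c.1.weight a K (c.1.limPoint i₀ (c.1.logSet K i₀) v))) v)) := by
  classical
  set S := c.1.logSet K i₀ with hS
  have hb : (D.b i₀ : ℝ) ≠ 0 := by exact_mod_cast D.b_ne_zero i₀
  obtain ⟨hGc, hGpos, -⟩ := ℒ.genNormExt_spec ψ ha c.1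
  set G := ℒ.genNormExt ψ a c.1 with hG
  obtain ⟨MG, hMG⟩ : ∃ MG, ∀ w ∈ Metric.closedBall p r, G (c.1.z.symm w) ≤ MG := by
    have h1 : ContinuousOn (fun w => G (c.1.z.symm w)) (Metric.closedBall p r) :=
      (hGc.comp c.1.z.symm.continuousOn fun w hw => c.1.z.map_target hw).mono hB.closedBall_subset
    obtain ⟨MG, hMG⟩ := (isCompact_closedBall p r).bddAbove_image h1
    exact ⟨MG, fun w hw => hMG (mem_image_of_mem _ hw)⟩
  let q : ℕ → ℂ → ℂ := fun k t => Complex.log t + 2 * Real.pi * Complex.I * k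
  let F : Model n → ℝ := fun w => g (c.1.z.symm w) * (G (c.1.z.symm w) * c.1.weight a K w)
  let H : ℕ → ℂ → (Fin n → ℂ) → ℝ := fun k t =>
    (c.1.branchDom i₀ S (q k t)).indicator fun u => F (c.1.branch i₀ S (q k t) u)
  let H₀ : (Fin n → ℂ) → ℝ := (c.1.limDom K i₀).indicator fun v =>
    g₀ (c.1.limPoint i₀ S v) (c.1.limLog K i₀ S v) *
      (G (c.1.z.symm (c.1.limPoint i₀ S v)) * c.1.weight a K (c.1.limPoint i₀ S v))
  have hT1 : ∀ᶠ t : ℂ in 𝓝[≠] 0, 1 ≤ -Real.log ‖t‖ := tendsto_neg_log_norm.eventually_ge_atTop 1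
  have ht0 : ∀ᶠ t : ℂ in 𝓝[≠] 0, t ≠ 0 := self_mem_nhdsWithin
  -- the integral over a branch vanishes where the polydisc is left
  have hF0 : ∀ w ∈ c.1.z.target, w ∉ Metric.closedBall p r → F w = 0 := by
    intro w hw hwp
    have : g (c.1.z.symm w) = 0 := hg0 _ fun h => hwp (by
      have h2 := h.2
      rwa [c.1.z.right_inv hw] at h2)
    simp [F, this]
  have hHeq : ∀ k t v, H k t (logScale S (-Real.log ‖t‖) v) =
      if (∀ j, v j ∈ paramDom (c.1.multRest i₀) S 0 j) ∧
        c.1.branchAt K i₀ k t v ∈ c.1.z.target then F (c.1.branchAt K i₀ k t v) else 0 := by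
    intro k t v
    simp only [H, indicator_apply, Chart.branchDom, mem_ofPred_eq, logScale_mem_paramDom]
    rfl
  have hmain : ∀ k, Tendsto (fun t => ∫ v, H k t (logScale S (-Real.log ‖t‖) v)) (𝓝[≠] 0)
      (𝓝 (∫ v, H₀ v)) := by
    intro k
    refine tendsto_integral_filter_of_dominated_convergence (fun v => M * (MG * ∏ j,
      majorant c.1 a K i₀ p r (1 + ∑ l ∈ Sᶜ,
        (c.1.multRest i₀ l : ℝ) * (‖p ((c.1.k i₀).succAbove l)‖ + 1)) j (v j))) ?_ ?_ ?_ ?_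
    · filter_upwards [hT1] with t ht
      refine aestronglyMeasurable_comp_logScale S (by linarith) (H := H k t) ?_
      have hD := (isOpen_branchDom c.1 i₀ S (q k t)).measurableSet
      refine (aestronglyMeasurable_indicator_iff hD).2 (AEMeasurable.aestronglyMeasurable ?_)
      have hbr : ContinuousOn (c.1.branch i₀ S (q k t)) (c.1.branchDom i₀ S (q k t)) :=
        (continuousOn_branch c.1 i₀ S (q k t)).mono fun u hu => hu.1
      have hx : ContinuousOn (fun u => c.1.z.symm (c.1.branch i₀ S (q k t) u))
          (c.1.branchDom i₀ S (q k t)) := c.1.z.symm.continuousOn.comp hbr fun u hu => hu.2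
      refine (hg.comp_aemeasurable (aemeasurable_of_continuousOn hD hx)).mul
        ((aemeasurable_of_continuousOn hD (hGc.comp hx fun u hu => c.1.z.map_target hu.2)).mul
        ((measurable_weight a).comp_aemeasurable (aemeasurable_of_continuousOn hD hbr)))
    · -- domination: the function is bounded, and the weight is bounded by the majorant in the
      -- polydisc
      have hsmall : ∀ᶠ t : ℂ in 𝓝[≠] 0, ‖t‖ < δ :=
        nhdsWithin_le_nhds (by simpa [Metric.ball, dist_eq_norm] using Metric.ball_mem_nhds (0 : ℂ) hδ)
      filter_upwards [hT1, hsmall, ht0] with t ht htδ htne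
      refine Eventually.of_forall fun v => ?_
      have hM : 0 ≤ MG * ∏ j, majorant c.1 a K i₀ p r (1 + ∑ l ∈ Sᶜ,
          (c.1.multRest i₀ l : ℝ) * (‖p ((c.1.k i₀).succAbove l)‖ + 1)) j (v j) := by
        refine mul_nonneg ?_ (Finset.prod_nonneg fun j _ => majorant_nonneg _ _ _)
        have hp : p ∈ Metric.closedBall p r := Metric.mem_closedBall_self hB.pos.le
        exact (hGpos _ (c.1.z.map_target (hB.closedBall_subset hp))).le.trans (hMG p hp)
      have hM0 : 0 ≤ M := by
        obtain ⟨x, hx⟩ : (0 : ℂ) ∈ range D.proj := by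
          rw [D.range_eq]; simp
        exact (abs_nonneg _).trans (hgM x (by simpa [hx] using hδ))
      rw [hHeq]
      split_ifs with h
      · by_cases hw : c.1.branchAt K i₀ k t v ∈ Metric.closedBall p r
        · have hwt := hB.weight_le_majorant ht (re_branch t k) h.1 hw
          have hproj : D.proj (c.1.z.symm (c.1.branchAt K i₀ k t v)) = t := by
            have hmem : logScale S (-Real.log ‖t‖) v ∈ c.1.branchDom i₀ S (q k t) :=
              ⟨fun j => (logScale_mem_paramDom j).2 (h.1 j), h.2⟩
            have h2 := Chart.proj_branch c (hB.subset hB.mem) hmem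
            rwa [exp_branch (Complex.exp_log htne) k] at h2
          have hgx := hgM (c.1.z.symm (c.1.branchAt K i₀ k t v)) (by rwa [hproj])
          have hGx := hMG _ hw
          have hG0 := hGpos _ (c.1.z.map_target h.2)
          simp only [F, Real.norm_eq_abs, abs_mul]
          rw [abs_of_pos hG0, abs_of_nonneg (c.1.weight_nonneg a K _)]
          refine mul_le_mul hgx ?_ (mul_nonneg hG0.le (c.1.weight_nonneg a K _)) hM0
          exact mul_le_mul hGx hwt (c.1.weight_nonneg a K _) (hG0.le.trans hGx)
        · rw [hF0 _ h.2 hw, norm_zero]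
          exact mul_nonneg hM0 hM
      · rw [norm_zero]
        exact mul_nonneg hM0 hM
    · exact ((Integrable.fintype_prod fun j => hB.integrable_majorant _ j).const_mul MG).const_mul M
    · -- pointwise limits, off the null set of the parameters over the boundary of the simplex
      have hnull : ∀ᵐ v : Fin n → ℂ, (∀ j, (v j).re ≠ 0) ∧
          ∑ j ∈ S, (c.1.multRest i₀ j : ℝ) * (v j).re ≠ 1 := by
        refine (ae_all_iff.2 fun j => ?_).and ?_
        · rw [ae_iff]; simpa using volume_setOf_re_eq j 0
        · rw [ae_iff]; simpa using volume_setOf_sum_re_eq S fun j => (c.1.multRest i₀ j : ℝ)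
      filter_upwards [hnull] with v hv
      simp only [hHeq]
      by_cases hvd : ∀ j, v j ∈ paramDom (c.1.multRest i₀) S 0 j
      swap
      · have h1 : v ∉ c.1.limDom K i₀ := fun h => hvd h.1
        simp only [hvd, false_and, if_false, H₀, indicator_of_notMem h1]
        exact tendsto_const_nhds
      simp only [hvd, implies_true, true_and]
      by_cases hin : (∀ j ∈ S, 0 < (v j).re) ∧ ∑ j ∈ S, (c.1.multRest i₀ j : ℝ) * (v j).re < 1
      swap
      · have h1 : v ∉ c.1.limDom K i₀ := fun h => hin ⟨h.2.1, h.2.2.1⟩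
        simp only [H₀, indicator_of_notMem h1]
        refine tendsto_const_nhds.congr' ?_
        -- outside the closed simplex, a coordinate grows and the polydisc is left
        have hout : (∃ j ∈ S, (v j).re < 0) ∨ 1 < ∑ j ∈ S, (c.1.multRest i₀ j : ℝ) * (v j).re := by
          by_contra! hcon
          exact hin ⟨fun j hj => lt_of_le_of_ne (hcon.1 j hj) (hv.1 j).symm,
            lt_of_le_of_ne hcon.2 hv.2⟩
        filter_upwards [eventually_notMem_closedBall p r hout k] with t ht
        split_ifs with h
        · exact (hF0 _ h ht).symm
        · rfl
      have hP := tendsto_branchAt hin.1 hin.2 k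
      rw [← hS] at hP
      by_cases hy : c.1.limPoint i₀ S v ∈ c.1.z.target
      swap
      · have h1 : v ∉ c.1.limDom K i₀ := fun h => hy h.2.2.2
        simp only [H₀, indicator_of_notMem h1]
        refine tendsto_const_nhds.congr' ?_
        have hy' : c.1.limPoint i₀ S v ∉ Metric.closedBall p r := fun h =>
          hy (hB.closedBall_subset h)
        filter_upwards [hP.eventually (Metric.isClosed_closedBall.isOpen_compl.mem_nhds hy')]
          with t ht
        split_ifs with h
        · exact (hF0 _ h ht).symm
        · rfl
      have h1 : v ∈ c.1.limDom K i₀ := ⟨hvd, hin.1, hin.2, hy⟩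
      simp only [H₀, indicator_of_mem h1]
      have hev : ∀ᶠ t in 𝓝[≠] (0 : ℂ), c.1.branchAt K i₀ k t v ∈ c.1.z.target :=
        hP.eventually (c.1.z.open_target.mem_nhds hy)
      have hne : ∀ i ∈ c.1.J, i ∉ K → c.1.limPoint i₀ S v (c.1.k i) ≠ 0 := fun i hi hiK =>
        limPoint_ne_zero hB.subset hB.mem hvd hi hiK
      have hx : Tendsto (fun t => c.1.z.symm (c.1.branchAt K i₀ k t v)) (𝓝[≠] 0)
          (𝓝 (c.1.z.symm (c.1.limPoint i₀ S v))) :=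
        (c.1.z.symm.continuousAt hy).tendsto.comp hP
      have hF : Tendsto (fun t => F (c.1.branchAt K i₀ k t v)) (𝓝[≠] 0)
          (𝓝 (g₀ (c.1.limPoint i₀ S v) (c.1.limLog K i₀ S v) *
            (G (c.1.z.symm (c.1.limPoint i₀ S v)) * c.1.weight a K (c.1.limPoint i₀ S v)))) := by
        refine Tendsto.mul ?_ (Tendsto.mul ?_ ?_)
        · refine hlim _ hy (fun i hi => limPoint_k c.1 i₀ hi v) hne _
            (limLog_mem_simplex c.1 hB.subset hB.mem (fun j hj => (hin.1 j hj).le) hin.2.le) _ ?_ hx ?_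
          · filter_upwards [hev, ht0] with t ht htne
            have hmem : logScale S (-Real.log ‖t‖) v ∈ c.1.branchDom i₀ S (q k t) :=
              ⟨fun j => (logScale_mem_paramDom j).2 (hvd j), ht⟩
            have h2 := Chart.proj_branch c (hB.subset hB.mem) hmem
            rwa [exp_branch (Complex.exp_log htne) k] at h2
          · intro i hi
            refine (tendsto_log_branchAt_div v k hi).congr' ?_
            filter_upwards [hev] with t ht
            rw [c.1.z.right_inv ht]
        · exact ((hGc.continuousAt (c.1.z.open_source.mem_nhds (c.1.z.map_target hy))).tendsto).comp hx
        · exact (weight_continuousAt a hne).tendsto.comp hP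
      refine hF.congr' ?_
      filter_upwards [hev] with t ht
      rw [if_pos ht]
  have hsum : Tendsto (fun t => ((D.b i₀ : ℝ) ^ 2)⁻¹ * ∑ k ∈ Finset.range (D.b i₀),
      ∫ v, H k t (logScale S (-Real.log ‖t‖) v)) (𝓝[≠] 0)
      (𝓝 (((D.b i₀ : ℝ) ^ 2)⁻¹ * ∑ k ∈ Finset.range (D.b i₀), ∫ v, H₀ v)) :=
    (tendsto_finsetSum _ fun k _ => hmain k).const_mul _
  -- the `b i₀` branches have the same limit
  have hconst : ((D.b i₀ : ℝ) ^ 2)⁻¹ * ∑ k ∈ Finset.range (D.b i₀), ∫ v, H₀ v =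
      (D.b i₀ : ℝ)⁻¹ * ∫ v, H₀ v := by
    rw [Finset.sum_const, Finset.card_range, nsmul_eq_mul]
    field_simp
  rw [hconst] at hsum
  refine hsum.congr' ?_
  filter_upwards [hT1, ht0, hgi] with t ht htne hti
  have hgs : ∀ x ∉ c.1.z.source, g x = 0 := fun x hx => hg0 x fun h => hx h.1
  rw [integral_fibreMeasure_chart ℒ ψ ha c hB.subset hB.mem (Complex.exp_log htne) hg hti hgs,
    mul_left_comm, Finset.mul_sum (Finset.range _) _ ((-Real.log ‖t‖) ^ S.card)⁻¹]
  congr 1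
  refine Finset.sum_congr rfl fun k _ => ?_
  exact integral_comp_logScale S (by linarith) (H k t)

end SncDegeneration
end LocalLimit

/-! ### Fubini for the local limit -/

section Splitting

/-- The restriction of the parameters to the two blocks of a partition preserves the measure. -/
theorem integral_mul_of_sum_equiv {A B N : Type*} [Fintype A] [Fintype B] [Fintype N]
    (ε : A ⊕ B ≃ N) (f : (A → ℂ) → ℝ) (g : (B → ℂ) → ℝ) :
    ∫ v : N → ℂ, f (fun i => v (ε (Sum.inl i))) * g (fun s => v (ε (Sum.inr s))) =
      (∫ x, f x) * ∫ y, g y := by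
  let e₁ : (N → ℂ) ≃ᵐ (A ⊕ B → ℂ) := (MeasurableEquiv.piCongrLeft (fun _ : N => ℂ) ε).symm
  let e₂ : (A ⊕ B → ℂ) ≃ᵐ (A → ℂ) × (B → ℂ) := MeasurableEquiv.sumPiEquivProdPi fun _ => ℂ
  have h₁ : MeasurePreserving e₁ := (volume_measurePreserving_piCongrLeft (fun _ : N => ℂ) ε).symm
  have h₂ : MeasurePreserving e₂ := volume_measurePreserving_sumPiEquivProdPi fun _ => ℂ
  have h := ((h₂.comp h₁).integral_comp (e₁.trans e₂).measurableEmbedding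
    fun z : (A → ℂ) × (B → ℂ) => f z.1 * g z.2)
  rw [← integral_prod_mul]
  exact h

theorem integral_mul_re_im {A : Type*} [Fintype A] (f g : (A → ℝ) → ℝ) :
    ∫ v : A → ℂ, f (fun i => (v i).re) * g (fun i => (v i).im) = (∫ x, f x) * ∫ y, g y := by
  let e₁ : (A → ℂ) ≃ᵐ (A → ℝ × ℝ) := MeasurableEquiv.piCongrRight fun _ =>
    Complex.measurableEquivRealProd
  let e₂ : (A → ℝ × ℝ) ≃ᵐ (A → ℝ) × (A → ℝ) := MeasurableEquiv.arrowProdEquivProdArrow ℝ ℝ A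
  have h₁ : MeasurePreserving e₁ := volume_preserving_pi fun _ =>
    Complex.volume_preserving_equiv_real_prod
  have h₂ : MeasurePreserving e₂ := volume_measurePreserving_arrowProdEquivProdArrow ℝ ℝ A
  have h := ((h₂.comp h₁).integral_comp (e₁.trans e₂).measurableEmbedding
    fun z : (A → ℝ) × (A → ℝ) => f z.1 * g z.2)
  rw [← integral_prod_mul]
  exact h

theorem integral_indicator_abs_lt {A : Type*} [Fintype A] {α : ℝ} (hα : 0 ≤ α) :
    ∫ x : A → ℝ, {x : A → ℝ | ∀ i, |x i| < α}.indicator (fun _ => (1 : ℝ)) x =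
      (2 * α) ^ Fintype.card A := by
  have hs : {x : A → ℝ | ∀ i, |x i| < α} = Set.pi univ fun _ => Ioo (-α) α := by
    ext x; simp [abs_lt]
  rw [hs, integral_indicator (MeasurableSet.univ_pi fun _ => measurableSet_Ioo)]
  simp only [integral_const, smul_eq_mul, mul_one, measureReal_def, Measure.restrict_apply_univ]
  rw [Real.volume_pi_Ioo_toReal (fun _ => by linarith)]
  simp only [Finset.prod_const, Finset.card_univ]
  congr 1
  ring

variable {n : ℕ} {X : Type u} [TopologicalSpace X] [ChartedSpace (Model n) X]
  [IsManifold 𝓘(ℂ, Model n) ω X] {I : Type v} {D : SncDegeneration n X I} [Fintype I]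
  [MeasurableSpace X] [BorelSpace X]

open CanonicalExtension (MonomialChart FibreChart SliceIndex slicePoint sliceDomain)

namespace SncDegeneration

open scoped Classical in
variable (D) in
/-- The parametrization of the simplex with vertices in `K` by its coordinates other than that
of `i₀`. -/
def simplexParam (K : Finset I) (i₀ : I) (w : {i // i ∈ K.erase i₀} → ℝ) : I → ℝ := fun i =>
  if h : i ∈ K.erase i₀ then w ⟨i, h⟩ else
    if i = i₀ then (1 - ∑ j, (D.b j.1 : ℝ) * w j) / D.b i₀ else 0

open scoped Classical in
variable (D) in
/-- The interior of the domain of `simplexParam`. -/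
def openSimplex (K : Finset I) (i₀ : I) : Set ({i // i ∈ K.erase i₀} → ℝ) :=
  {w | (∀ i, 0 < w i) ∧ ∑ j, (D.b j.1 : ℝ) * w j < 1}

open scoped Classical in
/-- The parameters of a branch are split into those that are logarithms of the equations of index in
`K \ {i₀}` and the coordinates on the stratum. -/
theorem Chart.exists_sumEquiv (c : D.Chart) {K : Finset I} (hK : K ⊆ c.J) {i₀ : I} (hi₀ : i₀ ∈ K) :
    ∃ ε : {i // i ∈ K.erase i₀} ⊕ SliceIndex c K ≃ Fin n,
      (∀ i, (c.k i₀).succAbove (ε (Sum.inl i)) = c.k i) ∧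
      ∀ s, (c.k i₀).succAbove (ε (Sum.inr s)) = s.1 := by
  let m : {i // i ∈ K.erase i₀} ⊕ SliceIndex c K → Fin (n + 1) :=
    Sum.elim (fun i => c.k i) Subtype.val
  have hinj : InjOn c.k (K : Set I) := c.isSnc.injOn.mono (by exact_mod_cast hK)
  have hne : ∀ x, m x ≠ c.k i₀ := by
    rintro (⟨i, hi⟩ | ⟨s, hs⟩) h
    · obtain ⟨h1, h2⟩ := Finset.mem_erase.1 hi
      exact h1 (hinj (by exact_mod_cast h2) (by exact_mod_cast hi₀) h)
    · exact hs (Finset.mem_image.2 ⟨i₀, hi₀, h.symm⟩)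
  let f : {i // i ∈ K.erase i₀} ⊕ SliceIndex c K → Fin n := fun x =>
    (Fin.exists_succAbove_eq (hne x)).choose
  have hf : ∀ x, (c.k i₀).succAbove (f x) = m x := fun x =>
    (Fin.exists_succAbove_eq (hne x)).choose_spec
  have hbij : Function.Bijective f := by
    constructor
    · intro x y hxy
      have h : m x = m y := by rw [← hf, ← hf, hxy]
      rcases x with ⟨i, hi⟩ | ⟨s, hs⟩ <;> rcases y with ⟨i', hi'⟩ | ⟨s', hs'⟩
      · have := hinj (by exact_mod_cast Finset.mem_of_mem_erase hi)
          (by exact_mod_cast Finset.mem_of_mem_erase hi') h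
        exact congrArg Sum.inl (Subtype.ext this)
      · exact absurd (Finset.mem_image.2 ⟨i, Finset.mem_of_mem_erase hi, h⟩) hs'
      · exact absurd (Finset.mem_image.2 ⟨i', Finset.mem_of_mem_erase hi', h.symm⟩) hs
      · exact congrArg Sum.inr (Subtype.ext h)
    · intro j
      by_cases hj : (c.k i₀).succAbove j ∈ K.image c.k
      · obtain ⟨i, hi, hij⟩ := Finset.mem_image.1 hj
        have hii : i ≠ i₀ := by
          rintro rfl
          exact Fin.succAbove_ne _ _ hij.symm
        refine ⟨Sum.inl ⟨i, Finset.mem_erase.2 ⟨hii, hi⟩⟩, ?_⟩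
        exact Fin.succAbove_right_injective ((hf _).trans hij)
      · exact ⟨Sum.inr ⟨_, hj⟩, Fin.succAbove_right_injective (hf _)⟩
  exact ⟨Equiv.ofBijective f hbij, fun i => hf (Sum.inl i), fun s => hf (Sum.inr s)⟩

open scoped Classical in
/-- The chart coordinates of the points of the slice `z_i = 0`, `i ∈ K`. -/
def Chart.sliceVec (c : D.Chart) (K : Finset I) (y : SliceIndex c K → ℂ) : Model n :=
  fun j => if h : j ∉ K.image c.k then y ⟨j, h⟩ else 0

open scoped Classical in
/-- Fubini for the limit of the integrals over the fibres. -/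
theorem integral_limDom (c : D.Chart) {K : Finset I} (hK : K ⊆ c.J) {i₀ : I}
    (hi₀ : i₀ ∈ K) (φ : (I → ℝ) → ℝ) (h : Model n → ℝ) :
    ∫ v, (c.limDom K i₀).indicator (fun v =>
        φ (c.limLog K i₀ (c.logSet K i₀) v) * h (c.limPoint i₀ (c.logSet K i₀) v)) v =
      (2 * Real.pi) ^ (K.card - 1) *
        (∫ w, (D.openSimplex K i₀).indicator (fun w => φ (D.simplexParam K i₀ w)) w) *
        ∫ y, (sliceDomain c K).indicator (fun y => h (c.sliceVec K y)) y := by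
  obtain ⟨ε, hl, hr⟩ := c.exists_sumEquiv hK hi₀
  set S := c.logSet K i₀ with hS
  have hSl : ∀ i, ε (Sum.inl i) ∈ S := fun i =>
    Chart.mem_logSet.2 ⟨i, Finset.mem_of_mem_erase i.2, (hl i).symm⟩
  have hSr : ∀ s, ε (Sum.inr s) ∉ S := by
    intro s hs
    obtain ⟨i, hi, hij⟩ := Chart.mem_logSet.1 hs
    rw [hr] at hij
    exact s.2 (Finset.mem_image.2 ⟨i, hi, hij⟩)
  have hSimage : S = Finset.univ.image fun i => ε (Sum.inl i) := by
    ext j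
    obtain ⟨x, rfl⟩ := ε.surjective j
    rcases x with i | s
    · simp [hSl]
    · simp only [hSr, Finset.mem_image, Finset.mem_univ, true_and, false_iff, not_exists]
      intro i hi
      simpa using ε.injective hi
  have hmult : ∀ i, c.multRest i₀ (ε (Sum.inl i)) = D.b i := fun i => by
    rw [Chart.multRest, hl, c.mult_k (hK (Finset.mem_of_mem_erase i.2))]
  have hsum : ∀ v : Fin n → ℂ, ∑ j ∈ S, (c.multRest i₀ j : ℝ) * (v j).re =
      ∑ i : {i // i ∈ K.erase i₀}, (D.b i.1 : ℝ) * (v (ε (Sum.inl i))).re := by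
    intro v
    rw [hSimage, Finset.sum_image]
    · exact Finset.sum_congr rfl fun i _ => by rw [hmult]
    · intro i _ i' _ hii
      simpa using ε.injective hii
  have hlog : ∀ v : Fin n → ℂ, c.limLog K i₀ S v =
      D.simplexParam K i₀ fun i => (v (ε (Sum.inl i))).re := by
    intro v
    funext i
    by_cases hi : i ∈ K
    · by_cases hii : i = i₀
      · subst hii
        simp [Chart.limLog, simplexParam, hi, hsum]
      · have hie : i ∈ K.erase i₀ := Finset.mem_erase.2 ⟨hii, hi⟩
        have hk := hl ⟨i, hie⟩
        simp only [Chart.limLog, hi, if_true, simplexParam, hie, dif_pos]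
        rw [← hk, Fin.insertNth_apply_succAbove]
    · have hii : i ≠ i₀ := fun h => hi (h ▸ hi₀)
      simp [Chart.limLog, simplexParam, hi, hii]
  have hpt : ∀ v : Fin n → ℂ, c.limPoint i₀ S v = c.sliceVec K fun s => v (ε (Sum.inr s)) := by
    intro v
    funext l
    rcases Fin.eq_self_or_eq_succAbove (c.k i₀) l with rfl | ⟨j, rfl⟩
    · have : c.k i₀ ∈ K.image c.k := Finset.mem_image_of_mem _ hi₀
      simp only [Chart.limPoint, Fin.insertNth_apply_same, Chart.sliceVec]
      rw [dif_neg (not_not.2 this)]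
    · obtain ⟨x, rfl⟩ := ε.surjective j
      simp only [Chart.limPoint, Fin.insertNth_apply_succAbove, Chart.sliceVec]
      rcases x with i | s
      · rw [if_pos (hSl i), dif_neg]
        rw [hl, not_not]
        exact Finset.mem_image_of_mem _ (Finset.mem_of_mem_erase i.2)
      · have hs : (c.k i₀).succAbove (ε (Sum.inr s)) ∉ K.image c.k := by rw [hr]; exact s.2
        rw [if_neg (hSr s), dif_pos hs]
        congr 2
        congr 1
        exact Subtype.ext (hr s).symm
  let B : Set ({i // i ∈ K.erase i₀} → ℝ) := {x | ∀ i, |x i| < Real.pi}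
  let f₁ : ({i // i ∈ K.erase i₀} → ℝ) → ℝ :=
    (D.openSimplex K i₀).indicator fun w => φ (D.simplexParam K i₀ w)
  let f₂ : (SliceIndex c K → ℂ) → ℝ := (sliceDomain c K).indicator fun y => h (c.sliceVec K y)
  have hcard : Fintype.card {i // i ∈ K.erase i₀} = K.card - 1 := by
    rw [Fintype.card_coe, Finset.card_erase_of_mem hi₀]
  -- up to a null set, the domain is the product of the simplex, of the cube of the imaginary parts
  -- and of the domain on the stratum; the cuts of the coordinates on the stratum are negligible
  have hae : ∀ᵐ v : Fin n → ℂ, (c.limDom K i₀).indicator (fun v =>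
      φ (c.limLog K i₀ S v) * h (c.limPoint i₀ S v)) v =
      (f₁ (fun i => (v (ε (Sum.inl i))).re) *
        B.indicator (fun _ => (1 : ℝ)) (fun i => (v (ε (Sum.inl i))).im)) *
        f₂ (fun s => v (ε (Sum.inr s))) := by
    have hnull : ∀ᵐ v : Fin n → ℂ, ∀ j, (v j).im ≠ 0 := by
      refine ae_all_iff.2 fun j => ?_
      rw [ae_iff]; simpa using volume_setOf_im_eq_zero j
    filter_upwards [hnull] with v hv
    have hmem : v ∈ c.limDom K i₀ ↔ (fun i => (v (ε (Sum.inl i))).re) ∈ D.openSimplex K i₀ ∧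
        (fun i => (v (ε (Sum.inl i))).im) ∈ B ∧ (fun s => v (ε (Sum.inr s))) ∈ sliceDomain c K := by
      have hS' : ∀ P : Fin n → Prop, (∀ j ∈ S, P j) ↔ ∀ i, P (ε (Sum.inl i)) := by
        refine fun P => ⟨fun h i => h _ (hSl i), fun h j hj => ?_⟩
        rw [hSimage] at hj
        obtain ⟨i, -, rfl⟩ := Finset.mem_image.1 hj
        exact h i
      have hpd : (∀ j, v j ∈ paramDom (c.multRest i₀) S 0 j) ↔
          ∀ j ∈ S, |(v j).im| < Real.pi := by
        refine forall_congr' fun j => ?_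
        by_cases hj : j ∈ S
        · simp [paramDom, hj]
        · simp only [paramDom, hj, if_false, false_implies, iff_true]
          split_ifs
          · trivial
          · simpa [Complex.mem_slitPlane_iff] using Or.inr (hv j)
      change (_ ∧ _ ∧ _ ∧ _) ↔ (_ ∧ _) ∧ _ ∧ _
      rw [← hS, hpd, hS', hS', hsum, hpt]
      change _ ↔ (_ ∧ _) ∧ (∀ i, |(v (ε (Sum.inl i))).im| < Real.pi) ∧
        c.sliceVec K (fun s => v (ε (Sum.inr s))) ∈ c.z.target
      tauto
    by_cases hin : v ∈ c.limDom K i₀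
    · obtain ⟨h1, h2, h3⟩ := hmem.1 hin
      simp only [f₁, f₂]
      rw [indicator_of_mem hin, hlog, hpt, indicator_of_mem h1, indicator_of_mem h2,
        indicator_of_mem h3, mul_one]
    · rw [indicator_of_notMem hin]
      by_cases h1 : (fun i => (v (ε (Sum.inl i))).re) ∈ D.openSimplex K i₀
      · by_cases h2 : (fun i => (v (ε (Sum.inl i))).im) ∈ B
        · have h3 : (fun s => v (ε (Sum.inr s))) ∉ sliceDomain c K := fun h3 =>
            hin (hmem.2 ⟨h1, h2, h3⟩)
          simp [f₂, h3]
        · simp [h2]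
      · simp [f₁, h1]
  rw [integral_congr_ae hae, integral_mul_of_sum_equiv ε
    (fun x => f₁ (fun i => (x i).re) * B.indicator (fun _ => (1 : ℝ)) (fun i => (x i).im)) f₂,
    integral_mul_re_im f₁ (B.indicator fun _ => (1 : ℝ)),
    integral_indicator_abs_lt Real.pi_pos.le, hcard]
  ring

theorem card_logSet (c : D.Chart) {K : Finset I} (hK : K ⊆ c.J) {i₀ : I} (hi₀ : i₀ ∈ K) :
    (c.logSet K i₀).card = K.card - 1 := by
  classical
  have h : ((c.logSet K i₀).image (c.k i₀).succAbove).card = ((K.erase i₀).image c.k).card := by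
    congr 1
    ext l
    simp only [Finset.mem_image, Chart.mem_logSet, Finset.mem_erase]
    constructor
    · rintro ⟨j, ⟨i, hi, hij⟩, rfl⟩
      refine ⟨i, ⟨?_, hi⟩, hij⟩
      rintro rfl
      exact Fin.succAbove_ne _ _ hij.symm
    · rintro ⟨i, ⟨hne, hi⟩, rfl⟩
      have : c.k i ≠ c.k i₀ := fun h => hne (c.isSnc.injOn (by exact_mod_cast hK hi)
        (by exact_mod_cast hK hi₀) h)
      obtain ⟨j, hj⟩ := Fin.exists_succAbove_eq this
      exact ⟨j, ⟨i, hi, hj.symm⟩, hj⟩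
  rw [Finset.card_image_of_injective _ Fin.succAbove_right_injective,
    Finset.card_image_of_injOn] at h
  · rw [h, Finset.card_erase_of_mem hi₀]
  · exact c.isSnc.injOn.mono fun i hi => hK (Finset.mem_of_mem_erase hi)

end SncDegeneration
end Splitting

/-! ### Covolume of a congruence lattice -/

section CongruenceLattice

/-- Bézout for the greatest common divisor of a finite family. -/
theorem exists_sum_mul_eq_gcd {A : Type*} (s : Finset A) (b : A → ℕ) :
    ∃ m : A → ℤ, ∑ i ∈ s, (b i : ℤ) * m i = s.gcd b := by
  classical
  induction s using Finset.induction_on with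
  | empty => exact ⟨0, by simp⟩
  | insert i s hi ih =>
    obtain ⟨m, hm⟩ := ih
    refine ⟨fun j => if j = i then Nat.gcdA (b i) (s.gcd b) else Nat.gcdB (b i) (s.gcd b) * m j, ?_⟩
    rw [Finset.sum_insert hi, Finset.gcd_insert]
    have h1 : ∑ j ∈ s, (b j : ℤ) * (if j = i then Nat.gcdA (b i) (s.gcd b) else
        Nat.gcdB (b i) (s.gcd b) * m j) = s.gcd b * Nat.gcdB (b i) (s.gcd b) := by
      rw [← hm, Finset.sum_mul]
      refine Finset.sum_congr rfl fun j hj => ?_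
      rw [if_neg (by rintro rfl; exact hi hj)]
      ring
    rw [h1]
    simp only [if_true]
    exact (Nat.gcd_eq_gcd_ab _ _).symm

variable {A : Type*} [Fintype A] (b : A → ℕ) (b₀ : ℕ)

/-- The integral vectors `m` such that `∑ b i * m i` is a multiple of `b₀`. -/
def congruenceLattice : Submodule ℤ (A → ℝ) where
  carrier := {v | ∃ m : A → ℤ, (∀ i, v i = m i) ∧ (b₀ : ℤ) ∣ ∑ i, (b i : ℤ) * m i}
  add_mem' := by
    rintro v w ⟨m, hm, hm'⟩ ⟨k, hk, hk'⟩
    refine ⟨m + k, fun i => by simp [hm, hk], ?_⟩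
    simpa [mul_add, Finset.sum_add_distrib] using dvd_add hm' hk'
  zero_mem' := ⟨0, by simp, by simp⟩
  smul_mem' := by
    rintro c v ⟨m, hm, hm'⟩
    refine ⟨c • m, fun i => by simp [hm], ?_⟩
    have : ∑ i, (b i : ℤ) * (c • m) i = c * ∑ i, (b i : ℤ) * m i := by
      rw [Finset.mul_sum]
      exact Finset.sum_congr rfl fun i _ => by simp; ring
    rw [this]
    exact Dvd.dvd.mul_left hm' c

theorem mem_span_basisFun {v : A → ℝ} :
    v ∈ Submodule.span ℤ (range (Pi.basisFun ℝ A)) ↔ ∃ m : A → ℤ, ∀ i, v i = m i := by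
  rw [Module.Basis.mem_span_iff_repr_mem]
  simp only [Pi.basisFun_repr]
  constructor
  · intro h
    choose m hm using h
    exact ⟨m, fun i => by simpa using (hm i).symm⟩
  · rintro ⟨m, hm⟩ i
    exact ⟨m i, by simpa using (hm i).symm⟩

theorem congruenceLattice_le :
    congruenceLattice b b₀ ≤ Submodule.span ℤ (range (Pi.basisFun ℝ A)) := by
  rintro v ⟨m, hm, -⟩
  exact mem_span_basisFun.2 ⟨m, hm⟩

instance : DiscreteTopology (congruenceLattice b b₀) :=
  DiscreteTopology.of_subset
    (inferInstanceAs (DiscreteTopology (Submodule.span ℤ (range (Pi.basisFun ℝ A)))))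
    (congruenceLattice_le b b₀)

theorem isZLattice_congruenceLattice (hb₀ : b₀ ≠ 0) : IsZLattice ℝ (congruenceLattice b b₀) where
  span_top := by
    classical
    rw [eq_top_iff, ← (Pi.basisFun ℝ A).span_eq, Submodule.span_le]
    rintro _ ⟨i, rfl⟩
    have h : (b₀ : ℝ) • Pi.basisFun ℝ A i ∈ (congruenceLattice b b₀ : Set (A → ℝ)) := by
      refine ⟨Pi.single i (b₀ : ℤ), fun j => ?_, ?_⟩
      · by_cases hj : j = i
        · subst hj; simp
        · simp [hj]
      · rw [Finset.sum_eq_single i]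
        · simp
        · intro j _ hj; simp [hj]
        · simp
    have h2 := Submodule.smul_mem _ (b₀ : ℝ)⁻¹ (Submodule.subset_span (R := ℝ) h)
    rwa [inv_smul_smul₀ (by exact_mod_cast hb₀)] at h2

/-- The lattice of the integral vectors `m` with `∑ b i * m i` divisible by `b₀` has index `b₀ /
gcd` in the lattice of all integral vectors. -/
theorem covolume_congruenceLattice (hb₀ : b₀ ≠ 0) :
    ZLattice.covolume (congruenceLattice b b₀) = b₀ / (b₀.gcd (Finset.univ.gcd b) : ℝ) := by
  classical
  have := isZLattice_congruenceLattice b b₀ hb₀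
  have h1 := ZLattice.covolume_div_covolume_eq_relIndex (congruenceLattice b b₀)
    (Submodule.span ℤ (range (Pi.basisFun ℝ A))) (congruenceLattice_le b b₀)
  have h2 : ZLattice.covolume (Submodule.span ℤ (range (Pi.basisFun ℝ A))) = 1 := by
    rw [ZLattice.covolume_eq_measure_fundamentalDomain _ volume
      (ZSpan.isAddFundamentalDomain (Pi.basisFun ℝ A) volume), ZSpan.volume_real_fundamentalDomain]
    have : Matrix.of (Pi.basisFun ℝ A) = (1 : Matrix A A ℝ) := by
      ext i j
      simp [Matrix.one_apply, Pi.single_apply, eq_comm]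
    rw [this]
    simp
  rw [h2, div_one] at h1
  rw [h1]
  let j : (A → ℤ) →+ (A → ℝ) := AddMonoidHom.compLeft (Int.castAddHom ℝ) A
  have hj : Function.Injective j := by
    intro m k hmk
    funext i
    have := congrFun hmk i
    simpa [j] using this
  -- the lattice is the kernel of `f`, and its index is the order of the image, which is generated
  -- by the greatest common divisor
  let f : (A → ℤ) →+ ZMod b₀ :=
    (Int.castAddHom (ZMod b₀)).comp
      (∑ i, (AddMonoidHom.mulLeft (b i : ℤ)).comp (Pi.evalAddMonoidHom _ i))
  have hf : ∀ m, f m = ((∑ i, (b i : ℤ) * m i : ℤ) : ZMod b₀) := by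
    intro m; simp [f]
  have hL₁ : (congruenceLattice b b₀).toAddSubgroup = f.ker.map j := by
    ext v
    constructor
    · rintro ⟨m, hm, hm'⟩
      refine ⟨m, ?_, funext fun i => (hm i).symm⟩
      change f m = 0
      rw [hf]
      exact (ZMod.intCast_zmod_eq_zero_iff_dvd _ _).2 hm'
    · rintro ⟨m, hm, rfl⟩
      refine ⟨m, fun i => rfl, ?_⟩
      have : f m = 0 := hm
      rw [hf] at this
      exact (ZMod.intCast_zmod_eq_zero_iff_dvd _ _).1 this
  have hL₂ : (Submodule.span ℤ (range (Pi.basisFun ℝ A))).toAddSubgroup =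
      (⊤ : AddSubgroup _).map j := by
    ext v
    rw [Submodule.mem_toAddSubgroup, mem_span_basisFun]
    constructor
    · rintro ⟨m, hm⟩
      exact ⟨m, trivial, funext fun i => (hm i).symm⟩
    · rintro ⟨m, -, rfl⟩
      exact ⟨m, fun i => rfl⟩
  have hrange : f.range = AddSubgroup.zmultiples ((Finset.univ.gcd b : ℕ) : ZMod b₀) := by
    ext x
    constructor
    · rintro ⟨m, rfl⟩
      rw [hf]
      have hd : ((Finset.univ.gcd b : ℕ) : ℤ) ∣ ∑ i, (b i : ℤ) * m i :=
        Finset.dvd_sum fun i _ => Dvd.dvd.mul_right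
          (by exact_mod_cast Finset.gcd_dvd (Finset.mem_univ i)) _
      obtain ⟨k, hk⟩ := hd
      exact AddSubgroup.mem_zmultiples_iff.2 ⟨k, by rw [hk]; push_cast; simp [mul_comm]⟩
    · intro hx
      obtain ⟨k, rfl⟩ := AddSubgroup.mem_zmultiples_iff.1 hx
      obtain ⟨m, hm⟩ := exists_sum_mul_eq_gcd Finset.univ b
      refine ⟨k • m, ?_⟩
      rw [map_zsmul, hf, hm]
      simp
  rw [hL₁, hL₂, AddSubgroup.relIndex_map_map_of_injective _ _ hj, AddSubgroup.relIndex_top_right,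
    AddSubgroup.index_ker, hrange, Nat.card_zmultiples, ZMod.addOrderOf_coe _ hb₀]
  have hg : (b₀.gcd (Finset.univ.gcd b) : ℝ) ≠ 0 := by
    exact_mod_cast (Nat.gcd_pos_of_pos_left _ (Nat.pos_of_ne_zero hb₀)).ne'
  rw [Nat.cast_div (Nat.gcd_dvd_left _ _) hg]

/-- The normalization of a Haar measure by the covolume of a lattice does not depend on the
measure. -/
theorem covolume_inv_smul_eq {E : Type*} [NormedAddCommGroup E] [NormedSpace ℝ E]
    [FiniteDimensional ℝ E] [MeasurableSpace E] [BorelSpace E] (Λ : Submodule ℤ E)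
    [DiscreteTopology Λ] [IsZLattice ℝ Λ] (μ ν : Measure E) [μ.IsAddHaarMeasure]
    [ν.IsAddHaarMeasure] :
    (ENNReal.ofReal (ZLattice.covolume Λ μ))⁻¹ • μ =
      (ENNReal.ofReal (ZLattice.covolume Λ ν))⁻¹ • ν := by
  have hμ := ZLattice.covolume_eq_measure_fundamentalDomain Λ μ
    (ZLattice.isAddFundamentalDomain (Module.Free.chooseBasis ℤ Λ) μ)
  have hν := ZLattice.covolume_eq_measure_fundamentalDomain Λ ν
    (ZLattice.isAddFundamentalDomain (Module.Free.chooseBasis ℤ Λ) ν)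
  have hs : μ = Measure.addHaarScalarFactor μ ν • ν := Measure.isAddLeftInvariant_eq_smul μ ν
  have hs0 : 0 < Measure.addHaarScalarFactor μ ν :=
    Measure.addHaarScalarFactor_pos_of_isAddHaarMeasure μ ν
  set s := Measure.addHaarScalarFactor μ ν
  have h1 : ZLattice.covolume Λ μ = s * ZLattice.covolume Λ ν := by
    rw [hμ, hν, hs]
    simp [measureReal_def, Measure.smul_apply]
  have hc := ZLattice.covolume_pos Λ ν
  rw [h1, ENNReal.ofReal_mul (NNReal.coe_nonneg s), ENNReal.ofReal_coe_nnreal]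
  conv_lhs => rw [hs]
  have hsE : (s : ℝ≥0∞) ≠ 0 := by exact_mod_cast hs0.ne'
  rw [ENNReal.mul_inv (Or.inl hsE) (Or.inl ENNReal.coe_ne_top)]
  change _ • ((s : ℝ≥0∞) • ν) = _
  rw [smul_smul]
  congr 1
  rw [mul_right_comm, ENNReal.inv_mul_cancel hsE ENNReal.coe_ne_top, one_mul]

end CongruenceLattice

/-! ### Lebesgue measure of a simplex -/

section SimplexMeasure

variable {n : ℕ} {X : Type u} [TopologicalSpace X] [ChartedSpace (Model n) X]
  [IsManifold 𝓘(ℂ, Model n) ω X] {I : Type v} {D : SncDegeneration n X I} [Fintype I]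

namespace SncDegeneration

open scoped Classical in
theorem sum_eq_add_sum_erase {K : Finset I} {i₀ : I} (hi₀ : i₀ ∈ K) (h : I → ℝ) :
    ∑ i ∈ K, h i = h i₀ + ∑ j : {i // i ∈ K.erase i₀}, h j.1 := by
  rw [← Finset.add_sum_erase K h hi₀, Finset.sum_coe_sort (K.erase i₀) h]

open scoped Classical in
variable (D) in
/-- The parametrization of the tangent space of a simplex by the coordinates other than that
of `i₀`. -/
def tangentEquiv {K : Finset I} {i₀ : I} (hi₀ : i₀ ∈ K) :
    ({i // i ∈ K.erase i₀} → ℝ) ≃L[ℝ] D.tangent K :=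
  LinearEquiv.toContinuousLinearEquiv
  { toFun := fun w => ⟨fun i => if h : i ∈ K.erase i₀ then w ⟨i, h⟩ else
        if i = i₀ then -(∑ j, (D.b j.1 : ℝ) * w j) / D.b i₀ else 0, by
      have hb : (D.b i₀ : ℝ) ≠ 0 := by exact_mod_cast D.b_ne_zero i₀
      refine ⟨fun i hi => ?_, ?_⟩
      · have h1 : i ∉ K.erase i₀ := fun h => hi (Finset.mem_of_mem_erase h)
        have h2 : i ≠ i₀ := fun h => hi (h ▸ hi₀)
        simp only
        rw [dif_neg h1, if_neg h2]
      · rw [sum_eq_add_sum_erase hi₀]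
        simp only
        rw [dif_neg (Finset.notMem_erase _ _), if_pos trivial, mul_div_cancel₀ _ hb]
        have : ∀ j : {i // i ∈ K.erase i₀}, (if h : j.1 ∈ K.erase i₀ then w ⟨j.1, h⟩ else
            if j.1 = i₀ then -(∑ j, (D.b j.1 : ℝ) * w j) / D.b i₀ else 0) = w j := fun j => by
          rw [dif_pos j.2]
        simp only [this]
        ring⟩
    invFun := fun v i => (v : I → ℝ) i
    map_add' := by
      intro w w'
      ext i
      simp only [Pi.add_apply, Submodule.coe_add]
      split_ifs
      · rfl
      · simp only [mul_add, Finset.sum_add_distrib]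
        ring
      · simp
    map_smul' := by
      intro c w
      ext i
      simp only [Pi.smul_apply, Submodule.coe_smul, RingHom.id_apply, smul_eq_mul]
      split_ifs
      · rfl
      · rw [mul_div_assoc', mul_neg, Finset.mul_sum]
        congr 2
        exact Finset.sum_congr rfl fun j _ => by ring
      · simp
    left_inv := by
      intro w
      funext i
      simp only
      rw [dif_pos i.2]
    right_inv := by
      intro v
      ext i
      have hb : (D.b i₀ : ℝ) ≠ 0 := by exact_mod_cast D.b_ne_zero i₀
      simp only
      split_ifs with h1 h2
      · rfl
      · subst h2
        have h := v.2.2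
        rw [sum_eq_add_sum_erase hi₀] at h
        rw [div_eq_iff hb]
        linarith
      · refine (v.2.1 i fun hi => h1 (Finset.mem_erase.2 ⟨h2, hi⟩)).symm }

open scoped Classical in
theorem tangentEquiv_apply {K : Finset I} {i₀ : I} (hi₀ : i₀ ∈ K) (w : {i // i ∈ K.erase i₀} → ℝ)
    (i : I) : (D.tangentEquiv hi₀ w : I → ℝ) i = if h : i ∈ K.erase i₀ then w ⟨i, h⟩ else
        if i = i₀ then -(∑ j, (D.b j.1 : ℝ) * w j) / D.b i₀ else 0 := rfl

open scoped Classical in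
/-- In the parametrization of the tangent space of the simplex by the coordinates different from
`i₀`, an integral tangent vector is an integral vector for which the coordinate `i₀`, determined by
`∑ b i * w i = 0`, is an integer as well. -/
theorem lattice_eq_comap {K : Finset I} {i₀ : I} (hi₀ : i₀ ∈ K) :
    D.lattice K = ZLattice.comap ℝ
      (congruenceLattice (fun j : {i // i ∈ K.erase i₀} => D.b j.1) (D.b i₀))
      ((D.tangentEquiv hi₀).symm : D.tangent K ≃L[ℝ] _).toLinearMap := by
  have hb : (D.b i₀ : ℝ) ≠ 0 := by exact_mod_cast D.b_ne_zero i₀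
  ext v
  have hv := v.2.2
  rw [sum_eq_add_sum_erase hi₀] at hv
  constructor
  · intro h
    choose m hm using h
    refine ⟨fun j => m j.1, fun j => hm j.1, -m i₀, ?_⟩
    have : ((∑ j : {i // i ∈ K.erase i₀}, (D.b j.1 : ℤ) * m j.1 : ℤ) : ℝ) =
        ((D.b i₀ * -m i₀ : ℤ) : ℝ) := by
      push_cast
      simp only [← hm]
      linarith
    exact_mod_cast this
  · rintro ⟨m, hm, k, hk⟩ i
    have hm' : ∀ j : {i // i ∈ K.erase i₀}, (v : I → ℝ) j.1 = m j := hm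
    by_cases h1 : i ∈ K.erase i₀
    · exact ⟨m ⟨i, h1⟩, hm' ⟨i, h1⟩⟩
    · by_cases h2 : i = i₀
      · subst h2
        refine ⟨-k, ?_⟩
        simp only [hm'] at hv
        have hk' : ∑ j : {j // j ∈ K.erase i}, (D.b j.1 : ℝ) * m j = D.b i * k := by
          exact_mod_cast hk
        rw [hk', ← mul_add] at hv
        have := (mul_eq_zero.1 hv).resolve_left hb
        push_cast
        linarith
      · exact ⟨0, by simpa using v.2.1 i fun hi => h1 (Finset.mem_erase.2 ⟨h2, hi⟩)⟩

open scoped Classical in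
theorem gcd_eq_bGcd {K : Finset I} {i₀ : I} (hi₀ : i₀ ∈ K) :
    (D.b i₀).gcd (Finset.univ.gcd fun j : {i // i ∈ K.erase i₀} => D.b j.1) = D.bGcd K := by
  have h1 : Finset.univ.gcd (fun j : {i // i ∈ K.erase i₀} => D.b j.1) = (K.erase i₀).gcd D.b := by
    refine Nat.dvd_antisymm (Finset.dvd_gcd fun i hi => ?_) (Finset.dvd_gcd fun j _ => ?_)
    · exact Finset.gcd_dvd (Finset.mem_univ (⟨i, hi⟩ : {i // i ∈ K.erase i₀}))
    · exact Finset.gcd_dvd j.2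
  rw [h1, bGcd]
  conv_rhs => rw [← Finset.insert_erase hi₀, Finset.gcd_insert]
  rfl

open scoped Classical in
/-- The Haar measure on the tangent space normalized by the lattice, in terms of the coordinates
different from `i₀`. -/
theorem tangentMeasure_eq {K : Finset I} {i₀ : I} (hi₀ : i₀ ∈ K) :
    D.tangentMeasure K = ENNReal.ofReal (D.bGcd K / D.b i₀) •
      (volume : Measure ({i // i ∈ K.erase i₀} → ℝ)).map (D.tangentEquiv hi₀) := by
  have hz := isZLattice_congruenceLattice (fun j : {i // i ∈ K.erase i₀} => D.b j.1) (D.b i₀)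
    (D.b_ne_zero i₀)
  have hl := D.lattice_eq_comap hi₀
  have hd : DiscreteTopology (D.lattice K) := by rw [hl]; infer_instance
  have hzl : IsZLattice ℝ (D.lattice K) := by
    refine ⟨?_⟩
    rw [hl]
    exact (instIsZLatticeComap ℝ _ (D.tangentEquiv hi₀).symm).span_top
  have hmp : MeasurePreserving (D.tangentEquiv hi₀).symm
      ((volume : Measure ({i // i ∈ K.erase i₀} → ℝ)).map (D.tangentEquiv hi₀)) volume := by
    refine ⟨(D.tangentEquiv hi₀).symm.continuous.measurable, ?_⟩
    rw [Measure.map_map (D.tangentEquiv hi₀).symm.continuous.measurable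
      (D.tangentEquiv hi₀).continuous.measurable]
    have : (D.tangentEquiv hi₀).symm ∘ (D.tangentEquiv hi₀) = id := by
      funext w; simp
    rw [this, Measure.map_id]
  have hcov : ZLattice.covolume (D.lattice K)
      ((volume : Measure ({i // i ∈ K.erase i₀} → ℝ)).map (D.tangentEquiv hi₀)) =
      D.b i₀ / D.bGcd K := by
    have h := ZLattice.covolume_comap
      (congruenceLattice (fun j : {i // i ∈ K.erase i₀} => D.b j.1) (D.b i₀)) volume _ hmp
    rw [covolume_congruenceLattice _ _ (D.b_ne_zero i₀), D.gcd_eq_bGcd hi₀] at h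
    rw [← h]
    congr 1
  rw [tangentMeasure, covolume_inv_smul_eq (D.lattice K) Measure.addHaar
    ((volume : Measure ({i // i ∈ K.erase i₀} → ℝ)).map (D.tangentEquiv hi₀)), hcov,
    ← ENNReal.ofReal_inv_of_pos, inv_div]
  have hb : 0 < D.b i₀ := D.b_pos i₀
  have hg : 0 < D.bGcd K := Nat.pos_of_ne_zero fun h => hb.ne' (by
    have := (Finset.gcd_eq_zero_iff.1 h) i₀ hi₀
    exact this)
  positivity

open scoped Classical in
theorem simplexParam_apply_erase {K : Finset I} {i₀ : I} (w : {i // i ∈ K.erase i₀} → ℝ)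
    (i : {i // i ∈ K.erase i₀}) : D.simplexParam K i₀ w i.1 = w i := by
  simp only [simplexParam]
  rw [dif_pos i.2]

open scoped Classical in
theorem continuous_simplexParam (K : Finset I) (i₀ : I) : Continuous (D.simplexParam K i₀) := by
  refine continuous_pi fun i => ?_
  unfold simplexParam
  split_ifs <;> fun_prop

open scoped Classical in
theorem simplexParam_mem_simplex_iff {K : Finset I} {i₀ : I} (hi₀ : i₀ ∈ K)
    (w : {i // i ∈ K.erase i₀} → ℝ) : D.simplexParam K i₀ w ∈ D.simplex K ↔
      (∀ i, 0 ≤ w i) ∧ ∑ j, (D.b j.1 : ℝ) * w j ≤ 1 := by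
  have hb : (0 : ℝ) < D.b i₀ := by exact_mod_cast D.b_pos i₀
  have h0 : D.simplexParam K i₀ w i₀ = (1 - ∑ j, (D.b j.1 : ℝ) * w j) / D.b i₀ := by
    simp [simplexParam]
  constructor
  · rintro ⟨h1, -, -⟩
    refine ⟨fun i => ?_, ?_⟩
    · rw [← simplexParam_apply_erase (D := D) w i]; exact h1 _
    · have := h1 i₀
      rw [h0, le_div_iff₀ hb] at this
      linarith
  · rintro ⟨h1, h2⟩
    refine ⟨fun i => ?_, fun i hi => ?_, ?_⟩
    · unfold simplexParam
      split_ifs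
      · exact h1 _
      · exact div_nonneg (by linarith) hb.le
      · exact le_rfl
    · have h3 : i ∉ K.erase i₀ := fun h => hi (Finset.mem_of_mem_erase h)
      have h4 : i ≠ i₀ := fun h => hi (h ▸ hi₀)
      simp only [simplexParam]
      rw [dif_neg h3, if_neg h4]
    · rw [sum_eq_add_sum_erase hi₀, h0, mul_div_cancel₀ _ hb.ne']
      simp only [simplexParam_apply_erase]
      ring

theorem measurableSet_simplex (K : Finset I) : MeasurableSet (D.simplex K) :=
  (D.isClosed_simplex K).measurableSet

open scoped Classical in
/-- The boundary of the simplex is a null set. -/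
theorem ae_openSimplex {K : Finset I} {i₀ : I} (hi₀ : i₀ ∈ K) :
    (D.simplexParam K i₀ ⁻¹' D.simplex K : Set _) =ᵐ[volume] D.openSimplex K i₀ := by
  have h1 : ∀ᵐ w : {i // i ∈ K.erase i₀} → ℝ, ∀ i, w i ≠ 0 := by
    refine ae_all_iff.2 fun i => ?_
    rw [ae_iff]
    simp only [not_not]
    let P : Submodule ℝ ({i // i ∈ K.erase i₀} → ℝ) := LinearMap.ker (LinearMap.proj i)
    have : {w : {i // i ∈ K.erase i₀} → ℝ | w i = 0} = (P : Set _) := by ext; simp [P]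
    rw [this]
    refine Measure.addHaar_submodule _ _ fun htop => ?_
    have : (fun _ => 1 : {i // i ∈ K.erase i₀} → ℝ) ∈ P := by rw [htop]; trivial
    simp [P] at this
  have h2 : ∀ᵐ w : {i // i ∈ K.erase i₀} → ℝ, ∑ j, (D.b j.1 : ℝ) * w j ≠ 1 := by
    rw [ae_iff]
    simp only [not_not]
    let ℓ : ({i // i ∈ K.erase i₀} → ℝ) →ₗ[ℝ] ℝ := ∑ j, (D.b j.1 : ℝ) • LinearMap.proj j
    have hℓ : ∀ u, ℓ u = ∑ j, (D.b j.1 : ℝ) * u j := fun u => by simp [ℓ]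
    by_cases h0 : ∃ u₀, ℓ u₀ = 1
    · obtain ⟨u₀, hu₀⟩ := h0
      have h : {u : {i // i ∈ K.erase i₀} → ℝ | ∑ j, (D.b j.1 : ℝ) * u j = 1} =
          (fun u => -u₀ + u) ⁻¹' (LinearMap.ker ℓ : Set _) := by
        ext u
        simp only [mem_ofPred_eq, ← hℓ, mem_preimage, SetLike.mem_coe, LinearMap.mem_ker, map_add,
          map_neg, hu₀]
        constructor <;> intro h <;> linarith
      rw [h, measure_preimage_add]
      refine Measure.addHaar_submodule _ _ fun htop => ?_
      have : u₀ ∈ LinearMap.ker ℓ := by rw [htop]; trivial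
      rw [LinearMap.mem_ker, hu₀] at this
      exact one_ne_zero this
    · have h : {u : {i // i ∈ K.erase i₀} → ℝ | ∑ j, (D.b j.1 : ℝ) * u j = 1} = ∅ := by
        ext u
        simp only [mem_ofPred_eq, mem_empty_iff_false, iff_false]
        exact fun h => h0 ⟨u, (hℓ u).trans h⟩
      rw [h, measure_empty]
  filter_upwards [h1, h2] with w hw hw'
  refine propext ?_
  change D.simplexParam K i₀ w ∈ D.simplex K ↔ _ ∧ _
  rw [simplexParam_mem_simplex_iff hi₀]
  exact and_congr (forall_congr' fun i => ⟨fun h => lt_of_le_of_ne h (hw i).symm, le_of_lt⟩)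
    ⟨fun h => lt_of_le_of_ne h hw', le_of_lt⟩

open scoped Classical in
/-- The normalized Lebesgue measure of a simplex, in the coordinates other than that of `i₀`. -/
theorem map_simplexMeasure {K : Finset I} {i₀ : I} (hi₀ : i₀ ∈ K) :
    (D.simplexMeasure K).map Subtype.val = ENNReal.ofReal (D.bGcd K / D.b i₀) •
      (volume.restrict (D.openSimplex K i₀)).map (D.simplexParam K i₀) := by
  have hcont := (D.continuous_simplexParam K i₀).measurable
  have hval : Measurable fun v : D.tangent K => D.barycentre K + (v : I → ℝ) :=
    measurable_subtype_coe.const_add _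
  have hb : (D.b i₀ : ℝ) ≠ 0 := by exact_mod_cast D.b_ne_zero i₀
  have hcard : (K.card : ℝ) ≠ 0 := by exact_mod_cast (Finset.card_pos.2 ⟨i₀, hi₀⟩).ne'
  -- the barycentre lies on the affine span of the simplex
  have hbary : ∑ i ∈ K, (D.b i : ℝ) * D.barycentre K i = 1 := by
    have : ∀ i ∈ K, (D.b i : ℝ) * D.barycentre K i = (K.card : ℝ)⁻¹ := by
      intro i hi
      have hbi : (D.b i : ℝ) ≠ 0 := by exact_mod_cast D.b_ne_zero i
      simp only [barycentre, hi, if_true]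
      field_simp
    rw [Finset.sum_congr rfl this, Finset.sum_const, nsmul_eq_mul, mul_inv_cancel₀ hcard]
  let w₀ : {i // i ∈ K.erase i₀} → ℝ := fun i => D.barycentre K i
  have hparam : ∀ w, D.barycentre K + (D.tangentEquiv hi₀ w : I → ℝ) =
      D.simplexParam K i₀ (w₀ + w) := by
    intro w
    funext i
    rw [Pi.add_apply, tangentEquiv_apply]
    unfold simplexParam
    split_ifs with h1 h2
    · rfl
    · subst h2
      rw [sum_eq_add_sum_erase hi₀] at hbary
      rw [eq_div_iff hb, add_mul, div_mul_cancel₀ _ hb]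
      simp only [Pi.add_apply, mul_add, Finset.sum_add_distrib, w₀]
      linarith
    · have : i ∉ K := fun hi => h1 (Finset.mem_erase.2 ⟨h2, hi⟩)
      simp [barycentre, this]
  rw [simplexMeasure, map_comap_subtype_coe (D.measurableSet_simplex K), tangentMeasure_eq hi₀,
    Measure.map_smul, Measure.map_map hval (D.tangentEquiv hi₀).continuous.measurable,
    Measure.restrict_smul]
  have hcomp : (fun v : D.tangent K => D.barycentre K + (v : I → ℝ)) ∘ (D.tangentEquiv hi₀) =
      D.simplexParam K i₀ ∘ fun w => w₀ + w := funext fun w => hparam w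
  rw [hcomp, ← Measure.map_map hcont (measurable_const_add w₀), map_add_left_eq_self,
    Measure.restrict_map hcont (D.measurableSet_simplex K),
    Measure.restrict_congr_set (D.ae_openSimplex hi₀)]

open scoped Classical in
theorem measurableEmbedding_simplexParam {K : Finset I} {i₀ : I} :
    MeasurableEmbedding (D.simplexParam K i₀) := by
  have h : Function.LeftInverse (fun (x : I → ℝ) (i : {i // i ∈ K.erase i₀}) => x i)
      (D.simplexParam K i₀) := fun w => funext fun i => simplexParam_apply_erase w i
  exact (h.isClosedEmbedding (by fun_prop) (D.continuous_simplexParam K i₀)).measurableEmbedding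

open scoped Classical in
theorem measurableSet_openSimplex (K : Finset I) (i₀ : I) :
    MeasurableSet (D.openSimplex K i₀) := by
  have : D.openSimplex K i₀ = (⋂ i, {w | 0 < w i}) ∩ {w | ∑ j, (D.b j.1 : ℝ) * w j < 1} := by
    ext w; simp [openSimplex]
  rw [this]
  exact (MeasurableSet.iInter fun i => measurableSet_lt measurable_const (measurable_pi_apply i)).inter
    (measurableSet_lt (by fun_prop) measurable_const)

open scoped Classical in
/-- Integrals over the simplex in terms of the coordinates different from `i₀`; the factor is the
inverse of the covolume of the lattice in these coordinates. -/
theorem integral_simplexMeasure {K : Finset I} {i₀ : I} (hi₀ : i₀ ∈ K) (φ : (I → ℝ) → ℝ) :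
    ∫ w : D.simplex K, φ w ∂(D.simplexMeasure K) = (D.bGcd K / D.b i₀ : ℝ) *
      ∫ w, (D.openSimplex K i₀).indicator (fun w => φ (D.simplexParam K i₀ w)) w := by
  rw [← (MeasurableEmbedding.subtype_coe (D.measurableSet_simplex K)).integral_map φ,
    map_simplexMeasure hi₀, integral_smul_measure, measurableEmbedding_simplexParam.integral_map,
    integral_indicator (D.measurableSet_openSimplex K i₀), ENNReal.toReal_ofReal (by positivity),
    smul_eq_mul]

open scoped Classical in
theorem volume_openSimplex_lt_top (K : Finset I) (i₀ : I) :
    volume (D.openSimplex K i₀) < ⊤ := by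
  refine lt_of_le_of_lt (measure_mono (t := Icc 0 1) ?_) measure_Icc_lt_top
  rintro w ⟨h1, h2⟩
  refine ⟨fun i => (h1 i).le, fun i => ?_⟩
  have hb : (1 : ℝ) ≤ D.b i.1 := by exact_mod_cast D.b_pos i.1
  have h3 : (D.b i.1 : ℝ) * w i ≤ ∑ j, (D.b j.1 : ℝ) * w j :=
    Finset.single_le_sum (f := fun j : {i // i ∈ K.erase i₀} => (D.b j.1 : ℝ) * w j)
      (fun j _ => mul_nonneg (Nat.cast_nonneg _) (h1 j).le) (Finset.mem_univ i)
  have h4 := le_mul_of_one_le_left (h1 i).le hb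
  simp only [Pi.one_apply]
  linarith

open scoped Classical in
theorem volume_openSimplex_pos (K : Finset I) (i₀ : I) :
    0 < volume (D.openSimplex K i₀) := by
  have hopen : IsOpen (D.openSimplex K i₀) := by
    have : D.openSimplex K i₀ = (⋂ i, {w | 0 < w i}) ∩ {w | ∑ j, (D.b j.1 : ℝ) * w j < 1} := by
      ext w; simp [openSimplex]
    rw [this]
    exact (isOpen_iInter_of_finite fun i => isOpen_lt continuous_const (continuous_apply i)).inter
      (isOpen_lt (by fun_prop) continuous_const)
  refine hopen.measure_pos _ ?_
  set s := ∑ j : {i // i ∈ K.erase i₀}, (D.b j.1 : ℝ)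
  have hs : 0 ≤ s := Finset.sum_nonneg fun j _ => Nat.cast_nonneg _
  refine ⟨fun _ => (s + 1)⁻¹, fun i => by positivity, ?_⟩
  rw [← Finset.sum_mul]
  change s * (s + 1)⁻¹ < 1
  rw [← div_eq_mul_inv, div_lt_one (by positivity)]
  linarith

theorem isFiniteMeasure_simplexMeasure {K : Finset I} (hK : K.Nonempty) :
    IsFiniteMeasure (D.simplexMeasure K) := by
  classical
  obtain ⟨i₀, hi₀⟩ := hK
  refine ⟨?_⟩
  have h := congrArg (fun m => m univ) (map_simplexMeasure (D := D) hi₀)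
  simp only [Measure.smul_apply, smul_eq_mul] at h
  rw [Measure.map_apply measurable_subtype_coe MeasurableSet.univ,
    Measure.map_apply (D.continuous_simplexParam K i₀).measurable MeasurableSet.univ] at h
  simp only [preimage_univ, Measure.restrict_apply_univ] at h
  rw [h]
  exact ENNReal.mul_lt_top ENNReal.ofReal_lt_top (D.volume_openSimplex_lt_top K i₀)

end SncDegeneration
end SimplexMeasure

/-! ### Functions on the hybrid space -/

section LocalHybrid

variable {n : ℕ} {X : Type u} [TopologicalSpace X] [ChartedSpace (Model n) X]
  [IsManifold 𝓘(ℂ, Model n) ω X] {I : Type v} {D : SncDegeneration n X I}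
  [MeasurableSpace X] [BorelSpace X]

open CanonicalExtension (MonomialChart FibreChart SliceIndex slicePoint sliceDomain)

namespace SncDegeneration

open scoped Classical in
/-- A function on the hybrid space, as a function on the total space vanishing on the zero fibre. -/
def onTotal (F : D.Hybrid → ℝ) (x : X) : ℝ :=
  if h : x ∈ D.generic then F (D.ofGeneric ⟨x, h⟩) else 0

theorem onTotal_of_mem (F : D.Hybrid → ℝ) (x : D.generic) :
    onTotal F (x : X) = F (D.ofGeneric x) := by
  simp [onTotal]

theorem measurable_onTotal {F : D.Hybrid → ℝ} (hF : Continuous F) : Measurable (onTotal F) := by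
  classical
  exact Measurable.dite (hF.comp D.continuous_ofGeneric).measurable measurable_const
    D.isOpen_generic.measurableSet

variable [Fintype I]

open scoped Classical in
/-- A function on the simplex of a stratum, extended by zero. -/
def onSimplex (F : D.Hybrid → ℝ) (Y : D.Stratum) (w : I → ℝ) : ℝ :=
  if h : w ∈ D.simplex Y.J then F (D.ofDual (D.ofSimplex Y ⟨w, h⟩)) else 0

variable {L : X → Type*} [TopologicalSpace (TotalSpace ℂ L)] [∀ x, AddCommGroup (L x)]
  [∀ x, Module ℂ (L x)] [∀ x, TopologicalSpace (L x)] [FiberBundle ℂ L] [VectorBundle ℂ ℂ L]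
  (ℒ : CanonicalExtension L D) (ψ : ContinuousMetric L)

/-- The integral of a function of the points of the slice `z_i = 0`, `i ∈ K`, with respect to the
limit of the densities of the fibres. -/
def sliceIntegral (a : I → ℚ) (c : D.Chart) (K : Finset I) (χ : X → ℝ) : ℝ :=
  ∫ y, (sliceDomain c K).indicator (fun y => χ (slicePoint c K y) *
    (ℒ.genNormExt ψ a c (slicePoint c K y) * c.weight a K (c.sliceVec K y))) y

/-- A point of an adapted polydisc which lies on the components with index in `K` and on no other
one is an interior point of the stratum of the centre. -/
theorem IsBox.isInterior {c : D.Chart} {a : I → ℚ} {K : Finset I} {i₀ : I} {p : X} {r : ℝ}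
    (hB : IsBox c a K i₀ (c.z p) r) (hp : p ∈ c.z.source) {Y : D.Stratum} (hYK : Y.J = K)
    (hpY : p ∈ Y.carrier) {y : Model n} (hy : y ∈ Metric.closedBall (c.z p) r)
    (h0 : ∀ i ∈ K, y (c.k i) = 0) (h1 : ∀ i ∈ c.J, i ∉ K → y (c.k i) ≠ 0) :
    IsInterior Y (c.z.symm y) := by
  have hyt := hB.closedBall_subset hy
  have hξ : c.z.symm y ∈ c.z.source := c.z.map_target hyt
  have hmem : ∀ i, c.z.symm y ∈ D.E i ↔ i ∈ K := by
    intro i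
    rw [c.isSnc.mem_iff _ hξ, c.z.right_inv hyt]
    constructor
    · rintro ⟨hi, hi0⟩
      by_contra hiK
      exact h1 i hi hiK hi0
    · exact fun hi => ⟨hB.subset hi, h0 i hi⟩
  refine ⟨?_, fun i => by rw [hmem, hYK]⟩
  rw [Y.carrier_eq hpY]
  refine c.mem_component hp hB.closedBall_subset (Y.carrier_subset hpY) hξ ?_ ?_
  · rwa [c.z.right_inv hyt]
  · intro i hi
    rw [hYK] at hi
    exact (hmem i).2 hi

theorem exists_bound_mul_onTotal {χ : X → ℝ} (hχ1 : ∀ x, |χ x| ≤ 1) {F : D.Hybrid → ℝ}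
    (hF : Continuous F) :
    ∃ M, ∃ δ > 0, δ < 1 ∧ ∀ x, ‖D.proj x‖ < δ → |χ x * onTotal F x| ≤ M := by
  obtain ⟨M, δ, hδ, hδ1, hM⟩ := exists_bound F hF
  refine ⟨max M 0, δ, hδ, hδ1, fun x hx => ?_⟩
  rw [abs_mul]
  refine (mul_le_mul (hχ1 x) (?_ : _ ≤ max M 0) (abs_nonneg _) zero_le_one).trans (one_mul _).le
  by_cases hg : x ∈ D.generic
  · rw [onTotal_of_mem F ⟨x, hg⟩]
    exact (hM ⟨x, hg⟩ hx.le).trans (le_max_left _ _)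
  · simp [onTotal, hg]

theorem eventually_integrable_mul_onTotal [T2Space X] [SecondCountableTopology X] {χ : X → ℝ}
    (hχ : Continuous χ) (hχ1 : ∀ x, |χ x| ≤ 1) {F : D.Hybrid → ℝ} (hF : Continuous F) :
    ∀ᶠ t in 𝓝[≠] (0 : ℂ), Integrable (fun x => χ x * onTotal F x) (ℒ.fibreMeasure ψ t) := by
  obtain ⟨M, δ, hδ, hδ1, hgM⟩ := exists_bound_mul_onTotal hχ1 hF
  have hsmall : ∀ᶠ t : ℂ in 𝓝[≠] 0, ‖t‖ < δ :=
    nhdsWithin_le_nhds (by simpa [Metric.ball, dist_eq_norm] using Metric.ball_mem_nhds (0 : ℂ) hδ)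
  filter_upwards [hsmall, self_mem_nhdsWithin] with t ht ht0
  have := ℒ.isFiniteMeasure_fibreMeasure ψ (t := t) ht0 (ht.trans hδ1)
  refine Integrable.of_bound
    (hχ.measurable.mul (measurable_onTotal hF)).aestronglyMeasurable M ?_
  have hae : ∀ᵐ x ∂(ℒ.fibreMeasure ψ t), D.proj x = t := by
    rw [ae_iff]; exact ℒ.fibreMeasure_compl ψ t
  filter_upwards [hae] with x hx
  exact hgM x (by rwa [hx])

/-- The local limit for a continuous function on the hybrid space multiplied by a cutoff function:
the limit is the product of the integral over the simplex of the stratum and of the integral of the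
cutoff function over the stratum. -/
theorem tendsto_integral_box_hybrid [T2Space X] [SecondCountableTopology X]
    {a : I → ℚ} (ha : ℒ.IsDecomposition a) (c : MonomialChart D)
    {K : Finset I} {i₀ : I} {p : X} {r : ℝ} (hB : IsBox c.1 a K i₀ (c.1.z p) r)
    (hp : p ∈ c.1.z.source) {Y : D.Stratum} (hYK : Y.J = K) (hpY : p ∈ Y.carrier)
    {χ : X → ℝ} (hχ : Continuous χ) (hχ1 : ∀ x, |χ x| ≤ 1)
    (hχ0 : ∀ x, ¬(x ∈ c.1.z.source ∧ c.1.z x ∈ Metric.closedBall (c.1.z p) r) → χ x = 0)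
    {F : D.Hybrid → ℝ} (hF : Continuous F) :
    Tendsto (fun t : ℂ => ((-Real.log ‖t‖) ^ (K.card - 1))⁻¹ *
      ((‖t‖ ^ (2 * D.kappaMin a))⁻¹ * ∫ x, χ x * onTotal F x ∂(ℒ.fibreMeasure ψ t))) (𝓝[≠] 0)
      (𝓝 ((2 * Real.pi) ^ (K.card - 1) * ((D.bGcd K : ℝ)⁻¹ *
        (∫ w : D.simplex Y.J, F (D.ofDual (D.ofSimplex Y w)) ∂(D.simplexMeasure Y.J)) *
        sliceIntegral ℒ ψ a c.1 K χ))) := by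
  classical
  have hKne : K.Nonempty := ⟨i₀, hB.mem⟩
  obtain ⟨M, δ, hδ, -, hgM⟩ := exists_bound_mul_onTotal hχ1 hF
  have hgm : Measurable fun x => χ x * onTotal F x := hχ.measurable.mul (measurable_onTotal hF)
  have hint := eventually_integrable_mul_onTotal ℒ ψ hχ hχ1 hF
  have hmain := tendsto_integral_box ℒ ψ ha c hB hgm hδ hgM hint
    (fun x hx => by rw [hχ0 x hx, zero_mul])
    (fun y w => χ (c.1.z.symm y) * onSimplex F Y w) ?_
  · rw [card_logSet c.1 hB.subset hB.mem] at hmain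
    refine hmain.trans (le_of_eq ?_)
    congr 1
    have h1 := integral_limDom c.1 hB.subset hB.mem (onSimplex F Y) fun y =>
      χ (c.1.z.symm y) * (ℒ.genNormExt ψ a c.1 (c.1.z.symm y) * c.1.weight a K y)
    have h2 : (fun v => (c.1.limDom K i₀).indicator (fun v =>
        (fun y w => χ (c.1.z.symm y) * onSimplex F Y w) (c.1.limPoint i₀ (c.1.logSet K i₀) v)
          (c.1.limLog K i₀ (c.1.logSet K i₀) v) *
        (ℒ.genNormExt ψ a c.1 (c.1.z.symm (c.1.limPoint i₀ (c.1.logSet K i₀) v)) *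
          c.1.weight a K (c.1.limPoint i₀ (c.1.logSet K i₀) v))) v) =
        fun v => (c.1.limDom K i₀).indicator (fun v =>
        onSimplex F Y (c.1.limLog K i₀ (c.1.logSet K i₀) v) *
        (fun y => χ (c.1.z.symm y) * (ℒ.genNormExt ψ a c.1 (c.1.z.symm y) * c.1.weight a K y))
          (c.1.limPoint i₀ (c.1.logSet K i₀) v)) v := by
      funext v
      simp only [indicator_apply]
      split_ifs
      · ring
      · rfl
    rw [h2, h1]
    have h3 := integral_simplexMeasure (D := D) hB.mem (onSimplex F Y)
    have h4 : ∫ w : D.simplex K, onSimplex F Y w ∂(D.simplexMeasure K) =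
        ∫ w : D.simplex Y.J, F (D.ofDual (D.ofSimplex Y w)) ∂(D.simplexMeasure Y.J) := by
      subst hYK
      refine integral_congr_ae (Eventually.of_forall fun w => ?_)
      simp [onSimplex]
    rw [h4] at h3
    have hb : (D.b i₀ : ℝ) ≠ 0 := by exact_mod_cast D.b_ne_zero i₀
    have hg : (D.bGcd K : ℝ) ≠ 0 := by
      exact_mod_cast fun h => D.b_ne_zero i₀ ((Finset.gcd_eq_zero_iff.1 h) i₀ hB.mem)
    rw [h3]
    change _ * (_ * _ * sliceIntegral ℒ ψ a c.1 K χ) = _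
    field_simp
  · intro y hy h0 h1 w hw x hxt hx hlog
    have hξ : c.1.z.symm y ∈ c.1.z.source := c.1.z.map_target hy
    have hχx : Tendsto (fun t => χ (x t)) (𝓝[≠] 0) (𝓝 (χ (c.1.z.symm y))) :=
      (hχ.tendsto _).comp hx
    by_cases hyb : y ∈ Metric.closedBall (c.1.z p) r
    · refine hχx.mul ?_
      have hY := hB.isInterior hp hYK hpY hyb h0 h1
      have hgen : ∀ᶠ t in 𝓝[≠] (0 : ℂ), x t ∈ D.generic := by
        filter_upwards [hxt, self_mem_nhdsWithin] with t ht ht0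
        change D.proj (x t) ≠ 0
        rwa [ht]
      obtain ⟨t₀, ht₀⟩ := hgen.exists
      let x' : ℂ → D.generic := fun t => if h : x t ∈ D.generic then ⟨x t, h⟩ else ⟨x t₀, ht₀⟩
      have hx' : ∀ᶠ t in 𝓝[≠] (0 : ℂ), (x' t : X) = x t := by
        filter_upwards [hgen] with t ht
        simp [x', ht]
      subst hYK
      have h5 := tendsto_ofDual (c := c) hξ hY ⟨w, hw⟩ x' (hx.congr' (hx'.mono fun t ht => ht.symm))
        (fun i hi => (hlog i hi).congr' (by
          filter_upwards [hx', hxt] with t ht ht'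
          rw [ht, ht']))
      have h6 := (hF.tendsto _).comp h5
      have h7 : onSimplex F Y w = F (D.ofDual (D.ofSimplex Y ⟨w, hw⟩)) := by simp [onSimplex, hw]
      rw [h7]
      refine h6.congr' ?_
      filter_upwards [hx'] with t ht
      rw [← ht, onTotal_of_mem]
      rfl
    · have h8 : χ (c.1.z.symm y) = 0 := hχ0 _ fun h => hyb (by
        have h2 := h.2
        rwa [c.1.z.right_inv hy] at h2)
      simp only [h8, zero_mul]
      refine tendsto_const_nhds.congr' ?_
      have h9 : Tendsto (fun t => c.1.z (x t)) (𝓝[≠] 0) (𝓝 y) := by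
        have := (c.1.z.continuousAt hξ).tendsto.comp hx
        rwa [c.1.z.right_inv hy] at this
      filter_upwards [h9.eventually (Metric.isClosed_closedBall.isOpen_compl.mem_nhds hyb)] with t ht
      rw [hχ0 (x t) fun h => ht h.2, zero_mul]

end SncDegeneration
end LocalHybrid

/-! ### Residual measures in an adapted chart -/

section Residual

variable {n : ℕ} {X : Type u} [TopologicalSpace X] [ChartedSpace (Model n) X]
  [IsManifold 𝓘(ℂ, Model n) ω X] {I : Type v} {D : SncDegeneration n X I} [Fintype I]
  [MeasurableSpace X] [BorelSpace X]

open CanonicalExtension (MonomialChart FibreChart SliceIndex slicePoint sliceDomain)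

namespace SncDegeneration

theorem continuous_sliceVec (c : D.Chart) (K : Finset I) : Continuous (c.sliceVec K) := by
  classical
  refine continuous_pi fun j => ?_
  by_cases h : j ∉ K.image c.k
  · simp only [Chart.sliceVec, h, not_false_eq_true, dite_true]
    exact continuous_apply _
  · simp only [Chart.sliceVec, h, dite_false]
    exact continuous_const

theorem isOpen_sliceDomain (c : D.Chart) (K : Finset I) : IsOpen (sliceDomain c K) :=
  c.z.open_target.preimage (continuous_sliceVec c K)

theorem continuousOn_slicePoint (c : D.Chart) (K : Finset I) :
    ContinuousOn (slicePoint c K) (sliceDomain c K) :=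
  c.z.symm.continuousOn.comp (continuous_sliceVec c K).continuousOn fun _ hy => hy

theorem slicePoint_mem (c : D.Chart) (K : Finset I) {y : SliceIndex c K → ℂ}
    (hy : y ∈ sliceDomain c K) : slicePoint c K y ∈ c.z.source := c.z.map_target hy

theorem coord_slicePoint (c : D.Chart) (K : Finset I) {y : SliceIndex c K → ℂ}
    (hy : y ∈ sliceDomain c K) : c.z (slicePoint c K y) = c.sliceVec K y := c.z.right_inv hy

theorem sliceVec_eq_zero (c : D.Chart) {K : Finset I} (y : SliceIndex c K → ℂ) {i : I}
    (hi : i ∈ K) : c.sliceVec K y (c.k i) = 0 := by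
  classical
  simp only [Chart.sliceVec]
  rw [dif_neg]
  exact not_not.2 (Finset.mem_image_of_mem _ hi)

theorem sliceVec_apply (c : D.Chart) {K : Finset I} (y : SliceIndex c K → ℂ)
    (s : SliceIndex c K) : c.sliceVec K y s.1 = y s := by
  classical
  simp only [Chart.sliceVec]
  rw [dif_pos s.2]

theorem exists_sliceVec_eq (c : D.Chart) {K : Finset I} {p : Model n}
    (hp : ∀ i ∈ K, p (c.k i) = 0) : c.sliceVec K (fun s => p s.1) = p := by
  classical
  funext j
  by_cases h : j ∉ K.image c.k
  · exact sliceVec_apply c _ ⟨j, h⟩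
  · obtain ⟨i, hi, rfl⟩ := Finset.mem_image.1 (not_not.1 h)
    rw [sliceVec_eq_zero c _ hi, hp i hi]

theorem slicePoint_mem_inter (c : D.Chart) {K : Finset I} (hK : K ⊆ c.J)
    {y : SliceIndex c K → ℂ} (hy : y ∈ sliceDomain c K) : slicePoint c K y ∈ D.inter K := by
  intro i hi
  rw [c.isSnc.mem_iff _ (slicePoint_mem c K hy), coord_slicePoint c K hy]
  exact ⟨hK hi, sliceVec_eq_zero c y hi⟩

theorem IsBox.slicePoint_mem_carrier {c : D.Chart} {a : I → ℚ} {K : Finset I} {i₀ : I} {p : X}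
    {r : ℝ} (hB : IsBox c a K i₀ (c.z p) r) (hp : p ∈ c.z.source) {Y : D.Stratum} (hYK : Y.J = K)
    (hpY : p ∈ Y.carrier) {y : SliceIndex c K → ℂ} (hy : y ∈ sliceDomain c K)
    (hyr : c.sliceVec K y ∈ Metric.closedBall (c.z p) r) : slicePoint c K y ∈ Y.carrier := by
  subst hYK
  rw [Y.carrier_eq hpY]
  refine c.mem_component hp hB.closedBall_subset (Y.carrier_subset hpY) (slicePoint_mem c _ hy) ?_
    (slicePoint_mem_inter c hB.subset hy)
  rwa [coord_slicePoint c _ hy]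

theorem weight_eq_of_gam_eq_zero (c : D.Chart) {a : I → ℚ} {K : Finset I}
    (h0 : ∀ i ∈ K, D.gam a i = 0) [DecidableEq I] (w : Model n) :
    c.weight a K w = ∏ i ∈ c.J \ K, ‖w (c.k i)‖ ^ (2 * (D.gam a i - 1)) := by
  rw [Chart.weight, Finset.prod_eq_one fun i hi => by rw [h0 i hi, mul_zero, Real.rpow_zero], one_mul]
  congr!

/-- On the stratum, the weight vanishes if some index in `K` has a positive exponent. -/
theorem weight_sliceVec_eq_zero (c : D.Chart) {a : I → ℚ} {K : Finset I} {i : I} (hi : i ∈ K)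
    (h0 : D.gam a i ≠ 0) (y : SliceIndex c K → ℂ) : c.weight a K (c.sliceVec K y) = 0 := by
  rw [Chart.weight, Finset.prod_eq_zero hi, zero_mul]
  rw [sliceVec_eq_zero c y hi, norm_zero, Real.zero_rpow (mul_ne_zero two_ne_zero h0)]

variable {L : X → Type*} [TopologicalSpace (TotalSpace ℂ L)] [∀ x, AddCommGroup (L x)]
  [∀ x, Module ℂ (L x)] [∀ x, TopologicalSpace (L x)] [FiberBundle ℂ L] [VectorBundle ℂ ℂ L]
  (ℒ : CanonicalExtension L D) (ψ : ContinuousMetric L)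

/-- Adapted polydiscs of faces which do not belong to the subcomplex of minimal `κ` do not
contribute to the limit. -/
theorem sliceIntegral_eq_zero {a : I → ℚ} (c : D.Chart) {K : Finset I} {i : I} (hi : i ∈ K)
    (h0 : D.gam a i ≠ 0) (χ : X → ℝ) : sliceIntegral ℒ ψ a c K χ = 0 := by
  simp [sliceIntegral, weight_sliceVec_eq_zero c hi h0]

/-- The density of the residual measure in the coordinates of a slice. -/
def sliceDensity (a : I → ℚ) (c : D.Chart) (K : Finset I) (y : SliceIndex c K → ℂ) : ℝ :=
  ℒ.genNormExt ψ a c (slicePoint c K y) * c.weight a K (c.sliceVec K y)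

theorem sliceDensity_nonneg {a : I → ℚ} (ha : ℒ.IsDecomposition a) (c : D.Chart) (K : Finset I)
    {y : SliceIndex c K → ℂ} (hy : y ∈ sliceDomain c K) : 0 ≤ sliceDensity ℒ ψ a c K y :=
  mul_nonneg ((ℒ.genNormExt_spec ψ ha c).2.1 _ (slicePoint_mem c K hy)).le (c.weight_nonneg a K _)

theorem aemeasurable_sliceDensity {a : I → ℚ} (ha : ℒ.IsDecomposition a) (c : D.Chart)
    (K : Finset I) : AEMeasurable (sliceDensity ℒ ψ a c K) (volume.restrict (sliceDomain c K)) :=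
  (aemeasurable_of_continuousOn (isOpen_sliceDomain c K).measurableSet
    ((ℒ.genNormExt_spec ψ ha c).1.comp (continuousOn_slicePoint c K)
      fun _ hy => slicePoint_mem c K hy)).mul
    ((measurable_weight a).comp (continuous_sliceVec c K).measurable).aemeasurable

variable {Y : D.Stratum}

theorem gam_eq_zero_of_isMinFace {a : I → ℚ} (hY : D.IsMinFace a Y) {i : I} (hi : i ∈ Y.J) :
    D.gam a i = 0 := (D.gam_eq_zero_iff a i).2 (hY i hi)

theorem localResMeasure_eq {a : I → ℚ} (hY : D.IsMinFace a Y) (c : MonomialChart D) :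
    ℒ.localResMeasure ψ a Y c = (((volume.restrict (sliceDomain c.1 Y.J)).withDensity fun y =>
      ENNReal.ofReal (sliceDensity ℒ ψ a c.1 Y.J y)).map (slicePoint c.1 Y.J)).restrict Y.carrier := by
  classical
  unfold CanonicalExtension.localResMeasure
  congr 2
  refine withDensity_congr_ae ?_
  filter_upwards [ae_restrict_mem (isOpen_sliceDomain c.1 Y.J).measurableSet] with y hy
  rw [sliceDensity, weight_eq_of_gam_eq_zero c.1 fun i hi => gam_eq_zero_of_isMinFace hY hi,
    coord_slicePoint c.1 _ hy]
  unfold CanonicalExtension.genNormExt gam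
  congr!

theorem localResMeasure_apply {a : I → ℚ} (hY : D.IsMinFace a Y) (c : MonomialChart D) {A : Set X}
    (hA : MeasurableSet A) : ℒ.localResMeasure ψ a Y c A =
      ∫⁻ y in sliceDomain c.1 Y.J ∩ slicePoint c.1 Y.J ⁻¹' (A ∩ Y.carrier),
        ENNReal.ofReal (sliceDensity ℒ ψ a c.1 Y.J y) := by
  classical
  rw [localResMeasure_eq ℒ ψ hY c, Measure.restrict_apply hA,
    map_withDensity_apply _ (isOpen_sliceDomain c.1 Y.J).measurableSet
      (continuousOn_slicePoint c.1 Y.J) _ (hA.inter Y.isClosed_carrier.measurableSet)]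

theorem localResMeasure_compl_source {a : I → ℚ} (hY : D.IsMinFace a Y) (c : MonomialChart D) :
    ℒ.localResMeasure ψ a Y c c.1.z.sourceᶜ = 0 := by
  rw [localResMeasure_apply ℒ ψ hY c c.1.z.open_source.measurableSet.compl]
  have : sliceDomain c.1 Y.J ∩ slicePoint c.1 Y.J ⁻¹' (c.1.z.sourceᶜ ∩ Y.carrier) = ∅ := by
    rw [eq_empty_iff_forall_notMem]
    exact fun y hy => hy.2.1 (slicePoint_mem c.1 _ hy.1)
  rw [this]
  simp

theorem localResMeasure_compl_carrier (a : I → ℚ) (Y : D.Stratum) (c : MonomialChart D) :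
    ℒ.localResMeasure ψ a Y c Y.carrierᶜ = 0 := by
  unfold CanonicalExtension.localResMeasure
  rw [Measure.restrict_apply Y.isClosed_carrier.measurableSet.compl]
  simp

/-- The residual measure is the limit of the densities of the fibres on a polydisc adapted to the
stratum. -/
theorem sliceIntegral_eq_integral {a : I → ℚ} (ha : ℒ.IsDecomposition a)
    (hY : D.IsMinFace a Y) (c : MonomialChart D) {i₀ : I} {p : X} {r : ℝ}
    (hB : IsBox c.1 a Y.J i₀ (c.1.z p) r) (hp : p ∈ c.1.z.source) (hpY : p ∈ Y.carrier)
    {χ : X → ℝ} (hχ : Continuous χ)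
    (hχ0 : ∀ x, ¬(x ∈ c.1.z.source ∧ c.1.z x ∈ Metric.closedBall (c.1.z p) r) → χ x = 0) :
    sliceIntegral ℒ ψ a c.1 Y.J χ = ∫ x, χ x ∂(ℒ.localResMeasure ψ a Y c) := by
  classical
  have hC := Y.isClosed_carrier.measurableSet
  have hS := (isOpen_sliceDomain c.1 Y.J).measurableSet
  rw [localResMeasure_eq ℒ ψ hY c, ← integral_indicator hC,
    integral_map_withDensity hS (continuousOn_slicePoint c.1 Y.J)
      (aemeasurable_sliceDensity ℒ ψ ha c.1 Y.J) (fun y hy => sliceDensity_nonneg ℒ ψ ha c.1 _ hy)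
      (hχ.measurable.indicator hC), sliceIntegral, integral_indicator hS]
  refine setIntegral_congr_fun hS fun y hy => ?_
  have h1 : Y.carrier.indicator χ (slicePoint c.1 Y.J y) = χ (slicePoint c.1 Y.J y) := by
    by_cases h : slicePoint c.1 Y.J y ∈ Y.carrier
    · rw [indicator_of_mem h]
    · rw [indicator_of_notMem h, hχ0 _ fun h' => h ?_]
      refine hB.slicePoint_mem_carrier hp rfl hpY hy ?_
      rw [← coord_slicePoint c.1 _ hy]
      exact h'.2
  change χ _ * sliceDensity ℒ ψ a c.1 Y.J y = _
  rw [h1, mul_comm]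

theorem isOpen_chartBall (c : D.Chart) (p : Model n) (r : ℝ) :
    IsOpen {x | x ∈ c.z.source ∧ c.z x ∈ Metric.ball p r} :=
  c.z.isOpen_inter_preimage Metric.isOpen_ball

/-- The residual measure of an adapted polydisc is finite: on the stratum, its density is bounded by
a product of integrable functions of one coordinate. -/
theorem IsBox.localResMeasure_lt_top {a : I → ℚ} (ha : ℒ.IsDecomposition a)
    (hY : D.IsMinFace a Y) (c : MonomialChart D) {i₀ : I} {p : Model n} {r : ℝ}
    (hB : IsBox c.1 a Y.J i₀ p r) :
    ℒ.localResMeasure ψ a Y c {x | x ∈ c.1.z.source ∧ c.1.z x ∈ Metric.ball p r} < ⊤ := by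
  classical
  have hGc := (ℒ.genNormExt_spec ψ ha c.1).1
  have hGpos := (ℒ.genNormExt_spec ψ ha c.1).2.1
  obtain ⟨MG, hMG⟩ : ∃ MG, ∀ w ∈ Metric.closedBall p r, ℒ.genNormExt ψ a c.1 (c.1.z.symm w) ≤ MG := by
    have h1 : ContinuousOn (fun w => ℒ.genNormExt ψ a c.1 (c.1.z.symm w)) (Metric.closedBall p r) :=
      (hGc.comp c.1.z.symm.continuousOn fun w hw => c.1.z.map_target hw).mono hB.closedBall_subset
    obtain ⟨MG, hMG⟩ := (isCompact_closedBall p r).bddAbove_image h1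
    exact ⟨MG, fun w hw => hMG (mem_image_of_mem _ hw)⟩
  obtain ⟨ε, hε1, hε2⟩ := c.1.exists_sumEquiv hB.subset hB.mem
  have hint : Integrable fun y : SliceIndex c.1 Y.J → ℂ =>
      MG * ∏ s, majorant c.1 a Y.J i₀ p r 0 (ε (Sum.inr s)) (y s) :=
    (Integrable.fintype_prod fun s => hB.integrable_majorant 0 (ε (Sum.inr s))).const_mul MG
  rw [localResMeasure_apply ℒ ψ hY c (isOpen_chartBall c.1 p r).measurableSet]
  refine lt_of_le_of_lt ?_ hint.lintegral_lt_top
  refine le_trans (setLIntegral_mono' ?_ fun y hy => ?_) (setLIntegral_le_lintegral _ _)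
  · exact measurableSet_inter_preimage (isOpen_sliceDomain c.1 Y.J).measurableSet
      (continuousOn_slicePoint c.1 Y.J)
      ((isOpen_chartBall c.1 p r).measurableSet.inter Y.isClosed_carrier.measurableSet)
  refine ENNReal.ofReal_le_ofReal ?_
  have hw : c.1.sliceVec Y.J y ∈ Metric.closedBall p r := by
    rw [← coord_slicePoint c.1 _ hy.1]
    exact Metric.ball_subset_closedBall hy.2.1.2
  have hG := hMG _ hw
  have hG0 := hGpos _ (slicePoint_mem c.1 _ hy.1)
  refine mul_le_mul hG (le_of_eq ?_) (c.1.weight_nonneg a _ _) (hG0.le.trans hG)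
  rw [weight_eq_of_gam_eq_zero c.1 (fun i hi => gam_eq_zero_of_isMinFace hY hi)]
  have h1 := c.1.prod_sdiff_eq hB.subset hB.mem fun i =>
    ‖c.1.sliceVec Y.J y (c.1.k i)‖ ^ (2 * (D.gam a i - 1))
  have h2 := ε.prod_comp fun j => ∏ i ∈ (c.1.J \ Y.J).filter
    (fun i => c.1.k i = (c.1.k i₀).succAbove j),
    ‖c.1.sliceVec Y.J y (c.1.k i)‖ ^ (2 * (D.gam a i - 1))
  have h3 : ∏ i ∈ c.1.J \ Y.J, ‖c.1.sliceVec Y.J y (c.1.k i)‖ ^ (2 * (D.gam a i - 1)) =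
      ∏ j, ∏ i ∈ (c.1.J \ Y.J).filter (fun i => c.1.k i = (c.1.k i₀).succAbove j),
        ‖c.1.sliceVec Y.J y (c.1.k i)‖ ^ (2 * (D.gam a i - 1)) := by
    convert h1
  rw [h3, ← h2, Fintype.prod_sum_type, Finset.prod_eq_one, one_mul]
  · refine Finset.prod_congr rfl fun s _ => ?_
    have hs : ε (Sum.inr s) ∉ c.1.logSet Y.J i₀ := by
      rw [Chart.mem_logSet]
      rintro ⟨i, hi, his⟩
      rw [hε2] at his
      exact s.2 (Finset.mem_image.2 ⟨i, hi, his⟩)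
    unfold majorant
    rw [if_neg hs, indicator_of_mem]
    · refine Finset.prod_congr (by congr!) fun i hi => ?_
      rw [(Finset.mem_filter.1 hi).2, hε2, sliceVec_apply]
    · have h4 := (dist_le_pi_dist _ _ s.1).trans hw
      rw [hε2]
      rwa [sliceVec_apply] at h4
  · intro i _
    have hi : ε (Sum.inl i) ∈ c.1.logSet Y.J i₀ :=
      Chart.mem_logSet.2 ⟨i, Finset.mem_of_mem_erase i.2, (hε1 i).symm⟩
    have h5 := hB.filter_eq_empty hi
    rw [show (c.1.J \ Y.J).filter (fun j => c.1.k j = (c.1.k i₀).succAbove (ε (Sum.inl i))) = ∅ by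
      convert h5, Finset.prod_empty]

/-- The density of the residual measure is positive off the other components, which is almost
everywhere on the stratum. -/
theorem IsBox.localResMeasure_pos {a : I → ℚ} (ha : ℒ.IsDecomposition a)
    (hY : D.IsMinFace a Y) (c : MonomialChart D) {i₀ : I} {p : X} {r : ℝ}
    (hB : IsBox c.1 a Y.J i₀ (c.1.z p) r) (hp : p ∈ c.1.z.source) (hpY : p ∈ Y.carrier) :
    0 < ℒ.localResMeasure ψ a Y c Y.carrier := by
  classical
  have hC := Y.isClosed_carrier.measurableSet
  rw [localResMeasure_apply ℒ ψ hY c hC, inter_self, pos_iff_ne_zero]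
  intro h
  set V : Set (SliceIndex c.1 Y.J → ℂ) := c.1.sliceVec Y.J ⁻¹' Metric.ball (c.1.z p) r with hV
  have hVo : IsOpen V := Metric.isOpen_ball.preimage (continuous_sliceVec c.1 Y.J)
  have hVd : V ⊆ sliceDomain c.1 Y.J := fun y hy =>
    hB.closedBall_subset (Metric.ball_subset_closedBall hy)
  have hVne : V.Nonempty := ⟨fun s => c.1.z p s.1, by
    rw [hV, mem_preimage, exists_sliceVec_eq c.1 hB.zero]
    exact Metric.mem_ball_self hB.pos⟩
  have hsub : V ⊆ sliceDomain c.1 Y.J ∩ slicePoint c.1 Y.J ⁻¹' Y.carrier := fun y hy =>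
    ⟨hVd hy, hB.slicePoint_mem_carrier hp rfl hpY (hVd hy) (Metric.ball_subset_closedBall hy)⟩
  have h0 : ∫⁻ y in V, ENNReal.ofReal (sliceDensity ℒ ψ a c.1 Y.J y) = 0 :=
    le_antisymm ((lintegral_mono_set hsub).trans h.le) bot_le
  rw [lintegral_eq_zero_iff' ((aemeasurable_sliceDensity ℒ ψ ha c.1 Y.J).mono_measure
    (Measure.restrict_mono hVd le_rfl)).ennreal_ofReal] at h0
  have hne : ∀ᵐ y : SliceIndex c.1 Y.J → ℂ, ∀ s, y s ≠ 0 := by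
    refine ae_all_iff.2 fun s => ?_
    rw [ae_iff]
    simp only [ne_eq, not_not]
    exact Measure.pi_hyperplane (fun _ : SliceIndex c.1 Y.J => (volume : Measure ℂ)) s 0
  have hfalse : ∀ᵐ y ∂(volume.restrict V), False := by
    filter_upwards [h0, ae_restrict_of_ae hne, ae_restrict_mem hVo.measurableSet] with y h1 h2 h3
    have h4 : sliceDensity ℒ ψ a c.1 Y.J y ≤ 0 := ENNReal.ofReal_eq_zero.1 h1
    have h5 : 0 < sliceDensity ℒ ψ a c.1 Y.J y := by
      refine mul_pos ((ℒ.genNormExt_spec ψ ha c.1).2.1 _ (slicePoint_mem c.1 _ (hVd h3))) ?_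
      rw [weight_eq_of_gam_eq_zero c.1 (fun i hi => gam_eq_zero_of_isMinFace hY hi)]
      refine Finset.prod_pos fun i hi => Real.rpow_pos_of_pos (norm_pos_iff.2 ?_) _
      obtain ⟨hiJ, hiK⟩ := Finset.mem_sdiff.1 hi
      have h6 : c.1.k i ∉ Y.J.image c.1.k := by
        intro h7
        obtain ⟨i', hi', hii⟩ := Finset.mem_image.1 h7
        have := c.1.isSnc.injOn (by exact_mod_cast hB.subset hi') (by exact_mod_cast hiJ) hii
        exact hiK (this ▸ hi')
      have h8 := sliceVec_apply c.1 y ⟨c.1.k i, by convert h6⟩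
      change c.1.sliceVec Y.J y (c.1.k i) = _ at h8
      rw [h8]
      exact h2 _
    exact absurd h5 h4.not_gt
  rw [ae_iff] at hfalse
  simp only [not_false_eq_true] at hfalse
  have h9 : volume V = 0 := by simpa using hfalse
  exact (hVo.measure_pos volume hVne).ne' h9

end SncDegeneration
end Residual

/-- Two measures, finite on a neighbourhood of a point, which agree on the continuous functions
supported there, agree near the point. -/
theorem exists_restrict_eq_of_forall_integral_eq {X : Type*} [TopologicalSpace X] [T2Space X]
    [SecondCountableTopology X] [LocallyCompactSpace X] [MeasurableSpace X] [BorelSpace X]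
    {μ ν : Measure X} {O : Set X} (hO : IsOpen O) {p : X} (hp : p ∈ O) (hμ : μ O < ⊤) (hν : ν O < ⊤)
    (h : ∀ χ : X → ℝ, Continuous χ → (∀ x, |χ x| ≤ 1) → (∀ x ∉ O, χ x = 0) →
      ∫ x, χ x ∂μ = ∫ x, χ x ∂ν) :
    ∃ N, IsOpen N ∧ p ∈ N ∧ μ.restrict N = ν.restrict N := by
  obtain ⟨K, hK, hpK, hKO⟩ := exists_compact_subset hO hp
  obtain ⟨χ, hχ1, hχ0, -, hχ⟩ := exists_continuous_one_zero_of_isCompact hK hO.isClosed_compl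
    (disjoint_compl_right_iff_subset.2 hKO)
  have hχm : Measurable fun x => ENNReal.ofReal (χ x) := χ.continuous.measurable.ennreal_ofReal
  have hfin : ∀ m : Measure X, m O < ⊤ → IsFiniteMeasure (m.withDensity fun x =>
      ENNReal.ofReal (χ x)) := by
    intro m hm
    refine isFiniteMeasure_withDensity (ne_of_lt (lt_of_le_of_lt (b := ∫⁻ x, O.indicator 1 x ∂m)
      (lintegral_mono fun x => ?_) ?_))
    · by_cases hx : x ∈ O
      · simpa [hx] using (hχ x).2
      · simp [hχ0 (show x ∈ Oᶜ from hx)]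
    · rwa [lintegral_indicator_one hO.measurableSet]
  have hint : ∀ (m : Measure X) (f : X → ℝ), ∫ x, f x ∂(m.withDensity fun x => ENNReal.ofReal (χ x)) =
      ∫ x, χ x * f x ∂m := by
    intro m f
    rw [integral_withDensity_eq_integral_toReal_smul hχm (by simp)]
    exact integral_congr_ae (Eventually.of_forall fun x => by
      simp [ENNReal.toReal_ofReal (hχ x).1])
  have := hfin μ hμ
  have := hfin ν hν
  -- multiplied by the bump function, the measures are finite and have the same integrals
  have heq : (μ.withDensity fun x => ENNReal.ofReal (χ x)) =
      ν.withDensity fun x => ENNReal.ofReal (χ x) := by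
    refine ext_of_forall_integral_eq_of_IsFiniteMeasure fun f => ?_
    have hM : 0 < ‖f‖ + 1 := by positivity
    have h1 := h (fun x => (‖f‖ + 1)⁻¹ * (χ x * f x))
      (continuous_const.mul (χ.continuous.mul f.continuous)) (fun x => ?_) (fun x hx => ?_)
    · rw [integral_const_mul, integral_const_mul] at h1
      rw [hint, hint]
      exact mul_left_cancel₀ (inv_ne_zero hM.ne') h1
    · rw [abs_mul, abs_mul, abs_of_pos (inv_pos.2 hM), inv_mul_le_iff₀ hM, mul_one,
        abs_of_nonneg (hχ x).1]
      have h2 : |f x| ≤ ‖f‖ := f.norm_coe_le_norm x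
      nlinarith [(hχ x).1, (hχ x).2, abs_nonneg (f x)]
    · simp [hχ0 (show x ∈ Oᶜ from hx)]
  refine ⟨interior K, isOpen_interior, hpK, ?_⟩
  have hres : ∀ m : Measure X, (m.withDensity fun x => ENNReal.ofReal (χ x)).restrict (interior K) =
      m.restrict (interior K) := by
    intro m
    rw [restrict_withDensity isOpen_interior.measurableSet]
    conv_rhs => rw [← withDensity_one (μ := m.restrict (interior K))]
    refine withDensity_congr_ae ?_
    filter_upwards [ae_restrict_mem isOpen_interior.measurableSet] with x hx
    simp [hχ1 (interior_subset hx)]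
  rw [← hres, heq, hres]

/-! ### Residual measures: finiteness and independence of the chart -/

section Residual

variable {n : ℕ} {X : Type u} [TopologicalSpace X] [ChartedSpace (Model n) X]
  [IsManifold 𝓘(ℂ, Model n) ω X] {I : Type v} {D : SncDegeneration n X I} [Fintype I]
  [MeasurableSpace X] [BorelSpace X]

open CanonicalExtension (MonomialChart FibreChart SliceIndex slicePoint sliceDomain)

namespace SncDegeneration

/-- A small polydisc around `p` is adapted to `K` if the components outside `K` through `p` have a
positive exponent. -/
theorem exists_isBox (c : D.Chart) {a : I → ℚ} {K : Finset I} {i₀ : I} {p : X}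
    (hp : p ∈ c.z.source) (hK : p ∈ D.inter K) (hi₀ : i₀ ∈ K)
    (h : ∀ i ∈ c.J, i ∉ K → 0 < D.gam a i ∨ c.z p (c.k i) ≠ 0) :
    ∃ r, IsBox c a K i₀ (c.z p) r := by
  obtain ⟨r₀, hr₀, hball⟩ := c.exists_closedBall hp
  have h1 : ∀ᶠ r in 𝓝[>] (0 : ℝ), ∀ i ∈ c.J, i ∉ K → 0 < D.gam a i ∨ r < ‖c.z p (c.k i)‖ := by
    refine (Finset.eventually_all c.J).2 fun i hi => ?_
    by_cases hiK : i ∈ K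
    · simp [hiK]
    rcases h i hi hiK with h2 | h2
    · simp [h2]
    · filter_upwards [nhdsWithin_le_nhds (gt_mem_nhds (norm_pos_iff.2 h2))] with r hr _
      exact Or.inr hr
  have h2 : ∀ᶠ r in 𝓝[>] (0 : ℝ), r ≤ min 1 r₀ :=
    nhdsWithin_le_nhds (ge_mem_nhds (lt_min one_pos hr₀))
  have h3 : ∀ᶠ r in 𝓝[>] (0 : ℝ), 0 < r := self_mem_nhdsWithin
  obtain ⟨r, hr1, hr2, hr3⟩ := (h1.and (h2.and h3)).exists
  have hsub := c.inter_subset hp hK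
  exact ⟨r, hsub, hi₀, hr3, hr2.trans (min_le_left _ _),
    (Metric.closedBall_subset_closedBall (hr2.trans (min_le_right _ _))).trans hball,
    fun i hi => ((c.isSnc.mem_iff p hp i).1 (hK i hi)).2, hr1⟩

/-- A polydisc around a point of a stratum of maximal dimension of `Δ(ℒ)` is adapted to the stratum
if it is small. -/
theorem exists_isBox_of_card {a : I → ℚ} {Y : D.Stratum} (hY : D.IsMinFace a Y)
    (hcard : Y.J.card = D.dimMin a + 1) (c : D.Chart) {p : X} (hp : p ∈ c.z.source)
    (hpY : p ∈ Y.carrier) : ∃ i₀ r, IsBox c a Y.J i₀ (c.z p) r := by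
  classical
  obtain ⟨i₀, hi₀⟩ := Y.nonempty
  refine ⟨i₀, exists_isBox c hp (Y.carrier_subset hpY) hi₀ fun i hi hiY => ?_⟩
  -- another component of minimal `κ` through `p` would produce a face of larger dimension
  by_contra! hcon
  have hg : D.gam a i = 0 := le_antisymm hcon.1 (D.gam_nonneg a i)
  have hpi : p ∈ D.inter (insert i Y.J) := by
    intro j hj
    rcases Finset.mem_insert.1 hj with rfl | hj
    · exact (c.isSnc.mem_iff p hp _).2 ⟨hi, hcon.2⟩
    · exact Y.carrier_subset hpY j hj
  have hmin : D.IsMinFace a (D.stratumAt (Finset.insert_nonempty i Y.J) hpi) := by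
    intro j hj
    rcases Finset.mem_insert.1 hj with rfl | hj
    · exact (D.gam_eq_zero_iff a _).1 hg
    · exact hY j hj
  have h1 := D.card_le_of_isMinFace a hmin
  change (insert i Y.J).card ≤ _ at h1
  rw [Finset.card_insert_of_notMem hiY] at h1
  omega

/-- Each point of the zero fibre is the centre of an adapted polydisc. Here `K` consists of the
components of minimal `κ` through the point, or of a single component if there are none. -/
theorem exists_adapted_isBox (a : I → ℚ) {p : X} (hp : D.proj p = 0) :
    ∃ (c : MonomialChart D) (K : Finset I) (i₀ : I) (r : ℝ), p ∈ c.1.z.source ∧ p ∈ D.inter K ∧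
      IsBox c.1 a K i₀ (c.1.z p) r ∧
      ((∀ i ∈ K, D.gam a i = 0) ∨ (K = {i₀} ∧ D.gam a i₀ ≠ 0)) := by
  classical
  obtain ⟨c, hpc⟩ := D.exists_monomialChart hp
  have hmem := c.1.isSnc.mem_iff p hpc
  rcases (c.1.J.filter fun i => c.1.z p (c.1.k i) = 0 ∧ D.gam a i = 0).eq_empty_or_nonempty
    with he | ⟨i₀, hi₀⟩
  · obtain ⟨i₀, hi₀⟩ := (D.zero_iff p).1 hp
    obtain ⟨hiJ, hi0⟩ := (hmem i₀).1 hi₀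
    have hrest : ∀ i ∈ c.1.J, 0 < D.gam a i ∨ c.1.z p (c.1.k i) ≠ 0 := by
      intro i hi
      by_contra! hcon
      exact Finset.filter_eq_empty_iff.1 he hi ⟨hcon.2, le_antisymm hcon.1 (D.gam_nonneg a i)⟩
    have hK : p ∈ D.inter {i₀} := by
      intro i hi
      rwa [Finset.mem_singleton.1 hi]
    obtain ⟨r, hr⟩ := exists_isBox c.1 hpc hK (Finset.mem_singleton_self i₀)
      fun i hi _ => hrest i hi
    exact ⟨c, {i₀}, i₀, r, hpc, hK, hr, Or.inr ⟨rfl, ((hrest i₀ hiJ).resolve_right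
      (not_not.2 hi0)).ne'⟩⟩
  · have hK : p ∈ D.inter (c.1.J.filter fun i => c.1.z p (c.1.k i) = 0 ∧ D.gam a i = 0) := by
      intro i hi
      obtain ⟨h1, h2, -⟩ := Finset.mem_filter.1 hi
      exact (hmem i).2 ⟨h1, h2⟩
    obtain ⟨r, hr⟩ := exists_isBox c.1 hpc hK hi₀ (a := a) fun i hi hiK => by
      by_contra! hcon
      exact hiK (Finset.mem_filter.2 ⟨hi, hcon.2, le_antisymm hcon.1 (D.gam_nonneg a i)⟩)
    exact ⟨c, _, i₀, r, hpc, hK, hr, Or.inl fun i hi => (Finset.mem_filter.1 hi).2.2⟩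

theorem simplexMeasure_univ_pos {K : Finset I} {i₀ : I} (hi₀ : i₀ ∈ K) :
    0 < (D.simplexMeasure K).real univ := by
  have h := integral_simplexMeasure (D := D) hi₀ fun _ => 1
  rw [integral_const, smul_eq_mul, mul_one] at h
  rw [h, integral_indicator (measurableSet_openSimplex K i₀)]
  have hb : (0 : ℝ) < D.b i₀ := by exact_mod_cast D.b_pos i₀
  have hg : (0 : ℝ) < D.bGcd K := by
    exact_mod_cast Nat.pos_of_ne_zero fun h => D.b_ne_zero i₀ ((Finset.gcd_eq_zero_iff.1 h) i₀ hi₀)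
  refine mul_pos (div_pos hg hb) ?_
  simp only [integral_const, smul_eq_mul, mul_one]
  rw [measureReal_def, Measure.restrict_apply_univ]
  exact ENNReal.toReal_pos (D.volume_openSimplex_pos K i₀).ne' (D.volume_openSimplex_lt_top K i₀).ne

variable {L : X → Type*} [TopologicalSpace (TotalSpace ℂ L)] [∀ x, AddCommGroup (L x)]
  [∀ x, Module ℂ (L x)] [∀ x, TopologicalSpace (L x)] [FiberBundle ℂ L] [VectorBundle ℂ ℂ L]
  (ℒ : CanonicalExtension L D) (ψ : ContinuousMetric L)

variable [T2Space X] [SecondCountableTopology X] {a : I → ℚ} {Y : D.Stratum}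

/-- The local residual measures of two charts have the same integrals near a point of the stratum,
because these integrals are limits of the same integrals over the fibres. -/
theorem integral_localResMeasure_eq (ha : ℒ.IsDecomposition a) (hY : D.IsMinFace a Y)
    {c c' : MonomialChart D} {i₀ i₁ : I} {p : X} {r r' : ℝ}
    (hB : IsBox c.1 a Y.J i₀ (c.1.z p) r) (hp : p ∈ c.1.z.source)
    (hB' : IsBox c'.1 a Y.J i₁ (c'.1.z p) r') (hp' : p ∈ c'.1.z.source) (hpY : p ∈ Y.carrier)
    {χ : X → ℝ} (hχ : Continuous χ) (hχ1 : ∀ x, |χ x| ≤ 1)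
    (hχ0 : ∀ x, ¬(x ∈ c.1.z.source ∧ c.1.z x ∈ Metric.closedBall (c.1.z p) r) → χ x = 0)
    (hχ0' : ∀ x, ¬(x ∈ c'.1.z.source ∧ c'.1.z x ∈ Metric.closedBall (c'.1.z p) r') → χ x = 0) :
    ∫ x, χ x ∂(ℒ.localResMeasure ψ a Y c) = ∫ x, χ x ∂(ℒ.localResMeasure ψ a Y c') := by
  have hF : Continuous fun _ : D.Hybrid => (1 : ℝ) := continuous_const
  have h1 := tendsto_integral_box_hybrid ℒ ψ ha c hB hp rfl hpY hχ hχ1 hχ0 hF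
  have h2 := tendsto_integral_box_hybrid ℒ ψ ha c' hB' hp' rfl hpY hχ hχ1 hχ0' hF
  have h3 := tendsto_nhds_unique h1 h2
  rw [sliceIntegral_eq_integral ℒ ψ ha hY c hB hp hpY hχ hχ0,
    sliceIntegral_eq_integral ℒ ψ ha hY c' hB' hp' hpY hχ hχ0'] at h3
  have hs := simplexMeasure_univ_pos (D := D) hB.mem
  have hg : (0 : ℝ) < D.bGcd Y.J := by
    exact_mod_cast Nat.pos_of_ne_zero fun h =>
      D.b_ne_zero i₀ ((Finset.gcd_eq_zero_iff.1 h) i₀ hB.mem)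
  simp only [integral_const, smul_eq_mul, mul_one] at h3
  have h4 := mul_left_cancel₀ (by positivity) h3
  exact mul_left_cancel₀ (mul_ne_zero (inv_ne_zero hg.ne') hs.ne') h4

/-- Local residual measures agree on the overlap of two charts. Near a point of the stratum this
follows from the uniqueness of the limits of the fibre integrals; off the stratum both measures
vanish. -/
theorem localResMeasure_agree (ha : ℒ.IsDecomposition a) (hY : D.IsMinFace a Y)
    (hcard : Y.J.card = D.dimMin a + 1) (c c' : MonomialChart D) :
    (ℒ.localResMeasure ψ a Y c).restrict (c.1.z.source ∩ c'.1.z.source) =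
      (ℒ.localResMeasure ψ a Y c').restrict (c.1.z.source ∩ c'.1.z.source) := by
  have : LocallyCompactSpace X := ChartedSpace.locallyCompactSpace (Model n) X
  refine restrict_eq_of_forall_exists_open _ _ _ fun p hp => ?_
  by_cases hpY : p ∈ Y.carrier
  · obtain ⟨i₀, r, hB⟩ := exists_isBox_of_card hY hcard c.1 hp.1 hpY
    obtain ⟨i₁, r', hB'⟩ := exists_isBox_of_card hY hcard c'.1 hp.2 hpY
    refine exists_restrict_eq_of_forall_integral_eq
      ((isOpen_chartBall c.1 (c.1.z p) r).inter (isOpen_chartBall c'.1 (c'.1.z p) r'))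
      ⟨⟨hp.1, Metric.mem_ball_self hB.pos⟩, hp.2, Metric.mem_ball_self hB'.pos⟩
      ((measure_mono inter_subset_left).trans_lt (hB.localResMeasure_lt_top ℒ ψ ha hY c))
      ((measure_mono inter_subset_right).trans_lt (hB'.localResMeasure_lt_top ℒ ψ ha hY c'))
      fun χ hχ hχ1 hχ0 => integral_localResMeasure_eq ℒ ψ ha hY hB hp.1 hB' hp.2 hpY hχ hχ1
        (fun x hx => hχ0 x fun h => hx ⟨h.1.1, Metric.ball_subset_closedBall h.1.2⟩)
        (fun x hx => hχ0 x fun h => hx ⟨h.2.1, Metric.ball_subset_closedBall h.2.2⟩)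
  · refine ⟨Y.carrierᶜ, Y.isClosed_carrier.isOpen_compl, hpY, ?_⟩
    rw [Measure.restrict_eq_zero.2 (localResMeasure_compl_carrier ℒ ψ a Y c),
      Measure.restrict_eq_zero.2 (localResMeasure_compl_carrier ℒ ψ a Y c')]

/-- In a chart which meets the stratum, the residual measure is the local one. -/
theorem resMeasure_restrict (ha : ℒ.IsDecomposition a) (hY : D.IsMinFace a Y)
    (hcard : Y.J.card = D.dimMin a + 1) (c : MonomialChart D) (hc : Y.J ⊆ c.1.J) :
    (ℒ.resMeasure ψ a Y).restrict c.1.z.source = ℒ.localResMeasure ψ a Y c :=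
  iSup_restrict_of_agree
    (fun c : {c : MonomialChart D // Y.J ⊆ c.1.J} => ℒ.localResMeasure ψ a Y c.1)
    (fun c => c.1.1.z.source) (fun c => c.1.1.z.open_source.measurableSet)
    (fun c => localResMeasure_compl_source ℒ ψ hY c.1)
    (fun c c' => localResMeasure_agree ℒ ψ ha hY hcard c.1 c'.1) ⟨c, hc⟩

theorem resMeasure_compl (a : I → ℚ) (Y : D.Stratum) : ℒ.resMeasure ψ a Y Y.carrierᶜ = 0 :=
  iSup_measure_compl_eq_zero _ _ Y.isClosed_carrier.measurableSet fun c =>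
    localResMeasure_compl_carrier ℒ ψ a Y c.1

/-- The residual measure is locally finite and carried by a compact stratum. -/
theorem isFiniteMeasure_resMeasure (ha : ℒ.IsDecomposition a) (hY : D.IsMinFace a Y)
    (hcard : Y.J.card = D.dimMin a + 1) : IsFiniteMeasure (ℒ.resMeasure ψ a Y) := by
  refine ⟨?_⟩
  rw [← measure_add_measure_compl Y.isClosed_carrier.measurableSet, resMeasure_compl, add_zero]
  refine Y.isCompact_carrier.measure_lt_top_of_nhdsWithin fun p hpY => ?_
  obtain ⟨c, hp⟩ := D.exists_monomialChart (Y.proj_eq_zero hpY)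
  obtain ⟨i₀, r, hB⟩ := exists_isBox_of_card hY hcard c.1 hp hpY
  refine ⟨_, mem_nhdsWithin_of_mem_nhds ((isOpen_chartBall c.1 (c.1.z p) r).mem_nhds
    ⟨hp, Metric.mem_ball_self hB.pos⟩), ?_⟩
  have h := hB.localResMeasure_lt_top ℒ ψ ha hY c
  rw [← resMeasure_restrict ℒ ψ ha hY hcard c hB.subset,
    Measure.restrict_apply (isOpen_chartBall c.1 (c.1.z p) r).measurableSet] at h
  rwa [inter_eq_left.2 fun x hx => hx.1] at h

/-- The residual measure of a stratum is not zero, so that the limit measure is not zero. -/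
theorem resMeasure_carrier_pos (ha : ℒ.IsDecomposition a) (hY : D.IsMinFace a Y)
    (hcard : Y.J.card = D.dimMin a + 1) : 0 < ℒ.resMeasure ψ a Y Y.carrier := by
  obtain ⟨p, hpY⟩ := Y.carrier_nonempty
  obtain ⟨c, hp⟩ := D.exists_monomialChart (Y.proj_eq_zero hpY)
  obtain ⟨i₀, r, hB⟩ := exists_isBox_of_card hY hcard c.1 hp hpY
  refine (hB.localResMeasure_pos ℒ ψ ha hY c hp hpY).trans_le ?_
  rw [← resMeasure_restrict ℒ ψ ha hY hcard c hB.subset]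
  exact Measure.restrict_apply_le _ _

/-- The integral over the stratum in the local limit is an integral for the residual measure. -/
theorem sliceIntegral_eq_integral_resMeasure (ha : ℒ.IsDecomposition a) (hY : D.IsMinFace a Y)
    (hcard : Y.J.card = D.dimMin a + 1) (c : MonomialChart D) {i₀ : I} {p : X} {r : ℝ}
    (hB : IsBox c.1 a Y.J i₀ (c.1.z p) r) (hp : p ∈ c.1.z.source) (hpY : p ∈ Y.carrier)
    {χ : X → ℝ} (hχ : Continuous χ)
    (hχ0 : ∀ x, ¬(x ∈ c.1.z.source ∧ c.1.z x ∈ Metric.closedBall (c.1.z p) r) → χ x = 0) :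
    sliceIntegral ℒ ψ a c.1 Y.J χ = ∫ x, χ x ∂(ℒ.resMeasure ψ a Y) := by
  rw [sliceIntegral_eq_integral ℒ ψ ha hY c hB hp hpY hχ hχ0,
    ← resMeasure_restrict ℒ ψ ha hY hcard c hB.subset]
  exact setIntegral_eq_integral_of_forall_compl_eq_zero fun x hx => hχ0 x fun h => hx h.1

theorem integral_resMeasure_eq_zero (a : I → ℚ) (Y : D.Stratum) {χ : X → ℝ}
    (hχ : ∀ x ∈ Y.carrier, χ x = 0) : ∫ x, χ x ∂(ℒ.resMeasure ψ a Y) = 0 := by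
  refine integral_eq_zero_of_ae ?_
  have h : ∀ᵐ x ∂(ℒ.resMeasure ψ a Y), x ∈ Y.carrier := by
    rw [ae_iff]; exact resMeasure_compl ℒ ψ a Y
  filter_upwards [h] with x hx using hχ x hx

end SncDegeneration
end Residual

/-! ### The limit measure -/

section Global

variable {n : ℕ} {X : Type u} [TopologicalSpace X] [ChartedSpace (Model n) X]
  [IsManifold 𝓘(ℂ, Model n) ω X] {I : Type v} {D : SncDegeneration n X I} [Fintype I]
  [MeasurableSpace X] [BorelSpace X]

open CanonicalExtension (MonomialChart)

namespace SncDegeneration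

variable (D) in
/-- The strata of the faces of `Δ(ℒ)` of maximal dimension. -/
abbrev TopFace (a : I → ℚ) : Type (max u v) :=
  {Y : D.Stratum // D.IsMinFace a Y ∧ Y.J.card = D.dimMin a + 1}

instance (a : I → ℚ) : Fintype (D.TopFace a) := Fintype.ofFinite _

/-- An adapted polydisc meets a stratum of maximal dimension of `Δ(ℒ)` only if it is adapted to
it. -/
theorem IsBox.eq_of_mem_carrier {c : D.Chart} {a : I → ℚ} {K : Finset I} {i₀ : I} {p : X} {r : ℝ}
    (hB : IsBox c a K i₀ (c.z p) r) (hp : p ∈ c.z.source) (hpK : p ∈ D.inter K)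
    (hK : (∀ i ∈ K, D.gam a i = 0) ∨ (K = {i₀} ∧ D.gam a i₀ ≠ 0)) (Y : D.TopFace a) {q : X}
    (hqY : q ∈ Y.1.carrier) (hq : q ∈ c.z.source) (hqr : c.z q ∈ Metric.closedBall (c.z p) r) :
    (∀ i ∈ K, D.gam a i = 0) ∧ Y.1.J = K ∧ p ∈ Y.1.carrier := by
  have hqJ := Y.1.carrier_subset hqY
  have hsub : Y.1.J ⊆ K := by
    intro i hi
    by_contra hiK
    obtain ⟨hiJ, hi0⟩ := (c.isSnc.mem_iff q hq i).1 (hqJ i hi)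
    rcases hB.rest i hiJ hiK with h | h
    · exact h.ne' (gam_eq_zero_of_isMinFace Y.2.1 hi)
    · have h1 := (dist_le_pi_dist _ _ (c.k i)).trans hqr
      rw [hi0, dist_zero_left] at h1
      exact absurd h h1.not_gt
  have h0 : ∀ i ∈ K, D.gam a i = 0 := by
    rcases hK with h | ⟨rfl, h⟩
    · exact h
    · obtain ⟨i, hi⟩ := Y.1.nonempty
      have hii := Finset.mem_singleton.1 (hsub hi)
      exact absurd (gam_eq_zero_of_isMinFace Y.2.1 hi) (hii ▸ h)
  have hcard := D.card_le_of_isMinFace a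
    (Y := D.stratumAt ⟨i₀, hB.mem⟩ hpK) fun i hi => (D.gam_eq_zero_iff a i).1 (h0 i hi)
  have hJ : Y.1.J = K := Finset.eq_of_subset_of_card_le hsub (hcard.trans Y.2.2.ge)
  refine ⟨h0, hJ, ?_⟩
  have h1 := c.mem_component hp hB.closedBall_subset hpK hq hqr (by rwa [hJ] at hqJ)
  rw [Y.1.carrier_eq hqY, hJ, ← connectedComponentIn_eq h1]
  exact mem_connectedComponentIn hpK

theorem continuous_onSimplex {F : D.Hybrid → ℝ} (hF : Continuous F) (Y : D.Stratum) :
    Continuous fun w : D.simplex Y.J => F (D.ofDual (D.ofSimplex Y w)) :=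
  hF.comp (D.continuous_ofDual.comp (D.continuous_ofSimplex Y))

theorem compactSpace_simplex (K : Finset I) : CompactSpace (D.simplex K) := by
  refine isCompact_iff_compactSpace.1 ((isCompact_Icc (a := (0 : I → ℝ)) (b := 1)).of_isClosed_subset
    (D.isClosed_simplex K) fun w hw => ⟨hw.1, fun i => ?_⟩)
  by_cases hi : i ∈ K
  · have h1 : (1 : ℝ) ≤ D.b i := by exact_mod_cast D.b_pos i
    have h2 := Finset.single_le_sum (f := fun i => (D.b i : ℝ) * w i)
      (fun i _ => mul_nonneg (Nat.cast_nonneg _) (hw.1 i)) hi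
    rw [hw.2.2] at h2
    exact (le_mul_of_one_le_left (hw.1 i) h1).trans h2
  · rw [hw.2.1 i hi]
    exact zero_le_one

theorem integrable_onSimplex {F : D.Hybrid → ℝ} (hF : Continuous F) (Y : D.Stratum) :
    Integrable (fun w : D.simplex Y.J => F (D.ofDual (D.ofSimplex Y w))) (D.simplexMeasure Y.J) := by
  have := compactSpace_simplex (D := D) Y.J
  have := isFiniteMeasure_simplexMeasure (D := D) Y.nonempty
  obtain ⟨M, hM⟩ := isCompact_univ.exists_bound_of_continuousOn
    (continuous_onSimplex hF Y).continuousOn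
  exact Integrable.of_bound (continuous_onSimplex hF Y).measurable.aestronglyMeasurable M
    (Eventually.of_forall fun w => hM w trivial)

/-- A partition of unity near the zero fibre subordinate to adapted polydiscs. -/
theorem exists_partition [T2Space X] (a : I → ℚ) :
    ∃ (m : ℕ) (f : Fin m → X → ℝ) (δ : ℝ), 0 < δ ∧ δ < 1 ∧ (∀ j, Continuous (f j)) ∧
      (∀ j x, |f j x| ≤ 1) ∧ (∀ x, ‖D.proj x‖ ≤ δ → ∑ j, f j x = 1) ∧
      ∀ j, ∃ (c : MonomialChart D) (K : Finset I) (i₀ : I) (p : X) (r : ℝ), p ∈ c.1.z.source ∧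
        p ∈ D.inter K ∧ IsBox c.1 a K i₀ (c.1.z p) r ∧
        ((∀ i ∈ K, D.gam a i = 0) ∨ (K = {i₀} ∧ D.gam a i₀ ≠ 0)) ∧
        ∀ x, ¬(x ∈ c.1.z.source ∧ c.1.z x ∈ Metric.closedBall (c.1.z p) r) → f j x = 0 := by
  have : LocallyCompactSpace X := ChartedSpace.locallyCompactSpace (Model n) X
  obtain ⟨x₀, hx₀⟩ : (0 : ℂ) ∈ range D.proj := by
    rw [D.range_eq]; simp
  have : Nonempty (MonomialChart D) := ⟨(D.exists_monomialChart hx₀).choose⟩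
  have : Nonempty I := ⟨((D.zero_iff x₀).1 hx₀).choose⟩
  choose! c K i₀ r hpc hpK hB hK using fun p (hp : D.proj p = 0) => exists_adapted_isBox (D := D) a hp
  let O : X → Set X := fun p => {x | x ∈ (c p).1.z.source ∧
    (c p).1.z x ∈ Metric.ball ((c p).1.z p) (r p)}
  have hO : ∀ p, IsOpen (O p) := fun p => isOpen_chartBall (c p).1 _ _
  obtain ⟨T, hT, hcov⟩ := D.isCompact_zeroFibre.elim_nhds_subcover O fun p hp =>
    (hO p).mem_nhds ⟨hpc p hp, Metric.mem_ball_self (hB p hp).pos⟩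
  let e := T.equivFin
  have hcov' : ∀ x, D.proj x = 0 → x ∈ ⋃ j, O (e.symm j).1 := by
    intro x hx
    obtain ⟨p, hp, hxp⟩ := mem_iUnion₂.1 (hcov hx)
    exact mem_iUnion.2 ⟨e ⟨p, hp⟩, by simpa using hxp⟩
  -- finitely many polydiscs cover the zero fibre, hence by properness the preimage of a small
  -- closed disc, which is compact
  obtain ⟨δ, hδ, hδ1, htube⟩ := D.exists_tube (isOpen_iUnion fun j => hO (e.symm j).1) hcov'
  have hcpt : IsCompact (D.proj ⁻¹' Metric.closedBall 0 δ) :=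
    D.proper _ (Metric.closedBall_subset_ball hδ1) (isCompact_closedBall _ _)
  obtain ⟨f, hf1, hf2, hf3, -⟩ := exists_continuous_sum_one_of_isOpen_isCompact
    (s := fun j => O (e.symm j).1) (fun j => hO _) hcpt fun x hx => htube x (by simpa using hx)
  refine ⟨_, fun j => f j, δ, hδ, hδ1, fun j => (f j).continuous, fun j x => ?_, fun x hx => ?_,
    fun j => ?_⟩
  · rw [abs_of_nonneg (hf3 j x).1]
    exact (hf3 j x).2
  · simpa using hf2 (show x ∈ D.proj ⁻¹' Metric.closedBall 0 δ by simpa using hx)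
  · have hp := hT _ (e.symm j).2
    refine ⟨c (e.symm j).1, K (e.symm j).1, i₀ (e.symm j).1, (e.symm j).1, r (e.symm j).1,
      hpc _ hp, hpK _ hp, hB _ hp, hK _ hp, fun x hx => ?_⟩
    by_contra h
    have h1 := hf1 j (subset_tsupport _ h)
    exact hx ⟨h1.1, Metric.ball_subset_closedBall h1.2⟩

variable {L : X → Type*} [TopologicalSpace (TotalSpace ℂ L)] [∀ x, AddCommGroup (L x)]
  [∀ x, Module ℂ (L x)] [∀ x, TopologicalSpace (L x)] [FiberBundle ℂ L] [VectorBundle ℂ ℂ L]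
  (ℒ : CanonicalExtension L D) (ψ : ContinuousMetric L)

variable [T2Space X] [SecondCountableTopology X] {a : I → ℚ}

/-- The contribution of an adapted polydisc to the limit. Polydiscs adapted to faces which do not
belong to `Δ(ℒ)`, or are not of maximal dimension, do not contribute. -/
theorem tendsto_integral_adapted (ha : ℒ.IsDecomposition a) (c : MonomialChart D) {K : Finset I}
    {i₀ : I} {p : X} {r : ℝ} (hp : p ∈ c.1.z.source) (hpK : p ∈ D.inter K)
    (hB : IsBox c.1 a K i₀ (c.1.z p) r)
    (hK : (∀ i ∈ K, D.gam a i = 0) ∨ (K = {i₀} ∧ D.gam a i₀ ≠ 0))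
    {χ : X → ℝ} (hχ : Continuous χ) (hχ1 : ∀ x, |χ x| ≤ 1)
    (hχ0 : ∀ x, ¬(x ∈ c.1.z.source ∧ c.1.z x ∈ Metric.closedBall (c.1.z p) r) → χ x = 0)
    {F : D.Hybrid → ℝ} (hF : Continuous F) :
    Tendsto (fun t : ℂ => ((-Real.log ‖t‖) ^ D.dimMin a)⁻¹ *
      ((‖t‖ ^ (2 * D.kappaMin a))⁻¹ * ∫ x, χ x * onTotal F x ∂(ℒ.fibreMeasure ψ t))) (𝓝[≠] 0)
      (𝓝 ((2 * Real.pi) ^ D.dimMin a * ∑ Y : D.TopFace a,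
        (∫ x, χ x ∂(ℒ.resMeasure ψ a Y.1)) * ((D.bGcd Y.1.J : ℝ)⁻¹ *
          ∫ w : D.simplex Y.1.J, F (D.ofDual (D.ofSimplex Y.1 w)) ∂(D.simplexMeasure Y.1.J)))) := by
  classical
  let Y₀ := D.stratumAt ⟨i₀, hB.mem⟩ hpK
  have hpY₀ : p ∈ Y₀.carrier := mem_connectedComponentIn hpK
  have hlim := tendsto_integral_box_hybrid ℒ ψ ha c hB hp (Y := Y₀) rfl hpY₀ hχ hχ1 hχ0 hF
  have hmin : (∀ i ∈ K, D.gam a i = 0) → D.IsMinFace a Y₀ := fun h i hi =>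
    (D.gam_eq_zero_iff a i).1 (h i hi)
  have hcardK : K.card - 1 ≤ D.dimMin a := by
    rcases hK with h | ⟨rfl, -⟩
    · have := D.card_le_of_isMinFace a (hmin h)
      change K.card ≤ _ at this
      omega
    · simp
  -- the residual measures of the other strata do not charge the polydisc
  have hzero : ∀ Y : D.TopFace a, ¬((∀ i ∈ K, D.gam a i = 0) ∧ Y.1.J = K ∧ p ∈ Y.1.carrier) →
      ∫ x, χ x ∂(ℒ.resMeasure ψ a Y.1) = 0 := by
    intro Y hY
    refine integral_resMeasure_eq_zero ℒ ψ a Y.1 fun x hx => hχ0 x fun h => hY ?_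
    exact hB.eq_of_mem_carrier hp hpK hK Y hx h.1 h.2
  by_cases hcase : (∀ i ∈ K, D.gam a i = 0) ∧ K.card = D.dimMin a + 1
  · obtain ⟨h0, hcard⟩ := hcase
    have hd : K.card - 1 = D.dimMin a := by omega
    rw [hd] at hlim
    refine hlim.trans (le_of_eq ?_)
    rw [Finset.sum_eq_single ⟨Y₀, hmin h0, hcard⟩]
    · have hs := sliceIntegral_eq_integral_resMeasure ℒ ψ ha (hmin h0) hcard c hB hp hpY₀ hχ hχ0
      change sliceIntegral ℒ ψ a c.1 K χ = _ at hs
      rw [hs]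
      congr 2
      change _ = _ * ((D.bGcd K : ℝ)⁻¹ * _)
      ring
    · intro Y _ hY
      rw [hzero Y, zero_mul]
      rintro ⟨-, hJ, hpY⟩
      refine hY (Subtype.ext (Stratum.ext' hJ ?_))
      rw [Y.1.carrier_eq hpY, hJ]
      rfl
    · simp
  · rw [Finset.sum_eq_zero fun Y _ => by
      rw [hzero Y fun h => hcase ⟨h.1, by rw [← h.2.1]; exact Y.2.2⟩, zero_mul], mul_zero]
    -- the local limit holds with the power `K.card - 1` of the logarithm, which is at most
    -- `D.dimMin a`
    have hsplit : ∀ t : ℂ, ((-Real.log ‖t‖) ^ D.dimMin a)⁻¹ =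
        ((-Real.log ‖t‖) ^ (D.dimMin a - (K.card - 1)))⁻¹ * ((-Real.log ‖t‖) ^ (K.card - 1))⁻¹ := by
      intro t
      rw [← mul_inv, ← pow_add, Nat.sub_add_cancel hcardK]
    simp only [hsplit, mul_assoc]
    by_cases h0 : ∀ i ∈ K, D.gam a i = 0
    · -- a face of `Δ(ℒ)` of smaller dimension: a positive power of the logarithm is left over
      have hne : D.dimMin a - (K.card - 1) ≠ 0 := by
        have h1 := Finset.card_pos.2 ⟨i₀, hB.mem⟩
        have h2 : K.card ≠ D.dimMin a + 1 := fun h => hcase ⟨h0, h⟩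
        have h3 := D.card_le_of_isMinFace a (hmin h0)
        change K.card ≤ _ at h3
        omega
      have h1 : Tendsto (fun t : ℂ => ((-Real.log ‖t‖) ^ (D.dimMin a - (K.card - 1)))⁻¹)
          (𝓝[≠] 0) (𝓝 0) :=
        tendsto_inv_atTop_zero.comp ((tendsto_pow_atTop hne).comp tendsto_neg_log_norm)
      have h2 := h1.mul hlim
      rwa [zero_mul] at h2
    · -- a face outside `Δ(ℒ)`: the local limit is zero
      push Not at h0
      obtain ⟨i, hi, hi0⟩ := h0
      rw [sliceIntegral_eq_zero ℒ ψ c.1 hi hi0, mul_zero, mul_zero] at hlim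
      have h1 : ∃ l, Tendsto (fun t : ℂ => ((-Real.log ‖t‖) ^ (D.dimMin a - (K.card - 1)))⁻¹)
          (𝓝[≠] 0) (𝓝 l) := by
        by_cases hne : D.dimMin a - (K.card - 1) = 0
        · exact ⟨1, by simp [hne]⟩
        · exact ⟨0, tendsto_inv_atTop_zero.comp ((tendsto_pow_atTop hne).comp tendsto_neg_log_norm)⟩
      obtain ⟨l, hl⟩ := h1
      have h2 := hl.mul hlim
      rwa [mul_zero] at h2

/-- The limit of the integrals over the fibres of a continuous function on the hybrid space. -/
theorem tendsto_integral_fibreMeasure (ha : ℒ.IsDecomposition a) {F : D.Hybrid → ℝ}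
    (hF : Continuous F) :
    Tendsto (fun t : ℂ => ((-Real.log ‖t‖) ^ D.dimMin a)⁻¹ *
      ((‖t‖ ^ (2 * D.kappaMin a))⁻¹ * ∫ x, onTotal F x ∂(ℒ.fibreMeasure ψ t))) (𝓝[≠] 0)
      (𝓝 ((2 * Real.pi) ^ D.dimMin a * ∑ Y : D.TopFace a,
        (ℒ.resMeasure ψ a Y.1).real Y.1.carrier * ((D.bGcd Y.1.J : ℝ)⁻¹ *
          ∫ w : D.simplex Y.1.J, F (D.ofDual (D.ofSimplex Y.1 w)) ∂(D.simplexMeasure Y.1.J)))) := by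
  obtain ⟨m, f, δ, hδ, hδ1, hfc, hf1, hfs, hf⟩ := exists_partition (D := D) a
  have hsum : Tendsto (fun t : ℂ => ∑ j, ((-Real.log ‖t‖) ^ D.dimMin a)⁻¹ *
      ((‖t‖ ^ (2 * D.kappaMin a))⁻¹ * ∫ x, f j x * onTotal F x ∂(ℒ.fibreMeasure ψ t))) (𝓝[≠] 0)
      (𝓝 (∑ j, (2 * Real.pi) ^ D.dimMin a * ∑ Y : D.TopFace a,
        (∫ x, f j x ∂(ℒ.resMeasure ψ a Y.1)) * ((D.bGcd Y.1.J : ℝ)⁻¹ *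
          ∫ w : D.simplex Y.1.J, F (D.ofDual (D.ofSimplex Y.1 w))
            ∂(D.simplexMeasure Y.1.J)))) := by
    refine tendsto_finsetSum _ fun j _ => ?_
    obtain ⟨c, K, i₀, p, r, hp, hpK, hB, hK, hfj⟩ := hf j
    exact tendsto_integral_adapted ℒ ψ ha c hp hpK hB hK (hfc j) (hf1 j) hfj hF
  have hlim : ∑ j, (2 * Real.pi) ^ D.dimMin a * ∑ Y : D.TopFace a,
        (∫ x, f j x ∂(ℒ.resMeasure ψ a Y.1)) * ((D.bGcd Y.1.J : ℝ)⁻¹ *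
          ∫ w : D.simplex Y.1.J, F (D.ofDual (D.ofSimplex Y.1 w)) ∂(D.simplexMeasure Y.1.J)) =
      (2 * Real.pi) ^ D.dimMin a * ∑ Y : D.TopFace a,
        (ℒ.resMeasure ψ a Y.1).real Y.1.carrier * ((D.bGcd Y.1.J : ℝ)⁻¹ *
          ∫ w : D.simplex Y.1.J, F (D.ofDual (D.ofSimplex Y.1 w)) ∂(D.simplexMeasure Y.1.J)) := by
    rw [← Finset.mul_sum, Finset.sum_comm]
    congr 1
    refine Finset.sum_congr rfl fun Y _ => ?_
    rw [← Finset.sum_mul]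
    congr 1
    have := isFiniteMeasure_resMeasure ℒ ψ ha Y.2.1 Y.2.2
    rw [← integral_finsetSum _ fun j _ => Integrable.of_bound
      (hfc j).measurable.aestronglyMeasurable 1 (Eventually.of_forall fun x => hf1 j x)]
    have hae : ∀ᵐ x ∂(ℒ.resMeasure ψ a Y.1), x ∈ Y.1.carrier := by
      rw [ae_iff]; exact resMeasure_compl ℒ ψ a Y.1
    have h1 : ∫ x, ∑ j, f j x ∂(ℒ.resMeasure ψ a Y.1) = ∫ _, (1 : ℝ) ∂(ℒ.resMeasure ψ a Y.1) := by
      refine integral_congr_ae ?_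
      filter_upwards [hae] with x hx
      exact hfs x (by rw [Y.1.proj_eq_zero hx]; simpa using hδ.le)
    rw [h1, integral_const, smul_eq_mul, mul_one]
    refine measureReal_congr ?_
    filter_upwards [hae] with x hx
    exact propext ⟨fun _ => hx, fun _ => trivial⟩
  rw [hlim] at hsum
  refine hsum.congr' ?_
  have hsmall : ∀ᶠ t : ℂ in 𝓝[≠] 0, ‖t‖ < δ :=
    nhdsWithin_le_nhds (by simpa [Metric.ball, dist_eq_norm] using Metric.ball_mem_nhds (0 : ℂ) hδ)
  filter_upwards [hsmall, eventually_all.2 fun j =>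
    eventually_integrable_mul_onTotal ℒ ψ (hfc j) (hf1 j) hF] with t ht hint
  rw [← Finset.mul_sum, ← Finset.mul_sum, ← integral_finsetSum _ fun j _ => hint j]
  congr 2
  have hae : ∀ᵐ x ∂(ℒ.fibreMeasure ψ t), D.proj x = t := by
    rw [ae_iff]; exact ℒ.fibreMeasure_compl ψ t
  refine integral_congr_ae ?_
  filter_upwards [hae] with x hx
  rw [← Finset.sum_mul, hfs x (by rw [hx]; exact ht.le), one_mul]

theorem integral_rescaledMeasure {F : D.Hybrid → ℝ} (hF : Continuous F) {t : ℂ}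
    (ht1 : ‖t‖ < 1) : ∫ p, F p ∂(ℒ.rescaledMeasure ψ a t) =
      ((2 * Real.pi) ^ D.dimMin a)⁻¹ * (((-Real.log ‖t‖) ^ D.dimMin a)⁻¹ *
        ((‖t‖ ^ (2 * D.kappaMin a))⁻¹ * ∫ x, onTotal F x ∂(ℒ.fibreMeasure ψ t))) := by
  have hlog : 0 ≤ -Real.log ‖t‖ := neg_nonneg.2 (Real.log_nonpos (norm_nonneg t) ht1.le)
  rw [CanonicalExtension.rescaledMeasure, integral_smul_measure,
    integral_map D.continuous_ofGeneric.measurable.aemeasurable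
      hF.measurable.aestronglyMeasurable]
  have h1 : ∫ x : D.generic, F (D.ofGeneric x) ∂((ℒ.fibreMeasure ψ t).comap Subtype.val) =
      ∫ x, onTotal F x ∂(ℒ.fibreMeasure ψ t) := by
    rw [← setIntegral_eq_integral_of_forall_compl_eq_zero (s := D.generic) fun x hx => by
      simp [onTotal, hx], ← integral_subtype_comap D.isOpen_generic.measurableSet]
    exact integral_congr_ae (Eventually.of_forall fun x => (onTotal_of_mem F x).symm)
  rw [h1, Real.log_inv, ENNReal.toReal_ofReal (by positivity), smul_eq_mul, inv_pow]
  rw [div_eq_mul_inv, mul_inv]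
  ring

theorem isFiniteMeasure_rescaledMeasure (a : I → ℚ) {t : ℂ} (ht : 0 < ‖t‖) (ht1 : ‖t‖ < 1) :
    IsFiniteMeasure (ℒ.rescaledMeasure ψ a t) := by
  have := ℒ.isFiniteMeasure_fibreMeasure ψ (norm_pos_iff.1 ht) ht1
  have : IsFiniteMeasure ((ℒ.fibreMeasure ψ t).comap (Subtype.val : D.generic → X)) :=
    ⟨by
      rw [(MeasurableEmbedding.subtype_coe D.isOpen_generic.measurableSet).comap_apply]
      exact measure_lt_top _ _⟩
  exact Measure.smul_finite _ ENNReal.ofReal_ne_top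

theorem isFiniteMeasure_limitMeasure_summand (ha : ℒ.IsDecomposition a) (Y : D.TopFace a) :
    IsFiniteMeasure ((ℒ.resMeasure ψ a Y.1 Y.1.carrier * (D.bGcd Y.1.J : ℝ≥0∞)⁻¹) •
      (D.simplexMeasure Y.1.J).map fun w => D.ofDual (D.ofSimplex Y.1 w)) := by
  have := isFiniteMeasure_resMeasure ℒ ψ ha Y.2.1 Y.2.2
  have := isFiniteMeasure_simplexMeasure (D := D) Y.1.nonempty
  have hg : D.bGcd Y.1.J ≠ 0 := by
    obtain ⟨i, hi⟩ := Y.1.nonempty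
    exact fun h => D.b_ne_zero i ((Finset.gcd_eq_zero_iff.1 h) i hi)
  refine Measure.smul_finite _ (ENNReal.mul_ne_top (measure_ne_top _ _) ?_)
  simpa using hg

theorem isFiniteMeasure_limitMeasure (ha : ℒ.IsDecomposition a) :
    IsFiniteMeasure (ℒ.limitMeasure ψ a) := by
  have := isFiniteMeasure_limitMeasure_summand ℒ ψ ha
  refine ⟨?_⟩
  rw [CanonicalExtension.limitMeasure, Measure.sum_apply _ MeasurableSet.univ, tsum_fintype]
  exact ENNReal.sum_lt_top.2 fun Y _ => measure_lt_top _ _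

theorem integral_limitMeasure (ha : ℒ.IsDecomposition a) {F : D.Hybrid → ℝ} (hF : Continuous F) :
    ∫ p, F p ∂(ℒ.limitMeasure ψ a) = ∑ Y : D.TopFace a,
      (ℒ.resMeasure ψ a Y.1).real Y.1.carrier * ((D.bGcd Y.1.J : ℝ)⁻¹ *
        ∫ w : D.simplex Y.1.J, F (D.ofDual (D.ofSimplex Y.1 w)) ∂(D.simplexMeasure Y.1.J)) := by
  have := isFiniteMeasure_limitMeasure_summand ℒ ψ ha
  have hm : ∀ Y : D.Stratum, Measurable fun w : D.simplex Y.J => D.ofDual (D.ofSimplex Y w) :=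
    fun Y => (D.continuous_ofDual.comp (D.continuous_ofSimplex Y)).measurable
  rw [CanonicalExtension.limitMeasure, Measure.sum_fintype, integral_finsetSum_measure]
  · refine Finset.sum_congr rfl fun Y _ => ?_
    rw [integral_smul_measure, integral_map (hm Y.1).aemeasurable
      hF.measurable.aestronglyMeasurable, ENNReal.toReal_mul, ENNReal.toReal_inv,
      ENNReal.toReal_natCast, smul_eq_mul, mul_assoc]
    rfl
  · intro Y _
    have := isFiniteMeasure_resMeasure ℒ ψ ha Y.2.1 Y.2.2
    have hg : D.bGcd Y.1.J ≠ 0 := by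
      obtain ⟨i, hi⟩ := Y.1.nonempty
      exact fun h => D.b_ne_zero i ((Finset.gcd_eq_zero_iff.1 h) i hi)
    refine Integrable.smul_measure ?_ (ENNReal.mul_ne_top (measure_ne_top _ _) (by simpa using hg))
    rw [integrable_map_measure hF.measurable.aestronglyMeasurable (hm Y.1).aemeasurable]
    exact integrable_onSimplex hF Y.1

theorem tendsto_integral_rescaledMeasure (ha : ℒ.IsDecomposition a) {F : D.Hybrid → ℝ}
    (hF : Continuous F) :
    Tendsto (fun t : ℂ => ∫ p, F p ∂(ℒ.rescaledMeasure ψ a t)) (𝓝[≠] 0)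
      (𝓝 (∫ p, F p ∂(ℒ.limitMeasure ψ a))) := by
  have h := (tendsto_integral_fibreMeasure ℒ ψ ha hF).const_mul ((2 * Real.pi) ^ D.dimMin a)⁻¹
  rw [← integral_limitMeasure ℒ ψ ha hF, inv_mul_cancel_left₀ (by positivity)] at h
  refine h.congr' ?_
  have hsmall : ∀ᶠ t : ℂ in 𝓝[≠] 0, ‖t‖ < 1 :=
    nhdsWithin_le_nhds (by
      simpa [Metric.ball, dist_eq_norm] using Metric.ball_mem_nhds (0 : ℂ) one_pos)
  filter_upwards [hsmall] with t ht
  exact (integral_rescaledMeasure ℒ ψ hF ht).symm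

/-- The constant in the asymptotics of the volume of the fibres is the mass of the limit measure,
up to the factor `(2π)^d`. It is positive since `Δ(ℒ)` has a face of maximal dimension, whose
residual measure does not vanish. -/
theorem isEquivalent_fibreMeasure (ha : ℒ.IsDecomposition a) :
    ∃ C : ℝ, 0 < C ∧ Asymptotics.IsEquivalent (𝓝[≠] 0)
      (fun t : ℂ => (ℒ.fibreMeasure ψ t).real (D.proj ⁻¹' {t}))
      (fun t : ℂ => C * ‖t‖ ^ (2 * D.kappaMin a) * Real.log ‖t‖⁻¹ ^ D.dimMin a) := by
  have h := tendsto_integral_fibreMeasure ℒ ψ ha (F := fun _ => 1) continuous_const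
  set C := (2 * Real.pi) ^ D.dimMin a * ∑ Y : D.TopFace a,
    (ℒ.resMeasure ψ a Y.1).real Y.1.carrier * ((D.bGcd Y.1.J : ℝ)⁻¹ *
      ∫ _ : D.simplex Y.1.J, (1 : ℝ) ∂(D.simplexMeasure Y.1.J)) with hC
  have hpos : 0 < C := by
    refine mul_pos (by positivity) (Finset.sum_pos (fun Y _ => ?_) ?_)
    · have := isFiniteMeasure_resMeasure ℒ ψ ha Y.2.1 Y.2.2
      obtain ⟨i, hi⟩ := Y.1.nonempty
      have hg : 0 < (D.bGcd Y.1.J : ℝ) := by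
        exact_mod_cast Nat.pos_of_ne_zero fun h =>
          D.b_ne_zero i ((Finset.gcd_eq_zero_iff.1 h) i hi)
      rw [integral_const, smul_eq_mul, mul_one]
      refine mul_pos (ENNReal.toReal_pos (resMeasure_carrier_pos ℒ ψ ha Y.2.1 Y.2.2).ne'
        (measure_ne_top _ _)) (mul_pos (inv_pos.2 hg) (simplexMeasure_univ_pos hi))
    · obtain ⟨Y, hY⟩ := D.exists_minFace a
      exact ⟨⟨Y, hY⟩, Finset.mem_univ _⟩
  refine ⟨C, hpos, Asymptotics.isEquivalent_of_tendsto_one ?_⟩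
  have h1 := h.const_mul C⁻¹
  rw [inv_mul_cancel₀ hpos.ne'] at h1
  refine h1.congr' ?_
  filter_upwards [self_mem_nhdsWithin] with t ht
  have hae : ∀ᵐ x ∂(ℒ.fibreMeasure ψ t), D.proj x = t := by
    rw [ae_iff]; exact ℒ.fibreMeasure_compl ψ t
  have h2 : ∫ x, onTotal (fun _ : D.Hybrid => (1 : ℝ)) x ∂(ℒ.fibreMeasure ψ t) =
      (ℒ.fibreMeasure ψ t).real (D.proj ⁻¹' {t}) := by
    have h3 : ∫ x, onTotal (fun _ : D.Hybrid => (1 : ℝ)) x ∂(ℒ.fibreMeasure ψ t) =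
        ∫ _, (1 : ℝ) ∂(ℒ.fibreMeasure ψ t) := by
      refine integral_congr_ae ?_
      filter_upwards [hae] with x hx
      have hg : x ∈ D.generic := by
        change D.proj x ≠ 0
        rwa [hx]
      exact onTotal_of_mem _ ⟨x, hg⟩
    rw [h3, integral_const, smul_eq_mul, mul_one]
    refine measureReal_congr ?_
    filter_upwards [hae] with x hx
    exact propext ⟨fun _ => hx, fun _ => trivial⟩
  rw [h2, Pi.div_apply, Real.log_inv, div_eq_mul_inv, mul_inv, mul_inv]
  ring

end SncDegeneration
end Global

end HybridLimit

end

theorem theoremA {n : ℕ} {X : Type*} [TopologicalSpace X] [T2Space X]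
    [SecondCountableTopology X] [ConnectedSpace X]
    [ChartedSpace (HybridLimit.Model n) X]
    [IsManifold 𝓘(ℂ, HybridLimit.Model n) ω X]
    [MeasurableSpace X] [BorelSpace X]
    {I : Type*} [Fintype I] (D : HybridLimit.SncDegeneration n X I)
    {L : X → Type*} [TopologicalSpace (TotalSpace ℂ L)] [∀ x, AddCommGroup (L x)]
    [∀ x, Module ℂ (L x)] [∀ x, TopologicalSpace (L x)] [FiberBundle ℂ L] [VectorBundle ℂ ℂ L]
    [ContMDiffVectorBundle ω ℂ L 𝓘(ℂ, HybridLimit.Model n)]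
    (ℒ : HybridLimit.CanonicalExtension L D)
    (a : I → ℚ) (ha : ℒ.IsDecomposition a)
    (ψ : HybridLimit.ContinuousMetric L) :
    (∀ t : ℂ, 0 < ‖t‖ → ‖t‖ < 1 → IsFiniteMeasure (ℒ.rescaledMeasure ψ a t)) ∧
    IsFiniteMeasure (ℒ.limitMeasure ψ a) ∧
    (∀ f : D.Hybrid → ℝ, Continuous f →
      Tendsto (fun t : ℂ => ∫ p, f p ∂(ℒ.rescaledMeasure ψ a t)) (𝓝[≠] 0)
        (𝓝 (∫ p, f p ∂(ℒ.limitMeasure ψ a)))) ∧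
    D.dimMin a ≤ n ∧
    ∃ C : ℝ, 0 < C ∧
      Asymptotics.IsEquivalent (𝓝[≠] 0)
        (fun t : ℂ => (ℒ.fibreMeasure ψ t).real (D.proj ⁻¹' {t}))
        (fun t : ℂ => C * ‖t‖ ^ (2 * D.kappaMin a) * Real.log ‖t‖⁻¹ ^ D.dimMin a) :=
  ⟨fun _ ht ht1 => HybridLimit.SncDegeneration.isFiniteMeasure_rescaledMeasure ℒ ψ a ht ht1,
    HybridLimit.SncDegeneration.isFiniteMeasure_limitMeasure ℒ ψ ha,
    fun _ hf => HybridLimit.SncDegeneration.tendsto_integral_rescaledMeasure ℒ ψ ha hf,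
    D.dimMin_le a, HybridLimit.SncDegeneration.isEquivalent_fibreMeasure ℒ ψ ha⟩
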